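/- **Model.** The external memory is a linear sequence of cells, each holding an item, an integer counter or pointer, or the symbol $\infty$; items come from a linearly ordered set and may only be copied and compared. It is partitioned into blocks of $B$ consecutive cells and is accessed only through a cache with room for $\lfloor M/B\rfloor$ blocks, initially empty. An IO is a transfer of a block between memory and cache: bringing a block into the cache, or writing a modified block back when it is evicted. Paging is optimal: the cost of a sequence of memory accesses is the least number of IOs with which it can be served. Parameters, local variables and local arrays of all procedures are stored on one contiguous call stack in the external memory, and accesses to them count. The program does not know $M$ and $B$. **Algorithm.** $\mathrm{SquareSort}(A,D,n)$ sorts $n$ distinct items from the array $A$ into the array $D$. If $n\le 16$, it uses insertion sort. Otherwise, with $m=\lceil\sqrt n\rceil$: 1. It splits $A$ into $m$ consecutive columns of at most $m$ items each and recursively sorts each column into the same positions of $D$. 2. It draws $m-1$ uniformly random entries of $D$ with repetition and sorts them by merge sort, and repeats this until they are distinct and none of them is the minimum of $D$. This gives pivots $p_1<\dots<p_{m-1}$; set $p_0=-\infty$ and $p_m=\infty$. The $j$-th bucket consists of the items in $[p_{j-1},p_j)$. 3. It computes the bucket sizes by scanning each column of $D$ along with the pivots, and from them the starting positions of the buckets.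 4. It applies SkewTranspose, which moves the items from $D$ to $A$ so that the buckets occupy consecutive parts of $A$. On $\ell$ sub-columns and $k$ buckets with $\ell,k\ge 4$, SkewTranspose calls itself recursively on (first half of the sub-columns, first half of the buckets), (second half, first half), (first half, second half), (second half, second half), in this order. If $\ell<4$ or $k<4$, it goes through the buckets, and for each bucket through the sub-columns, moving the remaining items of the sub-column that are smaller than the upper pivot of the bucket to the next free slots of the bucket. 5. It recursively sorts each bucket from $A$ into $D$. Let $T(n)=T_{M,B}(n)$ be the expected number of IOs of this algorithm over its random choices, in the worst case over inputs of $n$ distinct items and over the placement in the external memory of the disjoint arrays $A$ and $D$ and of the call stack, which starts somewhere behind both arrays and grows upwards. **Theorem.** There are constants $c\ge 64$, $\beta>\alpha>1$ and $C$ such that for all natural numbers $B>\beta$, $M\ge B^2$ and $n\ge 1$, $$T(n)\le \frac{cn}{B}\bigl(2\max(\log_{M/\alpha} n,\,1)-1\bigr)+\frac{c}{16},$$ and, if moreover $n\ge M/B$, $$T(n)\le C\,\frac nB\,\log_{M/B} n .$$ -/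

import Mathlib

open scoped ENNReal

namespace SquareSort

/-! ### Programs over an external memory

A memory cell holds an item, an integer counter or pointer, or the symbol `∞`.  The items come from
a linearly ordered set and can only be copied and compared.  A program touches the memory one cell
at a time; every touch is recorded, and nothing but the memory survives from one statement of an
algorithm to the next (apart from the frame pointer `fp`, which is a machine register that is saved
in the memory by every procedure call). -/

inductive Cell (α : Type*)
  | item (x : α)
  | num (k : ℕ)
  | infty

/-- The number stored in a cell (`0` if the cell does not hold a number). -/
def Cell.toNat {α : Type*} : Cell α → ℕ
  | .num k => k
  | _ => 0

open Classical in
/-- Strict comparison of two cells that hold items or `∞`. -/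
noncomputable def Cell.lt {α : Type*} [LinearOrder α] : Cell α → Cell α → Bool
  | .item x, .item y => decide (x < y)
  | .item _, .infty => true
  | _, _ => false

abbrev Mem (α : Type*) := ℕ → Cell α

/-- One touch of a memory cell: its address, and whether the cell is written. -/
structure Access where
  addr : ℕ
  write : Bool

/-- Programs that return a value of type `ρ`. `halt` means that the run is cut off. -/
inductive Prog (ρ : Type)
  | ret (x : ρ)
  | halt
  /-- read the number stored at address `a` -/
  | load (a : ℕ) (k : ℕ → Prog ρ)
  /-- write the number `v` at address `a` -/
  | store (a v : ℕ) (k : Prog ρ)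
  /-- write `∞` at address `a` -/
  | storeInfty (a : ℕ) (k : Prog ρ)
  /-- copy the content of `src` to `dst` -/
  | move (dst src : ℕ) (k : Prog ρ)
  /-- is the content of `a` smaller than that of `b`? -/
  | less (a b : ℕ) (k : Bool → Prog ρ)
  /-- draw an integer uniformly at random from `{0, …, r}` -/
  | rand (r : ℕ) (k : ℕ → Prog ρ)

namespace Prog

def bind {ρ σ : Type} : Prog ρ → (ρ → Prog σ) → Prog σ
  | ret x, g => g x
  | halt, _ => halt
  | load a k, g => load a fun v => (k v).bind g
  | store a v k, g => store a v (k.bind g)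
  | storeInfty a k, g => storeInfty a (k.bind g)
  | move d s k, g => move d s (k.bind g)
  | less a b k, g => less a b fun r => (k r).bind g
  | rand r k, g => rand r fun v => (k v).bind g

instance : Monad Prog where
  pure := ret
  bind := bind

/-- Put the accesses `l` in front of an outcome. -/
def prepend {β : Type*} (l : List Access) (o : List Access × β) : List Access × β :=
  (l ++ o.1, o.2)

/-- The random outcome of a program that is started on a given memory: the sequence of all memory
accesses, and (unless the run was cut off) the returned value with the final memory. -/
noncomputable def run {α : Type*} [LinearOrder α] {ρ : Type} :
    Prog ρ → Mem α → PMF (List Access × Option (ρ × Mem α))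
  | ret x, μ => PMF.pure ([], some (x, μ))
  | halt, _ => PMF.pure ([], none)
  | load a k, μ => ((k (μ a).toNat).run μ).map (prepend [⟨a, false⟩])
  | store a v k, μ => (k.run (Function.update μ a (.num v))).map (prepend [⟨a, true⟩])
  | storeInfty a k, μ => (k.run (Function.update μ a .infty)).map (prepend [⟨a, true⟩])
  | move d s k, μ =>
      (k.run (Function.update μ d (μ s))).map (prepend [⟨s, false⟩, ⟨d, true⟩])
  | less a b k, μ => ((k ((μ a).lt (μ b))).run μ).map (prepend [⟨a, false⟩, ⟨b, false⟩])
  | rand r k, μ => (PMF.uniformOfFintype (Fin (r + 1))).bind fun v => (k v).run μ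

/-- The distribution of the access sequence. -/
noncomputable def traceLaw {α : Type*} [LinearOrder α] (p : Prog Unit) (μ : Mem α) :
    PMF (List Access) :=
  (p.run μ).map Prod.fst

end Prog

open Prog

/-! ### Expressions and statements -/

/-- The expression that has the constant value `k` (no memory access). -/
def lit (k : ℕ) : Prog ℕ := ret k

/-- The value of the variable that is stored at address `a`. -/
def v (a : ℕ) : Prog ℕ := load a ret

/-- The number stored at the address given by an expression. -/
def deref (e : Prog ℕ) : Prog ℕ := e >>= v

def add (x y : Prog ℕ) : Prog ℕ := do return (← x) + (← y)
def sub (x y : Prog ℕ) : Prog ℕ := do return (← x) - (← y)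
def mul (x y : Prog ℕ) : Prog ℕ := do return (← x) * (← y)
def half (x : Prog ℕ) : Prog ℕ := do return (← x) / 2
def minimum (x y : Prog ℕ) : Prog ℕ := do return min (← x) (← y)

instance : Add (Prog ℕ) := ⟨add⟩
instance : Sub (Prog ℕ) := ⟨sub⟩
instance : Mul (Prog ℕ) := ⟨mul⟩
instance (k : ℕ) : OfNat (Prog ℕ) k := ⟨lit k⟩

/-- `⌈√n⌉` -/
def ceilSqrt (n : ℕ) : ℕ := if n.sqrt * n.sqrt < n then n.sqrt + 1 else n.sqrt

theorem ceilSqrt_eq (n : ℕ) : ceilSqrt n = ⌈Real.sqrt n⌉₊ := by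
  have h1 : n.sqrt * n.sqrt ≤ n := Nat.sqrt_le n
  have h2 : n < (n.sqrt + 1) * (n.sqrt + 1) := Nat.lt_succ_sqrt n
  unfold ceilSqrt
  split_ifs with h
  · symm
    rw [Nat.ceil_eq_iff (by omega)]
    constructor
    · apply Real.lt_sqrt_of_sq_lt
      rw [Nat.add_sub_cancel, sq]
      exact_mod_cast h
    · apply Real.sqrt_le_iff.2 ⟨by positivity, ?_⟩
      rw [sq]
      exact_mod_cast h2.le
  · have h3 : n.sqrt * n.sqrt = n := by omega
    have h4 : Real.sqrt n = (n.sqrt : ℝ) := by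
      rw [Real.sqrt_eq_iff_mul_self_eq (by positivity) (by positivity)]
      exact_mod_cast h3.symm
    rw [h4, Nat.ceil_natCast]

/-- A uniformly random element of `{0, …, x - 1}`, for `x ≥ 1`. -/
def random (x : Prog ℕ) : Prog ℕ := do rand ((← x) - 1) ret

def lt (x y : Prog ℕ) : Prog Bool := do return decide ((← x) < (← y))
def neg (c : Prog Bool) : Prog Bool := do return !(← c)
/-- conjunction and disjunction are evaluated from left to right, and only as far as needed -/
def both (c d : Prog Bool) : Prog Bool := do if ← c then d else return false
def either (c d : Prog Bool) : Prog Bool := do if ← c then return true else d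

/-- Compare the items stored at two addresses. -/
def lessAt (x y : Prog ℕ) : Prog Bool := do less (← x) (← y) ret

/-- `a := e`, for a variable stored at address `a`. -/
def assign (a : ℕ) (e : Prog ℕ) : Prog Unit := do store a (← e) (ret ())

/-- Write the number `e` at the address `x`. -/
def put (x e : Prog ℕ) : Prog Unit := do store (← x) (← e) (ret ())

def putInfty (x : Prog ℕ) : Prog Unit := do storeInfty (← x) (ret ())

/-- Copy the item at address `y` to address `x`. -/
def moveAt (x y : Prog ℕ) : Prog Unit := do move (← x) (← y) (ret ())

def cond (c : Prog Bool) (p q : Prog Unit) : Prog Unit := do if ← c then p else q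

/-- `while c do p`, cut off after `f` rounds. -/
def loop : ℕ → Prog Bool → Prog Unit → Prog Unit
  | 0, _, _ => halt
  | f + 1, c, p => cond c (do p; loop f c p) (ret ())

/-- Write the values of `es` into consecutive cells from address `a` on. -/
def pushAll : ℕ → List (Prog ℕ) → Prog Unit
  | _, [] => ret ()
  | a, e :: es => do assign a e; pushAll (a + 1) es

/-- Call a procedure from the frame `fp`. The frame of the callee starts at the address `top`; its
first cell saves the frame pointer of the caller, and the parameters follow. On return the frame
pointer of the caller is read back. -/
def call (fp : ℕ) (top : Prog ℕ) (args : List (Prog ℕ)) (body : ℕ → Prog Unit) : Prog Unit := do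
  let t ← top
  assign t (lit fp)
  pushAll (t + 1) args
  body t
  let _ ← v t

/-! ### The algorithm

In each procedure the cell `fp` holds the saved frame pointer, the next cells hold the parameters,
and then come the local variables and local arrays.  Array indices start from `0`.  The number `f`
bounds the depth of the recursion and the number of rounds of each loop; a run that exceeds the
bound is cut off. -/

/-- Insertion sort of the `n` items at `A` into the array at `D`. -/
def simpleSort (f fp : ℕ) : Prog Unit := do
  let A := fp + 1
  let D := fp + 2
  let n := fp + 3
  let i := fp + 4
  let j := fp + 5
  assign i 0
  loop f (lt (v i) (v n)) do
    assign j (v i)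
    loop f (both (lt 0 (v j)) (lessAt (v A + v i) (v D + v j - 1))) do
      moveAt (v D + v j) (v D + v j - 1)
      assign j (v j - 1)
    moveAt (v D + v j) (v A + v i)
    assign i (v i + 1)

/-- Merge sort of the `k` items at `P`, with a work array `W` on the stack: runs of length
`w = 1, 2, 4, …` are merged in pairs. -/
def mergeSort (f fp : ℕ) : Prog Unit := do
  let P := fp + 1
  let k := fp + 2
  let w := fp + 3
  let lo := fp + 4
  let mid := fp + 5
  let hi := fp + 6
  let i := fp + 7
  let j := fp + 8
  let t := fp + 9
  let W := lit (fp + 10)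
  assign w 1
  loop f (lt (v w) (v k)) do
    assign lo 0
    loop f (lt (v lo) (v k)) do
      assign mid (minimum (v lo + v w) (v k))
      assign hi (minimum (v lo + v w + v w) (v k))
      assign i (v lo)
      assign j (v mid)
      assign t (v lo)
      loop f (lt (v t) (v hi)) do
        cond (both (lt (v i) (v mid))
            (either (neg (lt (v j) (v hi))) (neg (lessAt (v P + v j) (v P + v i)))))
          (do moveAt (W + v t) (v P + v i)
              assign i (v i + 1))
          (do moveAt (W + v t) (v P + v j)
              assign j (v j + 1))
        assign t (v t + 1)
      assign lo (v hi)
    assign t 0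
    loop f (lt (v t) (v k)) do
      moveAt (v P + v t) (W + v t)
      assign t (v t + 1)
    assign w (v w + v w)

/-- Skew transposition without recursion: for each of the `k` buckets, and for each of the `l`
sub-columns of `A`, move the items below the pivot of the bucket. -/
def naiveSkewTranspose (f fp : ℕ) : Prog Unit := do
  let A := fp + 1
  let D := fp + 2
  let l := fp + 3
  let col := fp + 4
  let colEnd := fp + 5
  let k := fp + 6
  let pivots := fp + 7
  let buc := fp + 8
  let i := fp + 9
  let j := fp + 10
  assign i 0
  loop f (lt (v i) (v k)) do
    assign j 0
    loop f (lt (v j) (v l)) do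
      loop f (both (lt (deref (v col + v j)) (deref (v colEnd + v j)))
          (lessAt (v A + deref (v col + v j)) (v pivots + v i))) do
        moveAt (v D + deref (v buc + v i)) (v A + deref (v col + v j))
        put (v buc + v i) (deref (v buc + v i) + 1)
        put (v col + v j) (deref (v col + v j) + 1)
      assign j (v j + 1)
    assign i (v i + 1)

/-- Skew transposition of `l` sorted sub-columns of `A` into `k` buckets of `D`: `col[i]` is the
index of the first item of the `i`-th sub-column that was not moved yet, `colEnd[i]` bounds the
index from above, and `buc[j]` is the index of the first free slot of the `j`-th bucket. -/
def skewTranspose : ℕ → ℕ → Prog Unit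
  | 0, _ => halt
  | f + 1, fp => do
    let A := fp + 1
    let D := fp + 2
    let l := fp + 3
    let col := fp + 4
    let colEnd := fp + 5
    let k := fp + 6
    let pivots := fp + 7
    let buc := fp + 8
    let l₁ := fp + 9
    let k₁ := fp + 10
    let top := lit (fp + 11)
    cond (either (lt (v l) 4) (lt (v k) 4))
      (call fp top [v A, v D, v l, v col, v colEnd, v k, v pivots, v buc] (naiveSkewTranspose f))
      (do
        assign l₁ (half (v l))
        assign k₁ (half (v k))
        call fp top [v A, v D, v l₁, v col, v colEnd, v k₁, v pivots, v buc] (skewTranspose f)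
        call fp top [v A, v D, v l - v l₁, v col + v l₁, v colEnd + v l₁, v k₁, v pivots, v buc]
          (skewTranspose f)
        call fp top [v A, v D, v l₁, v col, v colEnd,
          v k - v k₁, v pivots + v k₁, v buc + v k₁] (skewTranspose f)
        call fp top [v A, v D, v l - v l₁, v col + v l₁, v colEnd + v l₁,
          v k - v k₁, v pivots + v k₁, v buc + v k₁] (skewTranspose f))

/-- Sort the `n` items at `A` into the array at `D`.  The local arrays `col`, `colEnd` and `pivots`
have `m` cells each, and `buc` has `m + 1` cells. -/
def squareSort : ℕ → ℕ → Prog Unit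
  | 0, _ => halt
  | f + 1, fp => do
    let A := fp + 1
    let D := fp + 2
    let n := fp + 3
    let m := fp + 4
    let i := fp + 5
    let j := fp + 6
    let t := fp + 7
    let ok := fp + 8
    let col := lit (fp + 9)
    let colEnd := lit (fp + 9) + v m
    let pivots := lit (fp + 9) + 2 * v m
    let buc := lit (fp + 9) + 3 * v m
    let top := lit (fp + 10) + 4 * v m
    cond (lt (v n) 17)
      -- small arrays are sorted directly
      (call fp (lit (fp + 9)) [v A, v D, v n] (simpleSort f))
      (do
        assign m (ceilSqrt <$> v n)
        -- the span of each column
        assign i 0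
        loop f (lt (v i) (v m)) do
          put (col + v i) (minimum (v i * v m) (v n))
          put (colEnd + v i) (minimum ((v i + 1) * v m) (v n))
          assign i (v i + 1)
        -- sort each column of `A` into `D`
        assign i 0
        loop f (lt (v i) (v m)) do
          call fp top [v A + deref (col + v i), v D + deref (col + v i),
            deref (colEnd + v i) - deref (col + v i)] (squareSort f)
          assign i (v i + 1)
        -- sample `m - 1` pivots, until they are distinct and none of them is the minimum of `D`
        assign ok 0
        loop f (lt (v ok) 1) do
          assign i 0
          loop f (lt (v i + 1) (v m)) do
            moveAt (pivots + v i) (v D + random (v n))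
            assign i (v i + 1)
          call fp top [pivots, v m - 1] (mergeSort f)
          -- are the sorted pivots distinct?
          assign ok 1
          assign i 0
          loop f (lt (v i + 2) (v m)) do
            cond (lessAt (pivots + v i) (pivots + v i + 1)) (ret ()) (assign ok 0)
            assign i (v i + 1)
          -- is the smallest pivot larger than the first item of some column?
          assign t 0
          assign i 0
          loop f (lt (v i) (v m)) do
            cond (both (lt (deref (col + v i)) (deref (colEnd + v i)))
                (lessAt (v D + deref (col + v i)) pivots))
              (assign t 1) (ret ())
            assign i (v i + 1)
          cond (lt (v t) 1) (assign ok 0) (ret ())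
        putInfty (pivots + v m - 1)
        -- the size of each bucket: scan each column of `D` along with the pivots
        assign j 0
        loop f (lt (v j) (v m)) do
          put (buc + v j + 1) 0
          assign j (v j + 1)
        assign i 0
        loop f (lt (v i) (v m)) do
          assign j 0
          assign t (deref (col + v i))
          loop f (lt (v t) (deref (colEnd + v i))) do
            cond (lessAt (v D + v t) (pivots + v j))
              (do put (buc + v j + 1) (deref (buc + v j + 1) + 1)
                  assign t (v t + 1))
              (assign j (v j + 1))
          assign i (v i + 1)
        -- the first position of each bucket
        assign t 0
        assign j 0
        loop f (lt (v j) (v m)) do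
          assign i (deref (buc + v j + 1))
          put (buc + v j + 1) (v t)
          assign t (v t + v i)
          assign j (v j + 1)
        -- skew transpose `D` into `A`
        call fp top [v D, v A, v m, col, colEnd, v m, pivots, buc + 1] (skewTranspose f)
        -- sort each bucket from `A` into `D`
        put buc 0
        assign j 0
        loop f (lt (v j) (v m)) do
          call fp top [v A + deref (buc + v j), v D + deref (buc + v j),
            deref (buc + v j + 1) - deref (buc + v j)] (squareSort f)
          assign j (v j + 1))

/-! ### Caches and the cost of an access sequence -/

/-- `Serves k C W l q`: a cache with room for `k` memory blocks, which holds the blocks `C`, of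
which those in `W` were modified since they were brought in, can serve the requests `l` with `q`
block transfers. A request names a block and says whether it modifies the block. Bringing a block
into the cache is one transfer, and so is writing a modified block back when it is evicted. -/
inductive Serves (k : ℕ) : Finset ℕ → Finset ℕ → List (ℕ × Bool) → ℕ → Prop
  | done (C W : Finset ℕ) : Serves k C W [] 0
  | access {C W : Finset ℕ} {b : ℕ} {w : Bool} {l : List (ℕ × Bool)} {q : ℕ} (hb : b ∈ C)
      (h : Serves k C (if w then insert b W else W) l q) : Serves k C W ((b, w) :: l) q
  | fetch {C W : Finset ℕ} {b : ℕ} {l : List (ℕ × Bool)} {q : ℕ} (hb : b ∉ C) (hk : C.card < k)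
      (h : Serves k (insert b C) W l q) : Serves k C W l (q + 1)
  | evict {C W : Finset ℕ} {b : ℕ} {l : List (ℕ × Bool)} {q : ℕ} (hb : b ∈ C)
      (h : Serves k (C.erase b) (W.erase b) l q) :
      Serves k C W l (if b ∈ W then q + 1 else q)

/-- The least number of block transfers for an access sequence, over all ways of managing a cache of
`M` cells that is divided into blocks of `B` cells and initially empty. -/
noncomputable def transfers (M B : ℕ) (l : List Access) : ℝ≥0∞ :=
  ⨅ (q : ℕ) (_ : Serves (M / B) ∅ ∅ (l.map fun a => (a.addr / B, a.write)) q), (q : ℝ≥0∞)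

/-- An initial memory, with `n` distinct items in the cells `a, …, a + n - 1`, a destination array
that starts at `d`, and the call stack from `s` on. -/
structure Input (α : Type*) (n : ℕ) where
  a : ℕ
  d : ℕ
  s : ℕ
  mem : Mem α
  items : Fin n → α
  distinct : Function.Injective items
  mem_eq : ∀ i : Fin n, mem (a + i) = .item (items i)
  disjoint : a + n ≤ d ∨ d + n ≤ a
  a_le : a + n ≤ s
  d_le : d + n ≤ s

/-- The whole sorting program, cut off at `f`. -/
def Input.main {α : Type*} {n : ℕ} (I : Input α n) (f : ℕ) : Prog Unit :=
  call 0 (lit I.s) [lit I.a, lit I.d, lit n] (squareSort f)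

/-- The expected number of block transfers on a given input. The access sequence of a run that is
cut off is an initial part of the sequence of the full run, and it grows with `f`, so the supremum
is the expectation for the full run. -/
noncomputable def Input.cost {α : Type*} [LinearOrder α] {n : ℕ} (I : Input α n) (M B : ℕ) : ℝ≥0∞ :=
  ⨆ f : ℕ, ∑' l : List Access, (I.main f).traceLaw I.mem l * transfers M B l

/-- The expected number of block transfers of the algorithm for sorting `n` distinct items, in the
worst case over the input. -/
noncomputable def expectedTransfers (α : Type*) [LinearOrder α] (M B n : ℕ) : ℝ≥0∞ :=
  ⨆ I : Input α n, I.cost M B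

end SquareSort

/-!
The proof separates what the program does from what it costs. A program is described by triples `Tr`
with a policy (which cells may be accessed when), a cost and a postcondition. The policy and the
postcondition form a weakest precondition `Safe`, and random choices are adversarial there. The cost
is the expectation `ex` of an explicit cache management that may change the cache before every
access at the price of two transfers per new block, one of them for a later write-back; by
`tsum_traceLaw_le` it bounds the expected number of transfers under optimal paging. Costs come from
three sources: a program makes few accesses (`Tr.of_len`), all its accesses fall into a few blocks
(`Cost.of_blocks`), or they are to a few blocks and under a few pointers that move forward
(`Cost.of_pointers`). In the last two the number of accesses does not matter.

Let `m = ⌈√n⌉`. Apart from the recursive calls, `squareSort` costs `O(m + m² / B + n / B + 1)`: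

* Loops over `m` entries cost `O(m)`, and the scans cost one more per block of the array.
* Skew transposition costs nothing beyond block crossings once every sub-column and every bucket
  of a call has a block in the cache (`Grid.spec_small`); above that the recursion tree has
  `O(m² / B²)` nodes (`Grid.spec_large`), and all parts together cross `O(m + n / B)` block
  boundaries by monotonicity of the pointers (`Grid.crossings_add`, `Grid.spec_square`).
* A sample is distinct and avoids the minimum with probability at least `1/3`, by the union bound.
  So an expectation over the accepted sample is at most three times the one over a single sample
  (`sampleLoop_ex`).

The sum of the squares of the bucket sizes is at most twice the number of pairs of items that no
pivot separates (`unseparated`). A pair with `e` items between survives a random sample with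
probability `(1 - e / n) ^ (m - 1)`, so the expected number of such pairs is `O(n m)`
(`avgL_unseparated`). Thus a quadratic majorant `a + b y + c y²` of the cost of a bucket of size `y`
bounds the expected cost of all buckets by `m a + b n + 12 c n m`, and `squareSort_large` is a
recurrence for the expected cost.

Put `L = M / 36`. For `n ≤ L` both arrays and the stack, `18 n` cells and a few more, fit into the
cache, and `cost_sortArea` gives `O(n / B + 1)`. For `n > L` the recurrence is solved by
`10⁷ (n / B) (2 log_L n - 1)`: the columns and the buckets have about `√n` items each, so that both
together contribute `10⁷ (n / B) (2 log_L n - 2)`, which leaves `10⁷ n / B` for the cost of one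
level and for the deviation of the buckets from their average size (`bound_recurrence`). The
hypothesis that `B` exceeds `36 exp 200` makes `log L` so large that this deviation is harmless.
-/

namespace SquareSort
open Prog
open Function (update update_of_ne update_self update_apply)
open Finset (range mem_range sum_congr mem_union_right mem_filter sum_le_sum sum_add_distrib
  mem_union_left card_union_le sum_range_succ card_range card_le_card card_image_le)

variable {α : Type*} [LinearOrder α] {ρ σ : Type}

/-! ### Safety: which cells a program touches, and where it ends -/

/-- The accesses that a program may make, depending on the current memory `μ`: `rd μ a` allows
reading the cell `a`, and `wr μ a c` allows overwriting it with `c`. -/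
structure Policy (α : Type*) where
  rd : Mem α → ℕ → Prop
  wr : Mem α → ℕ → Cell α → Prop

/-- Read in `R` and write in `W`, whatever the memory contains. -/
def Policy.box (R W : Set ℕ) : Policy α := ⟨fun _ a => a ∈ R, fun _ a _ => a ∈ W⟩

/-- The weakest precondition: from the memory `μ` every possible run of the program respects the
policy `π` and, unless it is cut off, ends in a value and a memory that satisfy `Q`. The random
choices are treated as adversarial. -/
def Safe (π : Policy α) : Prog ρ → Mem α → (ρ → Mem α → Prop) → Prop
  | .ret x, μ, Q => Q x μ
  | .halt, _, _ => True
  | .load a k, μ, Q => π.rd μ a ∧ Safe π (k (μ a).toNat) μ Q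
  | .store a v k, μ, Q => π.wr μ a (.num v) ∧ Safe π k (update μ a (.num v)) Q
  | .storeInfty a k, μ, Q => π.wr μ a .infty ∧ Safe π k (update μ a .infty) Q
  | .move d s k, μ, Q => π.rd μ s ∧ π.wr μ d (μ s) ∧ Safe π k (update μ d (μ s)) Q
  | .less a b k, μ, Q => π.rd μ a ∧ π.rd μ b ∧ Safe π (k ((μ a).lt (μ b))) μ Q
  | .rand r k, μ, Q => ∀ v ≤ r, Safe π (k v) μ Q

section SafeRules

variable {π : Policy α} {μ : Mem α}

theorem Safe.bind_iff {p : Prog ρ} {g : ρ → Prog σ} {Q : σ → Mem α → Prop} :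
    Safe π (Prog.bind p g) μ Q ↔ Safe π p μ fun x μ' => Safe π (g x) μ' Q := by
  induction p generalizing μ with
  | ret x => rfl
  | halt => rfl
  | load a k ih => simp only [Prog.bind, Safe, ih]
  | store a v k ih => simp only [Prog.bind, Safe, ih]
  | storeInfty a k ih => simp only [Prog.bind, Safe, ih]
  | move d s k ih => simp only [Prog.bind, Safe, ih]
  | less a b k ih => simp only [Prog.bind, Safe, ih]
  | rand r k ih => simp only [Prog.bind, Safe, ih]

theorem Safe.mono {p : Prog ρ} {Q Q' : ρ → Mem α → Prop} (h : Safe π p μ Q)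
    (hQ : ∀ x μ', Q x μ' → Q' x μ') : Safe π p μ Q' := by
  induction p generalizing μ with
  | ret x => exact hQ _ _ h
  | halt => trivial
  | load a k ih => exact ⟨h.1, ih _ h.2⟩
  | store a v k ih => exact ⟨h.1, ih h.2⟩
  | storeInfty a k ih => exact ⟨h.1, ih h.2⟩
  | move d s k ih => exact ⟨h.1, h.2.1, ih h.2.2⟩
  | less a b k ih => exact ⟨h.1, h.2.1, ih _ h.2.2⟩
  | rand r k ih => exact fun v hv => ih _ (h v hv)

/-- Change of the policy, under an invariant `J` of the memory that all permitted writes preserve;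
the invariant also holds at the end. -/
theorem Safe.weaken {π' : Policy α} {J : Mem α → Prop} {p : Prog ρ} {Q : ρ → Mem α → Prop}
    (h : Safe π p μ Q) (hJ : J μ)
    (hrd : ∀ μ a, J μ → π.rd μ a → π'.rd μ a)
    (hwr : ∀ μ a c, J μ → π.wr μ a c → π'.wr μ a c ∧ J (update μ a c)) :
    Safe π' p μ fun x μ' => Q x μ' ∧ J μ' := by
  induction p generalizing μ with
  | ret x => exact ⟨h, hJ⟩
  | halt => trivial
  | load a k ih => exact ⟨hrd _ _ hJ h.1, ih _ h.2 hJ⟩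
  | store a v k ih => exact ⟨(hwr _ _ _ hJ h.1).1, ih h.2 (hwr _ _ _ hJ h.1).2⟩
  | storeInfty a k ih => exact ⟨(hwr _ _ _ hJ h.1).1, ih h.2 (hwr _ _ _ hJ h.1).2⟩
  | move d s k ih =>
    exact ⟨hrd _ _ hJ h.1, (hwr _ _ _ hJ h.2.1).1, ih h.2.2 (hwr _ _ _ hJ h.2.1).2⟩
  | less a b k ih => exact ⟨hrd _ _ hJ h.1, hrd _ _ hJ h.2.1, ih _ h.2.2 hJ⟩
  | rand r k ih => exact fun v hv => ih _ (h v hv) hJ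

/-- Cells that the policy does not allow to be written keep their contents. -/
theorem Safe.frame {p : Prog ρ} {Q : ρ → Mem α → Prop} {W : Set ℕ}
    (h : Safe π p μ Q) (hW : ∀ μ a c, π.wr μ a c → a ∈ W) :
    Safe π p μ fun x μ' => Q x μ' ∧ ∀ a ∉ W, μ' a = μ a := by
  refine h.weaken (J := fun μ' => ∀ a ∉ W, μ' a = μ a) (fun _ _ => rfl) (fun _ _ _ h => h) ?_
  intro μ' a c hJ hw
  refine ⟨hw, fun x hx => ?_⟩
  rw [update_of_ne, hJ x hx]
  rintro rfl
  exact hx (hW _ _ _ hw)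

theorem Safe.and {p : Prog ρ} {Q Q' : ρ → Mem α → Prop} {π' : Policy α} (h : Safe π p μ Q)
    (h' : Safe π' p μ Q') : Safe π p μ fun x μ' => Q x μ' ∧ Q' x μ' := by
  induction p generalizing μ with
  | ret x => exact ⟨h, h'⟩
  | halt => trivial
  | load a k ih => exact ⟨h.1, ih _ h.2 h'.2⟩
  | store a v k ih => exact ⟨h.1, ih h.2 h'.2⟩
  | storeInfty a k ih => exact ⟨h.1, ih h.2 h'.2⟩
  | move d s k ih => exact ⟨h.1, h.2.1, ih h.2.2 h'.2.2⟩
  | less a b k ih => exact ⟨h.1, h.2.1, ih _ h.2.2 h'.2.2⟩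
  | rand r k ih => exact fun v hv => ih _ (h v hv) (h' v hv)

theorem Safe.box_mono {p : Prog ρ} {Q : ρ → Mem α → Prop} {R W R' W' : Set ℕ}
    (h : Safe (.box R W) p μ Q) (hR : R ⊆ R') (hW : W ⊆ W') : Safe (.box R' W') p μ Q :=
  (h.weaken (J := fun _ => True) trivial (fun _ _ _ h => hR h)
    (fun _ _ _ _ h => ⟨hW h, trivial⟩)).mono fun _ _ h => h.1

theorem Safe.box_frame {p : Prog ρ} {Q : ρ → Mem α → Prop} {R W : Set ℕ}
    (h : Safe (.box R W) p μ Q) :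
    Safe (.box R W) p μ fun x μ' => Q x μ' ∧ ∀ a ∉ W, μ' a = μ a :=
  h.frame fun _ _ _ h => h

/-! ### Safety of the basic expressions and statements -/

@[simp] theorem safe_ret {x : ρ} {Q : ρ → Mem α → Prop} : Safe π (.ret x) μ Q ↔ Q x μ := Iff.rfl

@[simp] theorem safe_pure {x : ρ} {Q : ρ → Mem α → Prop} :
    Safe π (pure x : Prog ρ) μ Q ↔ Q x μ := Iff.rfl

@[simp] theorem safe_bind {p : Prog ρ} {g : ρ → Prog σ} {Q : σ → Mem α → Prop} :
    Safe π (p >>= g) μ Q ↔ Safe π p μ fun x μ' => Safe π (g x) μ' Q := Safe.bind_iff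

@[simp] theorem safe_map {p : Prog ρ} {g : ρ → σ} {Q : σ → Mem α → Prop} :
    Safe π (g <$> p) μ Q ↔ Safe π p μ fun x μ' => Q (g x) μ' := Safe.bind_iff

@[simp] theorem safe_ite {b : Prop} [Decidable b] {p q : Prog ρ} {Q : ρ → Mem α → Prop} :
    Safe π (if b then p else q) μ Q ↔ if b then Safe π p μ Q else Safe π q μ Q := by
  split_ifs <;> rfl

variable {Q : ℕ → Mem α → Prop} {QB : Bool → Mem α → Prop} {QU : Unit → Mem α → Prop}

@[simp] theorem safe_v {a : ℕ} : Safe π (v a) μ Q ↔ π.rd μ a ∧ Q (μ a).toNat μ := Iff.rfl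
@[simp] theorem safe_deref {e : Prog ℕ} : Safe π (deref e) μ Q ↔
    Safe π e μ fun a μ' => π.rd μ' a ∧ Q (μ' a).toNat μ' := by
  simp [deref]
@[simp] theorem safe_add {x y : Prog ℕ} : Safe π (x + y) μ Q ↔
    Safe π x μ fun a μ' => Safe π y μ' fun b μ'' => Q (a + b) μ'' := by
  change Safe π (add x y) μ Q ↔ _
  simp [add]
@[simp] theorem safe_sub {x y : Prog ℕ} : Safe π (x - y) μ Q ↔
    Safe π x μ fun a μ' => Safe π y μ' fun b μ'' => Q (a - b) μ'' := by
  change Safe π (sub x y) μ Q ↔ _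
  simp [sub]
@[simp] theorem safe_mul {x y : Prog ℕ} : Safe π (x * y) μ Q ↔
    Safe π x μ fun a μ' => Safe π y μ' fun b μ'' => Q (a * b) μ'' := by
  change Safe π (mul x y) μ Q ↔ _
  simp [mul]
@[simp] theorem safe_assign {a : ℕ} {e : Prog ℕ} : Safe π (assign a e) μ QU ↔
    Safe π e μ fun x μ' => π.wr μ' a (.num x) ∧ QU () (update μ' a (.num x)) := by
  simp [assign, Safe]
@[simp] theorem safe_cond {c : Prog Bool} {p q : Prog Unit} : Safe π (SquareSort.cond c p q) μ QU ↔
    Safe π c μ fun b μ' => if b then Safe π p μ' QU else Safe π q μ' QU := by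
  simp [SquareSort.cond]
@[simp] theorem safe_pushAll_nil {a : ℕ} : Safe π (pushAll a []) μ QU ↔ QU () μ := Iff.rfl
@[simp] theorem safe_pushAll_cons {a : ℕ} {e : Prog ℕ} {es : List (Prog ℕ)} :
    Safe π (pushAll a (e :: es)) μ QU ↔
      Safe π (assign a e) μ fun _ μ' => Safe π (pushAll (a + 1) es) μ' QU := by
  simp [pushAll]

end SafeRules

@[simp] theorem toNat_num {α : Type*} (n : ℕ) : (Cell.num n : Cell α).toNat = n := rfl

@[simp] theorem box_rd {α : Type*} {R W : Set ℕ} {μ : Mem α} {a : ℕ} :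
    (Policy.box R W).rd μ a ↔ a ∈ R := Iff.rfl
@[simp] theorem box_wr {α : Type*} {R W : Set ℕ} {μ : Mem α} {a : ℕ} {c : Cell α} :
    (Policy.box R W).wr μ a c ↔ a ∈ W := Iff.rfl

/-- One round of `while c do p`; the result tells whether the condition held. -/
def iter (c : Prog Bool) (p : Prog Unit) : Prog Bool := do
  if ← c then do p; return true else return false

/-- The weakest preconditions of all expressions and statements without loops and calls, as one set
of rewriting rules. -/
theorem safe_rules {π : Policy α} {μ : Mem α} :
    (∀ (ρ : Type) (x : ρ) (Q : ρ → Mem α → Prop), Safe π (pure x : Prog ρ) μ Q ↔ Q x μ) ∧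
    (∀ (ρ : Type) (x : ρ) (Q : ρ → Mem α → Prop), Safe π (Prog.ret x) μ Q ↔ Q x μ) ∧
    (∀ (ρ σ : Type) (p : Prog ρ) (g : ρ → Prog σ) (Q : σ → Mem α → Prop), Safe π (p >>= g) μ Q ↔
      Safe π p μ fun x μ' => Safe π (g x) μ' Q) ∧
    (∀ (ρ σ : Type) (p : Prog ρ) (g : ρ → σ) (Q : σ → Mem α → Prop), Safe π (g <$> p) μ Q ↔
      Safe π p μ fun x μ' => Q (g x) μ') ∧
    (∀ (b : Bool) (ρ : Type) (p q : Prog ρ) (Q : ρ → Mem α → Prop),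
      Safe π (if b then p else q) μ Q ↔ if b then Safe π p μ Q else Safe π q μ Q) ∧
    (∀ (n : ℕ) (Q : ℕ → Mem α → Prop), Safe π (lit n) μ Q ↔ Q n μ) ∧
    (∀ (Q : ℕ → Mem α → Prop), Safe π (0 : Prog ℕ) μ Q ↔ Q 0 μ) ∧
    (∀ (Q : ℕ → Mem α → Prop), Safe π (1 : Prog ℕ) μ Q ↔ Q 1 μ) ∧
    (∀ (n : ℕ) (Q : ℕ → Mem α → Prop),
      Safe π (no_index (OfNat.ofNat n) : Prog ℕ) μ Q ↔ Q (OfNat.ofNat n) μ) ∧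
    (∀ (a : ℕ) (Q : ℕ → Mem α → Prop),
      Safe π (v a) μ Q ↔ π.rd μ a ∧ Q (μ a).toNat μ) ∧
    (∀ (x : Prog ℕ) (Q : ℕ → Mem α → Prop), Safe π (deref x) μ Q ↔
      Safe π x μ fun a μ' => π.rd μ' a ∧ Q (μ' a).toNat μ') ∧
    (∀ (x y : Prog ℕ) (Q : ℕ → Mem α → Prop), Safe π (x + y) μ Q ↔
      Safe π x μ fun a μ' => Safe π y μ' fun b μ'' => Q (a + b) μ'') ∧
    (∀ (x y : Prog ℕ) (Q : ℕ → Mem α → Prop), Safe π (x - y) μ Q ↔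
      Safe π x μ fun a μ' => Safe π y μ' fun b μ'' => Q (a - b) μ'') ∧
    (∀ (x y : Prog ℕ) (Q : ℕ → Mem α → Prop), Safe π (x * y) μ Q ↔
      Safe π x μ fun a μ' => Safe π y μ' fun b μ'' => Q (a * b) μ'') ∧
    (∀ (x : Prog ℕ) (Q : ℕ → Mem α → Prop), Safe π (half x) μ Q ↔
      Safe π x μ fun a μ' => Q (a / 2) μ') ∧
    (∀ (x y : Prog ℕ) (Q : ℕ → Mem α → Prop), Safe π (minimum x y) μ Q ↔
      Safe π x μ fun a μ' => Safe π y μ' fun b μ'' => Q (min a b) μ'') ∧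
    (∀ (x : Prog ℕ) (Q : ℕ → Mem α → Prop), Safe π (random x) μ Q ↔
      Safe π x μ fun a μ' => ∀ v ≤ a - 1, Q v μ') ∧
    (∀ (x y : Prog ℕ) (Q : Bool → Mem α → Prop), Safe π (lt x y) μ Q ↔
      Safe π x μ fun a μ' => Safe π y μ' fun b μ'' => Q (decide (a < b)) μ'') ∧
    (∀ (c : Prog Bool) (Q : Bool → Mem α → Prop), Safe π (neg c) μ Q ↔
      Safe π c μ fun b μ' => Q (!b) μ') ∧
    (∀ (c d : Prog Bool) (Q : Bool → Mem α → Prop), Safe π (both c d) μ Q ↔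
      Safe π c μ fun b μ' => if b then Safe π d μ' Q else Q false μ') ∧
    (∀ (c d : Prog Bool) (Q : Bool → Mem α → Prop), Safe π (either c d) μ Q ↔
      Safe π c μ fun b μ' => if b then Q true μ' else Safe π d μ' Q) ∧
    (∀ (x y : Prog ℕ) (Q : Bool → Mem α → Prop), Safe π (lessAt x y) μ Q ↔
      Safe π x μ fun a μ' => Safe π y μ' fun b μ'' =>
        π.rd μ'' a ∧ π.rd μ'' b ∧ Q ((μ'' a).lt (μ'' b)) μ'') ∧
    (∀ (a : ℕ) (e : Prog ℕ) (Q : Unit → Mem α → Prop), Safe π (assign a e) μ Q ↔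
      Safe π e μ fun x μ' => π.wr μ' a (.num x) ∧ Q () (update μ' a (.num x))) ∧
    (∀ (x e : Prog ℕ) (Q : Unit → Mem α → Prop), Safe π (put x e) μ Q ↔
      Safe π x μ fun a μ' => Safe π e μ' fun y μ'' =>
        π.wr μ'' a (.num y) ∧ Q () (update μ'' a (.num y))) ∧
    (∀ (x : Prog ℕ) (Q : Unit → Mem α → Prop), Safe π (putInfty x) μ Q ↔
      Safe π x μ fun a μ' => π.wr μ' a .infty ∧ Q () (update μ' a .infty)) ∧
    (∀ (x y : Prog ℕ) (Q : Unit → Mem α → Prop), Safe π (moveAt x y) μ Q ↔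
      Safe π x μ fun a μ' => Safe π y μ' fun b μ'' =>
        π.rd μ'' b ∧ π.wr μ'' a (μ'' b) ∧ Q () (update μ'' a (μ'' b))) ∧
    (∀ (c : Prog Bool) (p q : Prog Unit) (Q : Unit → Mem α → Prop),
      Safe π (SquareSort.cond c p q) μ Q ↔
        Safe π c μ fun b μ' => if b then Safe π p μ' Q else Safe π q μ' Q) ∧
    (∀ (c : Prog Bool) (p : Prog Unit) (Q : Bool → Mem α → Prop), Safe π (iter c p) μ Q ↔
      Safe π c μ fun b μ' => if b then Safe π p μ' fun _ μ'' => Q true μ'' else Q false μ') ∧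
    (∀ (a : ℕ) (Q : Unit → Mem α → Prop), Safe π (pushAll a []) μ Q ↔ Q () μ) ∧
    (∀ (a : ℕ) (e : Prog ℕ) (es : List (Prog ℕ)) (Q : Unit → Mem α → Prop),
      Safe π (pushAll a (e :: es)) μ Q ↔ Safe π e μ fun x μ' => π.wr μ' a (.num x) ∧
        Safe π (pushAll (a + 1) es) (update μ' a (.num x)) Q) := by
  refine ⟨?_, ?_, ?_, ?_, ?_, ?_, ?_, ?_, ?_, ?_, ?_, ?_, ?_, ?_, ?_, ?_, ?_, ?_, ?_, ?_, ?_, ?_,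
    ?_, ?_, ?_, ?_, ?_, ?_, ?_, ?_⟩ <;> intros <;>
    first | rfl |
    simp [iter, half, minimum, random, lt, neg, both, either, lessAt, put, putInfty, moveAt, Safe]

/-- Rewriting rules for the side conditions that `safe_rules` leaves. -/
theorem cell_rules {α : Type*} :
    (∀ (R W : Set ℕ) (μ : Mem α) (a : ℕ), (Policy.box R W).rd μ a ↔ a ∈ R) ∧
    (∀ (R W : Set ℕ) (μ : Mem α) (a : ℕ) (c : Cell α), (Policy.box R W).wr μ a c ↔ a ∈ W) ∧
    (∀ n : ℕ, (Cell.num n : Cell α).toNat = n) := by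
  simp

/-- Rewriting rules for the side conditions that `safe_rules` leaves. -/
theorem mem_rules :
    (∀ (P : ℕ → Prop) (a : ℕ), a ∈ {a | P a} ↔ P a) ∧
    (∀ p : Prop, (p ∨ True) ↔ True) ∧ (∀ p : Prop, (True ∨ p) ↔ True) ∧
    (∀ b : Bool, (!b) = true ↔ ¬ b = true) ∧
    (∀ a b : ℕ, (a = a + b) ↔ b = 0) ∧ (∀ a b : ℕ, (a + b = a) ↔ b = 0) := by
  simp

/-- Rewriting rules that evaluate updated memories at cells at a numeral distance; to be used with
`Nat.reduceEqDiff` and `if_true`, `if_false`. -/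
theorem upd_rules {α : Type*} :
    ∀ (μ : Mem α) (a b : ℕ) (c : Cell α), update μ a c b = if b = a then c else μ b := by
  simp [update_apply]

theorem Prog.bind_assoc {τ : Type} (p : Prog ρ) (g : ρ → Prog σ) (h : σ → Prog τ) :
    (p.bind g).bind h = p.bind fun x => (g x).bind h := by
  induction p with
  | ret x => rfl
  | halt => rfl
  | load a k ih => simp only [Prog.bind, ih]
  | store a v k ih => simp only [Prog.bind, ih]
  | storeInfty a k ih => simp only [Prog.bind, ih]
  | move d s k ih => simp only [Prog.bind, ih]
  | less a b k ih => simp only [Prog.bind, ih]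
  | rand r k ih => simp only [Prog.bind, ih]

theorem loop_succ (f : ℕ) (c : Prog Bool) (p : Prog Unit) :
    loop (f + 1) c p = iter c p >>= fun b => if b then loop f c p else Prog.ret () := by
  change (c.bind fun b => if b = true then p.bind (fun _ => loop f c p) else Prog.ret ()) =
    (c.bind fun b => if b = true then p.bind (fun _ => Prog.ret true) else Prog.ret false).bind _
  rw [Prog.bind_assoc]
  congr 1
  funext b
  cases b
  · rfl
  · simp only [if_true, Prog.bind_assoc]
    rfl

theorem Safe.loop {π : Policy α} {c : Prog Bool} {p : Prog Unit} {Q : Mem α → Prop}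
    (I : Mem α → Prop) {μ : Mem α} (f : ℕ) (h0 : I μ)
    (h : ∀ μ, I μ → Safe π (iter c p) μ fun b μ' => if b then I μ' else Q μ') :
    Safe π (loop f c p) μ fun _ => Q := by
  induction f generalizing μ with
  | zero => trivial
  | succ f ih =>
    rw [loop_succ, safe_bind]
    refine (h μ h0).mono fun b μ' hb => ?_
    cases b
    · simpa using hb
    · simpa using ih hb

/-! ### The expected cost of a program under explicit cache management -/

section

variable (k B : ℕ)

/-- The cheapest way to go on after the cache is changed from `C` to some `C'` of at most `k` blocks
with the property `P`, where `g` is the cost of what follows. Each new block is charged `2`: one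
transfer to bring it in, and one in advance for writing it back. -/
noncomputable def refetch (C : Finset ℕ) (P : Finset ℕ → Prop) (g : Finset ℕ → ℝ≥0∞) : ℝ≥0∞ :=
  ⨅ (C' : Finset ℕ) (_ : C'.card ≤ k) (_ : P C'), 2 * ((C' \ C).card : ℝ≥0∞) + g C'

/-- The expected cost of a program that is started with the memory `μ` and the blocks `C` in the
cache, if before every access the cache may be changed to any set of `k` blocks that contains the
blocks in question. Completed runs also pay `ψ` of the outcome; runs that are cut off do not. The
final cache is dropped, and the choice of the cache does not look into future random choices, so
this bounds the cost of optimal paging from above. -/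
noncomputable def ex : Prog ρ → Mem α → Finset ℕ → (ρ → Mem α → ℝ≥0∞) → ℝ≥0∞
  | .ret x, μ, _, ψ => ψ x μ
  | .halt, _, _, _ => 0
  | .load a p, μ, C, ψ => refetch k C (a / B ∈ ·) fun C' => ex (p (μ a).toNat) μ C' ψ
  | .store a v p, μ, C, ψ =>
      refetch k C (a / B ∈ ·) fun C' => ex p (update μ a (.num v)) C' ψ
  | .storeInfty a p, μ, C, ψ =>
      refetch k C (a / B ∈ ·) fun C' => ex p (update μ a .infty) C' ψ
  | .move d s p, μ, C, ψ =>
      refetch k C (fun C' => s / B ∈ C' ∧ d / B ∈ C') fun C' =>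
        ex p (update μ d (μ s)) C' ψ
  | .less a b p, μ, C, ψ =>
      refetch k C (fun C' => a / B ∈ C' ∧ b / B ∈ C') fun C' => ex (p ((μ a).lt (μ b))) μ C' ψ
  | .rand r p, μ, C, ψ => (∑ v : Fin (r + 1), ex (p v) μ C ψ) / (r + 1 : ℕ)

end

variable {k B : ℕ}

theorem refetch_le {C C' : Finset ℕ} {P : Finset ℕ → Prop} {g : Finset ℕ → ℝ≥0∞}
    (hk : C'.card ≤ k) (hP : P C') : refetch k C P g ≤ 2 * ((C' \ C).card : ℝ≥0∞) + g C' :=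
  iInf₂_le_of_le C' hk (iInf_le _ hP)

theorem refetch_mono {C : Finset ℕ} {P : Finset ℕ → Prop} {g g' : Finset ℕ → ℝ≥0∞}
    (h : ∀ C' : Finset ℕ, C'.card ≤ k → P C' → g C' ≤ g' C') : refetch k C P g ≤ refetch k C P g' :=
  iInf_mono fun _ => iInf_mono fun hk => iInf_mono fun hP => add_le_add_right (h _ hk hP) _

theorem refetch_switch {C C₁ : Finset ℕ} {P : Finset ℕ → Prop} {g : Finset ℕ → ℝ≥0∞} :
    refetch k C P g ≤ 2 * ((C₁ \ C).card : ℝ≥0∞) + refetch k C₁ P g := by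
  unfold refetch
  simp only [ENNReal.add_iInf]
  refine le_iInf fun C' => le_iInf fun hk => le_iInf fun hP => ?_
  refine (iInf₂_le_of_le C' hk (iInf_le _ hP)).trans ?_
  rw [← add_assoc, ← mul_add]
  gcongr
  have : (C' \ C).card ≤ (C₁ \ C).card + (C' \ C₁).card := by
    refine (card_le_card (t := (C₁ \ C) ∪ (C' \ C₁)) ?_).trans (card_union_le _ _)
    intro x
    simp only [Finset.mem_sdiff, Finset.mem_union]
    tauto
  exact_mod_cast this

theorem avg_le {r : ℕ} {g : Fin (r + 1) → ℝ≥0∞} {K : ℝ≥0∞} (h : ∀ v, g v ≤ K) :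
    (∑ v, g v) / (r + 1 : ℕ) ≤ K := by
  refine ENNReal.div_le_of_le_mul ?_
  refine (sum_le_sum fun v _ => h v).trans ?_
  simp [mul_comm]

/-- The cache may be changed at any time. -/
theorem ex_switch {p : Prog ρ} {μ : Mem α} {C : Finset ℕ} (C₁ : Finset ℕ) {ψ : ρ → Mem α → ℝ≥0∞} :
    ex k B p μ C ψ ≤ 2 * ((C₁ \ C).card : ℝ≥0∞) + ex k B p μ C₁ ψ := by
  induction p generalizing μ with
  | ret x => exact le_add_self
  | halt => exact zero_le
  | load a p ih => exact refetch_switch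
  | store a v p ih => exact refetch_switch
  | storeInfty a p ih => exact refetch_switch
  | move d s p ih => exact refetch_switch
  | less a b p ih => exact refetch_switch
  | rand r p ih =>
    simp only [ex]
    refine ENNReal.div_le_of_le_mul ?_
    refine (sum_le_sum fun v _ => ih _).trans ?_
    rw [sum_add_distrib, add_mul, ENNReal.div_mul_cancel (by positivity) (by simp)]
    simp [mul_comm]

theorem ex_bind_le {p : Prog ρ} {g : ρ → Prog σ} {μ : Mem α} {C : Finset ℕ}
    {ψ : σ → Mem α → ℝ≥0∞} :
    ex k B (p >>= g) μ C ψ ≤ ex k B p μ C fun x μ' => ex k B (g x) μ' ∅ ψ := by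
  change ex k B (p.bind g) μ C ψ ≤ _
  induction p generalizing μ C with
  | ret x =>
    refine (ex_switch ∅).trans ?_
    simp [ex, Prog.bind]
  | halt => exact le_rfl
  | load a p ih => exact refetch_mono fun C' _ _ => ih _
  | store a v p ih => exact refetch_mono fun C' _ _ => ih
  | storeInfty a p ih => exact refetch_mono fun C' _ _ => ih
  | move d s p ih => exact refetch_mono fun C' _ _ => ih
  | less a b p ih => exact refetch_mono fun C' _ _ => ih _
  | rand r p ih =>
    simp only [ex, Prog.bind]
    gcongr
    exact ih _

open Classical in
/-- Only the outcomes that are possible count. -/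
theorem ex_le_of_safe {π : Policy α} {p : Prog ρ} {μ : Mem α} {C : Finset ℕ}
    {Q : ρ → Mem α → Prop} {ψ : ρ → Mem α → ℝ≥0∞} (h : Safe π p μ Q) :
    ex k B p μ C ψ ≤ ex k B p μ C fun x μ' => if Q x μ' then ψ x μ' else 0 := by
  induction p generalizing μ C with
  | ret x => simp only [ex]; rw [if_pos (show Q x μ from h)]
  | halt => exact le_rfl
  | load a p ih => exact refetch_mono fun C' _ _ => ih _ h.2
  | store a v p ih => exact refetch_mono fun C' _ _ => ih h.2
  | storeInfty a p ih => exact refetch_mono fun C' _ _ => ih h.2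
  | move d s p ih => exact refetch_mono fun C' _ _ => ih h.2.2
  | less a b p ih => exact refetch_mono fun C' _ _ => ih _ h.2.2
  | rand r p ih =>
    simp only [ex]
    gcongr with v
    exact ih _ (h v (Nat.lt_succ_iff.1 v.2))

/-! ### Soundness of explicit cache management -/

/-- Evicting a block costs at most one transfer, whether or not it was modified. -/
theorem serves_evict (C W D : Finset ℕ) (l : List (ℕ × Bool)) (hD : D ⊆ C) {q : ℕ}
    (h : ∀ W' ⊆ C \ D, ∃ q' ≤ q, Serves k (C \ D) W' l q') (hW : W ⊆ C) :
    ∃ q' ≤ q + D.card, Serves k C W l q' := by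
  induction D using Finset.induction_on generalizing C W q with
  | empty => simpa using h W (by simpa using hW)
  | insert b D hb ih =>
    have hbC : b ∈ C := hD (Finset.mem_insert_self _ _)
    have e : C.erase b \ D = C \ insert b D := by
      ext x; simp only [Finset.mem_sdiff, Finset.mem_erase, Finset.mem_insert]; tauto
    obtain ⟨q', hq', hs⟩ := ih (C.erase b) (W.erase b)
      (fun x hx => Finset.mem_erase.2 ⟨by rintro rfl; exact hb hx, hD
          (Finset.mem_insert_of_mem hx)⟩)
      (q := q) (by rw [e]; exact h) (Finset.erase_subset_erase b hW)
    refine ⟨_, ?_, Serves.evict hbC hs⟩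
    rw [Finset.card_insert_of_notMem hb]
    split_ifs <;> omega

theorem serves_fetch (C W D : Finset ℕ) (l : List (ℕ × Bool)) (hD : Disjoint D C) {q : ℕ}
    (hk : (C ∪ D).card ≤ k) (h : Serves k (C ∪ D) W l q) :
    Serves k C W l (q + D.card) := by
  induction D using Finset.induction_on generalizing C q with
  | empty => simpa using h
  | insert b D hb ih =>
    rw [Finset.disjoint_insert_left] at hD
    have e : insert b C ∪ D = C ∪ insert b D := by
      ext x; simp only [Finset.mem_union, Finset.mem_insert]; tauto
    have hs := ih (insert b C) (Finset.disjoint_insert_right.2 ⟨hb, hD.2⟩) (by rwa [e]) (by rwa [e])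
    rw [Finset.card_insert_of_notMem hb, ← add_assoc]
    refine Serves.fetch hD.1 ?_ hs
    refine lt_of_lt_of_le ?_ hk
    apply Finset.card_lt_card
    rw [Finset.ssubset_iff_of_subset Finset.subset_union_left]
    exact ⟨b, by simp, hD.1⟩

theorem serves_switch {C C₁ W : Finset ℕ} {l : List (ℕ × Bool)} {q : ℕ} (hW : W ⊆ C)
    (hk : C₁.card ≤ k)
    (h : ∀ W ⊆ C₁, ∃ q' ≤ q + C₁.card, Serves k C₁ W l q') :
    ∃ q' ≤ 2 * (C₁ \ C).card + q + C.card, Serves k C W l q' := by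
  have e : C ∩ C₁ ∪ C₁ \ C = C₁ := by
    ext x; simp only [Finset.mem_union, Finset.mem_inter, Finset.mem_sdiff]; tauto
  have e' : C \ (C \ C₁) = C ∩ C₁ := by simp
  have h1 : ∀ W' ⊆ C \ (C \ C₁), ∃ q' ≤ q + C₁.card + (C₁ \ C).card,
      Serves k (C \ (C \ C₁)) W' l q' := by
    intro W' hW'
    rw [e'] at hW' ⊢
    obtain ⟨q', hq', hs⟩ := h W' (hW'.trans Finset.inter_subset_right)
    refine ⟨_, ?_, serves_fetch (C ∩ C₁) W' (C₁ \ C) l ?_ (by rwa [e]) (by rwa [e])⟩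
    · omega
    · rw [Finset.disjoint_left]
      intro x
      simp only [Finset.mem_sdiff, Finset.mem_inter]
      tauto
  obtain ⟨q', hq', hs⟩ := serves_evict C W (C \ C₁) l Finset.sdiff_subset h1 hW
  refine ⟨q', hq'.trans ?_, hs⟩
  have h3 := Finset.card_sdiff_add_card_inter C₁ C
  have h4 := Finset.card_sdiff_add_card_inter C C₁
  rw [Finset.inter_comm] at h3
  omega

/-- The least number of transfers for the accesses `l` from the cache `C`, when the write-backs of
the blocks in `C` are paid for: `q` is admissible if, whichever blocks `W` of `C` are modified, `q`
transfers suffice besides one for every block of `C`. -/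
noncomputable def opt (k B : ℕ) (C : Finset ℕ) (l : List Access) : ℝ≥0∞ :=
  ⨅ (q : ℕ) (_ : ∀ W ⊆ C, ∃ q' ≤ q + C.card,
    Serves k C W (l.map fun a => (a.addr / B, a.write)) q'), (q : ℝ≥0∞)

theorem transfers_le_opt (M : ℕ) (l : List Access) : transfers M B l ≤ opt (M / B) B ∅ l := by
  refine le_iInf₂ fun q hq => ?_
  obtain ⟨q', hq', hs⟩ := hq ∅ subset_rfl
  refine (iInf₂_le q' hs).trans ?_
  simpa using hq'

theorem opt_nil (C : Finset ℕ) : opt k B C [] = 0 := by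
  refine le_antisymm ((iInf₂_le 0 fun W _ => ⟨0, by simp, ?_⟩).trans (by simp)) zero_le
  exact Serves.done _ _

theorem opt_append_le {C C₁ : Finset ℕ} (s l : List Access) (hs : ∀ a ∈ s, a.addr / B ∈ C₁)
    (hk : C₁.card ≤ k) : opt k B C (s ++ l) ≤ 2 * ((C₁ \ C).card : ℝ≥0∞) + opt k B C₁ l := by
  unfold opt
  simp only [ENNReal.add_iInf]
  refine le_iInf fun q => le_iInf fun hq => ?_
  have key : ∀ W ⊆ C₁, ∃ q' ≤ q + C₁.card,
      Serves k C₁ W ((s ++ l).map fun a => (a.addr / B, a.write)) q' := by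
    induction s with
    | nil => exact hq
    | cons a s ih =>
      intro W hW
      have ha := hs a List.mem_cons_self
      obtain ⟨q', h1, h2⟩ := ih (fun b hb => hs b (List.mem_cons_of_mem _ hb))
        (if a.write then insert (a.addr / B) W else W)
        (by split_ifs
            · exact Finset.insert_subset ha hW
            · exact hW)
      exact ⟨q', h1, Serves.access ha h2⟩
  refine (iInf₂_le (2 * (C₁ \ C).card + q) fun W hW => serves_switch hW hk key).trans ?_
  push_cast
  exact le_rfl

theorem tsum_map_mul {β γ : Type*} (p : PMF β) (f : β → γ) (g : γ → ℝ≥0∞) :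
    ∑' c, (p.map f) c * g c = ∑' b, p b * g (f b) := by
  simp only [PMF.map_apply, ← ENNReal.tsum_mul_right]
  rw [ENNReal.tsum_comm]
  congr 1
  funext b
  rw [tsum_eq_single (f b)]
  · simp
  · intro c hc
    simp [hc]

theorem tsum_bind_mul {β γ : Type*} (p : PMF β) (f : β → PMF γ) (g : γ → ℝ≥0∞) :
    ∑' c, (p.bind f) c * g c = ∑' b, p b * ∑' c, f b c * g c := by
  simp only [PMF.bind_apply, ← ENNReal.tsum_mul_right, ← ENNReal.tsum_mul_left]
  rw [ENNReal.tsum_comm]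
  simp only [mul_assoc]

theorem prepend_opt_le {β : Type*} (p : PMF (List Access × β)) {s : List Access} {C : Finset ℕ}
    {P : Finset ℕ → Prop} {g : Finset ℕ → ℝ≥0∞}
    (hP : ∀ C', P C' → ∀ a ∈ s, a.addr / B ∈ C')
    (h : ∀ C', C'.card ≤ k → P C' → ∑' o, p o * opt k B C' o.1 ≤ g C') :
    ∑' o, (p.map (Prog.prepend s)) o * opt k B C o.1 ≤ refetch k C P g := by
  rw [tsum_map_mul]
  refine le_iInf fun C' => le_iInf fun hk => le_iInf fun hC => ?_
  refine le_trans ?_ (add_le_add_right (h C' hk hC) _)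
  calc ∑' o, p o * opt k B C (prepend s o).1
      ≤ ∑' o, (p o * (2 * ((C' \ C).card : ℝ≥0∞)) + p o * opt k B C' o.1) := by
        refine ENNReal.tsum_le_tsum fun o => ?_
        rw [← mul_add]
        gcongr
        exact opt_append_le _ _ (hP _ hC) hk
    _ = _ := by
        rw [ENNReal.tsum_add, ENNReal.tsum_mul_right, p.tsum_coe, one_mul]

theorem tsum_run_le_ex (p : Prog ρ) (μ : Mem α) (C : Finset ℕ) :
    ∑' o, p.run μ o * opt k B C o.1 ≤ ex k B p μ C fun _ _ => 0 := by
  induction p generalizing μ C with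
  | ret x =>
    simp only [run, ex, PMF.pure_apply]
    rw [tsum_eq_single ([], some (x, μ))]
    · simp [opt_nil]
    · intro o ho; simp [ho]
  | halt =>
    simp only [run, ex, PMF.pure_apply]
    rw [tsum_eq_single ([], none)]
    · simp [opt_nil]
    · intro o ho; simp [ho]
  | load a p ih => exact prepend_opt_le _ (by simp) fun C' _ _ => ih _ _ _
  | store a v p ih => exact prepend_opt_le _ (by simp) fun C' _ _ => ih _ _
  | storeInfty a p ih => exact prepend_opt_le _ (by simp) fun C' _ _ => ih _ _
  | move d s p ih => exact prepend_opt_le _ (by simp) fun C' _ _ => ih _ _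
  | less a b p ih => exact prepend_opt_le _ (by simp) fun C' _ _ => ih _ _ _
  | rand r p ih =>
    simp only [run, ex]
    rw [tsum_bind_mul, tsum_fintype, ENNReal.div_eq_inv_mul, Finset.mul_sum]
    refine sum_le_sum fun v _ => ?_
    rw [PMF.uniformOfFintype_apply, Fintype.card_fin]
    gcongr
    exact ih _ _ _

theorem tsum_traceLaw_le (p : Prog Unit) (μ : Mem α) (M : ℕ) :
    ∑' l, p.traceLaw μ l * transfers M B l ≤ ex (M / B) B p μ ∅ fun _ _ => 0 := by
  rw [traceLaw, tsum_map_mul]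
  refine le_trans (ENNReal.tsum_le_tsum fun o => ?_) (tsum_run_le_ex p μ ∅)
  gcongr
  exact transfers_le_opt _ _

variable {μ : Mem α}

/-! ### Bounds on the cost of a program with a postcondition -/

/-- `Q` bounds the outcomes of `p` and `e` its expected cost, in continuation form: if what follows
costs at most `K` whenever `Q` holds, then `p` together with what follows costs at most `e + K`. The
cache is empty before `p` and before what follows. -/
def Cost (k B : ℕ) (e : ℝ≥0∞) (p : Prog ρ) (μ : Mem α) (Q : ρ → Mem α → Prop) : Prop :=
  ∀ (ψ : ρ → Mem α → ℝ≥0∞) (K : ℝ≥0∞), (∀ x μ', Q x μ' → ψ x μ' ≤ K) →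
    ex k B p μ ∅ ψ ≤ e + K

theorem Cost.mono {e e' : ℝ≥0∞} {p : Prog ρ} {Q Q' : ρ → Mem α → Prop} (h : Cost k B e p μ Q)
    (he : e ≤ e') (hQ : ∀ x μ', Q x μ' → Q' x μ') : Cost k B e' p μ Q' := fun ψ K hK =>
  (h ψ K fun x μ' hx => hK x μ' (hQ x μ' hx)).trans (add_le_add_left he K)

theorem Cost.top {p : Prog ρ} {Q : ρ → Mem α → Prop} : Cost k B ⊤ p μ Q := fun _ _ _ => by simp

theorem Cost.bind {e e' : ℝ≥0∞} {p : Prog ρ} {g : ρ → Prog σ} {Q : ρ → Mem α → Prop}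
    {Q' : σ → Mem α → Prop} (h : Cost k B e p μ Q)
    (hg : ∀ x μ', Q x μ' → Cost k B e' (g x) μ' Q') : Cost k B (e + e') (p >>= g) μ Q' := by
  intro ψ K hK
  refine ex_bind_le.trans ?_
  rw [add_assoc]
  exact h _ _ fun x μ' hx => hg x μ' hx _ _ hK

theorem Cost.and {e : ℝ≥0∞} {p : Prog ρ} {Q Q' : ρ → Mem α → Prop} {π : Policy α}
    (h : Cost k B e p μ Q) (h' : Safe π p μ Q') : Cost k B e p μ fun x μ' => Q x μ' ∧ Q' x μ' := by
  classical
  intro ψ K hK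
  refine (ex_le_of_safe h').trans (h _ _ fun x μ' hx => ?_)
  split_ifs with hx'
  · exact hK _ _ ⟨hx, hx'⟩
  · exact zero_le

theorem Cost.ret {x : ρ} {Q : ρ → Mem α → Prop} (h : Q x μ) : Cost k B 0 (.ret x) μ Q :=
  fun ψ K hK => by simpa [ex] using hK x μ h

/-! ### Cost from the set of cells that are in use -/

/-- Keep the blocks `Γ μ` in the cache all the time. If every allowed access is to one of them, and
the potential `Ψ` pays for the blocks that a write adds to `Γ`, then only the initial `Γ` and the
potential have to be paid, however many accesses there are. -/
theorem Cost.of_amortized {π : Policy α} {p : Prog ρ} {Q : ρ → Mem α → Prop} (J : Mem α → Prop)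
    (Γ : Mem α → Finset ℕ) (Ψ : Mem α → ℕ) (h : Safe π p μ Q) (hJ : J μ)
    (hk : ∀ μ, J μ → (Γ μ).card ≤ k)
    (hrd : ∀ μ a, J μ → π.rd μ a → a / B ∈ Γ μ)
    (hwr : ∀ μ a c, J μ → π.wr μ a c → a / B ∈ Γ μ ∧ J (update μ a c) ∧
      (Γ (update μ a c) \ Γ μ).card + Ψ (update μ a c) ≤ Ψ μ) :
    Cost k B ((2 * (Γ μ).card + 2 * Ψ μ : ℕ) : ℝ≥0∞) p μ Q := by
  intro ψ K hK
  have step : ∀ (C : Finset ℕ) (P : Finset ℕ → Prop) (g : Finset ℕ → ℝ≥0∞) (X : ℝ≥0∞),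
      C.card ≤ k → P C → g C ≤ X → refetch k C P g ≤ X := by
    intro C P g X hk hP hg
    refine (refetch_le hk hP).trans ?_
    simpa using hg
  have main : ex k B p μ (Γ μ) ψ ≤ 2 * (Ψ μ : ℝ≥0∞) + K := by
    have up : ∀ (q : Prog ρ) (μ : Mem α) (a : ℕ) (c : Cell α), J μ → π.wr μ a c →
        ex k B q (update μ a c) (Γ (update μ a c)) ψ
          ≤ 2 * (Ψ (update μ a c) : ℝ≥0∞) + K →
        ex k B q (update μ a c) (Γ μ) ψ ≤ 2 * (Ψ μ : ℝ≥0∞) + K := by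
      intro q μ a c hJ hw hq
      obtain ⟨_, _, h3⟩ := hwr μ a c hJ hw
      refine (ex_switch (Γ (update μ a c))).trans ((add_le_add_right hq _).trans ?_)
      rw [← add_assoc, ← mul_add]
      gcongr
      exact_mod_cast h3
    induction p generalizing μ with
    | ret x => exact le_add_left (hK _ _ h)
    | halt => exact zero_le
    | load a p ih => exact step _ _ _ _ (hk _ hJ) (hrd _ _ hJ h.1) (ih _ h.2 hJ)
    | store a v p ih =>
      have hw := hwr _ _ _ hJ h.1
      exact step _ _ _ _ (hk _ hJ) hw.1 (up _ _ _ _ hJ h.1 (ih h.2 hw.2.1))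
    | storeInfty a p ih =>
      have hw := hwr _ _ _ hJ h.1
      exact step _ _ _ _ (hk _ hJ) hw.1 (up _ _ _ _ hJ h.1 (ih h.2 hw.2.1))
    | move d s p ih =>
      have hw := hwr _ _ _ hJ h.2.1
      exact step _ _ _ _ (hk _ hJ) ⟨hrd _ _ hJ h.1, hw.1⟩
        (up _ _ _ _ hJ h.2.1 (ih h.2.2 hw.2.1))
    | less a b p ih =>
      exact step _ _ _ _ (hk _ hJ) ⟨hrd _ _ hJ h.1, hrd _ _ hJ h.2.1⟩ (ih _ h.2.2 hJ)
    | rand r p ih => exact avg_le fun v => ih _ (h v (Nat.lt_succ_iff.1 v.2)) hJ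
  refine (ex_switch (Γ μ)).trans ?_
  push_cast
  rw [add_assoc]
  simpa using add_le_add_right main _

/-- A program whose accesses all lie in a set of blocks that fits into the cache pays two transfers
for each of them. -/
theorem Cost.of_blocks {R W : Set ℕ} {p : Prog ρ} {Q : ρ → Mem α → Prop} (S : Finset ℕ)
    (h : Safe (.box R W) p μ Q) (hk : S.card ≤ k) (hR : ∀ a ∈ R, a / B ∈ S)
    (hW : ∀ a ∈ W, a / B ∈ S) : Cost k B ((2 * S.card : ℕ) : ℝ≥0∞) p μ Q := by
  have := Cost.of_amortized (k := k) (B := B) (fun _ => True) (fun _ => S) (fun _ => 0) h trivial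
    (fun _ _ => hk) (fun _ a _ ha => hR a ha) (fun _ a _ _ ha => ⟨hW a ha, trivial, by simp⟩)
  simpa using this

/-- The address of the pointer `p = (base, cell)`: the content of `cell` is used as an index into
an array that starts at `base`. -/
def ptr (μ : Mem α) (p : ℕ × ℕ) : ℕ := p.1 + (μ p.2).toNat

/-- A program that works on the blocks `R` and on the cells under pointers, each of which only ever
moves forward by one cell up to its limit, pays for `R`, for the pointers, and for every block
boundary that a pointer crosses. -/
theorem Cost.of_pointers {π : Policy α} {p : Prog ρ} {Q : ρ → Mem α → Prop} (R : Finset ℕ)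
    (P : Finset (ℕ × ℕ)) (lim : ℕ × ℕ → ℕ) (h : Safe π p μ Q) (hlim : ∀ x ∈ P, ptr μ x ≤ lim x)
    (hk : R.card + P.card ≤ k)
    (hrd : ∀ μ a, π.rd μ a → a / B ∈ R ∨ ∃ x ∈ P, ptr μ x = a)
    (hwr : ∀ μ a c, π.wr μ a c → (a / B ∈ R ∨ ∃ x ∈ P, ptr μ x = a) ∧
      ∀ x ∈ P, x.2 = a → c.toNat = (μ a).toNat + 1 ∧ ptr μ x + 1 ≤ lim x) :
    Cost k B ((2 * (R.card + P.card) + 2 * ∑ x ∈ P, (lim x / B - ptr μ x / B) : ℕ) : ℝ≥0∞) p μ Q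
    := by
  have key := Cost.of_amortized (k := k) (B := B) (fun μ => ∀ x ∈ P, ptr μ x ≤ lim x)
    (fun μ => R ∪ P.image fun x => ptr μ x / B) (fun μ => ∑ x ∈ P, (lim x / B - ptr μ x / B))
    h hlim ?_ ?_ ?_
  · refine key.mono ?_ fun _ _ h => h
    have : (R ∪ P.image fun x => ptr μ x / B).card ≤ R.card + P.card :=
      (card_union_le _ _).trans (Nat.add_le_add_left card_image_le _)
    exact_mod_cast Nat.add_le_add_right (Nat.mul_le_mul_left 2 this) _
  · intro μ _
    exact ((card_union_le _ _).trans (Nat.add_le_add_left card_image_le _)).trans hk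
  · intro μ a _ ha
    rcases hrd μ a ha with h | ⟨x, hx, rfl⟩
    · exact mem_union_left _ h
    · exact mem_union_right _ (Finset.mem_image_of_mem (fun x => ptr μ x / B) hx)
  · intro μ a c hJ ha
    obtain ⟨h1, h2⟩ := hwr μ a c ha
    set μ' := update μ a c with hμ'
    have hstep : ∀ x ∈ P, ptr μ x ≤ ptr μ' x ∧ ptr μ' x ≤ lim x := by
      intro x hx
      by_cases hxa : x.2 = a
      · have := h2 x hx hxa
        subst hxa
        simp only [ptr, hμ', update_self] at this ⊢
        omega
      · simp only [ptr, hμ', update_of_ne hxa]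
        exact ⟨le_rfl, hJ x hx⟩
    refine ⟨?_, fun x hx => (hstep x hx).2, ?_⟩
    · rcases h1 with h | ⟨x, hx, rfl⟩
      · exact mem_union_left _ h
      · exact mem_union_right _ (Finset.mem_image_of_mem (fun x => ptr μ x / B) hx)
    · have h3 : ((R ∪ P.image fun x => ptr μ' x / B) \ (R ∪ P.image fun x => ptr μ x / B)).card
          ≤ ∑ x ∈ P, (ptr μ' x / B - ptr μ x / B) := by
        calc _ ≤ ((P.filter fun x => ptr μ x / B < ptr μ' x / B).image fun x => ptr μ' x / B).card
              := by
              apply card_le_card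
              intro b
              simp only [Finset.mem_sdiff, Finset.mem_union, Finset.mem_image, mem_filter]
              rintro ⟨h | ⟨x, hx, rfl⟩, h'⟩
              · exact absurd (Or.inl h) h'
              · refine ⟨x, ⟨hx, lt_of_le_of_ne (Nat.div_le_div_right (hstep x hx).1) ?_⟩, rfl⟩
                intro he
                exact h' (Or.inr ⟨x, hx, he⟩)
          _ ≤ (P.filter fun x => ptr μ x / B < ptr μ' x / B).card := card_image_le
          _ = ∑ x ∈ P, if ptr μ x / B < ptr μ' x / B then 1 else 0 := Finset.card_filter _ _
          _ ≤ _ := by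
              refine sum_le_sum fun x _ => ?_
              split_ifs <;> omega
      refine (Nat.add_le_add_right h3 _).trans ?_
      rw [← sum_add_distrib]
      refine sum_le_sum fun x hx => ?_
      have h4 := Nat.div_le_div_right (c := B) (hstep x hx).1
      have h5 := Nat.div_le_div_right (c := B) (hstep x hx).2
      omega

/-! ### Cost from the number of accesses -/

/-- `p` makes at most `n` memory accesses, whatever it reads. -/
def AccessesLE : Prog ρ → ℕ → Prop
  | .ret _, _ => True
  | .halt, _ => True
  | .load _ p, n => 1 ≤ n ∧ ∀ v, AccessesLE (p v) (n - 1)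
  | .store _ _ p, n => 1 ≤ n ∧ AccessesLE p (n - 1)
  | .storeInfty _ p, n => 1 ≤ n ∧ AccessesLE p (n - 1)
  | .move _ _ p, n => 2 ≤ n ∧ AccessesLE p (n - 2)
  | .less _ _ p, n => 2 ≤ n ∧ ∀ b, AccessesLE (p b) (n - 2)
  | .rand _ p, n => ∀ v, AccessesLE (p v) n

/-- A bound on a number of accesses, kept as an expression while instances are searched. -/
inductive Len
  | lit (n : ℕ)
  | add (m n : Len)
  | sup (m n : Len)

def Len.eval : Len → ℕ
  | lit n => n
  | add m n => m.eval + n.eval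
  | sup m n => max m.eval n.eval

/-- A bound on the number of accesses of a program without loops, found by instance search. -/
class HasLen {ρ : Type} (p : Prog ρ) (n : outParam Len) : Prop where
  le : AccessesLE p n.eval

theorem AccessesLE.mono {p : Prog ρ} {m n : ℕ} (h : AccessesLE p m) (hmn : m ≤ n) :
    AccessesLE p n := by
  induction p generalizing m n with
  | ret x => trivial
  | halt => trivial
  | load a p ih => exact ⟨h.1.trans hmn, fun v => ih v (h.2 v) (by omega)⟩
  | store a v p ih => exact ⟨h.1.trans hmn, ih h.2 (by omega)⟩
  | storeInfty a p ih => exact ⟨h.1.trans hmn, ih h.2 (by omega)⟩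
  | move d s p ih => exact ⟨h.1.trans hmn, ih h.2 (by omega)⟩
  | less a b p ih => exact ⟨h.1.trans hmn, fun v => ih v (h.2 v) (by omega)⟩
  | rand r p ih => exact fun v => ih v (h v) hmn

theorem AccessesLE.bind {p : Prog ρ} {g : ρ → Prog σ} {m n : ℕ} (h : AccessesLE p m)
    (hg : ∀ x, AccessesLE (g x) n) : AccessesLE (p.bind g) (m + n) := by
  induction p generalizing m with
  | ret x => exact (hg x).mono (by omega)
  | halt => trivial
  | load a p ih =>
    exact ⟨by have := h.1; omega, fun v => (ih v (h.2 v)).mono (by have := h.1; omega)⟩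
  | store a v p ih => exact ⟨by have := h.1; omega, (ih h.2).mono (by have := h.1; omega)⟩
  | storeInfty a p ih => exact ⟨by have := h.1; omega, (ih h.2).mono (by have := h.1; omega)⟩
  | move d s p ih => exact ⟨by have := h.1; omega, (ih h.2).mono (by have := h.1; omega)⟩
  | less a b p ih =>
    exact ⟨by have := h.1; omega, fun v => (ih v (h.2 v)).mono (by have := h.1; omega)⟩
  | rand r p ih => exact fun v => ih v (h v)

instance {x : ρ} : HasLen (Prog.ret x) (.lit 0) := ⟨trivial⟩
instance {x : ρ} : HasLen (pure x : Prog ρ) (.lit 0) := ⟨trivial⟩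
instance {n : ℕ} : HasLen (lit n) (.lit 0) := ⟨trivial⟩
instance {n : ℕ} : HasLen (no_index (OfNat.ofNat n) : Prog ℕ) (.lit 0) := ⟨trivial⟩
instance {a : ℕ} : HasLen (v a) (.lit 1) := ⟨⟨le_rfl, fun _ => trivial⟩⟩
instance HasLen.bind {p : Prog ρ} {g : ρ → Prog σ} {m n : Len} [hp : HasLen p m]
    [hg : ∀ x, HasLen (g x) n] : HasLen (p >>= g) (.add m n) := ⟨hp.le.bind fun x => (hg x).le⟩
instance {p : Prog ρ} {g : ρ → σ} {m : Len} [hp : HasLen p m] : HasLen (g <$> p) m :=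
  ⟨hp.le.bind (n := 0) (g := fun a => Prog.ret (g a)) fun _ => trivial⟩
instance {b : Prop} [Decidable b] {p q : Prog ρ} {m n : Len} [hp : HasLen p m] [hq : HasLen q n] :
    HasLen (if b then p else q) (.sup m n) := ⟨by
  split_ifs
  exacts [hp.le.mono (le_max_left _ _), hq.le.mono (le_max_right _ _)]⟩
instance {x : Prog ℕ} {m : Len} [HasLen x m] : HasLen (deref x) (.add m (.lit 1)) :=
  inferInstanceAs (HasLen (x >>= v) _)
instance {x y : Prog ℕ} {m n : Len} [HasLen x m] [HasLen y n] : HasLen (x + y)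
    (.add m (.add n (.lit 0))) :=
  inferInstanceAs (HasLen (x >>= fun a => y >>= fun b => pure (a + b)) _)
instance {x y : Prog ℕ} {m n : Len} [HasLen x m] [HasLen y n] : HasLen (x - y)
    (.add m (.add n (.lit 0))) :=
  inferInstanceAs (HasLen (x >>= fun a => y >>= fun b => pure (a - b)) _)
instance {x y : Prog ℕ} {m n : Len} [HasLen x m] [HasLen y n] : HasLen (x * y)
    (.add m (.add n (.lit 0))) :=
  inferInstanceAs (HasLen (x >>= fun a => y >>= fun b => pure (a * b)) _)
instance {x : Prog ℕ} {m : Len} [HasLen x m] : HasLen (half x) (.add m (.lit 0)) :=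
  inferInstanceAs (HasLen (x >>= fun a => pure (a / 2)) _)
instance {x y : Prog ℕ} {m n : Len} [HasLen x m] [HasLen y n] : HasLen (minimum x y)
    (.add m (.add n (.lit 0))) :=
  inferInstanceAs (HasLen (x >>= fun a => y >>= fun b => pure (min a b)) _)
instance {r : ℕ} : HasLen (Prog.rand r Prog.ret) (.lit 0) := ⟨fun _ => trivial⟩
instance {x : Prog ℕ} {m : Len} [HasLen x m] : HasLen (random x) (.add m (.lit 0)) :=
  inferInstanceAs (HasLen (x >>= fun a => Prog.rand (a - 1) Prog.ret) _)
instance {x y : Prog ℕ} {m n : Len} [HasLen x m] [HasLen y n] : HasLen (lt x y)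
    (.add m (.add n (.lit 0))) :=
  inferInstanceAs (HasLen (x >>= fun a => y >>= fun b => pure (decide (a < b))) _)
instance {c : Prog Bool} {m : Len} [HasLen c m] : HasLen (neg c) (.add m (.lit 0)) :=
  inferInstanceAs (HasLen (c >>= fun a => pure (!a)) _)
instance {c d : Prog Bool} {m n : Len} [HasLen c m] [HasLen d n] : HasLen (both c d)
    (.add m (.sup n (.lit 0))) :=
  inferInstanceAs (HasLen (c >>= fun a => if a then d else pure false) _)
instance {c d : Prog Bool} {m n : Len} [HasLen c m] [HasLen d n] :
    HasLen (either c d) (.add m (.sup (.lit 0) n)) :=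
  inferInstanceAs (HasLen (c >>= fun a => if a then pure true else d) _)
instance {a b : ℕ} : HasLen (Prog.less a b Prog.ret) (.lit 2) := ⟨⟨le_rfl, fun _ => trivial⟩⟩
instance {x y : Prog ℕ} {m n : Len} [HasLen x m] [HasLen y n] : HasLen (lessAt x y)
    (.add m (.add n (.lit 2))) :=
  inferInstanceAs (HasLen (x >>= fun a => y >>= fun b => Prog.less a b Prog.ret) _)
instance {a x : ℕ} : HasLen (Prog.store a x (Prog.ret ())) (.lit 1) := ⟨⟨le_rfl, trivial⟩⟩
instance {a : ℕ} : HasLen (Prog.storeInfty a (Prog.ret ())) (.lit 1) := ⟨⟨le_rfl, trivial⟩⟩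
instance {a b : ℕ} : HasLen (Prog.move a b (Prog.ret ())) (.lit 2) := ⟨⟨le_rfl, trivial⟩⟩
instance {a : ℕ} {e : Prog ℕ} {m : Len} [HasLen e m] : HasLen (assign a e) (.add m (.lit 1)) :=
  inferInstanceAs (HasLen (e >>= fun x => Prog.store a x (Prog.ret ())) _)
instance {x y : Prog ℕ} {m n : Len} [HasLen x m] [HasLen y n] : HasLen (put x y)
    (.add m (.add n (.lit 1))) :=
  inferInstanceAs (HasLen (x >>= fun a => y >>= fun b => Prog.store a b (Prog.ret ())) _)
instance {x : Prog ℕ} {m : Len} [HasLen x m] : HasLen (putInfty x) (.add m (.lit 1)) :=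
  inferInstanceAs (HasLen (x >>= fun a => Prog.storeInfty a (Prog.ret ())) _)
instance {x y : Prog ℕ} {m n : Len} [HasLen x m] [HasLen y n] : HasLen (moveAt x y)
    (.add m (.add n (.lit 2))) :=
  inferInstanceAs (HasLen (x >>= fun a => y >>= fun b => Prog.move a b (Prog.ret ())) _)
instance {c : Prog Bool} {p q : Prog Unit} {l m n : Len} [HasLen c l] [HasLen p m] [HasLen q n] :
    HasLen (SquareSort.cond c p q) (.add l (.sup m n)) :=
  inferInstanceAs (HasLen (c >>= fun a => if a then p else q) _)
instance {c : Prog Bool} {p : Prog Unit} {m n : Len} [HasLen c m] [HasLen p n] :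
    HasLen (iter c p) (.add m (.sup (.add n (.lit 0)) (.lit 0))) :=
  inferInstanceAs (HasLen
    (c >>= fun a => if a then (p >>= fun _ => pure true) else (pure false : Prog Bool)) _)
instance {a : ℕ} : HasLen (pushAll a []) (.lit 0) := ⟨trivial⟩
instance {a : ℕ} {e : Prog ℕ} {es : List (Prog ℕ)} {m n : Len} [HasLen e m]
    [HasLen (pushAll (a + 1) es) n] : HasLen (pushAll a (e :: es)) (.add (.add m (.lit 1)) n) :=
  inferInstanceAs (HasLen (assign a e >>= fun _ => pushAll (a + 1) es) _)

theorem Cost.of_accessesLE {π : Policy α} {p : Prog ρ} {Q : ρ → Mem α → Prop} {n : ℕ} (hk : 2 ≤ k)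
    (h : Safe π p μ Q) (hn : AccessesLE p n) : Cost k B (2 * (n : ℝ≥0∞)) p μ Q := by
  intro ψ K hK
  suffices H : ∀ C, ex k B p μ C ψ ≤ 2 * (n : ℝ≥0∞) + K from H ∅
  have step : ∀ (n i : ℕ) (C C' : Finset ℕ) (P : Finset ℕ → Prop) (g : Finset ℕ → ℝ≥0∞),
      C'.card ≤ i → i ≤ 2 → i ≤ n → P C' → g C' ≤ 2 * ((n - i : ℕ) : ℝ≥0∞) + K →
      refetch k C P g ≤ 2 * (n : ℝ≥0∞) + K := by
    intro n i C C' P g hi h2 hin hP hg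
    refine (refetch_le (hi.trans (h2.trans hk)) hP).trans ((add_le_add_right hg _).trans ?_)
    rw [← add_assoc, ← mul_add]
    gcongr
    have : (C' \ C).card + (n - i) ≤ n := by
      have := card_le_card (Finset.sdiff_subset (s := C') (t := C))
      omega
    exact_mod_cast this
  induction p generalizing μ n with
  | ret x => exact fun C => le_add_left (hK _ _ h)
  | halt => exact fun C => zero_le
  | load a p ih =>
    exact fun C => step n 1 C {a / B} _ _ (by simp) (by simp) hn.1 (by simp) (ih _ h.2 (hn.2 _) _)
  | store a v p ih =>
    exact fun C => step n 1 C {a / B} _ _ (by simp) (by simp) hn.1 (by simp) (ih h.2 hn.2 _)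
  | storeInfty a p ih =>
    exact fun C => step n 1 C {a / B} _ _ (by simp) (by simp) hn.1 (by simp) (ih h.2 hn.2 _)
  | move d s p ih =>
    exact fun C => step n 2 C {s / B, d / B} _ _ Finset.card_le_two (by simp) hn.1 (by simp)
      (ih h.2.2 hn.2 _)
  | less a b p ih =>
    exact fun C => step n 2 C {a / B, b / B} _ _ Finset.card_le_two (by simp) hn.1 (by simp)
      (ih _ h.2.2 (hn.2 _) _)
  | rand r p ih => exact fun C => avg_le fun v => ih _ (h v (Nat.lt_succ_iff.1 v.2)) (hn _) _

/-! ### Safety and cost together -/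

/-- A Hoare triple with costs: `p` respects `π`, ends in `Q`, and costs at most `e`. -/
structure Tr (k B : ℕ) (π : Policy α) (e : ℝ≥0∞) (p : Prog ρ) (μ : Mem α)
    (Q : ρ → Mem α → Prop) : Prop where
  safe : Safe π p μ Q
  cost : Cost k B e p μ Q

section

variable {π π' : Policy α} {e e' : ℝ≥0∞} {p : Prog ρ} {Q Q' : ρ → Mem α → Prop}

theorem Tr.mono (h : Tr k B π e p μ Q) (he : e ≤ e') (hQ : ∀ x μ', Q x μ' → Q' x μ') :
    Tr k B π e' p μ Q' := ⟨h.safe.mono hQ, h.cost.mono he hQ⟩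

theorem Tr.box_mono {R W R' W' : Set ℕ} (h : Tr k B (.box R W) e p μ Q) (hR : R ⊆ R')
    (hW : W ⊆ W') : Tr k B (.box R' W') e p μ Q := ⟨h.safe.box_mono hR hW, h.cost⟩

theorem Tr.of_safe (h : Safe π p μ Q) : Tr k B π ⊤ p μ Q := ⟨h, Cost.top⟩

theorem Tr.box_frame {R W : Set ℕ} (h : Tr k B (.box R W) e p μ Q) :
    Tr k B (.box R W) e p μ fun x μ' => Q x μ' ∧ ∀ a ∉ W, μ' a = μ a :=
  ⟨h.safe.box_frame, (h.cost.and h.safe.box_frame).mono le_rfl fun _ _ h => h.2⟩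

theorem Tr.bind {g : ρ → Prog σ} {Q' : σ → Mem α → Prop} (h : Tr k B π e p μ Q)
    (hg : ∀ x μ', Q x μ' → Tr k B π e' (g x) μ' Q') : Tr k B π (e + e') (p >>= g) μ Q' :=
  ⟨safe_bind.2 (h.safe.mono fun x μ' hx => (hg x μ' hx).safe),
    h.cost.bind fun x μ' hx => (hg x μ' hx).cost⟩

theorem Tr.ret {x : ρ} (h : Q x μ) : Tr k B π 0 (.ret x) μ Q := ⟨h, Cost.ret h⟩

theorem Tr.of_len (N : ℕ) {n : Len} (hk : 2 ≤ k) [hn : HasLen p n] (hN : n.eval ≤ N)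
    (h : Safe π p μ Q) : Tr k B π ((2 * N : ℕ) : ℝ≥0∞) p μ Q :=
  ⟨h, by exact_mod_cast Cost.of_accessesLE hk h (hn.le.mono hN)⟩

/-- A program `p` of bounded length, followed by `g`. -/
theorem Tr.step (N : ℕ) {g : ρ → Prog σ} {Q' : σ → Mem α → Prop} {n : Len} (hk : 2 ≤ k) [HasLen p n]
    (hN : n.eval ≤ N) (h : Safe π p μ fun x μ' => Tr k B π e (g x) μ' Q') :
    Tr k B π (((2 * N : ℕ) : ℝ≥0∞) + e) (p >>= g) μ Q' :=
  Tr.bind (Tr.of_len N hk hN h) fun _ _ h => h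

/-- `Tr.step` for a cost that is split into a number and a remaining term `Z`. -/
theorem Tr.step_add (N : ℕ) {c c' : ℕ} {Z : ℝ≥0∞} {g : ρ → Prog σ} {Q' : σ → Mem α → Prop}
    {n : Len} (hk : 2 ≤ k) [HasLen p n] (hN : n.eval ≤ N) (hc : 2 * N + c' ≤ c)
    (h : Safe π p μ fun x μ' => Tr k B π ((c' : ℕ) + Z) (g x) μ' Q') :
    Tr k B π ((c : ℕ) + Z) (p >>= g) μ Q' := by
  refine (Tr.step N hk hN h).mono ?_ fun _ _ h => h
  rw [← add_assoc, ← Nat.cast_add]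
  exact add_le_add_left (Nat.cast_le.2 hc) _

theorem Tr.round (N : ℕ) {c : Prog Bool} {p : Prog Unit} {Q : Bool → Mem α → Prop} {n : Len}
    (hk : 2 ≤ k) [HasLen c n] (hN : n.eval ≤ N)
    (h : Safe π c μ fun b μ' =>
      if b then Tr k B π e p μ' (fun _ μ'' => Q true μ'') else Q false μ') :
    Tr k B π (((2 * N : ℕ) : ℝ≥0∞) + e) (iter c p) μ Q := by
  refine Tr.step N hk hN (h.mono fun b μ' hb => ?_)
  cases b
  · exact (Tr.ret (Q := Q) (by simpa using hb)).mono zero_le fun _ _ h => h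
  · have := (show Tr k B π e p μ' (fun _ μ'' => Q true μ'') by simpa using hb).bind (Q' := Q)
      (g := fun _ => pure true) fun x μ'' h => Tr.ret h
    simpa using this

theorem Tr.cond (N : ℕ) {c : Prog Bool} {p q : Prog Unit} {Q : Unit → Mem α → Prop} {n : Len}
    (hk : 2 ≤ k) [HasLen c n] (hN : n.eval ≤ N)
    (h : Safe π c μ fun b μ' => if b then Tr k B π e p μ' Q else Tr k B π e q μ' Q) :
    Tr k B π (((2 * N : ℕ) : ℝ≥0∞) + e) (SquareSort.cond c p q) μ Q := by
  refine Tr.step N hk hN (h.mono fun b μ' hb => ?_)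
  cases b <;> simpa using hb

end

/-- A loop whose `i`-th round costs `e i`, when the invariant `I i` bounds the round number by `N`.
The last summand pays for the test that fails. -/
theorem Tr.loop {π : Policy α} {c : Prog Bool} {p : Prog Unit} {Q : Mem α → Prop}
    (I : ℕ → Mem α → Prop) (e : ℕ → ℝ≥0∞) (N : ℕ) (f : ℕ) {i : ℕ} (h0 : I i μ)
    (hN : ∀ i μ, I i μ → i ≤ N)
    (h : ∀ i μ, I i μ → Tr k B π (e i) (iter c p) μ fun b μ' => if b then I (i + 1) μ' else Q μ') :
    Tr k B π (∑ i ∈ Finset.Ico i (N + 1), e i) (SquareSort.loop f c p) μ fun _ => Q := by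
  refine ⟨Safe.loop (fun μ => ∃ i, I i μ) f ⟨i, h0⟩ ?_, ?_⟩
  · rintro μ ⟨i, hi⟩
    refine (h i μ hi).safe.mono fun b μ' hb => ?_
    cases b
    · simpa using hb
    · exact ⟨i + 1, by simpa using hb⟩
  · induction f generalizing μ i with
    | zero => exact fun ψ K hK => zero_le
    | succ f ih =>
      rw [loop_succ, Finset.sum_eq_sum_Ico_succ_bot (Nat.lt_succ_of_le (hN i μ h0))]
      refine (h i μ h0).cost.bind fun b μ' hb => ?_
      cases b
      · exact (Cost.ret (by simpa using hb)).mono zero_le fun _ _ h => h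
      · exact ih (by simpa using hb)

theorem Safe.loop_box {R W : Set ℕ} {c : Prog Bool} {p : Prog Unit} {Q : Mem α → Prop}
    (I : Mem α → Prop) (f : ℕ) (h0 : I μ)
    (h : ∀ μ', (∀ a ∉ W, μ' a = μ a) → I μ' →
      Safe (.box R W) (iter c p) μ' fun b μ'' => if b then I μ'' else Q μ'') :
    Safe (.box R W) (SquareSort.loop f c p) μ fun _ => Q := by
  refine Safe.loop (fun μ' => (∀ a ∉ W, μ' a = μ a) ∧ I μ') f ⟨fun _ _ => rfl, h0⟩ ?_
  rintro μ' ⟨h1, h2⟩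
  refine (h μ' h1 h2).box_frame.mono fun b μ'' hb => ?_
  cases b
  · simpa using hb.1
  · simp only [if_true] at hb ⊢
    exact ⟨fun a ha => (hb.2 a ha).trans (h1 a ha), hb.1⟩

theorem Tr.loop_box {R W : Set ℕ} {c : Prog Bool} {p : Prog Unit} {Q : Mem α → Prop}
    (I : ℕ → Mem α → Prop) (e : ℕ → ℝ≥0∞) (N : ℕ) (f : ℕ) {i : ℕ} (h0 : I i μ)
    (hN : ∀ i μ, I i μ → i ≤ N)
    (h : ∀ i μ', (∀ a ∉ W, μ' a = μ a) → I i μ' →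
      Tr k B (.box R W) (e i) (iter c p) μ' fun b μ'' => if b then I (i + 1) μ'' else Q μ'') :
    Tr k B (.box R W) (∑ i ∈ Finset.Ico i (N + 1), e i) (SquareSort.loop f c p) μ fun _ => Q := by
  refine Tr.loop (fun i μ' => (∀ a ∉ W, μ' a = μ a) ∧ I i μ') e N f ⟨fun _ _ => rfl, h0⟩
    (fun i μ' h => hN i μ' h.2) ?_
  rintro i μ' ⟨h1, h2⟩
  refine (h i μ' h1 h2).box_frame.mono le_rfl fun b μ'' hb => ?_
  cases b
  · simpa using hb.1
  · simp only [if_true] at hb ⊢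
    exact ⟨fun a ha => (hb.2 a ha).trans (h1 a ha), hb.1⟩

theorem Tr.loop_const {R W : Set ℕ} {c : Prog Bool} {p : Prog Unit} {Q : Mem α → Prop}
    (I : ℕ → Mem α → Prop) (C N f : ℕ) (h0 : I 0 μ)
    (hN : ∀ i μ, I i μ → i ≤ N)
    (h : ∀ i μ', (∀ a ∉ W, μ' a = μ a) → I i μ' →
      Tr k B (.box R W) (C : ℝ≥0∞) (iter c p) μ' fun b μ'' => if b then I (i + 1) μ'' else Q μ'') :
    Tr k B (.box R W) (((N + 1) * C : ℕ) : ℝ≥0∞) (SquareSort.loop f c p) μ fun _ => Q := by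
  refine (Tr.loop_box I (fun _ => (C : ℝ≥0∞)) N f h0 hN h).mono ?_ fun _ _ h => h
  simp

/-! ### The contents of intervals of cells -/

/-- The item in a cell, or `⊤` for a cell without one, the value of `∞`. `Cell.lt` is the strict
order of the keys except on cells with numbers. -/
def Cell.key {α : Type*} : Cell α → WithTop α
  | .item x => x
  | _ => ⊤

theorem Cell.lt_iff {c d : Cell α} (hd : d.key < ⊤ ∨ d = .infty) :
    c.lt d = true ↔ c.key < d.key := by
  cases c <;> cases d <;> simp_all [Cell.lt, Cell.key]

theorem Cell.key_inj {α : Type*} [LinearOrder α] {c d : Cell α} (hc : c.key < ⊤)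
    (h : c.key = d.key) : c = d := by
  cases c <;> cases d <;> simp_all [Cell.key]

/-- The multiset of the contents of the cells `a, …, b - 1`. -/
def ms {α : Type*} (μ : Mem α) (a b : ℕ) : Multiset (Cell α) := (Multiset.Ico a b).map μ

section

variable {α : Type*}

theorem ms_congr {μ μ' : Mem α} {a b : ℕ} (h : ∀ x, a ≤ x → x < b → μ x = μ' x) :
    ms μ a b = ms μ' a b :=
  Multiset.map_congr rfl fun x hx => by
    rw [Multiset.mem_Ico] at hx
    exact h x hx.1 hx.2

theorem ms_add (μ : Mem α) {a b c : ℕ} (h : a ≤ b) (h' : b ≤ c) :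
    ms μ a b + ms μ b c = ms μ a c := by
  rw [ms, ms, ← Multiset.map_add, Multiset.Ico_add_Ico_eq_Ico h h', ms]

@[simp] theorem ms_self (μ : Mem α) (a : ℕ) : ms μ a a = 0 := by simp [ms]

theorem ms_of_le (μ : Mem α) {a b : ℕ} (h : b ≤ a) : ms μ a b = 0 := by
  simp [ms, Multiset.Ico_eq_zero_of_le h]

theorem ms_succ (μ : Mem α) {a b : ℕ} (h : a ≤ b) : ms μ a (b + 1) = μ b ::ₘ ms μ a b := by
  rw [ms, ms, ← Multiset.map_cons]
  congr 1
  exact (Nat.Ico_succ_right_eq_insert_Ico h ▸ Finset.insert_val_of_notMem (by simp) :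
    (Finset.Ico a (b + 1)).val = _)

theorem mem_ms {μ : Mem α} {a b : ℕ} {c : Cell α} : c ∈ ms μ a b ↔ ∃ x, a ≤ x ∧ x < b ∧ μ x
    = c := by
  simp [ms, and_assoc]

@[simp] theorem ms_shift {μ μ' : Mem α} {a b n : ℕ} (h : ∀ x < n, μ (a + x) = μ' (b + x)) :
    ms μ a (a + n) = ms μ' b (b + n) := by
  induction n with
  | zero => simp
  | succ n ih =>
    rw [← add_assoc, ← add_assoc, ms_succ _ (by omega), ms_succ _ (by omega),
      ih fun x hx => h x (by omega), h n (by omega)]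

theorem ms_inj {μ : Mem α} {a b x y : ℕ} (h : (ms μ a b).Nodup) (hx : a ≤ x ∧ x < b)
    (hy : a ≤ y ∧ y < b) (hxy : μ x = μ y) : x = y :=
  Multiset.inj_on_of_nodup_map h x (by simpa using hx) y (by simpa using hy) hxy

end

/-- All the cells `a, …, b - 1` hold items. -/
def Items {α : Type*} [LinearOrder α] (μ : Mem α) (a b : ℕ) : Prop :=
  ∀ x, a ≤ x → x < b → (μ x).key < ⊤

/-- The keys in the cells `a, …, b - 1` do not decrease. -/
def Sorted {α : Type*} [LinearOrder α] (μ : Mem α) (a b : ℕ) : Prop :=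
  ∀ x y, a ≤ x → x < y → y < b → (μ x).key ≤ (μ y).key

theorem Items.of_ms {μ μ' : Mem α} {a b a' b' : ℕ} (h : Items μ a b)
    (hms : ms μ' a' b' = ms μ a b) : Items μ' a' b' := by
  intro x hx hx'
  have : μ' x ∈ ms μ a b := hms ▸ mem_ms.2 ⟨x, hx, hx', rfl⟩
  obtain ⟨y, hy, hy', e⟩ := mem_ms.1 this
  rw [← e]
  exact h y hy hy'

theorem Sorted.lt {μ : Mem α} {a b x y : ℕ} (h : Sorted μ a b) (hn : (ms μ a b).Nodup)
    (hi : Items μ a b) (hx : a ≤ x) (hxy : x < y) (hy : y < b) : (μ x).key < (μ y).key := by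
  refine lt_of_le_of_ne (h x y hx hxy hy) fun e => hxy.ne ?_
  exact ms_inj hn ⟨hx, hxy.trans hy⟩ ⟨hx.trans hxy.le, hy⟩
    (Cell.key_inj (hi x hx (hxy.trans hy)) e)

/-! ### Insertion sort -/

theorem simpleSort_inner {A D i fp f : ℕ} (h1 : μ (fp + 1) = .num A) (h2 : μ (fp + 2) = .num D)
    (h4 : μ (fp + 4) = .num i) (h5 : μ (fp + 5) = .num i) (hA : A + i < fp) (hD : D + i < fp)
    (hAD : A + i < D ∨ D + i < A) (hiA : Items μ D (D + i)) :
    Safe (.box {a | fp + 1 ≤ a ∧ a ≤ fp + 5 ∨ D ≤ a ∧ a ≤ D + i ∨ a = A + i}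
        {a | a = fp + 5 ∨ D ≤ a ∧ a ≤ D + i})
      (loop f (both (lt 0 (v (fp + 5))) (lessAt (v (fp + 1) + v (fp + 4))
          (v (fp + 2) + v (fp + 5) - 1))) do
        moveAt (v (fp + 2) + v (fp + 5)) (v (fp + 2) + v (fp + 5) - 1)
        assign (fp + 5) (v (fp + 5) - 1)) μ fun _ μ' =>
      ∃ j ≤ i, μ' (fp + 5) = .num j ∧ (∀ x < j, μ' (D + x) = μ (D + x)) ∧
        (∀ x, j ≤ x → x < i → μ' (D + x + 1) = μ (D + x)) ∧
        (∀ x, j ≤ x → x < i → (μ (A + i)).key < (μ (D + x)).key) ∧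
        (∀ x, x + 1 = j → (μ (D + x)).key ≤ (μ (A + i)).key) := by
  obtain ⟨I, hI⟩ : ∃ I : Mem α → Prop, ∀ μ', I μ' ↔ ∃ j ≤ i, μ' (fp + 5) = .num j ∧
      (∀ x < j, μ' (D + x) = μ (D + x)) ∧ (∀ x, j ≤ x → x < i → μ' (D + x + 1) = μ (D + x)) ∧
      (∀ x, j ≤ x → x < i → (μ (A + i)).key < (μ (D + x)).key) := ⟨_, fun _ => Iff.rfl⟩
  refine Safe.loop_box I f ((hI _).2 ⟨i, le_rfl, h5, fun _ _ => rfl, by omega, by omega⟩) ?_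
  intro μ' hfr hμ'
  obtain ⟨j, hj, e5, g1, g2, g3⟩ := (hI _).1 hμ'
  have e1 : μ' (fp + 1) = .num A := (hfr _ (by simp; omega)).trans h1
  have e2 : μ' (fp + 2) = .num D := (hfr _ (by simp; omega)).trans h2
  have e4 : μ' (fp + 4) = .num i := (hfr _ (by simp; omega)).trans h4
  have eA : μ' (A + i) = μ (A + i) := hfr _ (by simp; omega)
  rcases j with _ | j
  · simp only [safe_rules, cell_rules, mem_rules, e5]
    grind
  · have ej : μ' (D + j) = μ (D + j) := g1 j (by omega)
    have hlt := Cell.lt_iff (c := μ (A + i)) (Or.inl (hiA (D + j) (by omega) (by omega)))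
    have u : ∀ c, update μ' (D + (j + 1)) c (fp + 5) = μ' (fp + 5) :=
      fun c => update_of_ne (by omega) _ _
    simp only [safe_rules, cell_rules, mem_rules, e1, e2, e4, e5, eA,
      show D + (j + 1) - 1 = D + j from rfl, ej, u, Nat.zero_lt_succ, decide_true, if_true, hI]
    by_cases hc : (μ (A + i)).lt (μ (D + j)) = true
    · simp only [hc, if_true]
      constructorm* _ ∧ _
      any_goals first | exact trivial | omega
      exact ⟨j, by omega, by simp, by grind, by grind, by grind⟩
    · simp only [hc]
      grind

theorem simpleSort_safe {A D n fp f : ℕ} (h1 : μ (fp + 1) = .num A) (h2 : μ (fp + 2) = .num D)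
    (h3 : μ (fp + 3) = .num n) (hA : A + n ≤ fp) (hD : D + n ≤ fp)
    (hAD : A + n ≤ D ∨ D + n ≤ A) (hi : Items μ A (A + n)) :
    Safe (.box {a | fp + 1 ≤ a ∧ a ≤ fp + 5 ∨ D ≤ a ∧ a < D + n ∨ A ≤ a ∧ a < A + n}
        {a | fp + 4 ≤ a ∧ a ≤ fp + 5 ∨ D ≤ a ∧ a < D + n})
      (simpleSort f fp) μ fun _ μ' =>
      ms μ' D (D + n) = ms μ A (A + n) ∧ Sorted μ' D (D + n) := by
  unfold simpleSort
  obtain ⟨I, hI⟩ : ∃ I : Mem α → Prop, ∀ μ', I μ' ↔ ∃ i ≤ n, μ' (fp + 4) = .num i ∧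
      ms μ' D (D + i) = ms μ A (A + i) ∧ Sorted μ' D (D + i) := ⟨_, fun _ => Iff.rfl⟩
  simp only [safe_rules, cell_rules, mem_rules]
  refine ⟨by omega, Safe.loop_box I f ((hI _).2 ⟨0, by simp, by simp, by simp, ?_⟩) ?_⟩
  · intro x y h h' h''; omega
  intro μ' hfr hμ'
  obtain ⟨i, hin, e4, g1, g2⟩ := (hI _).1 hμ'
  have fr : ∀ a, a ≠ fp + 4 → a ≠ fp + 5 → (a < D ∨ D + n ≤ a) → μ' a = μ a := by
    intro a ha hb hc
    rw [hfr a (by simp; omega), update_of_ne ha]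
  have e1 := (fr (fp + 1) (by omega) (by omega) (by omega)).trans h1
  have e2 := (fr (fp + 2) (by omega) (by omega) (by omega)).trans h2
  have e3 := (fr (fp + 3) (by omega) (by omega) (by omega)).trans h3
  simp only [safe_rules, cell_rules, mem_rules, e3, e4]
  rcases hin.eq_or_lt with rfl | hlt
  · grind
  simp only [hlt, decide_true, if_true]
  constructorm* _ ∧ _
  any_goals first | exact trivial | omega
  obtain ⟨μ₁, hμ₁⟩ : ∃ m, m = update μ' (fp + 5) (Cell.num i) := ⟨_, rfl⟩
  rw [← hμ₁]
  have v₁ : ∀ x, μ₁ x = if x = fp + 5 then .num i else μ' x := by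
    simp [hμ₁, update_apply]
  have hD₁ : ms μ₁ D (D + i) = ms μ' D (D + i) := ms_congr fun x hx hx' => by grind
  have hiA' : Items μ₁ D (D + i) :=
    Items.of_ms (fun x h h' => hi x h (by omega : x < A + n)) (hD₁.trans g1)
  have q1 : μ₁ (fp + 1) = .num A := by grind
  have q2 : μ₁ (fp + 2) = .num D := by grind
  have q4 : μ₁ (fp + 4) = .num i := by grind
  have q5 : μ₁ (fp + 5) = .num i := by grind
  refine ((simpleSort_inner q1 q2 q4 q5 (by omega) (by omega) (by omega) hiA').box_frame.box_mono
    (by intro a; simp; omega) (by intro a; simp; omega)).mono ?_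
  rintro _ μ₂ ⟨⟨j, hj, k5, k1, k2, k3, k4⟩, hfr₂⟩
  have f1 : μ₂ (fp + 1) = .num A := (hfr₂ _ (by simp; omega)).trans q1
  have f2 : μ₂ (fp + 2) = .num D := (hfr₂ _ (by simp; omega)).trans q2
  have f4 : μ₂ (fp + 4) = .num i := (hfr₂ _ (by simp; omega)).trans q4
  have fA : μ₂ (A + i) = μ (A + i) := by
    rw [hfr₂ _ (by simp; omega), v₁, if_neg (by omega),
      fr _ (by omega) (by omega) (by omega)]
  have fA' : μ₁ (A + i) = μ (A + i) := by
    rw [v₁, if_neg (by omega), fr _ (by omega) (by omega) (by omega)]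
  have u : ∀ c, update μ₂ (D + j) c (fp + 4) = μ₂ (fp + 4) :=
      fun c => update_of_ne (by omega) _ _
  simp only [f1, f2, f4, k5, cell_rules, u, hI]
  constructorm* _ ∧ _
  any_goals first | exact trivial | omega
  rw [fA'] at k3 k4
  simp only [fA]
  obtain ⟨μ₃, hμ₃⟩ : ∃ m, m = update (update μ₂ (D + j) (μ (A + i))) (fp + 4)
    (Cell.num (i + 1)) := ⟨_, rfl⟩
  rw [← hμ₃]
  have v₃ : ∀ x, μ₃ x = if x = fp + 4 then .num (i + 1) else if x = D + j then μ (A + i)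
      else μ₂ x := by simp [hμ₃, update_apply]
  have w1 : ∀ x < j, μ₃ (D + x) = μ' (D + x) := by grind
  have w2 : μ₃ (D + j) = μ (A + i) := by grind
  have w3 : ∀ x, j ≤ x → x < i → μ₃ (D + x + 1) = μ' (D + x) := by grind
  have k3' : ∀ x, j ≤ x → x < i → (μ (A + i)).key < (μ' (D + x)).key := by grind
  have k4' : ∀ x, x + 1 = j → (μ' (D + x)).key ≤ (μ (A + i)).key := by grind
  refine ⟨i + 1, by omega, by simp [hμ₃], ?_, ?_⟩
  · rw [← add_assoc, ← add_assoc, ms_succ μ (by omega), ← g1,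
      ← ms_add μ₃ (b := D + j) (by omega) (by omega), ← ms_add μ' (b := D + j) (c := D + i)
      (by omega) (by omega), ms_congr (μ := μ₃) (μ' := μ') (b := D + j),
      ← ms_add μ₃ (b := D + j + 1) (by omega) (by omega), ms_succ μ₃ le_rfl, ms_self, w2]
    · have : ms μ₃ (D + j + 1) (D + i + 1) = ms μ' (D + j) (D + i) := by
        have := ms_shift (μ := μ₃) (μ' := μ') (a := D + j + 1) (b := D + j) (n := i - j)
          fun x hx => by
            have := w3 (j + x) (by omega) (by omega)
            rw [show D + j + x = D + (j + x) by omega, ← this]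
            congr 1
            omega
        rwa [show D + j + 1 + (i - j) = D + i + 1 by omega,
          show D + j + (i - j) = D + i by omega] at this
      rw [this]
      simp
    · intro x hx hx'
      have := w1 (x - D) (by omega)
      rwa [show D + (x - D) = x by omega] at this
  · have key : ∀ x y, x < y → y < i + 1 → (μ₃ (D + x)).key ≤ (μ₃ (D + y)).key := by
      have g2' : ∀ x y, x < y → y < i → (μ' (D + x)).key ≤ (μ' (D + y)).key :=
        fun x y h h' => g2 _ _ (by omega) (by omega) (by omega)
      have low : ∀ x < j, (μ' (D + x)).key ≤ (μ (A + i)).key := by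
        intro x hx
        rcases (show x ≤ j - 1 by omega).eq_or_lt with h | h
        · exact k4' x (by omega)
        · exact (g2' x (j - 1) h (by omega)).trans (k4' (j - 1) (by omega))
      intro x y hxy hy
      rcases lt_trichotomy y j with h | rfl | h
      · rw [w1 x (by omega), w1 y h]
        exact g2' x y hxy (by omega)
      · rw [w1 x hxy, w2]
        exact low x hxy
      · obtain ⟨y, rfl⟩ : ∃ z, y = z + 1 := ⟨y - 1, by omega⟩
        rw [← add_assoc, w3 y (by omega) (by omega)]
        rcases lt_trichotomy x j with h' | rfl | h'
        · rw [w1 x h']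
          exact g2' x y (by omega) (by omega)
        · rw [w2]
          exact (k3' y (by omega) (by omega)).le
        · obtain ⟨x, rfl⟩ : ∃ z, x = z + 1 := ⟨x - 1, by omega⟩
          rw [← add_assoc, w3 x (by omega) (by omega)]
          exact g2' x y (by omega) (by omega)
    intro x y hx hxy hy
    have := key (x - D) (y - D) (by omega) (by omega)
    rwa [show D + (x - D) = x by omega, show D + (y - D) = y by omega] at this

/-! ### Merge sort -/

/-- The loop of `mergeSort` that merges two neighbouring runs into the work array. -/
def mergeRuns (f fp : ℕ) : Prog Unit :=
  loop f (lt (v (fp + 9)) (v (fp + 6))) do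
    cond (both (lt (v (fp + 7)) (v (fp + 5)))
        (either (neg (lt (v (fp + 8)) (v (fp + 6))))
          (neg (lessAt (v (fp + 1) + v (fp + 8)) (v (fp + 1) + v (fp + 7))))))
      (do moveAt (lit (fp + 10) + v (fp + 9)) (v (fp + 1) + v (fp + 7))
          assign (fp + 7) (v (fp + 7) + 1))
      (do moveAt (lit (fp + 10) + v (fp + 9)) (v (fp + 1) + v (fp + 8))
          assign (fp + 8) (v (fp + 8) + 1))
    assign (fp + 9) (v (fp + 9) + 1)

theorem mergeRuns_tr (hk : 2 ≤ k) {P q lo mid hi fp f : ℕ} (h1 : μ (fp + 1) = .num P)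
    (h5 : μ (fp + 5) = .num mid)
    (h6 : μ (fp + 6) = .num hi) (h7 : μ (fp + 7) = .num lo) (h8 : μ (fp + 8) = .num mid)
    (h9 : μ (fp + 9) = .num lo) (hP : P + q ≤ fp) (hlm : lo ≤ mid) (hmh : mid ≤ hi) (hq : hi ≤ q)
    (hi' : Items μ P (P + q)) (hs : Sorted μ (P + lo) (P + mid))
    (hs' : Sorted μ (P + mid) (P + hi)) :
    Tr k B (.box {a | fp + 1 ≤ a ∧ a < fp + 10 ∨ P ≤ a ∧ a < P + q}
        {a | fp + 7 ≤ a ∧ a < fp + 10 ∨ fp + 10 + lo ≤ a ∧ a < fp + 10 + hi})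
      (((hi - lo + 1) * 60 : ℕ) : ℝ≥0∞)
      (mergeRuns f fp) μ fun _ μ' =>
      ms μ' (fp + 10 + lo) (fp + 10 + hi) = ms μ (P + lo) (P + hi) ∧
        Sorted μ' (fp + 10 + lo) (fp + 10 + hi) := by
  unfold mergeRuns
  obtain ⟨I, hI⟩ : ∃ I : ℕ → Mem α → Prop, ∀ s μ', I s μ' ↔ ∃ i j, lo ≤ i ∧ i ≤ mid ∧ mid ≤ j ∧
      j ≤ hi ∧ lo + s + mid = i + j ∧ μ' (fp + 7) = .num i ∧ μ' (fp + 8) = .num j ∧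
      μ' (fp + 9) = .num (lo + s) ∧
      Sorted μ' (fp + 10 + lo) (fp + 10 + (lo + s)) ∧
      (∀ x y, lo ≤ x → x < lo + s → (i ≤ y ∧ y < mid ∨ j ≤ y ∧ y < hi) →
        (μ' (fp + 10 + x)).key ≤ (μ (P + y)).key) ∧
      ms μ' (fp + 10 + lo) (fp + 10 + (lo + s)) =
        ms μ (P + lo) (P + i) + ms μ (P + mid) (P + j) := ⟨_, fun _ _ => Iff.rfl⟩
  have I0 : I 0 μ := by
    refine (hI _ _).2 ⟨lo, mid, le_rfl, hlm, le_rfl, hmh, by omega, h7, h8, by simpa using h9,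
      ?_, ?_, by simp⟩
    · intro x y; omega
    · intro x y; omega
  refine Tr.loop_const I (2 * 30) (hi - lo) f I0 ?_ ?_
  · intro s μ' hμ'
    obtain ⟨i, j, hμ'⟩ := (hI _ _).1 hμ'
    omega
  intro s μ' hfr hμ'
  obtain ⟨i, j, g1, g2, g3, g4, g5, e7, e8, e9, g6, g7, g8⟩ := (hI _ _).1 hμ'
  have e1 : μ' (fp + 1) = .num P := (hfr _ (by simp; omega)).trans h1
  have e5 : μ' (fp + 5) = .num mid := (hfr _ (by simp; omega)).trans h5
  have e6 : μ' (fp + 6) = .num hi := (hfr _ (by simp; omega)).trans h6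
  have eP : ∀ x < q, μ' (P + x) = μ (P + x) := fun x hx => hfr _ (by simp; omega)
  refine Tr.of_len 30 hk (by decide) ?_
  simp only [safe_rules, cell_rules, mem_rules, e1, e5, e6, e7, e8, e9]
  by_cases ht : lo + s < hi
  swap
  · rw [show i = mid by omega, show j = hi by omega, show lo + s = hi by omega,
      ms_add _ (by omega) (by omega)] at g8
    rw [show lo + s = hi by omega] at g6
    simp [ht, g8, g6]
  simp only [ht, decide_true, if_true]
  -- after the next item `P + y` was moved
  have step : ∀ y i' j' μ'', (∀ a, μ'' a = if a = fp + 9 then .num (lo + (s + 1)) else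
        if a = fp + 7 then .num i' else if a = fp + 8 then .num j' else
        if a = fp + 10 + (lo + s) then μ (P + y) else μ' a) →
      (y = i ∧ i < mid ∧ i' = i + 1 ∧ j' = j ∨ y = j ∧ j < hi ∧ i' = i ∧ j' = j + 1) →
      (∀ z, (i ≤ z ∧ z < mid ∨ j ≤ z ∧ z < hi) → (μ (P + y)).key ≤ (μ (P + z)).key) →
      I (s + 1) μ'' := by
    intro y i' j' μ'' hμ'' hy hz
    have w : ∀ x, x < lo + s → μ'' (fp + 10 + x) = μ' (fp + 10 + x) := by
      intro x hx; rw [hμ'']; grind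
    have w' : μ'' (fp + 10 + (lo + s)) = μ (P + y) := by rw [hμ'']; grind
    have hy' : i ≤ y ∧ y < mid ∨ j ≤ y ∧ y < hi := by omega
    refine (hI _ _).2 ⟨i', j', by omega, by omega, by omega, by omega, by omega, by grind,
      by grind, by grind, ?_, ?_, ?_⟩
    · intro a b ha hab hb
      obtain ⟨a, rfl⟩ : ∃ a', a = fp + 10 + a' := ⟨a - (fp + 10), by omega⟩
      obtain ⟨b, rfl⟩ : ∃ a', b = fp + 10 + a' := ⟨b - (fp + 10), by omega⟩
      rw [w a (by omega)]
      rcases (show b ≤ lo + s by omega).eq_or_lt with rfl | h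
      · rw [w']
        exact g7 a y (by omega) (by omega) hy'
      · rw [w b h]
        exact g6 _ _ ha hab (by omega)
    · intro x z hx hx' hz'
      rcases (show x ≤ lo + s by omega).eq_or_lt with rfl | h
      · rw [w']
        exact hz z (by omega)
      · rw [w x h]
        exact g7 x z hx h (by omega)
    · rw [← add_assoc lo, ← add_assoc (fp + 10), ms_succ _ (by omega), w',
        ms_congr (μ' := μ'), g8]
      · rcases hy with ⟨rfl, -, rfl, rfl⟩ | ⟨rfl, -, rfl, rfl⟩
        · rw [← add_assoc P, ms_succ _ (by omega)]
          simp
        · rw [← add_assoc P y, ms_succ _ (by omega)]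
          simp
      · intro a ha ha'
        have := w (a - (fp + 10)) (by omega)
        rwa [show fp + 10 + (a - (fp + 10)) = a by omega] at this
  have hmono : ∀ i z, i ≤ z → z < mid → lo ≤ i → (μ (P + i)).key ≤ (μ (P + z)).key := by
    intro i z h1 h2 h3
    rcases h1.eq_or_lt with rfl | h
    · exact le_rfl
    · exact hs _ _ (by omega) (by omega) (by omega)
  have hmono' : ∀ j z, j ≤ z → z < hi → mid ≤ j → (μ (P + j)).key ≤ (μ (P + z)).key := by
    intro i z h1 h2 h3
    rcases h1.eq_or_lt with rfl | h
    · exact le_rfl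
    · exact hs' _ _ (by omega) (by omega) (by omega)
  have upd : ∀ c, update μ' (fp + 10 + (lo + s)) c (fp + 7) = μ' (fp + 7) ∧
      update μ' (fp + 10 + (lo + s)) c (fp + 8) = μ' (fp + 8) ∧
      update μ' (fp + 10 + (lo + s)) c (fp + 9) = μ' (fp + 9) := fun c =>
    ⟨update_of_ne (by omega) _ _, update_of_ne (by omega) _ _,
      update_of_ne (by omega) _ _⟩
  have upd' : ∀ c c', update (update μ' (fp + 10 + (lo + s)) c) (fp + 7) c'
      (fp + 9) = μ' (fp + 9) ∧ update (update μ' (fp + 10 + (lo + s)) c)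
      (fp + 8) c' (fp + 9) = μ' (fp + 9) := fun c c' => by
    rw [update_of_ne (by omega), update_of_ne (by omega),
      update_of_ne (by omega), update_of_ne (by omega)]
    exact ⟨rfl, rfl⟩
  simp only [upd, upd', e7, e8, e9, cell_rules]
  have left : i < mid → (∀ z, j ≤ z → z < hi → (μ (P + i)).key ≤ (μ (P + z)).key) →
      I (s + 1) (update (update (update μ' (fp + 10 + (lo + s))
        (μ' (P + i))) (fp + 7) (.num (i + 1))) (fp + 9) (.num (lo + s + 1))) := by
    intro h h'
    refine step i (i + 1) j _ ?_ (Or.inl ⟨rfl, h, rfl, rfl⟩) ?_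
    · intro a
      rw [eP i (by omega)]
      simp only [update_apply]
      grind
    · intro z hz
      rcases hz with hz | hz
      · exact hmono i z hz.1 hz.2 g1
      · exact h' z hz.1 hz.2
  have right : j < hi → (i < mid → (μ (P + j)).key ≤ (μ (P + i)).key) →
      I (s + 1) (update (update (update μ' (fp + 10 + (lo + s))
        (μ' (P + j))) (fp + 8) (.num (j + 1))) (fp + 9) (.num (lo + s + 1))) := by
    intro h h'
    refine step j i (j + 1) _ ?_ (Or.inr ⟨rfl, h, rfl, rfl⟩) ?_
    · intro a
      rw [eP j (by omega)]
      simp only [update_apply]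
      grind
    · intro z hz
      rcases hz with hz | hz
      · exact (h' (by omega)).trans (hmono i z hz.1 hz.2 g1)
      · exact hmono' j z hz.1 hz.2 g3
  have hlt : ∀ i j, i < q → j < q →
      ((μ' (P + j)).lt (μ' (P + i)) = true ↔ (μ (P + j)).key < (μ (P + i)).key) := by
    intro i j h h'
    rw [eP i h, eP j h']
    exact Cell.lt_iff (Or.inl (hi' _ (by omega) (by omega)))
  by_cases him : i < mid
  · by_cases hj : j < hi
    · simp only [him, hj, decide_true, if_true, not_true_eq_false, if_false, hlt i j (by omega)
        (by omega)]
      by_cases hc : (μ (P + j)).key < (μ (P + i)).key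
      · simp only [hc, not_true_eq_false, if_false]
        constructorm* _ ∧ _
        any_goals first | exact trivial | omega
        exact right hj fun _ => hc.le
      · simp only [hc, not_false_eq_true, if_true]
        constructorm* _ ∧ _
        any_goals first | exact trivial | omega
        exact left him fun z hz hz' => (not_lt.1 hc).trans (hmono' j z hz hz' g3)
    · simp only [him, hj, decide_true, decide_false, Bool.false_eq_true, not_false_eq_true, if_true]
      constructorm* _ ∧ _
      any_goals first | exact trivial | omega
      exact left him fun z hz hz' => by omega
  · simp only [him, decide_false]
    simp
    constructorm* _ ∧ _
    any_goals first | exact trivial | omega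
    exact right (by omega) fun h => absurd h him

/-- The loop of `mergeSort` that merges all runs of one length in pairs. -/
def mergePass (f fp : ℕ) : Prog Unit :=
  loop f (lt (v (fp + 4)) (v (fp + 2))) do
    (do
      assign (fp + 5) (minimum (v (fp + 4) + v (fp + 3)) (v (fp + 2)))
      assign (fp + 6) (minimum (v (fp + 4) + v (fp + 3) + v (fp + 3)) (v (fp + 2)))
      assign (fp + 7) (v (fp + 4))
      assign (fp + 8) (v (fp + 5))
      assign (fp + 9) (v (fp + 4)))
    mergeRuns f fp
    assign (fp + 4) (v (fp + 6))

/-- The loop of `mergeSort` that copies the work array back. -/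
def mergeCopy (f fp : ℕ) : Prog Unit :=
  loop f (lt (v (fp + 9)) (v (fp + 2))) do
    moveAt (v (fp + 1) + v (fp + 9)) (lit (fp + 10) + v (fp + 9))
    assign (fp + 9) (v (fp + 9) + 1)

theorem mergeSort_eq (f fp : ℕ) : mergeSort f fp = (do
    assign (fp + 3) 1
    loop f (lt (v (fp + 3)) (v (fp + 2))) do
      assign (fp + 4) 0
      mergePass f fp
      assign (fp + 9) 0
      mergeCopy f fp
      assign (fp + 3) (v (fp + 3) + v (fp + 3))) := by
  rfl

/-- The `q` cells from `P` on are sorted in runs of length `w`. -/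
def Runs (μ : Mem α) (P q w : ℕ) : Prop :=
  ∀ t, Sorted μ (P + min (t * w) q) (P + min ((t + 1) * w) q)

theorem Sorted.congr {μ μ' : Mem α} {a b : ℕ} (h : Sorted μ a b)
    (hc : ∀ x, a ≤ x → x < b → μ' x = μ x) : Sorted μ' a b := by
  intro x y hx hxy hy
  rw [hc x hx (hxy.trans hy), hc y (hx.trans hxy.le) hy]
  exact h x y hx hxy hy

theorem Sorted.of_le {μ : Mem α} {a b : ℕ} (h : b ≤ a) : Sorted μ a b := by
  intro x y; omega

theorem Sorted.shift {μ μ' : Mem α} {a b n : ℕ} (h : Sorted μ b (b + n))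
    (hc : ∀ x < n, μ' (a + x) = μ (b + x)) : Sorted μ' a (a + n) := by
  intro x y hx hxy hy
  have h1 := hc (x - a) (by omega)
  have h2 := hc (y - a) (by omega)
  rw [show a + (x - a) = x by omega] at h1
  rw [show a + (y - a) = y by omega] at h2
  rw [h1, h2]
  exact h _ _ (by omega) (by omega) (by omega)

theorem sum_telescope_cast (g : ℕ → ℕ) (hg : Monotone g) (a c N : ℕ) :
    ∑ s ∈ Finset.Ico 0 (N + 1), (((g (s + 1) - g s) * a + c : ℕ) : ℝ≥0∞) =
      (((g (N + 1) - g 0) * a + (N + 1) * c : ℕ) : ℝ≥0∞) := by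
  rw [← Nat.cast_sum, sum_add_distrib, ← Finset.sum_mul, ← Finset.range_eq_Ico,
    Finset.sum_range_tsub hg]
  simp

theorem mergePass_tr (hk : 2 ≤ k) {P q w fp f : ℕ} (h1 : μ (fp + 1) = .num P)
    (h2 : μ (fp + 2) = .num q) (h3 : μ (fp + 3) = .num w) (h4 : μ (fp + 4) = .num 0)
    (hP : P + q ≤ fp) (hw : 0 < w) (hi' : Items μ P (P + q)) (hr : Runs μ P q w) :
    Tr k B (.box {a | fp + 1 ≤ a ∧ a < fp + 10 ∨ P ≤ a ∧ a < P + q}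
        {a | fp + 4 ≤ a ∧ a < fp + 10 + q})
      (((q + 1) * 240 : ℕ) : ℝ≥0∞) (mergePass f fp) μ fun _ μ' =>
      ms μ' (fp + 10) (fp + 10 + q) = ms μ P (P + q) ∧ Runs μ' (fp + 10) q (2 * w) := by
  unfold mergePass
  obtain ⟨I, hI⟩ : ∃ I : ℕ → Mem α → Prop, ∀ s μ', I s μ' ↔ s ≤ q ∧
      μ' (fp + 4) = .num (min (s * (2 * w)) q) ∧
      ms μ' (fp + 10) (fp + 10 + min (s * (2 * w)) q) = ms μ P (P + min (s * (2 * w)) q) ∧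
      ∀ t < s, Sorted μ' (fp + 10 + min (t * (2 * w)) q) (fp + 10 + min ((t + 1) * (2 * w)) q) :=
    ⟨_, fun _ _ => Iff.rfl⟩
  have hmono : Monotone fun s : ℕ => min (s * (2 * w)) q := fun a b h =>
    min_le_min_right _ (Nat.mul_le_mul_right _ h)
  refine (Tr.loop_box (i := 0) I (fun s => (((min ((s + 1) * (2 * w)) q - min (s * (2 * w)) q) *
      60 +
    150 : ℕ) : ℝ≥0∞)) q f ((hI _ _).2 ⟨by omega, by simpa using h4, by simp,
    fun t ht => absurd ht (by omega)⟩)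
    (fun s μ' h => ((hI s μ').1 h).1) ?_).mono ?_ fun _ _ h => h
  swap
  · rw [sum_telescope_cast _ hmono]
    have : min ((q + 1) * (2 * w)) q ≤ q := min_le_right _ _
    norm_cast
    simp only [zero_mul, Nat.zero_min, Nat.sub_zero]
    omega
  intro s μ' hfr hμ'
  obtain ⟨hsq, e4, g1, g2⟩ := (hI _ _).1 hμ'
  have e1 : μ' (fp + 1) = .num P := (hfr _ (by simp)).trans h1
  have e2 : μ' (fp + 2) = .num q := (hfr _ (by simp)).trans h2
  have e3 : μ' (fp + 3) = .num w := (hfr _ (by simp)).trans h3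
  have eP : ∀ x, P ≤ x → x < P + q → μ' x = μ x := fun x hx hx' => hfr _ (by simp; omega)
  refine (Tr.round (e := ((((min ((s + 1) * (2 * w)) q - min (s * (2 * w)) q) * 60 +
    130 : ℕ) : ℝ≥0∞))) 3 hk (by decide) ?_).mono ?_ fun _ _ h => h
  swap
  · norm_cast; omega
  simp only [safe_rules, cell_rules, mem_rules, e2, e4]
  by_cases hlo : s * (2 * w) < q
  swap
  · have hq : min (s * (2 * w)) q = q := by omega
    rw [hq] at g1
    simp only [hq, lt_irrefl, decide_false, Bool.false_eq_true, if_false]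
    refine ⟨by omega, by omega, g1, fun t => ?_⟩
    rcases lt_or_ge t s with h | h
    · exact g2 t h
    · have : s * (2 * w) ≤ t * (2 * w) := Nat.mul_le_mul_right _ h
      exact Sorted.of_le (by omega)
  have t0 : s * (2 * w) = 2 * s * w := by ring
  have t1 : (2 * s + 1) * w = 2 * s * w + w := by ring
  have t2 : (2 * s + 1 + 1) * w = 2 * s * w + 2 * w := by ring
  have t3 : (s + 1) * (2 * w) = 2 * s * w + 2 * w := by ring
  have r1 := hr (2 * s)
  have r2 := hr (2 * s + 1)
  rw [t0] at hlo e4 g1 ⊢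
  rw [t1] at r1 r2
  rw [t2] at r2
  rw [t3]
  generalize 2 * s * w = lo at *
  rw [min_eq_left hlo.le] at r1 g1 e4 ⊢
  simp only [hlo, decide_true, if_true]
  refine ⟨by omega, by omega, ?_⟩
  obtain ⟨mid, hmid⟩ : ∃ mid, mid = min (lo + w) q := ⟨_, rfl⟩
  obtain ⟨hi, hhi⟩ : ∃ hi, hi = min (lo + 2 * w) q := ⟨_, rfl⟩
  have hhi' : min (lo + w + w) q = hi := by omega
  rw [← hmid] at r1 r2
  rw [← hhi] at r2
  simp only [← hhi]
  refine (Tr.step (e := (((hi - lo) * 60 + 64 : ℕ) : ℝ≥0∞)) 30 hk (by decide) ?_).mono ?_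
    fun _ _ h => h
  swap
  · norm_cast; omega
  simp only [safe_rules, cell_rules, mem_rules, upd_rules,
    Nat.reduceEqDiff, if_true, if_false, e2, e3, e4, ← hmid, hhi']
  constructorm* _ ∧ _
  any_goals first | exact trivial | omega
  obtain ⟨μ₁, hμ₁⟩ : ∃ m, m = update (update (update (update
    (update μ' (fp + 5) (.num mid)) (fp + 6) (.num hi)) (fp + 7) (.num lo)) (fp + 8)
    (.num mid)) (fp + 9) (.num lo) := ⟨_, rfl⟩
  rw [← hμ₁]
  have v₁ : ∀ x, μ₁ x = if x = fp + 9 then .num lo else if x = fp + 8 then .num mid else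
      if x = fp + 7 then .num lo else if x = fp + 6 then .num hi else if x = fp + 5 then .num mid
      else μ' x := by
    simp [hμ₁, update_apply]
  have v1 : ∀ x, fp + 10 ≤ x ∨ x < fp + 5 → μ₁ x = μ' x := by
    intro x hx; rw [v₁]; grind
  have vP : ∀ x, P ≤ x → x < P + q → μ₁ x = μ x := by
    intro x hx hx'; rw [v1 x (by omega), eP x hx hx']
  have k1 : μ₁ (fp + 1) = .num P := by rw [v1 _ (by omega), e1]
  have k5 : μ₁ (fp + 5) = .num mid := by rw [v₁]; grind
  have k6 : μ₁ (fp + 6) = .num hi := by rw [v₁]; grind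
  have k7 : μ₁ (fp + 7) = .num lo := by rw [v₁]; grind
  have k8 : μ₁ (fp + 8) = .num mid := by rw [v₁]; grind
  have k9 : μ₁ (fp + 9) = .num lo := by rw [v₁]; grind
  refine (Tr.bind (((mergeRuns_tr hk k1 k5 k6 k7 k8 k9 hP (by omega) (by omega) (by omega)
    (fun x h h' => vP x h h' ▸ hi' x h h')
    (r1.congr fun x h h' => vP x (by omega) (by omega))
    (r2.congr fun x h h' => vP x (by omega) (by omega))).box_frame).box_mono
      (by intro a; simp) (by intro a; simp; omega)) (e' := (4 : ℕ)) ?_).mono ?_ fun _ _ h => h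
  swap
  · norm_cast; omega
  rintro _ μ₂ ⟨⟨m1, m2⟩, hfr₂⟩
  have n6 : μ₂ (fp + 6) = .num hi := (hfr₂ _ (by simp; omega)).trans k6
  refine Tr.of_len 2 hk (by decide) ?_
  simp only [safe_rules, cell_rules, mem_rules, n6]
  have w1 : ∀ x, fp + 10 ≤ x → update μ₂ (fp + 4) (.num hi) x = μ₂ x := fun x hx =>
    update_of_ne (by omega) _ _
  have w2 : ∀ x, fp + 10 ≤ x → x < fp + 10 + lo → μ₂ x = μ' x := fun x hx hx' => by
    rw [hfr₂ x (by simp; omega), v1 x (by omega)]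
  constructorm* _ ∧ _
  any_goals first | exact trivial | omega
  · refine (hI _ _).2 ⟨?_, by simp [t3, hhi], ?_, fun t ht => ?_⟩
    · have : s * 1 ≤ s * (2 * w) := Nat.mul_le_mul_left _ (by omega)
      omega
    · rw [t3, ← hhi, ms_congr (μ' := μ₂) fun x hx _ => w1 x hx, ← ms_add μ₂ (b := fp + 10 + lo)
        (by omega) (by omega), m1, ms_congr (μ' := μ') fun x hx hx' => w2 x hx hx', g1,
        ms_congr (μ := μ₁) (μ' := μ) fun x hx hx' => vP x (by omega) (by omega), ms_add _
        (by omega) (by omega)]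
    · rcases (show t ≤ s by omega).eq_or_lt with rfl | h
      · rw [t3, ← hhi, t0, min_eq_left hlo.le]
        exact m2.congr fun x hx hx' => w1 x (by omega)
      · have : (t + 1) * (2 * w) ≤ s * (2 * w) := Nat.mul_le_mul_right _ h
        exact (g2 t h).congr fun x hx hx' => by rw [w1 x (by omega), w2 x (by omega) (by omega)]

theorem mergeCopy_tr (hk : 2 ≤ k) {P q fp f : ℕ} (h1 : μ (fp + 1) = .num P)
    (h2 : μ (fp + 2) = .num q) (h9 : μ (fp + 9) = .num 0) (hP : P + q ≤ fp) :
    Tr k B (.box {a | fp + 1 ≤ a ∧ a < fp + 10 + q}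
        {a | a = fp + 9 ∨ P ≤ a ∧ a < P + q})
      (((q + 1) * 30 : ℕ) : ℝ≥0∞) (mergeCopy f fp) μ fun _ μ' =>
      ∀ x < q, μ' (P + x) = μ (fp + 10 + x) := by
  unfold mergeCopy
  obtain ⟨I, hI⟩ : ∃ I : ℕ → Mem α → Prop, ∀ s μ', I s μ' ↔ s ≤ q ∧
      μ' (fp + 9) = .num s ∧ ∀ x < s, μ' (P + x) = μ (fp + 10 + x) :=
    ⟨_, fun _ _ => Iff.rfl⟩
  refine Tr.loop_const I (2 * 15) q f ((hI _ _).2 ⟨by omega, h9, by omega⟩)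
    (fun s μ' h => ((hI _ _).1 h).1) ?_
  intro s μ' hfr hμ'
  obtain ⟨hsq, e9, g1⟩ := (hI _ _).1 hμ'
  have e1 : μ' (fp + 1) = .num P := (hfr _ (by simp; omega)).trans h1
  have e2 : μ' (fp + 2) = .num q := (hfr _ (by simp; omega)).trans h2
  have eW : ∀ x, μ' (fp + 10 + x) = μ (fp + 10 + x) := fun x => hfr _ (by simp; omega)
  refine Tr.of_len 15 hk (by decide) ?_
  by_cases hs : s < q
  · have u : ∀ c, update μ' (P + s) c (fp + 9) = μ' (fp + 9) :=
      fun c => update_of_ne (by omega) _ _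
    simp only [safe_rules, cell_rules, mem_rules, e1, e2, e9, hs, u, decide_true, if_true, eW]
    constructorm* _ ∧ _
    any_goals first | exact trivial | omega
    refine (hI _ _).2 ⟨by omega, by simp, fun x hx => ?_⟩
    rw [update_of_ne (by omega), update_apply]
    split_ifs with h
    · congr 2; omega
    · exact g1 x (by omega)
  · simp only [safe_rules, cell_rules, mem_rules, e2, e9, hs, decide_false, Bool.false_eq_true,
      if_false]
    refine ⟨by omega, by omega, fun x hx => g1 x (by omega)⟩

theorem mergeSort_tr (hk : 2 ≤ k) {P q fp f : ℕ} (h1 : μ (fp + 1) = .num P)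
    (h2 : μ (fp + 2) = .num q) (hP : P + q ≤ fp) (hi' : Items μ P (P + q)) :
    Tr k B (.box {a | fp + 1 ≤ a ∧ a < fp + 10 + q ∨ P ≤ a ∧ a < P + q}
        {a | fp + 3 ≤ a ∧ a < fp + 10 + q ∨ P ≤ a ∧ a < P + q})
      (((Nat.log 2 q + 3) * ((q + 1) * 300) : ℕ) : ℝ≥0∞) (mergeSort f fp) μ fun _ μ' =>
      ms μ' P (P + q) = ms μ P (P + q) ∧ Sorted μ' P (P + q) := by
  rw [mergeSort_eq]
  obtain ⟨I, hI⟩ : ∃ I : ℕ → Mem α → Prop, ∀ s μ', I s μ' ↔ s ≤ Nat.log 2 q + 1 ∧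
      μ' (fp + 3) = .num (2 ^ s) ∧ ms μ' P (P + q) = ms μ P (P + q) ∧ Runs μ' P q (2 ^ s) :=
    ⟨_, fun _ _ => Iff.rfl⟩
  refine (Tr.step (e := (((Nat.log 2 q + 1 + 1) * ((q + 1) * 300) : ℕ) : ℝ≥0∞))
    5 hk (by decide) ?_).mono ?_ fun _ _ h => h
  swap
  · norm_cast
    rw [show Nat.log 2 q + 3 = Nat.log 2 q + 1 + 1 + 1 from rfl, Nat.succ_mul (Nat.log 2 q + 1 + 1)]
    omega
  simp only [safe_rules, cell_rules, mem_rules]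
  refine ⟨by omega, Tr.loop_const I ((q + 1) * 300) (Nat.log 2 q + 1) f
    ((hI _ _).2 ⟨by omega, by simp, ms_congr fun x h h' => update_of_ne (by omega) _ _,
      fun t x y hx hxy hy => ?_⟩) (fun s μ' h => ((hI _ _).1 h).1) ?_⟩
  · simp only [pow_zero, mul_one] at hx hy
    omega
  intro s μ' hfr hμ'
  obtain ⟨hsq, e3, g1, g2⟩ := (hI _ _).1 hμ'
  have e1 : μ' (fp + 1) = .num P :=
    (hfr _ (by simp; omega)).trans ((update_of_ne (by omega) _ _).trans h1)
  have e2 : μ' (fp + 2) = .num q :=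
    (hfr _ (by simp; omega)).trans ((update_of_ne (by omega) _ _).trans h2)
  refine (Tr.round (e := (((q + 1) * 290 : ℕ) : ℝ≥0∞)) 3 hk (by decide) ?_).mono ?_ fun _ _ h => h
  swap
  · norm_cast; omega
  simp only [safe_rules, cell_rules, mem_rules, e2, e3]
  by_cases hs : 2 ^ s < q
  swap
  · simp only [hs, decide_false, Bool.false_eq_true, if_false]
    refine ⟨by omega, by omega, g1, ?_⟩
    have := g2 0
    simpa [min_eq_right (not_lt.1 hs)] using this
  have hlog : s ≤ Nat.log 2 q := Nat.le_log_of_pow_le (by norm_num) hs.le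
  simp only [hs, decide_true, if_true]
  refine ⟨by omega, by omega, ?_⟩
  refine (Tr.step (e := (((q + 1) * 285 : ℕ) : ℝ≥0∞)) 1 hk (by decide) ?_).mono ?_ fun _ _ h => h
  swap
  · norm_cast; omega
  simp only [safe_rules, cell_rules, mem_rules]
  refine ⟨by omega, ?_⟩
  obtain ⟨μ₁, hμ₁⟩ : ∃ m, m = update μ' (fp + 4) (.num 0) := ⟨_, rfl⟩
  rw [← hμ₁]
  have v₁ : ∀ x, x ≠ fp + 4 → μ₁ x = μ' x := fun x hx => by
    rw [hμ₁, update_of_ne hx]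
  have hiP : Items μ' P (P + q) := hi'.of_ms g1
  refine (Tr.bind (((mergePass_tr hk ((v₁ _ (by omega)).trans e1) ((v₁ _ (by omega)).trans e2)
    ((v₁ _ (by omega)).trans e3) (by simp [hμ₁]) hP (by positivity)
    (fun x h h' => (v₁ x (by omega)) ▸ hiP x h h')
    (fun t => (g2 t).congr fun x h h' => v₁ x (by omega))).box_frame).box_mono
      (by intro a; simp; omega) (by intro a; simp; omega)) (e' := (((q + 1) * 30 + 10 : ℕ) : ℝ≥0∞))
      ?_).mono ?_ fun _ _ h => h
  swap
  · simp only [← Nat.cast_add, Nat.cast_le]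
    omega
  rintro _ μ₂ ⟨⟨m1, m2⟩, hfr₂⟩
  refine (Tr.step (e := (((q + 1) * 30 + 8 : ℕ) : ℝ≥0∞)) 1 hk (by decide) ?_).mono ?_
    fun _ _ h => h
  swap
  · norm_cast; omega
  simp only [safe_rules, cell_rules, mem_rules]
  refine ⟨by omega, ?_⟩
  obtain ⟨μ₃, hμ₃⟩ : ∃ m, m = update μ₂ (fp + 9) (.num 0) := ⟨_, rfl⟩
  rw [← hμ₃]
  have v₃ : ∀ x, x ≠ fp + 9 → μ₃ x = μ₂ x := fun x hx => by
    rw [hμ₃, update_of_ne hx]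
  have w : ∀ x, x < fp + 4 → μ₃ x = μ' x := fun x hx => by
    rw [v₃ _ (by omega), hfr₂ _ (by simp; omega), v₁ _ (by omega)]
  refine (Tr.bind (((mergeCopy_tr hk ((w _ (by omega)).trans e1) ((w _ (by omega)).trans e2)
    (by simp [hμ₃]) hP).box_frame).box_mono
      (by intro a; simp; omega) (by intro a; simp; omega)) (e' := (8 : ℕ))
      ?_).mono ?_ fun _ _ h => h
  swap
  · simp only [← Nat.cast_add, Nat.cast_le]
    omega
  rintro _ μ₄ ⟨c1, hfr₄⟩
  have w3 : μ₄ (fp + 3) = .num (2 ^ s) := by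
    rw [hfr₄ _ (by simp; omega), w _ (by omega), e3]
  have cW : ∀ x < q, μ₄ (P + x) = μ₂ (fp + 10 + x) := fun x hx => by
    rw [c1 x hx, v₃ _ (by omega)]
  refine Tr.of_len 4 hk (by decide) ?_
  have h2s : 2 ^ s + 2 ^ s = 2 ^ (s + 1) := by ring
  simp only [safe_rules, cell_rules, mem_rules, w3, h2s]
  constructorm* _ ∧ _
  any_goals first | exact trivial | omega
  have x : ∀ x, P ≤ x → x < P + q → update μ₄ (fp + 3) (.num (2 ^ (s + 1))) x = μ₄ x :=
    fun x h h' => update_of_ne (by omega) _ _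
  refine (hI _ _).2 ⟨by omega, by simp, ?_, fun t => ?_⟩
  · rw [ms_congr x, ms_shift cW, m1, ← g1]
    exact ms_congr fun x h h' => v₁ x (by omega)
  · have := m2 t
    rw [← pow_succ'] at this
    refine Sorted.congr ?_ fun y h h' => x y (by omega) (by omega)
    have hle : min (t * 2 ^ (s + 1)) q ≤ min ((t + 1) * 2 ^ (s + 1)) q :=
      min_le_min_right _ (Nat.mul_le_mul_right _ (by omega))
    generalize min (t * 2 ^ (s + 1)) q = a at *
    obtain ⟨d, hd⟩ := Nat.exists_eq_add_of_le hle
    have hq : min ((t + 1) * 2 ^ (s + 1)) q ≤ q := min_le_right _ _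
    rw [hd, ← add_assoc] at this ⊢
    refine Sorted.shift this fun x hx => ?_
    have := cW (a + x) (by omega)
    rwa [← add_assoc, ← add_assoc] at this

/-! ### Intervals of blocks -/

/-- The blocks that meet the cells from `a` to `b`, including `b`. -/
def blocks (B a b : ℕ) : Finset ℕ := Finset.Icc (a / B) (b / B)

theorem mem_blocks {a b x : ℕ} (h : a ≤ x) (h' : x ≤ b) : x / B ∈ blocks B a b :=
  Finset.mem_Icc.2 ⟨Nat.div_le_div_right h, Nat.div_le_div_right h'⟩

theorem card_blocks (hB : 0 < B) (a n : ℕ) : (blocks B a (a + n)).card ≤ n / B + 2 := by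
  have : (a + n) / B ≤ a / B + n / B + 1 := by
    rw [Nat.add_div hB]
    split_ifs <;> omega
  simp only [blocks, Nat.card_Icc]
  generalize n / B = x at *
  omega

theorem sq_le_two_pow (s : ℕ) : s * s ≤ 4 * 2 ^ s := by
  rcases lt_or_ge s 4 with h | h
  · interval_cases s <;> norm_num
  · induction s, h using Nat.le_induction with
    | base => norm_num
    | succ s hs ih =>
      rw [pow_succ]
      nlinarith

theorem log_add_mul_le {q B : ℕ} (hq : B * B ≤ 16 * q) :
    B * ((Nat.log 2 q + 3) * (q + 1)) ≤ 128 * (q * q) := by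
  rcases Nat.eq_zero_or_pos q with rfl | hq0
  · have : B = 0 := by
      by_contra h
      have : 0 < B * B := by positivity
      omega
    simp [this]
  have h1 : 2 ^ Nat.log 2 q ≤ q := Nat.pow_log_le_self 2 hq0.ne'
  have h2 := sq_le_two_pow (Nat.log 2 q)
  set L := Nat.log 2 q
  have h3 : (L + 3) * (L + 3) ≤ 32 * q := by nlinarith
  have h4 : (B * (L + 3)) ^ 2 ≤ (32 * q) ^ 2 := by
    have : (B * B) * ((L + 3) * (L + 3)) ≤ (16 * q) * (32 * q) := Nat.mul_le_mul hq h3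
    nlinarith
  have h5 : B * (L + 3) ≤ 32 * q := (Nat.pow_le_pow_iff_left (by norm_num)).1 h4
  calc B * ((L + 3) * (q + 1)) = (B * (L + 3)) * (q + 1) := by ring
    _ ≤ (32 * q) * (2 * q) := Nat.mul_le_mul h5 (by omega)
    _ ≤ _ := by nlinarith

/-- If the array of `q` items and the stack fit into the cache, merge sort costs `O(1 + q / B)`, and
otherwise `q` is at least of the order of `B²`, so that the number `O(q log q)` of accesses is
itself `O(q² / B)`. -/
theorem mergeSort_cost (hB : 64 ≤ B) (hk : B ≤ k) {P q fp f : ℕ} (h1 : μ (fp + 1) = .num P)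
    (h2 : μ (fp + 2) = .num q) (hP : P + q ≤ fp) (hi' : Items μ P (P + q)) :
    Tr k B (.box {a | fp + 1 ≤ a ∧ a < fp + 10 + q ∨ P ≤ a ∧ a < P + q}
        {a | fp + 3 ≤ a ∧ a < fp + 10 + q ∨ P ≤ a ∧ a < P + q})
      (((q + q * q / B + 1) * 40000 : ℕ) : ℝ≥0∞) (mergeSort f fp) μ fun _ μ' =>
      ms μ' P (P + q) = ms μ P (P + q) ∧ Sorted μ' P (P + q) := by
  have key := mergeSort_tr (k := k) (B := B) (f := f) (by omega) h1 h2 hP hi'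
  rcases lt_or_ge (16 * q) (B * B) with hq | hq
  · refine ⟨key.safe, (Cost.of_blocks (blocks B (fp + 1) (fp + 1 + (9 + q)) ∪
      blocks B P (P + q)) key.safe ?_ ?_ ?_).mono ?_ fun _ _ h => h⟩
    · refine (card_union_le _ _).trans ?_
      have h3 := card_blocks (B := B) (by omega) (fp + 1) (9 + q)
      have h4 := card_blocks (B := B) (by omega) P q
      have h5 : (9 + q) / B ≤ 1 + q / B := by
        calc (9 + q) / B ≤ (B + q) / B := Nat.div_le_div_right (by omega)
          _ = 1 + q / B := by rw [Nat.add_div_left _ (by omega)]; omega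
      have h6 : q / B < B / 16 + 1 := by
        rw [Nat.div_lt_iff_lt_mul (by omega)]
        have : B < 16 * (B / 16 + 1) := by omega
        nlinarith
      omega
    · rintro a (ha | ha)
      · exact mem_union_left _ (mem_blocks (by omega) (by omega))
      · exact mem_union_right _ (mem_blocks (by omega) (by omega))
    · rintro a (ha | ha)
      · exact mem_union_left _ (mem_blocks (by omega) (by omega))
      · exact mem_union_right _ (mem_blocks (by omega) (by omega))
    · have h3 := card_blocks (B := B) (by omega) (fp + 1) (9 + q)
      have h4 := card_blocks (B := B) (by omega) P q
      have h5 := card_union_le (blocks B (fp + 1) (fp + 1 + (9 + q))) (blocks B P (P + q))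
      have h6 := Nat.div_le_self (9 + q) B
      have h7 := Nat.div_le_self q B
      refine Nat.cast_le.2 ?_
      generalize q * q / B = x
      omega
  · refine key.mono ?_ fun _ _ h => h
    have h3 := log_add_mul_le hq
    have h4 : (Nat.log 2 q + 3) * (q + 1) ≤ 128 * (q * q) / B := by
      rw [Nat.le_div_iff_mul_le (by omega)]
      linarith
    have h5 : 128 * (q * q) / B ≤ 128 * (q * q / B + 1) := by
      rw [← Nat.lt_add_one_iff, Nat.div_lt_iff_lt_mul (by omega)]
      have := Nat.lt_div_mul_add (a := q * q) (b := B) (by omega)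
      nlinarith
    refine Nat.cast_le.2 ?_
    calc (Nat.log 2 q + 3) * ((q + 1) * 300) = ((Nat.log 2 q + 3) * (q + 1)) * 300 := by ring
      _ ≤ (128 * (q * q / B + 1)) * 300 := Nat.mul_le_mul_right _ (h4.trans h5)
      _ ≤ _ := by omega

/-! ### Procedure calls -/

/-- The expression `x` evaluates to `a` in every memory that agrees with `μ` below `s`. For
arguments of a call `s` is the top of the frame: pushing earlier arguments does not change later
ones. -/
def Eval (π : Policy α) (x : Prog ℕ) (μ : Mem α) (s a : ℕ) : Prop :=
  ∀ μ' : Mem α, (∀ y < s, μ' y = μ y) → ∀ Q : ℕ → Mem α → Prop, Q a μ' → Safe π x μ' Q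

section

variable {π : Policy α} {s a b : ℕ} {x y : Prog ℕ}

theorem Eval.v {c : ℕ} (hc : c < s) (h : μ c = .num a) (hrd : ∀ μ', π.rd μ' c) :
    Eval π (v c) μ s a := fun μ' h' Q hQ =>
  safe_v.2 ⟨hrd _, by rw [h' _ hc, h]; exact hQ⟩

theorem Eval.lit : Eval π (lit a) μ s a := fun _ _ _ hQ => hQ
theorem Eval.ofNat [a.AtLeastTwo] : Eval π (OfNat.ofNat a) μ s a := fun _ _ _ hQ => hQ
theorem Eval.one : Eval π 1 μ s 1 := fun _ _ _ hQ => hQ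

theorem Eval.add (h : Eval π x μ s a) (h' : Eval π y μ s b) : Eval π (x + y) μ s (a + b) :=
  fun _ hμ _ hQ => safe_add.2 (h _ hμ _ (h' _ hμ _ hQ))

theorem Eval.sub (h : Eval π x μ s a) (h' : Eval π y μ s b) : Eval π (x - y) μ s (a - b) :=
  fun _ hμ _ hQ => safe_sub.2 (h _ hμ _ (h' _ hμ _ hQ))

theorem Eval.mul (h : Eval π x μ s a) (h' : Eval π y μ s b) : Eval π (x * y) μ s (a * b) :=
  fun _ hμ _ hQ => safe_mul.2 (h _ hμ _ (h' _ hμ _ hQ))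

theorem Eval.deref (h : Eval π x μ s a) (ha : a < s) (h' : μ a = .num b)
    (hrd : ∀ μ', π.rd μ' a) : Eval π (deref x) μ s b :=
  fun μ' hμ _ hQ => safe_deref.2 (h _ hμ _ ⟨hrd _, by rw [hμ _ ha, h']; exact hQ⟩)

theorem Safe.pushAll {es : List (Prog ℕ)} {as : List ℕ}
    (h : List.Forall₂ (fun x a => Eval π x μ s a) es as) {c : ℕ} (hc : s ≤ c) {μ' : Mem α}
    (hμ : ∀ y < s, μ' y = μ y) (hwr : ∀ μ' y d, c ≤ y → y < c + as.length → π.wr μ' y d) :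
    Safe π (pushAll c es) μ' fun _ μ'' => (∀ i b, as[i]? = some b → μ'' (c + i) = .num b) ∧
      ∀ y, (y < c ∨ c + as.length ≤ y) → μ'' y = μ' y := by
  induction h generalizing c μ' with
  | nil => simp
  | @cons x a es as hx _ ih =>
    rw [safe_pushAll_cons, safe_assign]
    refine hx _ hμ _ ⟨hwr _ _ _ le_rfl (by simp), ?_⟩
    refine (ih (c := c + 1) (by omega) (fun y hy => by
      rw [update_of_ne (by omega), hμ y hy]) fun μ' y d hy hy' =>
        hwr _ _ _ (by omega) (by simp; omega)).mono ?_
    rintro _ μ'' ⟨h1, h2⟩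
    refine ⟨fun i b hb => ?_, fun y hy => ?_⟩
    · rcases i with _ | i
      · rw [h2 _ (by omega)]
        simp at hb
        simp [hb]
      · rw [← h1 i b (by simpa using hb)]
        congr 1
        omega
    · rw [List.length_cons] at hy
      rw [h2 y (by omega), update_of_ne (by omega)]

/-- A call costs what the body costs and a constant for pushing the arguments. The frame of the
callee starts at `t`. -/
theorem Tr.call {e : ℝ≥0∞} {fp t : ℕ} {top : Prog ℕ} {es : List (Prog ℕ)} {as : List ℕ}
    {body : ℕ → Prog Unit} {Q : Mem α → Prop} {n₁ n₂ : Len} (N : ℕ) (hk : 2 ≤ k)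
    [HasLen top n₁] [hn : ∀ t, HasLen (pushAll (t + 1) es) n₂]
    (hN : n₁.eval + n₂.eval + 2 ≤ N) (htop : Eval π top μ t t)
    (hes : List.Forall₂ (fun x a => Eval π x μ t a) es as)
    (hwr : ∀ μ' y d, t ≤ y → y < t + 1 + as.length → π.wr μ' y d)
    (h : ∀ μ₁ : Mem α, (∀ i b, as[i]? = some b → μ₁ (t + 1 + i) = .num b) →
      (∀ y, (y < t ∨ t + 1 + as.length ≤ y) → μ₁ y = μ y) →
      Tr k B π e (body t) μ₁ fun _ μ' => π.rd μ' t ∧ Q μ') :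
    Tr k B π (((2 * N : ℕ) : ℝ≥0∞) + e) (call fp top es body) μ fun _ => Q := by
  have h1 : Tr k B π ((2 * n₁.eval : ℕ) : ℝ≥0∞) top μ (fun x μ' => x = t ∧ μ' = μ) :=
    Tr.of_len _ hk le_rfl (htop μ (fun _ _ => rfl) _ ⟨rfl, rfl⟩)
  refine (h1.bind (e' := ((2 * 1 : ℕ) : ℝ≥0∞) + (((2 * n₂.eval : ℕ) : ℝ≥0∞) +
    (e + ((2 * 1 : ℕ) : ℝ≥0∞)))) (Q' := fun _ => Q) ?_).mono ?_ fun _ _ h => h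
  · rintro x μ' ⟨rfl, rfl⟩
    refine Tr.step 1 hk (by decide) ?_
    simp only [safe_rules]
    refine ⟨hwr _ _ _ le_rfl (by omega), ?_⟩
    have hp := Safe.pushAll hes (c := x + 1) (by omega)
      (μ' := update μ' x (.num fp)) (fun y hy => update_of_ne (by omega) _ _)
      fun μ' y d hy hy' => hwr μ' y d (by omega) hy'
    refine Tr.bind (Tr.of_len (n₂.eval) hk le_rfl hp) ?_
    rintro _ μ₁ ⟨h2, h3⟩
    refine (h μ₁ h2 fun y hy => ?_).bind fun _ μ₂ h4 => ?_
    · rw [h3 y (by omega), update_of_ne (by omega)]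
    · refine Tr.of_len 1 hk (by decide) ?_
      simp only [safe_rules]
      exact h4
  · rw [show ((2 * n₁.eval : ℕ) : ℝ≥0∞) + (((2 * 1 : ℕ) : ℝ≥0∞) + (((2 * n₂.eval : ℕ) : ℝ≥0∞) +
      (e + ((2 * 1 : ℕ) : ℝ≥0∞)))) = ((2 * n₁.eval + 2 * 1 + 2 * n₂.eval + 2 * 1 : ℕ) : ℝ≥0∞) + e by
        push_cast; ring]
    gcongr
    omega

end

/-! ### Skew transposition: moving one sub-column into one bucket -/

/-- The innermost loop of `naiveSkewTranspose`: the remaining items of one sub-column that are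
smaller than the upper pivot of one bucket move to the next free slots of the bucket. -/
def moveRun (f fp : ℕ) : Prog Unit :=
  loop f (both (lt (deref (v (fp + 4) + v (fp + 10))) (deref (v (fp + 5) + v (fp + 10))))
      (lessAt (v (fp + 1) + deref (v (fp + 4) + v (fp + 10))) (v (fp + 7) + v (fp + 9)))) do
    moveAt (v (fp + 2) + deref (v (fp + 8) + v (fp + 9)))
      (v (fp + 1) + deref (v (fp + 4) + v (fp + 10)))
    put (v (fp + 8) + v (fp + 9)) (deref (v (fp + 8) + v (fp + 9)) + 1)
    put (v (fp + 4) + v (fp + 10)) (deref (v (fp + 4) + v (fp + 10)) + 1)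

theorem moveRun_safe {π : Policy α} {fp f src dst c e p q s t r₀ r₁ rm b₀ : ℕ} {D : ℕ → Cell α}
    {pc : Cell α} (h1 : μ (fp + 1) = .num src) (h2 : μ (fp + 2) = .num dst)
    (h4 : μ (fp + 4) = .num c) (h5 : μ (fp + 5) = .num e) (h7 : μ (fp + 7) = .num p)
    (h8 : μ (fp + 8) = .num q) (h9 : μ (fp + 9) = .num t) (h10 : μ (fp + 10) = .num s)
    (hc : μ (c + s) = .num r₀) (he : μ (e + s) = .num rm) (hp : μ (p + t) = pc)
    (hb : μ (q + t) = .num b₀) (hD : ∀ x < rm, μ (src + x) = D x)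
    (lce : c + s < e + s) (lep : e + s < p + t) (lpq : p + t < q + t) (lqf : q + t < fp)
    (ldc : dst + (b₀ + (r₁ - r₀)) ≤ c + s) (lsc : src + rm ≤ c + s)
    (lds : src + rm ≤ dst ∨ dst + (b₀ + (r₁ - r₀)) ≤ src) (h01 : r₀ ≤ r₁) (h1m : r₁ ≤ rm)
    (below : ∀ x, r₀ ≤ x → x < r₁ → (D x).lt pc = true) (ends : r₁ < rm → (D r₁).lt pc = false)
    (hrd : ∀ μ' a, (fp ≤ a ∧ a < fp + 11 ∨ a = c + s ∨ a = e + s ∨ a = p + t ∨ a = q + t) →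
      π.rd μ' a)
    (hrs : ∀ μ' x, μ' (c + s) = .num x → x < rm → π.rd μ' (src + x))
    (hwd : ∀ μ' x d, μ' (q + t) = .num (b₀ + x) → x < r₁ - r₀ → π.wr μ' (dst + (b₀ + x)) d)
    (hwb : ∀ μ' x, μ' (q + t) = .num (b₀ + x) → x < r₁ - r₀ →
      π.wr μ' (q + t) (.num (b₀ + x + 1)))
    (hwc : ∀ μ' x, μ' (c + s) = .num (r₀ + x) → x < r₁ - r₀ →
      π.wr μ' (c + s) (.num (r₀ + x + 1))) :
    Safe π (moveRun f fp) μ fun _ μ' => μ' (c + s) = .num r₁ ∧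
      μ' (q + t) = .num (b₀ + (r₁ - r₀)) ∧
      (∀ x < r₁ - r₀, μ' (dst + (b₀ + x)) = D (r₀ + x)) ∧
      ∀ a, a ≠ c + s → a ≠ q + t → (a < dst + b₀ ∨ dst + (b₀ + (r₁ - r₀)) ≤ a) → μ' a = μ a := by
  obtain ⟨Q, hQ⟩ : ∃ Q : Mem α → Prop, ∀ μ', Q μ' ↔ μ' (c + s) = .num r₁ ∧
      μ' (q + t) = .num (b₀ + (r₁ - r₀)) ∧
      (∀ x < r₁ - r₀, μ' (dst + (b₀ + x)) = D (r₀ + x)) ∧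
      ∀ a, a ≠ c + s → a ≠ q + t → (a < dst + b₀ ∨ dst + (b₀ + (r₁ - r₀)) ≤ a) → μ' a = μ a :=
    ⟨_, fun _ => Iff.rfl⟩
  suffices Safe π (moveRun f fp) μ fun _ => Q from this.mono fun _ _ => (hQ _).1
  unfold moveRun
  obtain ⟨I, hI⟩ : ∃ I : Mem α → Prop, ∀ μ', I μ' ↔ ∃ x ≤ r₁ - r₀, μ' (c + s) = .num (r₀ + x) ∧
      μ' (q + t) = .num (b₀ + x) ∧ (∀ y < x, μ' (dst + (b₀ + y)) = D (r₀ + y)) ∧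
      ∀ a, a ≠ c + s → a ≠ q + t → (a < dst + b₀ ∨ dst + (b₀ + x) ≤ a) → μ' a = μ a :=
    ⟨_, fun _ => Iff.rfl⟩
  refine Safe.loop I f ((hI _).2 ⟨0, by omega, hc, hb, by omega, fun _ _ _ _ => rfl⟩) ?_
  intro μ' hμ'
  obtain ⟨x, hx, g1, g2, g3, g4⟩ := (hI _).1 hμ'
  have e1 : μ' (fp + 1) = .num src := by rw [g4 _ (by omega) (by omega) (by omega), h1]
  have e2 : μ' (fp + 2) = .num dst := by rw [g4 _ (by omega) (by omega) (by omega), h2]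
  have e4 : μ' (fp + 4) = .num c := by rw [g4 _ (by omega) (by omega) (by omega), h4]
  have e5 : μ' (fp + 5) = .num e := by rw [g4 _ (by omega) (by omega) (by omega), h5]
  have e7 : μ' (fp + 7) = .num p := by rw [g4 _ (by omega) (by omega) (by omega), h7]
  have e8 : μ' (fp + 8) = .num q := by rw [g4 _ (by omega) (by omega) (by omega), h8]
  have e9 : μ' (fp + 9) = .num t := by rw [g4 _ (by omega) (by omega) (by omega), h9]
  have e10 : μ' (fp + 10) = .num s := by rw [g4 _ (by omega) (by omega) (by omega), h10]
  have ee : μ' (e + s) = .num rm := by rw [g4 _ (by omega) (by omega) (by omega), he]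
  have ep : μ' (p + t) = pc := by rw [g4 _ (by omega) (by omega) (by omega), hp]
  have final : x = r₁ - r₀ → Q μ' := by
    rintro rfl
    rw [show r₀ + (r₁ - r₀) = r₁ by omega] at g1
    exact (hQ _).2 ⟨g1, g2, g3, g4⟩
  have rdf : ∀ μ' a, fp ≤ a → a < fp + 11 → π.rd μ' a := fun μ' a h h' => hrd _ _ (by omega)
  have rdc : ∀ μ', π.rd μ' (c + s) := fun μ' => hrd _ _ (by omega)
  have rde : ∀ μ', π.rd μ' (e + s) := fun μ' => hrd _ _ (by omega)
  have rdp : ∀ μ', π.rd μ' (p + t) := fun μ' => hrd _ _ (by omega)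
  have rdq : ∀ μ', π.rd μ' (q + t) := fun μ' => hrd _ _ (by omega)
  by_cases hlt : r₀ + x < rm
  swap
  · simp only [safe_rules, cell_rules, e1, e4, e5, e7, e9, e10, g1, ee, hlt, decide_false,
      Bool.false_eq_true, if_false]
    constructorm* _ ∧ _
    any_goals first | exact rdf _ _ (by omega) (by omega) | exact rdc _ | exact rde _
    exact final (by omega)
  have eD : μ' (src + (r₀ + x)) = D (r₀ + x) := by
    rw [g4 _ (by omega) (by omega) (by omega), hD _ hlt]
  by_cases hd : (D (r₀ + x)).lt pc = true
  swap
  · have hx' : x = r₁ - r₀ := by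
      by_contra h
      exact hd (below _ (by omega) (by omega))
    simp only [safe_rules, cell_rules, e1, e4, e5, e7, e9, e10, g1, ee, hlt, decide_true, if_true,
      eD, ep, hd, Bool.false_eq_true, if_false]
    constructorm* _ ∧ _
    any_goals first | exact rdf _ _ (by omega) (by omega) | exact rdc _ | exact rde _ | exact rdp _
    any_goals exact hrs _ _ g1 hlt
    exact final hx'
  have hx' : x < r₁ - r₀ := by
    by_contra h
    have : r₀ + x = r₁ := by omega
    rw [this] at hd hlt
    simp [ends hlt] at hd
  have u : ∀ a d, fp ≤ a ∨ a = c + s ∨ a = q + t →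
      update μ' (dst + (b₀ + x)) d a = μ' a :=
    fun a d h => update_of_ne (by omega) _ _
  have u' : ∀ a d d', fp ≤ a ∨ a = c + s → update (update μ' (dst + (b₀ + x)) d)
      (q + t) d' a = μ' a :=
    fun a d d' h => by rw [update_of_ne (by omega), u _ _ (by omega)]
  have w2 := fun d => u (fp + 8) d (by omega)
  have w3 := fun d => u (fp + 9) d (by omega)
  have w6 := fun d => u (q + t) d (by omega)
  have z1 := fun d d' => u' (fp + 4) d d' (by omega)
  have z4 := fun d d' => u' (fp + 10) d d' (by omega)
  have z5 := fun d d' => u' (c + s) d d' (by omega)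
  simp only [safe_rules, cell_rules, e1, e2, e4, e5, e7, e8, e9, e10, g1, g2, ee, hlt, decide_true,
    if_true, eD, ep, hd, w2, w3, w6, z1, z4, z5]
  constructorm* _ ∧ _
  any_goals first | exact rdf _ _ (by omega) (by omega) | exact rdc _ | exact rde _
  any_goals first | exact rdp _ | exact rdq _
  any_goals exact hrs _ _ g1 hlt
  any_goals exact hwd _ _ _ g2 hx'
  any_goals exact hwb _ _ ((w6 _).trans g2) hx'
  any_goals exact hwc _ _ ((z5 _ _).trans g1) hx'
  refine (hI _).2 ⟨x + 1, by omega, by simp [add_assoc], ?_, fun y hy => ?_, fun a ha hb hc => ?_⟩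
  · rw [update_of_ne (by omega), update_self, add_assoc]
  · rw [update_of_ne (by omega), update_of_ne (by omega), update_apply]
    split_ifs with h
    · congr 2; omega
    · exact g3 y (by omega)
  · rw [update_of_ne ha, update_of_ne hb, update_of_ne (by omega),
      g4 a ha hb (by omega)]

/-! ### Skew transposition: the grid of sub-columns and buckets -/

/-- What a skew transposition works on: the addresses of the two item arrays and of the arrays
`col`, `colEnd`, `pivots` and `buc`; the number `m` of columns and of buckets; the index `r i j`
where the `i`-th sub-column meets the `j`-th bucket; the slot `b j i` where the items of the `i`-th
sub-column start in the `j`-th bucket; the items `D` of the source array and the upper pivots `piv`.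
A call handles the sub-columns `i₀, …, i₀ + l - 1` and the buckets `j₀, …, j₀ + w - 1`. -/
structure Grid (α : Type*) where
  src : ℕ
  dst : ℕ
  col : ℕ
  colEnd : ℕ
  pivots : ℕ
  buc : ℕ
  m : ℕ
  r : ℕ → ℕ → ℕ
  b : ℕ → ℕ → ℕ
  D : ℕ → Cell α
  piv : ℕ → Cell α

namespace Grid

/-- The arrays are disjoint and lie below `s`, the sub-columns are cut by the pivots at the indices
`r i j`, and the slots of the buckets follow each other. -/
structure Valid (G : Grid α) (n s : ℕ) : Prop where
  src_le : G.src + n ≤ G.col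
  dst_le : G.dst + n ≤ G.col
  disj : G.src + n ≤ G.dst ∨ G.dst + n ≤ G.src
  col_le : G.col + G.m ≤ G.colEnd
  colEnd_le : G.colEnd + G.m ≤ G.pivots
  pivots_le : G.pivots + G.m ≤ G.buc
  buc_le : G.buc + G.m ≤ s
  r_le : ∀ i < G.m, G.r i G.m ≤ n
  r_mono : ∀ i < G.m, ∀ j j', j ≤ j' → j' ≤ G.m → G.r i j ≤ G.r i j'
  below : ∀ i < G.m, ∀ j < G.m, ∀ x, G.r i j ≤ x → x < G.r i (j + 1) →
    (G.D x).lt (G.piv j) = true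
  ends : ∀ i < G.m, ∀ j < G.m, G.r i (j + 1) < G.r i G.m →
    (G.D (G.r i (j + 1))).lt (G.piv j) = false
  b_succ : ∀ i < G.m, ∀ j < G.m, G.b j (i + 1) = G.b j i + (G.r i (j + 1) - G.r i j)
  b_le : ∀ j < G.m, G.b j G.m ≤ n
  b_next : ∀ j, j + 1 < G.m → G.b j G.m ≤ G.b (j + 1) 0

/-- The part of the memory that the skew transposition reads and never changes. -/
structure Static (G : Grid α) (n : ℕ) (μ : Mem α) : Prop where
  colEnd : ∀ i < G.m, μ (G.colEnd + i) = .num (G.r i G.m)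
  pivots : ∀ j < G.m, μ (G.pivots + j) = G.piv j
  src : ∀ x < n, μ (G.src + x) = G.D x

/-- The parameters of a call for the part `i₀, l, j₀, w` of the grid, in the frame at `fp`. -/
structure Args (G : Grid α) (i₀ l j₀ w fp : ℕ) (μ : Mem α) : Prop where
  src : μ (fp + 1) = .num G.src
  dst : μ (fp + 2) = .num G.dst
  l : μ (fp + 3) = .num l
  col : μ (fp + 4) = .num (G.col + i₀)
  colEnd : μ (fp + 5) = .num (G.colEnd + i₀)
  w : μ (fp + 6) = .num w
  pivots : μ (fp + 7) = .num (G.pivots + j₀)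
  buc : μ (fp + 8) = .num (G.buc + j₀)

/-- The pointers before the call: the buckets before `j₀` have been served for these sub-columns,
and the sub-columns before `i₀` for these buckets. -/
structure Start (G : Grid α) (i₀ l j₀ w : ℕ) (μ : Mem α) : Prop where
  col : ∀ i, i₀ ≤ i → i < i₀ + l → μ (G.col + i) = .num (G.r i j₀)
  buc : ∀ j, j₀ ≤ j → j < j₀ + w → μ (G.buc + j) = .num (G.b j i₀)

/-- The pointers after the call, and the items in their slots. -/
structure Finish (G : Grid α) (i₀ l j₀ w : ℕ) (μ : Mem α) : Prop where
  col : ∀ i, i₀ ≤ i → i < i₀ + l → μ (G.col + i) = .num (G.r i (j₀ + w))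
  buc : ∀ j, j₀ ≤ j → j < j₀ + w → μ (G.buc + j) = .num (G.b j (i₀ + l))
  slot : ∀ i, i₀ ≤ i → i < i₀ + l → ∀ j, j₀ ≤ j → j < j₀ + w → ∀ x < G.r i (j + 1) - G.r i j,
    μ (G.dst + (G.b j i + x)) = G.D (G.r i j + x)

/-- The accesses of one call. Every pointer into an item array moves forward cell by cell within its
part of the grid, and items are accessed under such pointers only; this is the form that
`Cost.of_pointers` asks for. The stack is used from `fp` to `fp + S - 1`. -/
def policy (G : Grid α) (i₀ l j₀ w fp S : ℕ) : Policy α where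
  rd μ a := fp ≤ a ∧ a < fp + S ∨
    (∃ i, i₀ ≤ i ∧ i < i₀ + l ∧ (a = G.col + i ∨ a = G.colEnd + i ∨
      a = G.src + (μ (G.col + i)).toNat ∧ (μ (G.col + i)).toNat < G.r i G.m)) ∨
    ∃ j, j₀ ≤ j ∧ j < j₀ + w ∧ (a = G.pivots + j ∨ a = G.buc + j)
  wr μ a c := fp ≤ a ∧ a < fp + S ∨
    (∃ i, i₀ ≤ i ∧ i < i₀ + l ∧ a = G.col + i ∧ c = .num ((μ a).toNat + 1) ∧
      (μ a).toNat < G.r i (j₀ + w)) ∨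
    ∃ j, j₀ ≤ j ∧ j < j₀ + w ∧ (a = G.buc + j ∧ c = .num ((μ a).toNat + 1) ∧
        (μ a).toNat < G.b j (i₀ + l) ∨
      a = G.dst + (μ (G.buc + j)).toNat ∧ G.b j i₀ ≤ (μ (G.buc + j)).toNat ∧
        (μ (G.buc + j)).toNat < G.b j (i₀ + l))

/-- The cells that a call may write. -/
def area (G : Grid α) (i₀ l j₀ w fp S : ℕ) : Set ℕ :=
  {a | fp ≤ a ∧ a < fp + S ∨ G.col + i₀ ≤ a ∧ a < G.col + (i₀ + l) ∨
    G.buc + j₀ ≤ a ∧ a < G.buc + (j₀ + w) ∨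
    ∃ j y, j₀ ≤ j ∧ j < j₀ + w ∧ G.b j i₀ ≤ y ∧ y < G.b j (i₀ + l) ∧ a = G.dst + y}

variable {G : Grid α} {n s i₀ l j₀ w fp S : ℕ}

theorem Valid.layout (hG : G.Valid n s) : G.src + n ≤ G.col ∧ G.dst + n ≤ G.col ∧
    G.col + G.m ≤ G.colEnd ∧ G.colEnd + G.m ≤ G.pivots ∧ G.pivots + G.m ≤ G.buc ∧
    G.buc + G.m ≤ s :=
  ⟨hG.src_le, hG.dst_le, hG.col_le, hG.colEnd_le, hG.pivots_le, hG.buc_le⟩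

theorem Valid.b_mono (hG : G.Valid n s) {j i i' : ℕ} (hj : j < G.m) (h : i ≤ i') (h' : i' ≤ G.m) :
    G.b j i ≤ G.b j i' := by
  induction i', h using Nat.le_induction with
  | base => exact le_rfl
  | succ i' h ih => exact (ih (by omega)).trans (by rw [hG.b_succ i' (by omega) j hj]; omega)

theorem Valid.b_sep (hG : G.Valid n s) {j j' : ℕ} (h : j < j') (h' : j' < G.m) :
    G.b j G.m ≤ G.b j' 0 := by
  induction j', h using Nat.le_induction with
  | base => exact hG.b_next j h'
  | succ j' h ih =>
    exact (ih (by omega)).trans ((hG.b_mono (by omega) (Nat.zero_le _) le_rfl).trans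
      (hG.b_next j' h'))

theorem Valid.slot_ne (hG : G.Valid n s) {i j i' l' j' x y : ℕ} (hi : i < G.m) (hj : j < G.m)
    (hx : x < G.r i (j + 1) - G.r i j) (hl : i' + l' ≤ G.m) (hj' : j' < G.m)
    (hne : j' ≠ j ∨ i < i' ∨ i' + l' ≤ i) (hy : G.b j' i' ≤ y)
    (hy' : y < G.b j' (i' + l')) : G.b j i + x ≠ y := by
  have h1 := hG.b_succ i hi j hj
  have h2 := hG.b_mono hj (Nat.zero_le i) hi.le
  have h3 := hG.b_mono hj (show i + 1 ≤ G.m by omega) le_rfl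
  have h4 := hG.b_mono hj' (Nat.zero_le i') (by omega)
  have h5 := hG.b_mono hj' (show i' + l' ≤ G.m by omega) le_rfl
  rcases lt_trichotomy j j' with h | rfl | h
  · have := hG.b_sep h hj'
    omega
  · rcases hne with h | h | h
    · exact absurd rfl h
    · have := hG.b_mono hj (show i + 1 ≤ i' by omega) (by omega)
      omega
    · have := hG.b_mono hj h hi.le
      omega
  · have := hG.b_sep h hj
    omega

theorem Valid.slot_lt (hG : G.Valid n s) {j y i : ℕ} (hj : j < G.m) (hi : i ≤ G.m)
    (hy : y < G.b j i) : G.dst + y < G.col := by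
  have h5 := hG.b_mono hj hi le_rfl
  have := hG.b_le j hj
  have := hG.dst_le
  omega

theorem Valid.notMem_area (hG : G.Valid n s) (hl : i₀ + l ≤ G.m) (hw : j₀ + w ≤ G.m) {a : ℕ}
    (ha : G.col ≤ a) (h1 : a < fp ∨ fp + S ≤ a) (h2 : a < G.col + i₀ ∨ G.col + (i₀ + l) ≤ a)
    (h3 : a < G.buc + j₀ ∨ G.buc + (j₀ + w) ≤ a) : a ∉ G.area i₀ l j₀ w fp S := by
  rintro (h | h | h | ⟨j, y, h4, h5, h6, h7, rfl⟩)
  any_goals omega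
  have := hG.slot_lt (show j < G.m by omega) hl h7
  omega

theorem Valid.slot_notMem (hG : G.Valid n s) (hs : s ≤ fp) (hl : i₀ + l ≤ G.m) (hw : j₀ + w ≤ G.m)
    {i j x : ℕ} (hi : i < G.m) (hj : j < G.m) (hx : x < G.r i (j + 1) - G.r i j)
    (hne : i < i₀ ∨ i₀ + l ≤ i ∨ j < j₀ ∨ j₀ + w ≤ j) :
    G.dst + (G.b j i + x) ∉ G.area i₀ l j₀ w fp S := by
  have h1 := hG.b_succ i hi j hj
  have h2 := hG.slot_lt hj (show i + 1 ≤ G.m by omega) (show G.b j i + x < _ by omega)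
  have layout := hG.layout
  rintro (h | h | h | ⟨j', y, h4, h5, h6, h7, h⟩)
  any_goals omega
  exact hG.slot_ne hi hj hx hl (show j' < G.m by omega) (by omega) h6 h7 (by omega)

theorem Valid.static (hG : G.Valid n s) (hs : s ≤ fp) (hl : i₀ + l ≤ G.m) (hw : j₀ + w ≤ G.m)
    {μ μ' : Mem α} (h : G.Static n μ) (hμ : ∀ a ∉ G.area i₀ l j₀ w fp S, μ' a = μ a) :
    G.Static n μ' := by
  have layout := hG.layout
  refine ⟨fun i hi => ?_, fun j hj => ?_, fun x hx => ?_⟩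
  · rw [hμ _ (hG.notMem_area hl hw (by omega) (by omega) (by omega) (by omega)), h.colEnd i hi]
  · rw [hμ _ (hG.notMem_area hl hw (by omega) (by omega) (by omega) (by omega)), h.pivots j hj]
  · rw [hμ _ ?_, h.src x hx]
    have := hG.src_le
    rintro (h | h | h | ⟨j', y, h4, h5, h6, h7, h⟩)
    any_goals omega
    have h8 := hG.b_mono (show j' < G.m by omega) hl le_rfl
    have := hG.b_le j' (by omega)
    have := hG.disj
    omega

theorem policy_frame {α : Type*} {G : Grid α} {μ : Mem α} {a : ℕ} {c : Cell α}
    (h : (G.policy i₀ l j₀ w fp S).wr μ a c) :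
    a ∈ G.area i₀ l j₀ w fp S := by
  rcases h with h | ⟨i, h1, h2, rfl, _⟩ | ⟨j, h1, h2, ⟨rfl, _⟩ | ⟨h3, h4, h5⟩⟩
  · exact Or.inl h
  · exact Or.inr (Or.inl (by omega))
  · exact Or.inr (Or.inr (Or.inl (by omega)))
  · exact Or.inr (Or.inr (Or.inr ⟨j, _, h1, h2, h4, h5, h3⟩))

theorem naive_eq (f fp : ℕ) : naiveSkewTranspose f fp = (do
    assign (fp + 9) 0
    loop f (lt (v (fp + 9)) (v (fp + 6))) do
      assign (fp + 10) 0
      loop f (lt (v (fp + 10)) (v (fp + 3))) do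
        moveRun f fp
        assign (fp + 10) (v (fp + 10) + 1)
      assign (fp + 9) (v (fp + 9) + 1)) := by
  rfl

/-- The invariant of the loop over the sub-columns of `naiveSkewTranspose`: `t` buckets are
complete, and the next one has received the items of `s` sub-columns. -/
structure Mid (G : Grid α) (i₀ l j₀ w t s fp : ℕ) (μ₀ μ : Mem α) : Prop where
  frame : ∀ a ∉ G.area i₀ l j₀ w (fp + 9) 2, μ a = μ₀ a
  bucket : μ (fp + 9) = .num t
  column : μ (fp + 10) = .num s
  s_le : s ≤ l
  col_lt : ∀ i, i₀ ≤ i → i < i₀ + s → μ (G.col + i) = .num (G.r i (j₀ + t + 1))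
  col_ge : ∀ i, i₀ + s ≤ i → i < i₀ + l → μ (G.col + i) = .num (G.r i (j₀ + t))
  buc_lt : ∀ j, j₀ ≤ j → j < j₀ + t → μ (G.buc + j) = .num (G.b j (i₀ + l))
  buc_eq : μ (G.buc + (j₀ + t)) = .num (G.b (j₀ + t) (i₀ + s))
  buc_gt : ∀ j, j₀ + t < j → j < j₀ + w → μ (G.buc + j) = .num (G.b j i₀)
  slot : ∀ i, i₀ ≤ i → i < i₀ + l → ∀ j, j₀ ≤ j → (j < j₀ + t ∨ j = j₀ + t ∧ i < i₀ + s) →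
    ∀ x < G.r i (j + 1) - G.r i j, μ (G.dst + (G.b j i + x)) = G.D (G.r i j + x)

/-- The invariant of the loop over the buckets of `naiveSkewTranspose`: `t` buckets are complete. -/
structure Outer (G : Grid α) (i₀ l j₀ w t fp : ℕ) (μ₀ μ : Mem α) : Prop where
  frame : ∀ a ∉ G.area i₀ l j₀ w (fp + 9) 2, μ a = μ₀ a
  bucket : μ (fp + 9) = .num t
  t_le : t ≤ w
  col : ∀ i, i₀ ≤ i → i < i₀ + l → μ (G.col + i) = .num (G.r i (j₀ + t))
  buc_lt : ∀ j, j₀ ≤ j → j < j₀ + t → μ (G.buc + j) = .num (G.b j (i₀ + l))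
  buc_ge : ∀ j, j₀ + t ≤ j → j < j₀ + w → μ (G.buc + j) = .num (G.b j i₀)
  slot : ∀ i, i₀ ≤ i → i < i₀ + l → ∀ j, j₀ ≤ j → j < j₀ + t →
    ∀ x < G.r i (j + 1) - G.r i j, μ (G.dst + (G.b j i + x)) = G.D (G.r i j + x)

theorem Mid.args {t s₁ : ℕ} {μ₀ μ : Mem α} (h : G.Mid i₀ l j₀ w t s₁ fp μ₀ μ) (hG : G.Valid n s)
    (hs : s ≤ fp) (hl : i₀ + l ≤ G.m) (hw : j₀ + w ≤ G.m) {a : ℕ} (ha : fp < a)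
    (ha' : a < fp + 9) : μ a = μ₀ a := by
  have layout := hG.layout
  exact h.frame _ (hG.notMem_area hl hw (by omega) (by omega) (by omega) (by omega))

theorem Outer.args {t : ℕ} {μ₀ μ : Mem α} (h : G.Outer i₀ l j₀ w t fp μ₀ μ) (hG : G.Valid n s)
    (hs : s ≤ fp) (hl : i₀ + l ≤ G.m) (hw : j₀ + w ≤ G.m) {a : ℕ} (ha : fp < a)
    (ha' : a < fp + 9) : μ a = μ₀ a := by
  have layout := hG.layout
  exact h.frame _ (hG.notMem_area hl hw (by omega) (by omega) (by omega) (by omega))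

theorem mid_step (hG : G.Valid n s) (hs : s ≤ fp) (hl : i₀ + l ≤ G.m) (hw : j₀ + w ≤ G.m)
    (hst : G.Static n μ) (ha : G.Args i₀ l j₀ w fp μ) {t s₁ f : ℕ} (ht : t < w) {μ' : Mem α}
    (h : G.Mid i₀ l j₀ w t s₁ fp μ μ') (hs₁ : s₁ < l) :
    Safe (G.policy i₀ l j₀ w fp 11) (moveRun f fp >>= fun _ => assign (fp + 10) (v (fp + 10) + 1))
      μ' fun _ μ'' => G.Mid i₀ l j₀ w t (s₁ + 1) fp μ μ'' := by
  have layout := hG.layout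
  have l7 := hG.disj
  have hst' : G.Static n μ' := hG.static (show s ≤ fp + 9 by omega) hl hw hst h.frame
  have hi : i₀ + s₁ < G.m := by omega
  have hj : j₀ + t < G.m := by omega
  have b1 := hG.b_succ _ hi _ hj
  have b2 := hG.b_mono hj (show i₀ ≤ i₀ + s₁ by omega) (by omega)
  have b3 := hG.b_mono hj (show i₀ + s₁ + 1 ≤ i₀ + l by omega) (by omega)
  have b4 := hG.b_mono hj (show i₀ + l ≤ G.m by omega) le_rfl
  have b5 := hG.b_le _ hj
  have r1 := hG.r_mono _ hi (j₀ + t) (j₀ + t + 1) (by omega) (by omega)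
  have r2 := hG.r_mono _ hi (j₀ + t + 1) (j₀ + w) (by omega) (by omega)
  have r3 := hG.r_mono _ hi (j₀ + w) G.m (by omega) (by omega)
  have r4 := hG.r_le _ hi
  have A := fun {a} => h.args hG hs hl hw (a := a)
  rw [safe_bind]
  refine (moveRun_safe (r₀ := G.r (i₀ + s₁) (j₀ + t)) (r₁ := G.r (i₀ + s₁) (j₀ + t + 1))
    (rm := G.r (i₀ + s₁) G.m) (b₀ := G.b (j₀ + t) (i₀ + s₁)) (D := G.D) (pc := G.piv (j₀ + t))
    ((A (by omega) (by omega)).trans ha.src) ((A (by omega) (by omega)).trans ha.dst)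
    ((A (by omega) (by omega)).trans ha.col) ((A (by omega) (by omega)).trans ha.colEnd)
    ((A (by omega) (by omega)).trans ha.pivots) ((A (by omega) (by omega)).trans ha.buc)
    h.bucket h.column
    (by rw [add_assoc]; exact h.col_ge _ le_rfl (by omega))
    (by rw [add_assoc]; exact hst'.colEnd _ hi)
    (by rw [add_assoc]; exact hst'.pivots _ hj)
    (by rw [add_assoc]; exact h.buc_eq)
    (fun x hx => hst'.src x (by omega)) (by omega) (by omega) (by omega) (by omega) (by omega)
    (by omega) (by omega) r1 (by omega) (hG.below _ hi _ hj) (hG.ends _ hi _ hj)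
    ?_ ?_ ?_ ?_ ?_).mono ?_
  · rintro μ' a (h | h | h | h | h)
    · exact Or.inl h
    · exact Or.inr (Or.inl ⟨i₀ + s₁, by omega, by omega, Or.inl (by omega)⟩)
    · exact Or.inr (Or.inl ⟨i₀ + s₁, by omega, by omega, Or.inr (Or.inl (by omega))⟩)
    · exact Or.inr (Or.inr ⟨j₀ + t, by omega, by omega, Or.inl (by omega)⟩)
    · exact Or.inr (Or.inr ⟨j₀ + t, by omega, by omega, Or.inr (by omega)⟩)
  · intro μ' x h hx
    refine Or.inr (Or.inl ⟨i₀ + s₁, by omega, by omega, Or.inr (Or.inr ?_)⟩)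
    rw [← add_assoc, h]
    exact ⟨rfl, hx⟩
  · intro μ' x d h hx
    refine Or.inr (Or.inr ⟨j₀ + t, by omega, by omega, Or.inr ?_⟩)
    rw [← add_assoc G.buc, h]
    exact ⟨rfl, by rw [toNat_num]; omega, by rw [toNat_num]; omega⟩
  · intro μ' x h hx
    refine Or.inr (Or.inr ⟨j₀ + t, by omega, by omega, Or.inl ?_⟩)
    rw [h]
    exact ⟨by omega, rfl, by rw [toNat_num]; omega⟩
  · intro μ' x h hx
    refine Or.inr (Or.inl ⟨i₀ + s₁, by omega, by omega, by omega, ?_⟩)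
    rw [h]
    exact ⟨rfl, by rw [toNat_num]; omega⟩
  rintro _ μ₂ ⟨g1, g2, g3, g4⟩
  rw [← b1] at g2
  rw [add_assoc] at g1 g2
  have e10 : μ₂ (fp + 10) = .num s₁ := by
    rw [g4 _ (by omega) (by omega) (by omega), h.column]
  simp only [safe_rules, e10, cell_rules]
  refine ⟨Or.inl ⟨by omega, by omega⟩, Or.inl ⟨by omega, by omega⟩, ?_⟩
  have u : ∀ a d, a ≠ fp + 10 → update μ₂ (fp + 10) d a = μ₂ a := fun a d h =>
    update_of_ne h _ _
  constructor
  · intro a ha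
    have hx : ¬ (fp + 9 ≤ a ∧ a < fp + 9 + 2) := fun h => ha (Or.inl h)
    have hy : ¬ (G.col + i₀ ≤ a ∧ a < G.col + (i₀ + l)) := fun h => ha (Or.inr (Or.inl h))
    have hz : ¬ (G.buc + j₀ ≤ a ∧ a < G.buc + (j₀ + w)) :=
      fun h => ha (Or.inr (Or.inr (Or.inl h)))
    rw [u _ _ (by omega), g4 a (by omega) (by omega), h.frame a ha]
    by_contra hc
    exact ha (Or.inr (Or.inr (Or.inr ⟨j₀ + t, a - G.dst, by omega, by omega, by omega, by omega,
      by omega⟩)))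
  · rw [u _ _ (by omega), g4 _ (by omega) (by omega) (by omega), h.bucket]
  · rw [update_self]
  · omega
  · intro i hi1 hi2
    rw [u _ _ (by omega)]
    rcases (show i ≤ i₀ + s₁ by omega).eq_or_lt with rfl | h'
    · exact g1
    · rw [g4 _ (by omega) (by omega) (by omega)]
      exact h.col_lt i hi1 h'
  · intro i hi1 hi2
    rw [u _ _ (by omega), g4 _ (by omega) (by omega) (by omega)]
    exact h.col_ge i (by omega) hi2
  · intro j hj1 hj2
    rw [u _ _ (by omega), g4 _ (by omega) (by omega) (by omega)]
    exact h.buc_lt j hj1 hj2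
  · rw [u _ _ (by omega), g2]
    rfl
  · intro j hj1 hj2
    rw [u _ _ (by omega), g4 _ (by omega) (by omega) (by omega)]
    exact h.buc_gt j hj1 hj2
  · intro i hi1 hi2 j hj1 hj2 x hx
    have c1 := hG.b_succ i (by omega) j (by omega)
    have c2 := hG.slot_lt (show j < G.m by omega) (show i + 1 ≤ G.m by omega)
      (show G.b j i + x < _ by omega)
    rw [u _ _ (by omega)]
    by_cases hij : j = j₀ + t ∧ i = i₀ + s₁
    · obtain ⟨rfl, rfl⟩ := hij
      exact g3 x hx
    · rw [g4 _ (by omega) (by omega)]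
      · exact h.slot i hi1 hi2 j hj1 (by omega) x hx
      · have := fun hy => hG.slot_ne (show i < G.m by omega) (show j < G.m by omega) hx
          (i' := i₀ + s₁) (l' := 1) (j' := j₀ + t) (y := G.b j i + x) (by omega) hj (by omega) hy
        by_contra hc
        exact this (by omega) (by omega) rfl

theorem naive_safe (hG : G.Valid n s) (hs : s ≤ fp) (hl : i₀ + l ≤ G.m) (hw : j₀ + w ≤ G.m)
    (hst : G.Static n μ) (ha : G.Args i₀ l j₀ w fp μ) (h0 : G.Start i₀ l j₀ w μ) (f : ℕ) :
    Safe (G.policy i₀ l j₀ w fp 11) (naiveSkewTranspose f fp) μ fun _ => G.Finish i₀ l j₀ w := by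
  have l2 := hG.dst_le
  have l3 := hG.col_le
  have l4 := hG.colEnd_le
  have l5 := hG.pivots_le
  have l6 := hG.buc_le
  have stack : ∀ (μ : Mem α) a, fp ≤ a → a < fp + 11 → (G.policy i₀ l j₀ w fp 11).rd μ a :=
    fun _ _ h h' => Or.inl ⟨h, h'⟩
  have stack' : ∀ (μ : Mem α) a c, fp ≤ a → a < fp + 11 → (G.policy i₀ l j₀ w fp 11).wr μ a c :=
    fun _ _ _ h h' => Or.inl ⟨h, h'⟩
  rw [naive_eq]
  simp only [safe_rules]
  refine ⟨stack' _ _ _ (by omega) (by omega), Safe.loop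
    (fun μ' => ∃ t, G.Outer i₀ l j₀ w t fp μ μ') f ⟨0, ?_⟩ ?_⟩
  · have u : ∀ a d, a ≠ fp + 9 → update μ (fp + 9) d a = μ a := fun a d h =>
      update_of_ne h _ _
    refine ⟨fun a ha => ?_, by simp, by omega, fun i h1 h2 => ?_, fun j h1 h2 => ?_,
      fun j h1 h2 => ?_, fun i h1 h2 j h3 h4 => ?_⟩
    · rw [u]
      rintro rfl
      exact ha (Or.inl (by omega))
    · rw [u _ _ (by omega)]
      exact h0.col i h1 h2
    · omega
    · rw [u _ _ (by omega)]
      exact h0.buc j h1 h2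
    · omega
  rintro μ' ⟨t, ht⟩
  have e6 : μ' (fp + 6) = .num w := (ht.args hG hs hl hw (by omega) (by omega)).trans ha.w
  have e9 := ht.bucket
  by_cases htw : t < w
  swap
  · simp only [safe_rules, e6, e9, cell_rules, htw, decide_false, Bool.false_eq_true, if_false]
    obtain rfl : t = w := by have := ht.t_le; omega
    exact ⟨stack _ _ (by omega) (by omega), stack _ _ (by omega) (by omega), ht.col, ht.buc_lt,
      ht.slot⟩
  simp only [safe_rules, e6, e9, cell_rules, htw, decide_true, if_true]
  refine ⟨stack _ _ (by omega) (by omega), stack _ _ (by omega) (by omega),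
    stack' _ _ _ (by omega) (by omega), (Safe.loop (Q := G.Mid i₀ l j₀ w t l fp μ)
    (fun μ' => ∃ s₁, G.Mid i₀ l j₀ w t s₁ fp μ μ') f ⟨0, ?_⟩ ?_).mono ?_⟩
  · have u : ∀ a d, a ≠ fp + 10 → update μ' (fp + 10) d a = μ' a := fun a d h =>
      update_of_ne h _ _
    refine ⟨fun a ha => ?_, ?_, by simp, by omega, fun i h1 h2 => ?_, fun i h1 h2 => ?_,
      fun j h1 h2 => ?_, ?_, fun j h1 h2 => ?_, fun i h1 h2 j h3 h4 x hx => ?_⟩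
    · rw [u]
      · exact ht.frame a ha
      rintro rfl
      exact ha (Or.inl (by omega))
    · rw [u _ _ (by omega), e9]
    · omega
    · rw [u _ _ (by omega)]
      exact ht.col i h1 h2
    · rw [u _ _ (by omega)]
      exact ht.buc_lt j h1 h2
    · rw [u _ _ (by omega)]
      exact ht.buc_ge _ (by omega) (by omega)
    · rw [u _ _ (by omega)]
      exact ht.buc_ge _ (by omega) (by omega)
    · have c1 := hG.b_succ i (by omega) j (by omega)
      have c2 := hG.slot_lt (show j < G.m by omega) (show i + 1 ≤ G.m by omega)
        (show G.b j i + x < _ by omega)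
      rw [u _ _ (by omega)]
      exact ht.slot i h1 h2 j h3 (by omega) x hx
  · rintro μ' ⟨s₁, hs₁⟩
    have e3 : μ' (fp + 3) = .num l := (hs₁.args hG hs hl hw (by omega) (by omega)).trans ha.l
    have e10 := hs₁.column
    by_cases hlt : s₁ < l
    · have := mid_step hG hs hl hw hst ha (f := f) htw hs₁ hlt
      rw [safe_bind] at this
      simp only [safe_rules, e3, e10, cell_rules, hlt, decide_true, if_true]
      refine ⟨stack _ _ (by omega) (by omega), stack _ _ (by omega) (by omega), this.mono ?_⟩
      intro _ μ'' h
      simp only [safe_rules] at h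
      exact ⟨h.1, h.2.1, _, h.2.2⟩
    · simp only [safe_rules, e3, e10, cell_rules, hlt, decide_false, Bool.false_eq_true, if_false]
      obtain rfl : s₁ = l := by have := hs₁.s_le; omega
      exact ⟨stack _ _ (by omega) (by omega), stack _ _ (by omega) (by omega), hs₁⟩
  · rintro _ μ₂ h
    have e9 := h.bucket
    simp only [e9, cell_rules]
    refine ⟨stack _ _ (by omega) (by omega), stack' _ _ _ (by omega) (by omega), t + 1, ?_⟩
    have u : ∀ a d, a ≠ fp + 9 → update μ₂ (fp + 9) d a = μ₂ a := fun a d h =>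
      update_of_ne h _ _
    refine ⟨fun a ha => ?_, by simp, by omega, fun i h1 h2 => ?_, fun j h1 h2 => ?_,
      fun j h1 h2 => ?_, fun i h1 h2 j h3 h4 x hx => ?_⟩
    · rw [u]
      · exact h.frame a ha
      rintro rfl
      exact ha (Or.inl (by omega))
    · rw [u _ _ (by omega)]
      exact h.col_lt i h1 h2
    · rw [u _ _ (by omega)]
      rcases (show j ≤ j₀ + t by omega).eq_or_lt with rfl | h'
      · exact h.buc_eq
      · exact h.buc_lt j h1 h'
    · rw [u _ _ (by omega)]
      exact h.buc_gt j (by omega) h2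
    · have c1 := hG.b_succ i (by omega) j (by omega)
      have c2 := hG.slot_lt (show j < G.m by omega) (show i + 1 ≤ G.m by omega)
        (show G.b j i + x < _ by omega)
      rw [u _ _ (by omega)]
      exact h.slot i h1 h2 j h3 (by omega) x hx

end Grid

theorem Tr.imp {π π' : Policy α} {e : ℝ≥0∞} {p : Prog ρ} {Q : ρ → Mem α → Prop}
    (h : Tr k B π e p μ Q) (hrd : ∀ μ a, π.rd μ a → π'.rd μ a)
    (hwr : ∀ μ a c, π.wr μ a c → π'.wr μ a c) : Tr k B π' e p μ Q :=
  ⟨(h.safe.weaken (J := fun _ => True) trivial (fun _ _ _ h => hrd _ _ h)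
    fun _ _ _ _ h => ⟨hwr _ _ _ h, trivial⟩).mono fun _ _ h => h.1, h.cost⟩

theorem Tr.frame {π : Policy α} {e : ℝ≥0∞} {p : Prog ρ} {Q : ρ → Mem α → Prop} {W : Set ℕ}
    (h : Tr k B π e p μ Q) (hW : ∀ μ a c, π.wr μ a c → a ∈ W) :
    Tr k B π e p μ fun x μ' => Q x μ' ∧ ∀ a ∉ W, μ' a = μ a :=
  ⟨h.safe.frame hW, (h.cost.and (h.safe.frame hW)).mono le_rfl fun _ _ h => h.2⟩

namespace Grid

variable {G : Grid α} {n s i₀ l j₀ w fp S : ℕ}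

theorem policy_mono (hG : G.Valid n s) {i₁ l₁ j₁ w₁ fp₁ S₁ : ℕ} (hl : i₀ + l ≤ G.m)
    (hw : j₀ + w ≤ G.m) (h1 : i₀ ≤ i₁) (h2 : i₁ + l₁ ≤ i₀ + l) (h3 : j₀ ≤ j₁)
    (h4 : j₁ + w₁ ≤ j₀ + w) (h5 : fp ≤ fp₁) (h6 : fp₁ + S₁ ≤ fp + S) :
    (∀ (μ : Mem α) a, (G.policy i₁ l₁ j₁ w₁ fp₁ S₁).rd μ a → (G.policy i₀ l j₀ w fp S).rd μ a) ∧
    ∀ (μ : Mem α) a c, (G.policy i₁ l₁ j₁ w₁ fp₁ S₁).wr μ a c →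
      (G.policy i₀ l j₀ w fp S).wr μ a c := by
  constructor
  · rintro μ a (⟨h, h'⟩ | ⟨i, h, h', h''⟩ | ⟨j, h, h', h''⟩)
    · exact Or.inl ⟨by omega, by omega⟩
    · exact Or.inr (Or.inl ⟨i, by omega, by omega, h''⟩)
    · exact Or.inr (Or.inr ⟨j, by omega, by omega, h''⟩)
  · rintro μ a c (⟨h, h'⟩ | ⟨i, h, h', rfl, rfl, g⟩ | ⟨j, h, h', ⟨rfl, rfl, g⟩ | ⟨rfl, g, g'⟩⟩)
    · exact Or.inl ⟨by omega, by omega⟩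
    · exact Or.inr (Or.inl ⟨i, by omega, by omega, rfl, rfl,
        g.trans_le (hG.r_mono i (by omega) _ _ h4 hw)⟩)
    · exact Or.inr (Or.inr ⟨j, by omega, by omega, Or.inl ⟨rfl, rfl,
        g.trans_le (hG.b_mono (by omega) h2 hl)⟩⟩)
    · exact Or.inr (Or.inr ⟨j, by omega, by omega, Or.inr ⟨rfl,
        (hG.b_mono (by omega) h1 (by omega)).trans g,
        g'.trans_le (hG.b_mono (by omega) h2 hl)⟩⟩)

/-- `p` carries out the part `i₀, l, j₀, w` of the skew transposition at cost `e`, with `S` cells of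
stack. -/
def Spec (G : Grid α) (n k B : ℕ) (e : ℝ≥0∞) (p : ℕ → Prog Unit) (i₀ l j₀ w fp S : ℕ) : Prop :=
  ∀ μ : Mem α, G.Static n μ → G.Args i₀ l j₀ w fp μ → G.Start i₀ l j₀ w μ →
    Tr k B (G.policy i₀ l j₀ w fp S) e (p fp) μ fun _ => G.Finish i₀ l j₀ w

theorem Spec.mono {e e' : ℝ≥0∞} {p : ℕ → Prog Unit} (h : G.Spec n k B e p i₀ l j₀ w fp S)
    (he : e ≤ e') : G.Spec n k B e' p i₀ l j₀ w fp S :=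
  fun μ h1 h2 h3 => (h μ h1 h2 h3).mono he fun _ _ h => h

theorem call_tr (hk : 2 ≤ k) (hG : G.Valid n s) (hs : s ≤ fp) (hl : i₀ + l ≤ G.m)
    (hw : j₀ + w ≤ G.m) {i₁ l₁ j₁ w₁ S₁ : ℕ} (h1 : i₀ ≤ i₁) (h2 : i₁ + l₁ ≤ i₀ + l)
    (h3 : j₀ ≤ j₁) (h4 : j₁ + w₁ ≤ j₀ + w) (hS : 11 + S₁ ≤ S) (hS' : 9 ≤ S₁)
    {p : ℕ → Prog Unit} {e : ℝ≥0∞} (hspec : G.Spec n k B e p i₁ l₁ j₁ w₁ (fp + 11) S₁)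
    {es : List (Prog ℕ)} {n₂ : Len} [∀ t, HasLen (pushAll (t + 1) es) n₂]
    (hN : n₂.eval ≤ 40)
    (hes : List.Forall₂ (fun x a => Eval (G.policy i₀ l j₀ w fp S) x μ (fp + 11) a) es
      [G.src, G.dst, l₁, G.col + i₁, G.colEnd + i₁, w₁, G.pivots + j₁, G.buc + j₁])
    (hst : G.Static n μ) (h0 : G.Start i₁ l₁ j₁ w₁ μ) :
    Tr k B (G.policy i₀ l j₀ w fp S) (((2 * 42 : ℕ) : ℝ≥0∞) + e)
      (call fp (lit (fp + 11)) es p) μ fun _ μ' =>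
        G.Finish i₁ l₁ j₁ w₁ μ' ∧ ∀ a ∉ G.area i₁ l₁ j₁ w₁ (fp + 11) S₁, μ' a = μ a := by
  have layout := hG.layout
  refine Tr.call 42 hk (n₁ := .lit 0) (n₂ := n₂) (by simp only [Len.eval]; omega) Eval.lit hes
    (fun μ' y d h h' => Or.inl ⟨by omega, by simp at h'; omega⟩) ?_
  intro μ₁ hp hfr
  simp only [List.length_cons, List.length_nil] at hfr
  have hst₁ : G.Static n μ₁ := ⟨fun i hi => (hfr _ (by omega)).trans (hst.colEnd i hi),
    fun j hj => (hfr _ (by omega)).trans (hst.pivots j hj),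
    fun x hx => (hfr _ (by omega)).trans (hst.src x hx)⟩
  have h0₁ : G.Start i₁ l₁ j₁ w₁ μ₁ := ⟨fun i h h' => (hfr _ (by omega)).trans (h0.col i h h'),
    fun j h h' => (hfr _ (by omega)).trans (h0.buc j h h')⟩
  have ha : G.Args i₁ l₁ j₁ w₁ (fp + 11) μ₁ := ⟨hp 0 _ rfl, hp 1 _ rfl, hp 2 _ rfl, hp 3 _ rfl,
    hp 4 _ rfl, hp 5 _ rfl, hp 6 _ rfl, hp 7 _ rfl⟩
  obtain ⟨q1, q2⟩ := policy_mono hG (fp := fp) (S := S) (fp₁ := fp + 11) (S₁ := S₁) hl hw h1 h2 h3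
    h4 (by omega) (by omega)
  refine (((hspec μ₁ hst₁ ha h0₁).frame fun _ _ _ h => policy_frame h).imp q1 q2).mono le_rfl ?_
  rintro _ μ₂ ⟨g1, g2⟩
  refine ⟨Or.inl (by omega), g1, fun a h => ?_⟩
  rw [g2 a h, hfr a]
  by_contra hc
  exact h (Or.inl (by omega))

theorem skew_eq (f fp : ℕ) : skewTranspose (f + 1) fp =
    SquareSort.cond (either (lt (v (fp + 3)) 4) (lt (v (fp + 6)) 4))
      (call fp (lit (fp + 11)) [v (fp + 1), v (fp + 2), v (fp + 3), v (fp + 4), v (fp + 5),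
        v (fp + 6), v (fp + 7), v (fp + 8)] (naiveSkewTranspose f))
      ((do
        assign (fp + 9) (half (v (fp + 3)))
        assign (fp + 10) (half (v (fp + 6)))) >>= fun _ => do
        call fp (lit (fp + 11)) [v (fp + 1), v (fp + 2), v (fp + 9), v (fp + 4), v (fp + 5),
          v (fp + 10), v (fp + 7), v (fp + 8)] (skewTranspose f)
        call fp (lit (fp + 11)) [v (fp + 1), v (fp + 2), v (fp + 3) - v (fp + 9),
          v (fp + 4) + v (fp + 9), v (fp + 5) + v (fp + 9), v (fp + 10), v (fp + 7), v (fp + 8)]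
          (skewTranspose f)
        call fp (lit (fp + 11)) [v (fp + 1), v (fp + 2), v (fp + 9), v (fp + 4), v (fp + 5),
          v (fp + 6) - v (fp + 10), v (fp + 7) + v (fp + 10), v (fp + 8) + v (fp + 10)]
          (skewTranspose f)
        call fp (lit (fp + 11)) [v (fp + 1), v (fp + 2), v (fp + 3) - v (fp + 9),
          v (fp + 4) + v (fp + 9), v (fp + 5) + v (fp + 9),
          v (fp + 6) - v (fp + 10), v (fp + 7) + v (fp + 10), v (fp + 8) + v (fp + 10)]
          (skewTranspose f)) := by
  rfl

theorem spec_leaf (hk : 2 ≤ k) (hG : G.Valid n s) (hs : s ≤ fp) (hl : i₀ + l ≤ G.m)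
    (hw : j₀ + w ≤ G.m) (hlw : l < 4 ∨ w < 4) (f : ℕ) :
    G.Spec n k B ⊤ (skewTranspose (f + 1)) i₀ l j₀ w fp (11 * (l + w) + 22) := by
  intro μ hst ha h0
  have stack : ∀ (μ : Mem α) a, fp ≤ a → a < fp + 11 →
    (G.policy i₀ l j₀ w fp (11 * (l + w) + 22)).rd μ a := fun _ _ h h' => Or.inl ⟨h, by omega⟩
  refine ⟨?_, Cost.top⟩
  rw [skew_eq]
  have E : ∀ {a b}, fp ≤ a → a < fp + 11 → μ a = .num b →
      Eval (G.policy i₀ l j₀ w fp (11 * (l + w) + 22)) (v a) μ (fp + 11) b :=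
    fun h h' e => Eval.v h' e fun μ' => stack _ _ h h'
  have key := (call_tr (k := k) (B := B) (fp := fp) (S := 11 * (l + w) + 22) (S₁ := 11) hk hG hs
    hl hw le_rfl le_rfl le_rfl le_rfl (by omega) (by omega) (p := naiveSkewTranspose f) (e := ⊤)
    (fun μ h1 h2 h3 => Tr.of_safe (naive_safe hG (by omega) hl hw h1 h2 h3 f)) (by decide)
    (es := [v (fp + 1), v (fp + 2), v (fp + 3), v (fp + 4), v (fp + 5),
        v (fp + 6), v (fp + 7), v (fp + 8)])
    (.cons (E (by omega) (by omega) ha.src) (.cons (E (by omega) (by omega) ha.dst)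
      (.cons (E (by omega) (by omega) ha.l) (.cons (E (by omega) (by omega) ha.col)
      (.cons (E (by omega) (by omega) ha.colEnd) (.cons (E (by omega) (by omega) ha.w)
      (.cons (E (by omega) (by omega) ha.pivots) (.cons (E (by omega) (by omega) ha.buc)
      .nil)))))))) hst h0).safe.mono (fun _ _ h => h.1)
  have e3 := ha.l
  have e6 := ha.w
  by_cases hl4 : l < 4
  · simp only [safe_rules, e3, e6, cell_rules, hl4, decide_true, if_true]
    exact ⟨stack _ _ (by omega) (by omega), key⟩
  · have hw4 : w < 4 := by omega
    simp only [safe_rules, e3, e6, cell_rules, hl4, hw4, decide_true, if_true, decide_false,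
      Bool.false_eq_true, if_false]
    exact ⟨stack _ _ (by omega) (by omega), stack _ _ (by omega) (by omega), key⟩

/-- One level of the recursion of `skewTranspose`. -/
theorem spec_node (hk : 2 ≤ k) (hG : G.Valid n s) (hs : s ≤ fp) (hl : i₀ + l ≤ G.m)
    (hw : j₀ + w ≤ G.m) (hl4 : 4 ≤ l) (hw4 : 4 ≤ w) {f : ℕ} {e₁ e₂ e₃ e₄ : ℝ≥0∞}
    (h1 : G.Spec n k B e₁ (skewTranspose f) i₀ (l / 2) j₀ (w / 2) (fp + 11)
      (11 * (l / 2 + w / 2) + 22))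
    (h2 : G.Spec n k B e₂ (skewTranspose f) (i₀ + l / 2) (l - l / 2) j₀ (w / 2) (fp + 11)
      (11 * (l - l / 2 + w / 2) + 22))
    (h3 : G.Spec n k B e₃ (skewTranspose f) i₀ (l / 2) (j₀ + w / 2) (w - w / 2) (fp + 11)
      (11 * (l / 2 + (w - w / 2)) + 22))
    (h4 : G.Spec n k B e₄ (skewTranspose f) (i₀ + l / 2) (l - l / 2) (j₀ + w / 2) (w - w / 2)
      (fp + 11) (11 * (l - l / 2 + (w - w / 2)) + 22)) :
    G.Spec n k B ((400 : ℕ) + (e₁ + e₂ + e₃ + e₄)) (skewTranspose (f + 1)) i₀ l j₀ w fp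
      (11 * (l + w) + 22) := by
  intro μ hst ha h0
  have layout := hG.layout
  have stack : ∀ (μ : Mem α) a, fp ≤ a → a < fp + 11 →
    (G.policy i₀ l j₀ w fp (11 * (l + w) + 22)).rd μ a := fun _ _ h h' => Or.inl ⟨h, by omega⟩
  have stack' : ∀ (μ : Mem α) a c, fp ≤ a → a < fp + 11 →
    (G.policy i₀ l j₀ w fp (11 * (l + w) + 22)).wr μ a c := fun _ _ _ h h' => Or.inl ⟨h, by omega⟩
  rw [skew_eq]
  obtain ⟨μ₁, hμ₁⟩ : ∃ m, m = update (update μ (fp + 9) (.num (l / 2)))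
    (fp + 10) (.num (w / 2)) := ⟨_, rfl⟩
  have v₁ : ∀ a, a ≠ fp + 9 → a ≠ fp + 10 → μ₁ a = μ a := fun a h h' => by
    rw [hμ₁, update_of_ne h', update_of_ne h]
  have e9 : μ₁ (fp + 9) = .num (l / 2) := by simp [hμ₁]
  have e10 : μ₁ (fp + 10) = .num (w / 2) := by simp [hμ₁]
  have hst₁ : G.Static n μ₁ := ⟨fun i hi => (v₁ _ (by omega) (by omega)).trans (hst.colEnd i hi),
    fun j hj => (v₁ _ (by omega) (by omega)).trans (hst.pivots j hj),
    fun x hx => (v₁ _ (by omega) (by omega)).trans (hst.src x hx)⟩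
  -- the arguments of the four calls, whatever the earlier calls did behind the frame
  have E : ∀ {μ' : Mem α}, (∀ a, fp ≤ a → a < fp + 11 → μ' a = μ₁ a) → ∀ {a b}, fp ≤ a →
      a < fp + 11 → μ₁ a = .num b →
      Eval (G.policy i₀ l j₀ w fp (11 * (l + w) + 22)) (v a) μ' (fp + 11) b :=
    fun hμ' _ _ h h' e => Eval.v h' ((hμ' _ h h').trans e) fun μ' => stack _ _ h h'
  have a1 : μ₁ (fp + 1) = .num G.src := (v₁ _ (by omega) (by omega)).trans ha.src
  have a2 : μ₁ (fp + 2) = .num G.dst := (v₁ _ (by omega) (by omega)).trans ha.dst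
  have a3 : μ₁ (fp + 3) = .num l := (v₁ _ (by omega) (by omega)).trans ha.l
  have a4 : μ₁ (fp + 4) = .num (G.col + i₀) := (v₁ _ (by omega) (by omega)).trans ha.col
  have a5 : μ₁ (fp + 5) = .num (G.colEnd + i₀) := (v₁ _ (by omega) (by omega)).trans ha.colEnd
  have a6 : μ₁ (fp + 6) = .num w := (v₁ _ (by omega) (by omega)).trans ha.w
  have a7 : μ₁ (fp + 7) = .num (G.pivots + j₀) := (v₁ _ (by omega) (by omega)).trans ha.pivots
  have a8 : μ₁ (fp + 8) = .num (G.buc + j₀) := (v₁ _ (by omega) (by omega)).trans ha.buc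
  suffices H : Tr k B (G.policy i₀ l j₀ w fp (11 * (l + w) + 22))
      ((((2 * 42 : ℕ) : ℝ≥0∞) + e₁) + ((((2 * 42 : ℕ) : ℝ≥0∞) + e₂) + ((((2 * 42 : ℕ) : ℝ≥0∞) + e₃)
        + (((2 * 42 : ℕ) : ℝ≥0∞) + e₄)))) _ μ₁ fun _ => G.Finish i₀ l j₀ w by
    refine (Tr.cond (e := ((2 * 10 : ℕ) : ℝ≥0∞) + ((((2 * 42 : ℕ) : ℝ≥0∞) + e₁) +
      ((((2 * 42 : ℕ) : ℝ≥0∞) + e₂) + ((((2 * 42 : ℕ) : ℝ≥0∞) + e₃) +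
      (((2 * 42 : ℕ) : ℝ≥0∞) + e₄))))) 4 hk (by decide) ?_).mono ?_ fun _ _ h => h
    · have e3 := ha.l
      have e6 := ha.w
      simp only [safe_rules, e3, e6, cell_rules, show ¬ l < 4 by omega, show ¬ w < 4 by omega,
        decide_false, Bool.false_eq_true, if_false]
      refine ⟨stack _ _ (by omega) (by omega), stack _ _ (by omega) (by omega), ?_⟩
      refine Tr.step 10 hk (by decide) ?_
      simp only [safe_rules, e3, e6, cell_rules, upd_rules, mem_rules, Nat.reduceEqDiff, if_false]
      refine ⟨stack _ _ (by omega) (by omega), stack' _ _ _ (by omega) (by omega),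
        stack _ _ (by omega) (by omega), stack' _ _ _ (by omega) (by omega), ?_⟩
      rw [← hμ₁]
      exact H
    · rw [show ((2 * 4 : ℕ) : ℝ≥0∞) + (((2 * 10 : ℕ) : ℝ≥0∞) + ((((2 * 42 : ℕ) : ℝ≥0∞) + e₁) +
        ((((2 * 42 : ℕ) : ℝ≥0∞) + e₂) + ((((2 * 42 : ℕ) : ℝ≥0∞) + e₃) +
        (((2 * 42 : ℕ) : ℝ≥0∞) + e₄))))) = ((364 : ℕ) : ℝ≥0∞) + (e₁ + e₂ + e₃ + e₄) by
          push_cast; ring]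
      gcongr
      norm_num
  -- first half of the columns, first half of the buckets
  refine Tr.bind (call_tr hk hG hs hl hw le_rfl (by omega) le_rfl (by omega) (by omega) (by omega)
    h1 (by decide)
    (have F := @E μ₁ fun _ _ _ => rfl
    .cons (F (by omega) (by omega) a1) (.cons (F (by omega) (by omega) a2)
      (.cons (F (by omega) (by omega) e9) (.cons (F (by omega) (by omega) a4)
      (.cons (F (by omega) (by omega) a5) (.cons (F (by omega) (by omega) e10)
      (.cons (F (by omega) (by omega) a7) (.cons (F (by omega) (by omega) a8)
      .nil))))))))
    hst₁ ⟨fun i h h' => ?_, fun j h h' => ?_⟩) ?_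
  · rw [v₁ _ (by omega) (by omega)]
    exact h0.col i h (by omega)
  · rw [v₁ _ (by omega) (by omega)]
    exact h0.buc j h (by omega)
  rintro _ μ₂ ⟨f1, fr1⟩
  have n1 := fun {a} h1 h2 h3 h4 => fr1 a (hG.notMem_area (by omega) (by omega) h1 h2 h3 h4)
  have hst₂ := hG.static (by omega) (by omega) (by omega) hst₁ fr1
  -- second half of the columns, first half of the buckets
  refine Tr.bind (call_tr hk hG hs hl hw (by omega) (by omega) le_rfl (by omega) (by omega)
    (by omega) h2 (by decide)
    (have F := @E μ₂ fun a h h' => n1 (by omega) (by omega) (by omega) (by omega)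
    .cons (F (by omega) (by omega) a1) (.cons (F (by omega) (by omega) a2)
      (.cons (.sub (F (by omega) (by omega) a3) (F (by omega) (by omega) e9))
      (.cons (add_assoc G.col _ _ ▸ .add (F (by omega) (by omega) a4) (F (by omega) (by omega) e9))
      (.cons (add_assoc G.colEnd _ _ ▸
        .add (F (by omega) (by omega) a5) (F (by omega) (by omega) e9))
      (.cons (F (by omega) (by omega) e10)
      (.cons (F (by omega) (by omega) a7) (.cons (F (by omega) (by omega) a8)
      .nil))))))))
    hst₂ ⟨fun i h h' => ?_, fun j h h' => ?_⟩) ?_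
  · rw [n1 (by omega) (by omega) (by omega) (by omega), v₁ _ (by omega) (by omega)]
    exact h0.col i (by omega) (by omega)
  · exact f1.buc j h h'
  rintro _ μ₃ ⟨f2, fr2⟩
  have n2 := fun {a} h1 h2 h3 h4 => fr2 a (hG.notMem_area (by omega) (by omega) h1 h2 h3 h4)
  have hst₃ := hG.static (by omega) (by omega) (by omega) hst₂ fr2
  -- first half of the columns, second half of the buckets
  refine Tr.bind (call_tr hk hG hs hl hw le_rfl (by omega) (by omega) (by omega) (by omega)
    (by omega) h3 (by decide)
    (have F := @E μ₃ fun a h h' => (n2 (by omega) (by omega) (by omega) (by omega)).trans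
      (n1 (by omega) (by omega) (by omega) (by omega))
    .cons (F (by omega) (by omega) a1) (.cons (F (by omega) (by omega) a2)
      (.cons (F (by omega) (by omega) e9) (.cons (F (by omega) (by omega) a4)
      (.cons (F (by omega) (by omega) a5)
      (.cons (.sub (F (by omega) (by omega) a6) (F (by omega) (by omega) e10))
      (.cons (add_assoc G.pivots _ _ ▸
        .add (F (by omega) (by omega) a7) (F (by omega) (by omega) e10))
      (.cons (add_assoc G.buc _ _ ▸ .add (F (by omega) (by omega) a8) (F (by omega) (by omega) e10))
      .nil))))))))
    hst₃ ⟨fun i h h' => ?_, fun j h h' => ?_⟩) ?_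
  · rw [n2 (by omega) (by omega) (by omega) (by omega)]
    exact f1.col i h h'
  · rw [n2 (by omega) (by omega) (by omega) (by omega),
      n1 (by omega) (by omega) (by omega) (by omega), v₁ _ (by omega) (by omega)]
    exact h0.buc j (by omega) (by omega)
  rintro _ μ₄ ⟨f3, fr3⟩
  have n3 := fun {a} h1 h2 h3 h4 => fr3 a (hG.notMem_area (by omega) (by omega) h1 h2 h3 h4)
  have hst₄ := hG.static (by omega) (by omega) (by omega) hst₃ fr3
  -- second half of the columns, second half of the buckets
  refine (call_tr hk hG hs hl hw (by omega) (by omega) (by omega) (by omega) (by omega)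
    (by omega) h4 (by decide)
    (have F := @E μ₄ fun a h h' => ((n3 (by omega) (by omega) (by omega) (by omega)).trans
      (n2 (by omega) (by omega) (by omega) (by omega))).trans
      (n1 (by omega) (by omega) (by omega) (by omega))
    .cons (F (by omega) (by omega) a1) (.cons (F (by omega) (by omega) a2)
      (.cons (.sub (F (by omega) (by omega) a3) (F (by omega) (by omega) e9))
      (.cons (add_assoc G.col _ _ ▸ .add (F (by omega) (by omega) a4) (F (by omega) (by omega) e9))
      (.cons (add_assoc G.colEnd _ _ ▸
        .add (F (by omega) (by omega) a5) (F (by omega) (by omega) e9))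
      (.cons (.sub (F (by omega) (by omega) a6) (F (by omega) (by omega) e10))
      (.cons (add_assoc G.pivots _ _ ▸
        .add (F (by omega) (by omega) a7) (F (by omega) (by omega) e10))
      (.cons (add_assoc G.buc _ _ ▸ .add (F (by omega) (by omega) a8) (F (by omega) (by omega) e10))
      .nil))))))))
    hst₄ ⟨fun i h h' => ?_, fun j h h' => ?_⟩).mono le_rfl ?_
  · rw [n3 (by omega) (by omega) (by omega) (by omega)]
    exact f2.col i h h'
  · exact f3.buc j h h'
  rintro _ μ₅ ⟨f4, fr4⟩
  have n4 := fun {a} h1 h2 h3 h4 => fr4 a (hG.notMem_area (by omega) (by omega) h1 h2 h3 h4)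
  have c1 : j₀ + w / 2 + (w - w / 2) = j₀ + w := by omega
  have c2 : i₀ + l / 2 + (l - l / 2) = i₀ + l := by omega
  refine ⟨fun i h h' => ?_, fun j h h' => ?_, fun i h h' j g g' x hx => ?_⟩
  · by_cases hi : i < i₀ + l / 2
    · rw [n4 (by omega) (by omega) (by omega) (by omega), f3.col i h hi, c1]
    · rw [f4.col i (by omega) (by omega), c1]
  · by_cases hj : j < j₀ + w / 2
    · rw [n4 (by omega) (by omega) (by omega) (by omega),
        n3 (by omega) (by omega) (by omega) (by omega), f2.buc j h hj, c2]
    · rw [f4.buc j (by omega) (by omega), c2]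
  · have p := fun i₁ l₁ j₁ w₁ S => hG.slot_notMem (i₀ := i₁) (l := l₁) (j₀ := j₁) (w := w₁)
      (fp := fp + 11) (S := S) (show s ≤ fp + 11 by omega) (i := i) (j := j) (x := x)
    by_cases hi : i < i₀ + l / 2
    · by_cases hj : j < j₀ + w / 2
      · rw [fr4 _ (p _ _ _ _ _ (by omega) (by omega) (by omega) (by omega) hx (by omega)),
          fr3 _ (p _ _ _ _ _ (by omega) (by omega) (by omega) (by omega) hx (by omega)),
          fr2 _ (p _ _ _ _ _ (by omega) (by omega) (by omega) (by omega) hx (by omega))]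
        exact f1.slot i h hi j g hj x hx
      · rw [fr4 _ (p _ _ _ _ _ (by omega) (by omega) (by omega) (by omega) hx (by omega))]
        exact f3.slot i h hi j (by omega) (by omega) x hx
    · by_cases hj : j < j₀ + w / 2
      · rw [fr4 _ (p _ _ _ _ _ (by omega) (by omega) (by omega) (by omega) hx (by omega)),
          fr3 _ (p _ _ _ _ _ (by omega) (by omega) (by omega) (by omega) hx (by omega))]
        exact f2.slot i (by omega) (by omega) j g hj x hx
      · exact f4.slot i (by omega) (by omega) j (by omega) (by omega) x hx

theorem spec_top (hk : 2 ≤ k) (hG : G.Valid n s) (f : ℕ) : ∀ i₀ l j₀ w fp, s ≤ fp →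
    i₀ + l ≤ G.m → j₀ + w ≤ G.m →
    G.Spec n k B ⊤ (skewTranspose f) i₀ l j₀ w fp (11 * (l + w) + 22) := by
  induction f with
  | zero => exact fun _ _ _ _ _ _ _ _ _ _ _ _ => ⟨trivial, Cost.top⟩
  | succ f ih =>
    intro i₀ l j₀ w fp hs hl hw
    by_cases h : l < 4 ∨ w < 4
    · exact spec_leaf hk hG hs hl hw h f
    · exact (spec_node hk hG hs hl hw (by omega) (by omega)
        (ih _ _ _ _ _ (by omega) (by omega) (by omega))
        (ih _ _ _ _ _ (by omega) (by omega) (by omega))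
        (ih _ _ _ _ _ (by omega) (by omega) (by omega))
        (ih _ _ _ _ _ (by omega) (by omega) (by omega))).mono le_top

/-- The number of block boundaries that the pointers into the two item arrays cross. -/
def crossings (G : Grid α) (B i₀ l j₀ w : ℕ) : ℕ :=
  ∑ i ∈ Finset.Ico i₀ (i₀ + l), ((G.src + G.r i (j₀ + w)) / B - (G.src + G.r i j₀) / B) +
    ∑ j ∈ Finset.Ico j₀ (j₀ + w), ((G.dst + G.b j (i₀ + l)) / B - (G.dst + G.b j i₀) / B)

theorem crossings_add (hG : G.Valid n s) (hl : i₀ + l ≤ G.m) (hw : j₀ + w ≤ G.m) {l₁ w₁ : ℕ}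
    (hl₁ : l₁ ≤ l) (hw₁ : w₁ ≤ w) : G.crossings B i₀ l j₀ w =
      G.crossings B i₀ l₁ j₀ w₁ + G.crossings B (i₀ + l₁) (l - l₁) j₀ w₁ +
      G.crossings B i₀ l₁ (j₀ + w₁) (w - w₁) +
      G.crossings B (i₀ + l₁) (l - l₁) (j₀ + w₁) (w - w₁) := by
  have c1 : j₀ + w₁ + (w - w₁) = j₀ + w := by omega
  have c2 : i₀ + l₁ + (l - l₁) = i₀ + l := by omega
  have s1 := Finset.sum_Ico_consecutive (fun i => (G.src + G.r i (j₀ + w)) / B -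
    (G.src + G.r i j₀) / B) (show i₀ ≤ i₀ + l₁ by omega) (show i₀ + l₁ ≤ i₀ + l by omega)
  have s2 := Finset.sum_Ico_consecutive (fun j => (G.dst + G.b j (i₀ + l)) / B -
    (G.dst + G.b j i₀) / B) (show j₀ ≤ j₀ + w₁ by omega) (show j₀ + w₁ ≤ j₀ + w by omega)
  have t1 : ∀ a b, i₀ ≤ a → b ≤ i₀ + l → ∑ i ∈ Finset.Ico a b, ((G.src + G.r i (j₀ + w)) / B -
      (G.src + G.r i j₀) / B) = ∑ i ∈ Finset.Ico a b, ((G.src + G.r i (j₀ + w₁)) / B -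
      (G.src + G.r i j₀) / B) + ∑ i ∈ Finset.Ico a b, ((G.src + G.r i (j₀ + w)) / B -
      (G.src + G.r i (j₀ + w₁)) / B) := by
    intro a b ha hb
    rw [← sum_add_distrib]
    refine sum_congr rfl fun i hi => ?_
    rw [Finset.mem_Ico] at hi
    have h1 : (G.src + G.r i j₀) / B ≤ (G.src + G.r i (j₀ + w₁)) / B :=
      Nat.div_le_div_right (Nat.add_le_add_left (hG.r_mono i (by omega) _ _ (by omega)
        (by omega)) _)
    have h2 : (G.src + G.r i (j₀ + w₁)) / B ≤ (G.src + G.r i (j₀ + w)) / B :=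
      Nat.div_le_div_right (Nat.add_le_add_left (hG.r_mono i (by omega) _ _ (by omega)
        (by omega)) _)
    omega
  have t2 : ∀ a b, j₀ ≤ a → b ≤ j₀ + w → ∑ j ∈ Finset.Ico a b, ((G.dst + G.b j (i₀ + l)) / B -
      (G.dst + G.b j i₀) / B) = ∑ j ∈ Finset.Ico a b, ((G.dst + G.b j (i₀ + l₁)) / B -
      (G.dst + G.b j i₀) / B) + ∑ j ∈ Finset.Ico a b, ((G.dst + G.b j (i₀ + l)) / B -
      (G.dst + G.b j (i₀ + l₁)) / B) := by
    intro a b ha hb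
    rw [← sum_add_distrib]
    refine sum_congr rfl fun j hj => ?_
    rw [Finset.mem_Ico] at hj
    have h1 : (G.dst + G.b j i₀) / B ≤ (G.dst + G.b j (i₀ + l₁)) / B :=
      Nat.div_le_div_right (Nat.add_le_add_left (hG.b_mono (by omega) (by omega) (by omega)) _)
    have h2 : (G.dst + G.b j (i₀ + l₁)) / B ≤ (G.dst + G.b j (i₀ + l)) / B :=
      Nat.div_le_div_right (Nat.add_le_add_left (hG.b_mono (by omega) (by omega) (by omega)) _)
    omega
  simp only [crossings, c1, c2]
  rw [← s1, ← s2, t1 i₀ _ le_rfl (by omega), t1 _ (i₀ + l) (by omega) le_rfl,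
    t2 j₀ _ le_rfl (by omega), t2 _ (j₀ + w) (by omega) le_rfl]
  ring

/-- Once the sub-columns and buckets of a call are few enough to have a block in the cache for each
of their pointers, the cost of the whole call, including all deeper recursion, is the number of
pointers and block crossings: the safety of the full call and `Cost.of_pointers` give this without
looking at the recursion. -/
theorem spec_small (hk : B ≤ k) (hB : 64 ≤ B) (hG : G.Valid n s) (hs : s ≤ fp)
    (hl : i₀ + l ≤ G.m) (hw : j₀ + w ≤ G.m) (hlw : 2 * (l + w) ≤ B) (f : ℕ) :
    G.Spec n k B ((2 * (22 + l + w) + 2 * G.crossings B i₀ l j₀ w : ℕ) : ℝ≥0∞)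
      (skewTranspose f) i₀ l j₀ w fp (11 * (l + w) + 22) := by
  intro μ hst ha h0
  have layout := hG.layout
  have key := (spec_top (k := k) (B := B) (by omega) hG f i₀ l j₀ w fp hs hl hw μ hst ha h0).safe
  refine ⟨key, ?_⟩
  obtain ⟨R, hR⟩ : ∃ R, R = blocks B fp (fp + (11 * (l + w) + 22)) ∪
    (blocks B (G.col + i₀) (G.col + i₀ + l) ∪ (blocks B (G.colEnd + i₀) (G.colEnd + i₀ + l) ∪
    (blocks B (G.pivots + j₀) (G.pivots + j₀ + w) ∪ blocks B (G.buc + j₀) (G.buc + j₀ + w)))) :=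
    ⟨_, rfl⟩
  have R1 : ∀ a, fp ≤ a → a < fp + (11 * (l + w) + 22) → a / B ∈ R := fun a h h' => by
    rw [hR]; exact mem_union_left _ (mem_blocks h h'.le)
  have R2 : ∀ i, i₀ ≤ i → i < i₀ + l → (G.col + i) / B ∈ R := fun a h h' => by
    rw [hR]; exact mem_union_right _ (mem_union_left _
      (mem_blocks (by omega) (by omega)))
  have R3 : ∀ i, i₀ ≤ i → i < i₀ + l → (G.colEnd + i) / B ∈ R := fun a h h' => by
    rw [hR]; exact mem_union_right _ (mem_union_right _ (mem_union_left _
      (mem_blocks (by omega) (by omega))))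
  have R4 : ∀ j, j₀ ≤ j → j < j₀ + w → (G.pivots + j) / B ∈ R := fun a h h' => by
    rw [hR]; exact mem_union_right _ (mem_union_right _ (mem_union_right _
      (mem_union_left _ (mem_blocks (by omega) (by omega)))))
  have R5 : ∀ j, j₀ ≤ j → j < j₀ + w → (G.buc + j) / B ∈ R := fun a h h' => by
    rw [hR]; exact mem_union_right _ (mem_union_right _ (mem_union_right _
      (mem_union_right _ (mem_blocks (by omega) (by omega)))))
  have hRc : R.card ≤ 22 := by
    have d1 : (11 * (l + w) + 22) / B ≤ 6 := by
      rw [← Nat.lt_succ_iff, Nat.div_lt_iff_lt_mul (by omega)]; omega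
    have d2 : l / B = 0 := Nat.div_eq_of_lt (by omega)
    have d3 : w / B = 0 := Nat.div_eq_of_lt (by omega)
    have c1 := card_blocks (B := B) (by omega) fp (11 * (l + w) + 22)
    have c2 := card_blocks (B := B) (by omega) (G.col + i₀) l
    have c3 := card_blocks (B := B) (by omega) (G.colEnd + i₀) l
    have c4 := card_blocks (B := B) (by omega) (G.pivots + j₀) w
    have c5 := card_blocks (B := B) (by omega) (G.buc + j₀) w
    rw [hR]
    refine (card_union_le _ _).trans ?_
    refine (Nat.add_le_add_left (card_union_le _ _) _).trans ?_
    refine (Nat.add_le_add_left (Nat.add_le_add_left (card_union_le _ _) _) _).trans ?_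
    refine (Nat.add_le_add_left (Nat.add_le_add_left (Nat.add_le_add_left
      (card_union_le _ _) _) _) _).trans ?_
    omega
  obtain ⟨P, hP⟩ : ∃ P : Finset (ℕ × ℕ), P =
    (Finset.Ico i₀ (i₀ + l)).image (fun i => (G.src, G.col + i)) ∪
    (Finset.Ico j₀ (j₀ + w)).image (fun j => (G.dst, G.buc + j)) := ⟨_, rfl⟩
  have hPm : ∀ x, x ∈ P ↔ (∃ i, i₀ ≤ i ∧ i < i₀ + l ∧ x = (G.src, G.col + i)) ∨
      ∃ j, j₀ ≤ j ∧ j < j₀ + w ∧ x = (G.dst, G.buc + j) := by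
    intro x
    simp only [hP, Finset.mem_union, Finset.mem_image, Finset.mem_Ico, and_assoc, eq_comm]
  have hPd : Disjoint ((Finset.Ico i₀ (i₀ + l)).image (fun i => (G.src, G.col + i)))
      ((Finset.Ico j₀ (j₀ + w)).image (fun j => (G.dst, G.buc + j))) := by
    rw [Finset.disjoint_left]
    simp only [Finset.mem_image, Finset.mem_Ico]
    rintro x ⟨i, hi, rfl⟩ ⟨j, hj, h⟩
    simp only [Prod.mk.injEq] at h
    omega
  obtain ⟨lim, hlim⟩ : ∃ lim : ℕ × ℕ → ℕ, ∀ x, lim x = if x.2 < G.colEnd then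
    G.src + G.r (x.2 - G.col) (j₀ + w) else G.dst + G.b (x.2 - G.buc) (i₀ + l) :=
    ⟨_, fun _ => rfl⟩
  have lim1 : ∀ i, i < i₀ + l → lim (G.src, G.col + i) = G.src + G.r i (j₀ + w) := by
    intro i hi
    rw [hlim, if_pos (by simp only; omega)]
    simp
  have lim2 : ∀ j, j < j₀ + w → lim (G.dst, G.buc + j) = G.dst + G.b j (i₀ + l) := by
    intro i hi
    rw [hlim, if_neg (by simp only; omega)]
    simp
  have p1 : ∀ i, i₀ ≤ i → i < i₀ + l → ptr μ (G.src, G.col + i) = G.src + G.r i j₀ := by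
    intro i h h'
    simp [ptr, h0.col i h h']
  have p2 : ∀ j, j₀ ≤ j → j < j₀ + w → ptr μ (G.dst, G.buc + j) = G.dst + G.b j i₀ := by
    intro i h h'
    simp [ptr, h0.buc i h h']
  have hPc : P.card ≤ l + w := by
    rw [hP]
    refine (card_union_le _ _).trans (Nat.add_le_add card_image_le
      card_image_le |>.trans ?_)
    simp
  refine (Cost.of_pointers R P lim key ?_ (by omega) ?_ ?_).mono ?_ fun _ _ h => h
  · intro x hx
    rcases (hPm x).1 hx with ⟨i, h, h', rfl⟩ | ⟨j, h, h', rfl⟩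
    · rw [p1 i h h', lim1 i h']
      exact Nat.add_le_add_left (hG.r_mono i (by omega) _ _ (by omega) (by omega)) _
    · rw [p2 j h h', lim2 j h']
      exact Nat.add_le_add_left (hG.b_mono (by omega) (by omega) (by omega)) _
  · rintro μ a (⟨h, h'⟩ | ⟨i, h, h', rfl | rfl | ⟨rfl, _⟩⟩ | ⟨j, h, h', rfl | rfl⟩)
    · exact Or.inl (R1 a h h')
    · exact Or.inl (R2 i h h')
    · exact Or.inl (R3 i h h')
    · exact Or.inr ⟨(G.src, G.col + i), (hPm _).2 (Or.inl ⟨i, h, h', rfl⟩), rfl⟩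
    · exact Or.inl (R4 j h h')
    · exact Or.inl (R5 j h h')
  · rintro μ a c (⟨h, h'⟩ | ⟨i, h, h', rfl, rfl, g⟩ | ⟨j, h, h', ⟨rfl, rfl, g⟩ | ⟨rfl, g, g'⟩⟩)
    · refine ⟨Or.inl (R1 a h h'), fun x hx hxa => ?_⟩
      rcases (hPm x).1 hx with ⟨i, _, _, rfl⟩ | ⟨j, _, _, rfl⟩ <;> simp only at hxa <;> omega
    · refine ⟨Or.inl (R2 i h h'), fun x hx hxa => ⟨rfl, ?_⟩⟩
      rcases (hPm x).1 hx with ⟨i', q, q', rfl⟩ | ⟨j, _, _, rfl⟩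
      · obtain rfl : i' = i := by simp only at hxa; omega
        rw [lim1 _ h']
        simp only [ptr]
        omega
      · simp only at hxa; omega
    · refine ⟨Or.inl (R5 j h h'), fun x hx hxa => ⟨rfl, ?_⟩⟩
      rcases (hPm x).1 hx with ⟨i', q, q', rfl⟩ | ⟨j', _, _, rfl⟩
      · simp only at hxa; omega
      · obtain rfl : j' = j := by simp only at hxa; omega
        rw [lim2 _ h']
        simp only [ptr]
        omega
    · refine ⟨Or.inr ⟨(G.dst, G.buc + j), (hPm _).2 (Or.inr ⟨j, h, h', rfl⟩), rfl⟩,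
        fun x hx hxa => ?_⟩
      have := hG.slot_lt (show j < G.m by omega) hl g'
      rcases (hPm x).1 hx with ⟨i, _, _, rfl⟩ | ⟨j', _, _, rfl⟩ <;> simp only at hxa <;> omega
  · refine Nat.cast_le.2 ?_
    have : ∑ x ∈ P, (lim x / B - ptr μ x / B) = G.crossings B i₀ l j₀ w := by
      rw [hP, Finset.sum_union hPd, Finset.sum_image (by intro a _ b _ h; simpa using h),
        Finset.sum_image (by intro a _ b _ h; simpa using h)]
      unfold crossings
      congr 1
      · refine sum_congr rfl fun i hi => ?_
        rw [Finset.mem_Ico] at hi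
        rw [lim1 i hi.2, p1 i hi.1 hi.2]
      · refine sum_congr rfl fun i hi => ?_
        rw [Finset.mem_Ico] at hi
        rw [lim2 i hi.2, p2 i hi.1 hi.2]
    rw [this]
    omega

/-- Above the size of `spec_small`, the recursion on nearly square parts has `O(l * w / B²)` leaves
of cost `O(B)` besides the block crossings. The `200` in the induction hypothesis absorbs the
constant cost of the inner nodes. -/
theorem spec_large (hk : B ≤ k) (hB : 1024 ≤ B) (hG : G.Valid n s) (f : ℕ) : ∀ i₀ l j₀ w fp,
    s ≤ fp → i₀ + l ≤ G.m → j₀ + w ≤ G.m → l ≤ w + 1 → w ≤ l + 1 → B ≤ 8 * (l + w) →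
    ∃ e : ℕ, B * (e + 200) ≤ 400 * (l * w) ∧
      G.Spec n k B ((e + 2 * G.crossings B i₀ l j₀ w : ℕ) : ℝ≥0∞)
        (skewTranspose f) i₀ l j₀ w fp (11 * (l + w) + 22) := by
  induction f with
  | zero =>
    intro i₀ l j₀ w fp _ _ _ h1 h2 h3
    refine ⟨0, ?_, fun μ _ _ _ => ⟨trivial, fun ψ K hK => zero_le⟩⟩
    nlinarith
  | succ f ih =>
    intro i₀ l j₀ w fp hs hl hw h1 h2 h3
    by_cases hlw : 2 * (l + w) ≤ B
    · refine ⟨_, ?_, spec_small hk (by omega) hG hs hl hw hlw _⟩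
      have : (l + w) * (l + w) ≤ 4 * (l * w) + 1 := by
        rcases (show l = w + 1 ∨ w = l + 1 ∨ l = w by omega) with rfl | rfl | rfl <;> nlinarith
      nlinarith
    · obtain ⟨e₁, g1, s1⟩ := ih i₀ (l / 2) j₀ (w / 2) (fp + 11) (by omega) (by omega) (by omega)
        (by omega) (by omega) (by omega)
      obtain ⟨e₂, g2, s2⟩ := ih (i₀ + l / 2) (l - l / 2) j₀ (w / 2) (fp + 11) (by omega) (by omega)
        (by omega) (by omega) (by omega) (by omega)
      obtain ⟨e₃, g3, s3⟩ := ih i₀ (l / 2) (j₀ + w / 2) (w - w / 2) (fp + 11) (by omega) (by omega)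
        (by omega) (by omega) (by omega) (by omega)
      obtain ⟨e₄, g4, s4⟩ := ih (i₀ + l / 2) (l - l / 2) (j₀ + w / 2) (w - w / 2) (fp + 11)
        (by omega) (by omega) (by omega) (by omega) (by omega) (by omega)
      refine ⟨400 + (e₁ + e₂ + e₃ + e₄), ?_, (spec_node (by omega) hG hs hl hw (by omega)
        (by omega) s1 s2 s3 s4).mono ?_⟩
      · have e1 : l * w = (l / 2 + (l - l / 2)) * (w / 2 + (w - w / 2)) := by
          rw [Nat.add_sub_cancel' (by omega), Nat.add_sub_cancel' (by omega)]
        rw [e1]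
        nlinarith
      · rw [crossings_add (B := B) hG hl hw (show l / 2 ≤ l by omega) (show w / 2 ≤ w by omega)]
        norm_cast
        omega

theorem sum_gaps_le (u d : ℕ → ℕ) (m n : ℕ) (hd : ∀ i < m, d i ≤ u i)
    (hu : ∀ i, i + 1 < m → u i ≤ d (i + 1)) (hn : ∀ i < m, u i ≤ n) : ∑ i ∈ range m, (u i - d i)
        ≤ n := by
  suffices H : ∀ t, t + 1 ≤ m → ∑ i ∈ range (t + 1), (u i - d i) ≤ u t by
    rcases m with _ | m
    · simp
    · exact (H m le_rfl).trans (hn m (by omega))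
  intro t ht
  induction t with
  | zero => simp
  | succ t ih =>
    rw [sum_range_succ]
    have := ih (by omega)
    have := hu t (by omega)
    have := hd (t + 1) (by omega)
    omega

theorem sum_crossings_le (hB : 0 < B) (a : ℕ) (u d : ℕ → ℕ) (m n : ℕ)
    (h : ∑ i ∈ range m, (u i - d i) ≤ n) :
    ∑ i ∈ range m, ((a + u i) / B - (a + d i) / B) ≤ n / B + m := by
  have h1 : ∀ i, (a + u i) / B - (a + d i) / B ≤ (u i - d i) / B + 1 := by
    intro i
    rcases le_total (u i) (d i) with h | h
    · have : (a + u i) / B ≤ (a + d i) / B := Nat.div_le_div_right (by omega)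
      exact (Nat.sub_eq_zero_of_le this).trans_le (Nat.zero_le _)
    · have : (a + u i) / B ≤ (a + d i) / B + (u i - d i) / B + 1 := by
        rw [show a + u i = a + d i + (u i - d i) by omega, Nat.add_div hB]
        split_ifs <;> omega
      generalize (u i - d i) / B = x at *
      generalize (a + u i) / B = y at *
      generalize (a + d i) / B = z at *
      omega
  refine (sum_le_sum fun i _ => h1 i).trans ?_
  rw [sum_add_distrib]
  simp only [Finset.sum_const, card_range, smul_eq_mul, mul_one]
  refine Nat.add_le_add_right ?_ _
  rw [Nat.le_div_iff_mul_le hB, Finset.sum_mul]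
  exact (sum_le_sum fun i _ => Nat.div_mul_le_self _ _).trans h

/-- The full skew transposition costs `O(m² / B + m + n / B)`. -/
theorem spec_square (hk : B ≤ k) (hB : 1024 ≤ B) (hG : G.Valid n s) (hs : s ≤ fp)
    (hr : ∀ i, i + 1 < G.m → G.r i G.m ≤ G.r (i + 1) 0) (f : ℕ) :
    G.Spec n k B ((400 * (G.m * G.m / B) + 8 * G.m + 4 * (n / B) + 500 : ℕ) : ℝ≥0∞)
      (skewTranspose f) 0 G.m 0 G.m fp (11 * (G.m + G.m) + 22) := by
  have hX : G.crossings B 0 G.m 0 G.m ≤ 2 * (n / B) + 2 * G.m := by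
    have h1 := sum_crossings_le (B := B) (by omega) G.src (fun i => G.r i G.m) (fun i => G.r i 0)
      G.m n (sum_gaps_le _ _ _ _ (fun i hi => hG.r_mono i hi _ _ (by omega) le_rfl) hr hG.r_le)
    have h2 := sum_crossings_le (B := B) (by omega) G.dst (fun j => G.b j G.m) (fun j => G.b j 0)
      G.m n (sum_gaps_le _ _ _ _ (fun j hj => hG.b_mono hj (by omega) le_rfl) hG.b_next hG.b_le)
    simp only [crossings, zero_add, ← Finset.range_eq_Ico]
    omega
  by_cases h : 2 * (G.m + G.m) ≤ B
  · refine (spec_small hk (by omega) hG hs (by omega) (by omega) h f).mono (Nat.cast_le.2 ?_)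
    generalize G.m * G.m / B = y
    omega
  · obtain ⟨e, h1, h2⟩ := spec_large hk hB hG f 0 G.m 0 G.m fp hs (by omega) (by omega) (by omega)
      (by omega) (by omega)
    refine h2.mono (Nat.cast_le.2 ?_)
    have h3 : e ≤ 400 * (G.m * G.m / B) + 400 := by
      have := Nat.lt_div_mul_add (a := G.m * G.m) (b := B) (by omega)
      have h5 : B * (e + 200) < B * (400 * (G.m * G.m / B + 1)) := by
        calc B * (e + 200) ≤ 400 * (G.m * G.m) := h1
          _ < 400 * (G.m * G.m / B * B + B) := by omega
          _ = _ := by ring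
      have := Nat.lt_of_mul_lt_mul_left h5
      generalize G.m * G.m / B = y at *
      omega
    generalize G.m * G.m / B = y at *
    omega

end Grid

/-! ### The parts of the sorting procedure -/

/-- The loop of `squareSort` that fills in the spans of the columns. -/
def spanLoop (f fp : ℕ) : Prog Unit :=
  loop f (lt (v (fp + 5)) (v (fp + 4))) do
    put (lit (fp + 9) + v (fp + 5)) (minimum (v (fp + 5) * v (fp + 4)) (v (fp + 3)))
    put (lit (fp + 9) + v (fp + 4) + v (fp + 5))
      (minimum ((v (fp + 5) + 1) * v (fp + 4)) (v (fp + 3)))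
    assign (fp + 5) (v (fp + 5) + 1)

/-- The loop of `squareSort` that sorts the columns recursively. -/
def columnLoop (f fp : ℕ) : Prog Unit :=
  loop f (lt (v (fp + 5)) (v (fp + 4))) do
    call fp (lit (fp + 10) + 4 * v (fp + 4))
      [v (fp + 1) + deref (lit (fp + 9) + v (fp + 5)),
        v (fp + 2) + deref (lit (fp + 9) + v (fp + 5)),
        deref (lit (fp + 9) + v (fp + 4) + v (fp + 5)) - deref (lit (fp + 9) + v (fp + 5))]
      (squareSort f)
    assign (fp + 5) (v (fp + 5) + 1)

/-- The loop of `squareSort` that draws one sample. -/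
def drawLoop (f fp : ℕ) : Prog Unit :=
  loop f (lt (v (fp + 5) + 1) (v (fp + 4))) do
    moveAt (lit (fp + 9) + 2 * v (fp + 4) + v (fp + 5)) (v (fp + 2) + random (v (fp + 3)))
    assign (fp + 5) (v (fp + 5) + 1)

/-- The loop of `squareSort` that tests whether the sorted sample has distinct entries. -/
def distinctLoop (f fp : ℕ) : Prog Unit :=
  loop f (lt (v (fp + 5) + 2) (v (fp + 4))) do
    SquareSort.cond (lessAt (lit (fp + 9) + 2 * v (fp + 4) + v (fp + 5))
      (lit (fp + 9) + 2 * v (fp + 4) + v (fp + 5) + 1)) (ret ()) (assign (fp + 8) 0)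
    assign (fp + 5) (v (fp + 5) + 1)

/-- The loop of `squareSort` that compares the smallest pivot with the first item of each column. -/
def minimumLoop (f fp : ℕ) : Prog Unit :=
  loop f (lt (v (fp + 5)) (v (fp + 4))) do
    SquareSort.cond (both (lt (deref (lit (fp + 9) + v (fp + 5)))
        (deref (lit (fp + 9) + v (fp + 4) + v (fp + 5))))
        (lessAt (v (fp + 2) + deref (lit (fp + 9) + v (fp + 5))) (lit (fp + 9) + 2 * v (fp + 4))))
      (assign (fp + 7) 1) (ret ())
    assign (fp + 5) (v (fp + 5) + 1)

/-- The part of a sampling round after the drawing: sort the sample and decide about it. -/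
def checkSample (f fp : ℕ) : Prog Unit := do
  call fp (lit (fp + 10) + 4 * v (fp + 4)) [lit (fp + 9) + 2 * v (fp + 4), v (fp + 4) - 1]
    (mergeSort f)
  assign (fp + 8) 1
  assign (fp + 5) 0
  distinctLoop f fp
  assign (fp + 7) 0
  assign (fp + 5) 0
  minimumLoop f fp
  SquareSort.cond (lt (v (fp + 7)) 1) (assign (fp + 8) 0) (ret ())

/-- The rejection loop for the pivots. -/
def sampleLoop (f fp : ℕ) : Prog Unit :=
  loop f (lt (v (fp + 8)) 1) do
    assign (fp + 5) 0
    drawLoop f fp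
    checkSample f fp

/-- The loop of `squareSort` that sets the counters of the buckets to zero. -/
def clearLoop (f fp : ℕ) : Prog Unit :=
  loop f (lt (v (fp + 6)) (v (fp + 4))) do
    put (lit (fp + 9) + 3 * v (fp + 4) + v (fp + 6) + 1) 0
    assign (fp + 6) (v (fp + 6) + 1)

/-- The loop of `squareSort` that scans one column along with the pivots. -/
def scanLoop (f fp : ℕ) : Prog Unit :=
  loop f (lt (v (fp + 7)) (deref (lit (fp + 9) + v (fp + 4) + v (fp + 5)))) do
    SquareSort.cond (lessAt (v (fp + 2) + v (fp + 7)) (lit (fp + 9) + 2 * v (fp + 4) + v (fp + 6)))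
      (do put (lit (fp + 9) + 3 * v (fp + 4) + v (fp + 6) + 1)
            (deref (lit (fp + 9) + 3 * v (fp + 4) + v (fp + 6) + 1) + 1)
          assign (fp + 7) (v (fp + 7) + 1))
      (assign (fp + 6) (v (fp + 6) + 1))

/-- The loop of `squareSort` that counts the items of the buckets in all columns. -/
def countLoop (f fp : ℕ) : Prog Unit :=
  loop f (lt (v (fp + 5)) (v (fp + 4))) do
    assign (fp + 6) 0
    assign (fp + 7) (deref (lit (fp + 9) + v (fp + 5)))
    scanLoop f fp
    assign (fp + 5) (v (fp + 5) + 1)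

/-- The loop of `squareSort` that turns the sizes of the buckets into their first positions. -/
def offsetLoop (f fp : ℕ) : Prog Unit :=
  loop f (lt (v (fp + 6)) (v (fp + 4))) do
    assign (fp + 5) (deref (lit (fp + 9) + 3 * v (fp + 4) + v (fp + 6) + 1))
    put (lit (fp + 9) + 3 * v (fp + 4) + v (fp + 6) + 1) (v (fp + 7))
    assign (fp + 7) (v (fp + 7) + v (fp + 5))
    assign (fp + 6) (v (fp + 6) + 1)

/-- The loop of `squareSort` that sorts the buckets recursively. -/
def bucketLoop (f fp : ℕ) : Prog Unit :=
  loop f (lt (v (fp + 6)) (v (fp + 4))) do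
    call fp (lit (fp + 10) + 4 * v (fp + 4))
      [v (fp + 1) + deref (lit (fp + 9) + 3 * v (fp + 4) + v (fp + 6)),
        v (fp + 2) + deref (lit (fp + 9) + 3 * v (fp + 4) + v (fp + 6)),
        deref (lit (fp + 9) + 3 * v (fp + 4) + v (fp + 6) + 1) -
          deref (lit (fp + 9) + 3 * v (fp + 4) + v (fp + 6))]
      (squareSort f)
    assign (fp + 6) (v (fp + 6) + 1)

/-- Everything that `squareSort` does after the pivots are fixed. -/
def distribute (f fp : ℕ) : Prog Unit := do
  putInfty (lit (fp + 9) + 2 * v (fp + 4) + v (fp + 4) - 1)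
  assign (fp + 6) 0
  clearLoop f fp
  assign (fp + 5) 0
  countLoop f fp
  assign (fp + 7) 0
  assign (fp + 6) 0
  offsetLoop f fp
  call fp (lit (fp + 10) + 4 * v (fp + 4)) [v (fp + 2), v (fp + 1), v (fp + 4), lit (fp + 9),
    lit (fp + 9) + v (fp + 4), v (fp + 4), lit (fp + 9) + 2 * v (fp + 4),
    lit (fp + 9) + 3 * v (fp + 4) + 1] (skewTranspose f)
  put (lit (fp + 9) + 3 * v (fp + 4)) 0
  assign (fp + 6) 0
  bucketLoop f fp

theorem squareSort_eq (f fp : ℕ) : squareSort (f + 1) fp =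
    SquareSort.cond (lt (v (fp + 3)) 17)
      (call fp (lit (fp + 9)) [v (fp + 1), v (fp + 2), v (fp + 3)] (simpleSort f))
      (do
        assign (fp + 4) (ceilSqrt <$> v (fp + 3))
        assign (fp + 5) 0
        spanLoop f fp
        assign (fp + 5) 0
        columnLoop f fp
        assign (fp + 8) 0
        sampleLoop f fp
        distribute f fp) := by
  rfl

/-- The parameters of `squareSort`, and the local variable `m`. -/
structure Locals (A D n m fp : ℕ) (μ : Mem α) : Prop where
  src : μ (fp + 1) = .num A
  dst : μ (fp + 2) = .num D
  size : μ (fp + 3) = .num n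
  count : μ (fp + 4) = .num m

theorem Locals.of_eq {α : Type*} {A D n m fp : ℕ} {μ μ' : Mem α} (h : Locals A D n m fp μ)
    (hμ : ∀ x, fp + 1 ≤ x → x ≤ fp + 4 → μ' x = μ x) : Locals A D n m fp μ' :=
  ⟨(hμ _ (by omega) (by omega)).trans h.1, (hμ _ (by omega) (by omega)).trans h.2,
    (hμ _ (by omega) (by omega)).trans h.3, (hμ _ (by omega) (by omega)).trans h.4⟩

/-- The index where the `i`-th column starts. -/
def edge (n m i : ℕ) : ℕ := min (i * m) n

theorem edge_le (n m i : ℕ) : edge n m i ≤ n := min_le_right _ _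
theorem edge_mono (n m : ℕ) {i j : ℕ} (h : i ≤ j) : edge n m i ≤ edge n m j :=
  min_le_min_right _ (Nat.mul_le_mul_right _ h)
theorem edge_succ_le (n m i : ℕ) : edge n m (i + 1) ≤ edge n m i + m := by
  simp only [edge, Nat.succ_mul]
  omega

/-- The local arrays `col` and `colEnd` hold the spans of the columns. -/
structure Spans (n m fp : ℕ) (μ : Mem α) : Prop where
  col : ∀ i < m, μ (fp + 9 + i) = .num (edge n m i)
  colEnd : ∀ i < m, μ (fp + 9 + m + i) = .num (edge n m (i + 1))

theorem Spans.of_eq {α : Type*} {n m fp : ℕ} {μ μ' : Mem α} (h : Spans n m fp μ)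
    (hμ : ∀ x, fp + 9 ≤ x → x < fp + 9 + 2 * m → μ' x = μ x) : Spans n m fp μ' :=
  ⟨fun i hi => (hμ _ (by omega) (by omega)).trans (h.1 i hi),
    fun i hi => (hμ _ (by omega) (by omega)).trans (h.2 i hi)⟩

variable {A D n m fp f : ℕ}

theorem spanLoop_tr (hk : 2 ≤ k) (h : Locals A D n m fp μ) (h5 : μ (fp + 5) = .num 0) :
    Tr k B (.box {a | fp ≤ a ∧ a < fp + 9 + 2 * m}
        {a | a = fp + 5 ∨ fp + 9 ≤ a ∧ a < fp + 9 + 2 * m})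
      (((m + 1) * 60 : ℕ) : ℝ≥0∞) (spanLoop f fp) μ fun _ => Spans n m fp := by
  unfold spanLoop
  obtain ⟨I, hI⟩ : ∃ I : ℕ → Mem α → Prop, ∀ s μ', I s μ' ↔ s ≤ m ∧
      μ' (fp + 5) = .num s ∧ (∀ x < s, μ' (fp + 9 + x) = .num (edge n m x)) ∧
      ∀ x < s, μ' (fp + 9 + m + x) = .num (edge n m (x + 1)) := ⟨_, fun _ _ => Iff.rfl⟩
  refine Tr.loop_const I (2 * 30) m f ((hI _ _).2 ⟨by omega, h5, by omega, by omega⟩)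
    (fun s μ' h => ((hI _ _).1 h).1) ?_
  intro s μ' hfr hμ'
  obtain ⟨hsm, e5, g1, g2⟩ := (hI _ _).1 hμ'
  obtain ⟨e1, e2, e3, e4⟩ := h.of_eq (μ' := μ') fun x h h' => hfr x (by simp; omega)
  refine Tr.of_len 30 hk (by decide) ?_
  by_cases hs : s < m
  · have u1 : ∀ c, update μ' (fp + 9 + s) c (fp + 3) = .num n :=
      fun c => (update_of_ne (by omega) _ _).trans e3
    have u2 : ∀ c, update μ' (fp + 9 + s) c (fp + 4) = .num m :=
      fun c => (update_of_ne (by omega) _ _).trans e4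
    have u3 : ∀ c, update μ' (fp + 9 + s) c (fp + 5) = .num s :=
      fun c => (update_of_ne (by omega) _ _).trans e5
    have u4 : ∀ c c', update (update μ' (fp + 9 + s) c) (fp + 9 + m + s) c'
        (fp + 5) = .num s :=
      fun c c' => (update_of_ne (by omega) _ _).trans (u3 c)
    simp only [safe_rules, cell_rules, mem_rules, e3, e4, e5, u1, u2, u3, u4, hs, decide_true,
      if_true]
    constructorm* _ ∧ _
    any_goals first | exact trivial | omega
    refine (hI _ _).2 ⟨by omega, by simp, fun x hx => ?_, fun x hx => ?_⟩
    · rw [update_of_ne (by omega), update_of_ne (by omega)]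
      rcases (show x ≤ s by omega).eq_or_lt with rfl | h
      · rw [update_self, edge]
      · rw [update_of_ne (by omega), g1 x h]
    · rw [update_of_ne (by omega)]
      rcases (show x ≤ s by omega).eq_or_lt with rfl | h
      · rw [update_self, edge]
      · rw [update_of_ne (by omega), update_of_ne (by omega), g2 x h]
  · simp only [safe_rules, cell_rules, mem_rules, e4, e5, hs, decide_false, Bool.false_eq_true,
      if_false]
    exact ⟨by omega, by omega, fun x hx => g1 x (by omega), fun x hx => g2 x (by omega)⟩

theorem clearLoop_tr (hk : 2 ≤ k) (h : Locals A D n m fp μ) (h6 : μ (fp + 6) = .num 0) :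
    Tr k B (.box {a | fp ≤ a ∧ a < fp + 10 + 4 * m}
        {a | a = fp + 6 ∨ fp + 10 + 3 * m ≤ a ∧ a < fp + 10 + 4 * m})
      (((m + 1) * 40 : ℕ) : ℝ≥0∞) (clearLoop f fp) μ fun _ μ' =>
      ∀ j < m, μ' (fp + 9 + 3 * m + j + 1) = .num 0 := by
  unfold clearLoop
  obtain ⟨I, hI⟩ : ∃ I : ℕ → Mem α → Prop, ∀ s μ', I s μ' ↔ s ≤ m ∧
      μ' (fp + 6) = .num s ∧ (∀ x < s, μ' (fp + 9 + 3 * m + x + 1) = .num 0) :=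
    ⟨_, fun _ _ => Iff.rfl⟩
  refine Tr.loop_const I (2 * 20) m f ((hI _ _).2 ⟨by omega, h6, by omega⟩)
    (fun s μ' h => ((hI _ _).1 h).1) ?_
  intro s μ' hfr hμ'
  obtain ⟨hsm, e6, g1⟩ := (hI _ _).1 hμ'
  obtain ⟨e1, e2, e3, e4⟩ := h.of_eq (μ' := μ') fun x h h' => hfr x (by simp; omega)
  refine Tr.of_len 20 hk (by decide) ?_
  by_cases hs : s < m
  · have u3 : ∀ c, update μ' (fp + 9 + 3 * m + s + 1) c (fp + 6) = .num s :=
      fun c => (update_of_ne (by omega) _ _).trans e6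
    simp only [safe_rules, cell_rules, mem_rules, e4, e6, u3, hs, decide_true, if_true]
    constructorm* _ ∧ _
    any_goals first | exact trivial | omega
    refine (hI _ _).2 ⟨by omega, by simp, fun x hx => ?_⟩
    rw [update_of_ne (by omega)]
    rcases (show x ≤ s by omega).eq_or_lt with rfl | h
    · rw [update_self]
    · rw [update_of_ne (by omega), g1 x h]
  · simp only [safe_rules, cell_rules, mem_rules, e4, e6, hs, decide_false, Bool.false_eq_true,
      if_false]
    exact ⟨by omega, by omega, fun x hx => g1 x (by omega)⟩

theorem offsetLoop_tr (hk : 2 ≤ k) (h : Locals A D n m fp μ) (h6 : μ (fp + 6) = .num 0)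
    (h7 : μ (fp + 7) = .num 0) (cnt : ℕ → ℕ)
    (hc : ∀ j < m, μ (fp + 9 + 3 * m + j + 1) = .num (cnt j)) :
    Tr k B (.box {a | fp ≤ a ∧ a < fp + 10 + 4 * m}
        {a | fp + 5 ≤ a ∧ a ≤ fp + 7 ∨ fp + 10 + 3 * m ≤ a ∧ a < fp + 10 + 4 * m})
      (((m + 1) * 60 : ℕ) : ℝ≥0∞) (offsetLoop f fp) μ fun _ μ' =>
      ∀ j < m, μ' (fp + 9 + 3 * m + j + 1) = .num (∑ i ∈ range j, cnt i) := by
  unfold offsetLoop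
  obtain ⟨I, hI⟩ : ∃ I : ℕ → Mem α → Prop, ∀ s μ', I s μ' ↔ s ≤ m ∧
      μ' (fp + 6) = .num s ∧ μ' (fp + 7) = .num (∑ i ∈ range s, cnt i) ∧
      (∀ j < s, μ' (fp + 9 + 3 * m + j + 1) = .num (∑ i ∈ range j, cnt i)) ∧
      (∀ j, s ≤ j → j < m → μ' (fp + 9 + 3 * m + j + 1) = .num (cnt j)) :=
    ⟨_, fun _ _ => Iff.rfl⟩
  refine Tr.loop_const I (2 * 30) m f ((hI _ _).2 ⟨by omega, h6, by simpa, by omega,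
    fun j _ => hc j⟩) (fun s μ' h => ((hI _ _).1 h).1) ?_
  intro s μ' hfr hμ'
  obtain ⟨hsm, e6, e7, g1, g2⟩ := (hI _ _).1 hμ'
  obtain ⟨e1, e2, e3, e4⟩ := h.of_eq (μ' := μ') fun x h h' => hfr x (by simp; omega)
  refine Tr.of_len 30 hk (by decide) ?_
  by_cases hs : s < m
  · have g3 := g2 s le_rfl hs
    have u1 : ∀ c a, fp + 6 ≤ a → update μ' (fp + 5) c a = μ' a :=
      fun c a ha => update_of_ne (by omega) _ _
    have u4 : ∀ c, update μ' (fp + 5) c (fp + 4) = .num m :=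
      fun c => (update_of_ne (by omega) _ _).trans e4
    have u6 : ∀ c, update μ' (fp + 5) c (fp + 6) = .num s :=
      fun c => (update_of_ne (by omega) _ _).trans e6
    have u7 : ∀ c, update μ' (fp + 5) c (fp + 7) = .num (∑ i ∈ range s, cnt i) :=
      fun c => (update_of_ne (by omega) _ _).trans e7
    have w5 : ∀ c c', update (update μ' (fp + 5) c)
        (fp + 9 + 3 * m + s + 1) c' (fp + 5) = c :=
      fun c c' => (update_of_ne (by omega) _ _).trans (update_self _ _ _)
    have w7 : ∀ c c', update (update μ' (fp + 5) c)
        (fp + 9 + 3 * m + s + 1) c' (fp + 7) = .num (∑ i ∈ range s, cnt i) :=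
      fun c c' => (update_of_ne (by omega) _ _).trans (u7 c)
    have x6 : ∀ c c' c'', update (update (update μ' (fp + 5) c)
        (fp + 9 + 3 * m + s + 1) c') (fp + 7) c'' (fp + 6) = .num s :=
      fun c c' c'' => (update_of_ne (by omega) _ _).trans
        ((update_of_ne (by omega) _ _).trans (u6 c))
    simp only [safe_rules, cell_rules, mem_rules, e4, e6, u4, u6, u7, w5, w7, x6, g3, hs,
      decide_true, if_true]
    constructorm* _ ∧ _
    any_goals first | exact trivial | omega
    refine (hI _ _).2 ⟨by omega, by simp, ?_, fun x hx => ?_, fun x hx hx' => ?_⟩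
    · rw [update_of_ne (by omega), update_self, sum_range_succ]
    · rw [update_of_ne (by omega), update_of_ne (by omega)]
      rcases (show x ≤ s by omega).eq_or_lt with rfl | h
      · rw [update_self]
      · rw [update_of_ne (by omega), update_of_ne (by omega), g1 x h]
    · rw [update_of_ne (by omega), update_of_ne (by omega),
        update_of_ne (by omega), update_of_ne (by omega), g2 x (by omega) hx']
  · simp only [safe_rules, cell_rules, mem_rules, e4, e6, hs, decide_false, Bool.false_eq_true,
      if_false]
    exact ⟨by omega, by omega, fun x hx => g1 x (by omega)⟩

theorem distinctLoop_tr (hk : 2 ≤ k) (h : Locals A D n m fp μ) (h5 : μ (fp + 5) = .num 0)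
    (h8 : μ (fp + 8) = .num 1) :
    Tr k B (.box {a | fp ≤ a ∧ a < fp + 9 + 3 * m} {a | a = fp + 5 ∨ a = fp + 8})
      (((m + 1) * 60 : ℕ) : ℝ≥0∞) (distinctLoop f fp) μ fun _ μ' =>
      ∃ b : ℕ, μ' (fp + 8) = .num b ∧ (0 < b ↔ ∀ i, i + 2 < m →
        (μ (fp + 9 + 2 * m + i)).lt (μ (fp + 9 + 2 * m + i + 1)) = true) := by
  unfold distinctLoop
  obtain ⟨I, hI⟩ : ∃ I : ℕ → Mem α → Prop, ∀ s μ', I s μ' ↔ s ≤ m ∧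
      μ' (fp + 5) = .num s ∧ ∃ b : ℕ, μ' (fp + 8) = .num b ∧ (0 < b ↔ ∀ i < s, i + 2 < m →
        (μ (fp + 9 + 2 * m + i)).lt (μ (fp + 9 + 2 * m + i + 1)) = true) :=
    ⟨_, fun _ _ => Iff.rfl⟩
  refine Tr.loop_const I (2 * 30) m f ((hI _ _).2 ⟨by omega, h5, 1, h8, by simp⟩)
    (fun s μ' h => ((hI _ _).1 h).1) ?_
  intro s μ' hfr hμ'
  obtain ⟨hsm, e5, b, e8, g1⟩ := (hI _ _).1 hμ'
  obtain ⟨e1, e2, e3, e4⟩ := h.of_eq (μ' := μ') fun x h h' => hfr x (by simp; omega)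
  have eP : ∀ x, μ' (fp + 9 + 2 * m + x) = μ (fp + 9 + 2 * m + x) := fun x => hfr _ (by simp; omega)
  have eP' : ∀ x, μ' (fp + 9 + 2 * m + x + 1) = μ (fp + 9 + 2 * m + x + 1) :=
    fun x => hfr _ (by simp; omega)
  refine Tr.of_len 30 hk (by decide) ?_
  by_cases hs : s + 2 < m
  · have hstep : (∀ i < s + 1, i + 2 < m →
        (μ (fp + 9 + 2 * m + i)).lt (μ (fp + 9 + 2 * m + i + 1)) = true) ↔ (∀ i < s, i + 2 < m →
        (μ (fp + 9 + 2 * m + i)).lt (μ (fp + 9 + 2 * m + i + 1)) = true) ∧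
        (μ (fp + 9 + 2 * m + s)).lt (μ (fp + 9 + 2 * m + s + 1)) = true :=
      ⟨fun h => ⟨fun i hi => h i (by omega), h s (by omega) hs⟩, fun h i hi hi' => by
        rcases (show i ≤ s by omega).eq_or_lt with rfl | h'
        exacts [h.2, h.1 i h' hi']⟩
    have u5 : ∀ c, update μ' (fp + 8) c (fp + 5) = .num s :=
      fun c => (update_of_ne (by omega) _ _).trans e5
    simp only [safe_rules, cell_rules, mem_rules, e4, e5, eP, eP', hs, decide_true, if_true]
    by_cases hc : (μ (fp + 9 + 2 * m + s)).lt (μ (fp + 9 + 2 * m + s + 1)) = true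
    · simp only [hc, if_true]
      constructorm* _ ∧ _
      any_goals first | exact trivial | omega
      refine (hI _ _).2 ⟨by omega, by simp, b, ?_, ?_⟩
      · rw [update_of_ne (by omega), e8]
      · rw [hstep, g1]
        simp [hc]
    · simp only [hc, if_false, u5, cell_rules, Bool.false_eq_true]
      constructorm* _ ∧ _
      any_goals first | exact trivial | omega
      refine (hI _ _).2 ⟨by omega, by simp, 0, ?_, ?_⟩
      · rw [update_of_ne (by omega), update_self]
      · rw [hstep]
        simp [hc]
  · simp only [safe_rules, cell_rules, mem_rules, e4, e5, hs, decide_false, Bool.false_eq_true,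
      if_false]
    exact ⟨by omega, by omega, b, e8, g1.trans ⟨fun h i hi => h i (by omega) hi,
      fun h i _ hi => h i hi⟩⟩

theorem minimumLoop_tr (hk : 2 ≤ k) (h : Locals A D n m fp μ) (hS : Spans n m fp μ)
    (hm : 0 < m) (hD : D + n ≤ fp) (h5 : μ (fp + 5) = .num 0) (h7 : μ (fp + 7) = .num 0) :
    Tr k B (.box {a | fp ≤ a ∧ a < fp + 9 + 3 * m ∨ D ≤ a ∧ a < D + n}
        {a | a = fp + 5 ∨ a = fp + 7})
      (((m + 1) * 60 : ℕ) : ℝ≥0∞) (minimumLoop f fp) μ fun _ μ' =>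
      ∃ b : ℕ, μ' (fp + 7) = .num b ∧ (0 < b ↔ ∃ i < m, edge n m i < edge n m (i + 1) ∧
        (μ (D + edge n m i)).lt (μ (fp + 9 + 2 * m)) = true) := by
  unfold minimumLoop
  obtain ⟨I, hI⟩ : ∃ I : ℕ → Mem α → Prop, ∀ s μ', I s μ' ↔ s ≤ m ∧
      μ' (fp + 5) = .num s ∧ ∃ b : ℕ, μ' (fp + 7) = .num b ∧ (0 < b ↔ ∃ i < s,
        edge n m i < edge n m (i + 1) ∧ (μ (D + edge n m i)).lt (μ (fp + 9 + 2 * m)) = true) :=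
    ⟨_, fun _ _ => Iff.rfl⟩
  refine Tr.loop_const I (2 * 30) m f ((hI _ _).2 ⟨by omega, h5, 0, h7, by simp⟩)
    (fun s μ' h => ((hI _ _).1 h).1) ?_
  intro s μ' hfr hμ'
  obtain ⟨hsm, e5, b, e7, g1⟩ := (hI _ _).1 hμ'
  obtain ⟨e1, e2, e3, e4⟩ := h.of_eq (μ' := μ') fun x h h' => hfr x (by simp; omega)
  have hS' := hS.of_eq (μ' := μ') fun x h h' => hfr x (by simp; omega)
  have eP : μ' (fp + 9 + 2 * m) = μ (fp + 9 + 2 * m) := hfr _ (by simp; omega)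
  have eD : ∀ x ≤ n, x < n → μ' (D + x) = μ (D + x) := fun x _ _ => hfr _ (by simp; omega)
  refine Tr.of_len 30 hk (by decide) ?_
  by_cases hs : s < m
  · have hstep : (∃ i < s + 1, edge n m i < edge n m (i + 1) ∧
        (μ (D + edge n m i)).lt (μ (fp + 9 + 2 * m)) = true) ↔ (∃ i < s,
        edge n m i < edge n m (i + 1) ∧ (μ (D + edge n m i)).lt (μ (fp + 9 + 2 * m)) = true) ∨
        edge n m s < edge n m (s + 1) ∧ (μ (D + edge n m s)).lt (μ (fp + 9 + 2 * m)) = true := by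
      constructor
      · rintro ⟨i, hi, h⟩
        rcases (show i ≤ s by omega).eq_or_lt with rfl | h'
        exacts [Or.inr h, Or.inl ⟨i, h', h⟩]
      · rintro (⟨i, hi, h⟩ | h)
        exacts [⟨i, by omega, h⟩, ⟨s, by omega, h⟩]
    have u5 : ∀ c, update μ' (fp + 7) c (fp + 5) = .num s :=
      fun c => (update_of_ne (by omega) _ _).trans e5
    have c1 := hS'.col s hs
    have c2 := hS'.colEnd s hs
    have l1 := edge_le n m (s + 1)
    simp only [safe_rules, cell_rules, mem_rules, e2, e4, e5, c1, c2, hs, decide_true, if_true]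
    by_cases hlt : edge n m s < edge n m (s + 1)
    · have l2 : μ' (D + edge n m s) = μ (D + edge n m s) := eD _ (by omega) (by omega)
      simp only [hlt, decide_true, if_true, l2, eP]
      by_cases hc : (μ (D + edge n m s)).lt (μ (fp + 9 + 2 * m)) = true
      · simp only [hc, if_true, u5, cell_rules]
        constructorm* _ ∧ _
        any_goals first | exact trivial | omega
        refine (hI _ _).2 ⟨by omega, by simp, 1, ?_, ?_⟩
        · rw [update_of_ne (by omega), update_self]
        · rw [hstep]
          simp [hc, hlt]
      · simp only [hc, if_false, Bool.false_eq_true]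
        constructorm* _ ∧ _
        any_goals first | exact trivial | omega
        refine (hI _ _).2 ⟨by omega, by simp, b, ?_, ?_⟩
        · rw [update_of_ne (by omega), e7]
        · rw [hstep, g1]
          simp [hc]
    · simp only [hlt, decide_false, if_false, Bool.false_eq_true]
      constructorm* _ ∧ _
      any_goals first | exact trivial | omega
      refine (hI _ _).2 ⟨by omega, by simp, b, ?_, ?_⟩
      · rw [update_of_ne (by omega), e7]
      · rw [hstep, g1]
        simp [hlt]
  · simp only [safe_rules, cell_rules, mem_rules, e4, e5, hs, decide_false, Bool.false_eq_true,
      if_false]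
    obtain rfl : s = m := by omega
    exact ⟨by omega, by omega, b, e7, g1⟩

/-! ### The recursive calls -/

/-- The cells that sorting `n` items may touch: both arrays, and `16 n + 32` cells of stack. This is
enough for the recursion: the frame takes `4 m + 10` cells, and every column or bucket leaves out at
least `m - 1` of the `n` items. -/
def sortArea (A D n fp : ℕ) : Set ℕ :=
  {a | fp ≤ a ∧ a < fp + 16 * n + 32 ∨ A ≤ a ∧ a < A + n ∨ D ≤ a ∧ a < D + n}

theorem mem_sortArea (A D n fp a : ℕ) : a ∈ sortArea A D n fp ↔
    fp ≤ a ∧ a < fp + 16 * n + 32 ∨ A ≤ a ∧ a < A + n ∨ D ≤ a ∧ a < D + n := Iff.rfl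

/-- `p`, called like `squareSort`, sorts `n` distinct items at cost `T n` and within `sortArea`. -/
def SortSpec (α : Type*) [LinearOrder α] (k B : ℕ) (T : ℕ → ℝ≥0∞) (p : ℕ → Prog Unit) : Prop :=
  ∀ (μ : Mem α) (A D n fp : ℕ), μ (fp + 1) = .num A → μ (fp + 2) = .num D →
    μ (fp + 3) = .num n → (A + n ≤ D ∨ D + n ≤ A) → A + n ≤ fp → D + n ≤ fp → Items μ A (A + n) →
    (ms μ A (A + n)).Nodup → Tr k B (.box (sortArea A D n fp) (sortArea A D n fp)) (T n) (p fp) μ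
      fun _ μ' => ms μ' D (D + n) = ms μ A (A + n) ∧ Sorted μ' D (D + n)

theorem ms_sub {α : Type*} (μ : Mem α) {a b a' b' : ℕ} (h : a ≤ a') (h' : b' ≤ b) :
    ms μ a' b' ≤ ms μ a b := by
  rcases le_or_gt a' b' with g | g
  · rw [← ms_add μ (h.trans g) h', ← ms_add μ h g]
    exact (Multiset.le_add_left _ _).trans (Multiset.le_add_right _ _)
  · rw [ms_of_le _ g.le]
    exact Multiset.zero_le _

/-- A recursive call on a segment of the array. It writes only to this segment and above the local
arrays of the caller. -/
theorem SortSpec.call {T : ℕ → ℝ≥0∞} {p : ℕ → Prog Unit} (hp : SortSpec α k B T p) (hk : 2 ≤ k)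
    (h4 : μ (fp + 4) = .num m)
    {lo hi : ℕ} (hlo : lo ≤ hi) (hhi : hi ≤ n) (hAD : A + n ≤ D ∨ D + n ≤ A) (hA : A + n ≤ fp)
    (hD : D + n ≤ fp) (hst : 10 + 4 * m + 16 * (hi - lo) ≤ 16 * n)
    (hit : Items μ (A + lo) (A + hi)) (hnd : (ms μ (A + lo) (A + hi)).Nodup) {es : List (Prog ℕ)}
    {n₂ : Len} [hn : ∀ t, HasLen (pushAll (t + 1) es) n₂] (hN : n₂.eval ≤ 20)
    (hes : ∀ W, List.Forall₂ (fun x a => Eval (.box (sortArea A D n fp) W) x μ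
      (fp + 10 + 4 * m) a) es [A + lo, D + lo, hi - lo]) :
    Tr k B (.box (sortArea A D n fp) {a | A + lo ≤ a ∧ a < A + hi ∨ D + lo ≤ a ∧ a < D + hi ∨
        fp + 10 + 4 * m ≤ a ∧ a < fp + 16 * n + 32}) ((60 : ℕ) + T (hi - lo))
      (call fp (lit (fp + 10) + 4 * v (fp + 4)) es p) μ fun _ μ' =>
      ms μ' (D + lo) (D + hi) = ms μ (A + lo) (A + hi) ∧ Sorted μ' (D + lo) (D + hi) := by
  obtain ⟨S, hS⟩ : ∃ S : Set ℕ, S = sortArea A D n fp := ⟨_, rfl⟩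
  have hSm : ∀ a, a ∈ S ↔ fp ≤ a ∧ a < fp + 16 * n + 32 ∨ A ≤ a ∧ a < A + n ∨ D ≤ a ∧ a < D + n :=
    fun a => hS ▸ Iff.rfl
  obtain ⟨W, hW⟩ : ∃ W : Set ℕ, W = {a | A + lo ≤ a ∧ a < A + hi ∨ D + lo ≤ a ∧ a < D + hi ∨
        fp + 10 + 4 * m ≤ a ∧ a < fp + 16 * n + 32} := ⟨_, rfl⟩
  have hWm : ∀ a, a ∈ W ↔ A + lo ≤ a ∧ a < A + hi ∨ D + lo ≤ a ∧ a < D + hi ∨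
        fp + 10 + 4 * m ≤ a ∧ a < fp + 16 * n + 32 := fun a => hW ▸ Iff.rfl
  replace hes := hes W
  rw [← hS] at hes ⊢
  rw [← hW]
  obtain ⟨t, ht⟩ : ∃ t, t = fp + 10 + 4 * m := ⟨_, rfl⟩
  rw [← ht] at hes
  simp only [← ht] at hWm
  obtain ⟨s, hs⟩ : ∃ s, s = hi - lo := ⟨_, rfl⟩
  rw [← hs] at hes hst ⊢
  have htop : Eval (.box S W) (lit (fp + 10) + 4 * v (fp + 4)) μ t t := by
    have := (Eval.lit (π := .box S W) (μ := μ) (s := t) (a := fp + 10)).add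
      ((Eval.ofNat (a := 4)).mul (Eval.v (c := fp + 4) (by omega) h4 fun μ' => by
        simp only [box_rd, hSm]; omega))
    rwa [← ht] at this
  refine (Tr.call (e := T s) 30 hk (by
    simp only [Len.eval]; omega) htop hes (fun μ' y d h h' => ?_) ?_).mono ?_ fun _ _ h => h
  · simp only [List.length_cons, List.length_nil] at h'
    simp only [box_wr, hWm]; omega
  · intro μ₁ h1 h2
    simp only [List.length_cons, List.length_nil] at h2
    have e1 : μ₁ (t + 1) = _ := h1 0 _ rfl
    have e2 : μ₁ (t + 2) = _ := h1 1 _ rfl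
    have e3 : μ₁ (t + 3) = _ := h1 2 _ rfl
    have eA : ∀ a, A + lo ≤ a → a < A + lo + s → μ₁ a = μ a := fun a _ _ => h2 a (by omega)
    have ea : A + hi = A + lo + s := by omega
    have ed : D + hi = D + lo + s := by omega
    rw [ea] at hit hnd
    rw [ea, ed]
    refine ((hp μ₁ (A + lo) (D + lo) s t e1 e2 e3
      (by omega) (by omega) (by omega) (hit.of_ms (ms_congr eA))
      ((ms_congr eA) ▸ hnd)).box_mono ?_ ?_).mono le_rfl ?_
    · intro a ha
      rw [hSm]
      simp only [sortArea, Set.mem_ofPred_eq] at ha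
      omega
    · intro a ha
      rw [hWm]
      simp only [sortArea, Set.mem_ofPred_eq] at ha
      omega
    · rintro _ μ' ⟨h3, h4⟩
      refine ⟨?_, h3.trans (ms_congr eA), h4⟩
      simp only [box_rd, hSm]
      omega
  · exact le_rfl

/-- The loop that sorts all segments `u i, …, u (i + 1) - 1` recursively; it serves for the columns
and for the buckets, which differ in the loop variable `c` and in the argument expressions `es`. -/
theorem segments_tr {T : ℕ → ℝ≥0∞} {p : ℕ → Prog Unit} (hp : SortSpec α k B T p) (hk : 2 ≤ k)
    (h4 : μ (fp + 4) = .num m) {c : ℕ} (hc : c = fp + 5 ∨ c = fp + 6) (h0 : μ c = .num 0)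
    (u : ℕ → ℕ) (hu : ∀ i < m, u i ≤ u (i + 1)) (hun : u m ≤ n)
    (hAD : A + n ≤ D ∨ D + n ≤ A) (hA : A + n ≤ fp) (hD : D + n ≤ fp)
    (hst : ∀ i < m, 10 + 4 * m + 16 * (u (i + 1) - u i) ≤ 16 * n)
    (hit : Items μ A (A + n)) (hnd : (ms μ A (A + n)).Nodup) {es : List (Prog ℕ)}
    {n₂ : Len} [hn : ∀ t, HasLen (pushAll (t + 1) es) n₂] (hN : n₂.eval ≤ 20)
    (hes : ∀ i < m, ∀ μ' : Mem α, μ' c = .num i →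
      (∀ a, fp + 1 ≤ a → a < fp + 10 + 4 * m → a ≠ c → μ' a = μ a) →
      ∀ W, List.Forall₂ (fun x a => Eval (.box (sortArea A D n fp) W) x μ'
      (fp + 10 + 4 * m) a) es [A + u i, D + u i, u (i + 1) - u i]) :
    Tr k B (.box (sortArea A D n fp) {a | a = c ∨ A ≤ a ∧ a < A + n ∨ D ≤ a ∧ a < D + n ∨
        fp + 10 + 4 * m ≤ a ∧ a < fp + 16 * n + 32})
      (((m + 1) * 100 : ℕ) + ∑ i ∈ range m, T (u (i + 1) - u i))
      (loop f (lt (v c) (v (fp + 4))) (do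
        call fp (lit (fp + 10) + 4 * v (fp + 4)) es p
        assign c (v c + 1))) μ fun _ μ' =>
      ∀ i < m, ms μ' (D + u i) (D + u (i + 1)) = ms μ (A + u i) (A + u (i + 1)) ∧
        Sorted μ' (D + u i) (D + u (i + 1)) := by
  obtain ⟨W, hW⟩ : ∃ W : Set ℕ, ∀ a, a ∈ W ↔ a = c ∨ A ≤ a ∧ a < A + n ∨ D ≤ a ∧ a < D + n ∨
        fp + 10 + 4 * m ≤ a ∧ a < fp + 16 * n + 32 := ⟨_, fun _ => Iff.rfl⟩
  have hW' : {a | a = c ∨ A ≤ a ∧ a < A + n ∨ D ≤ a ∧ a < D + n ∨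
        fp + 10 + 4 * m ≤ a ∧ a < fp + 16 * n + 32} = W := Set.ext fun a => (hW a).symm
  rw [hW']
  have hum : ∀ i j, i ≤ j → j ≤ m → u i ≤ u j := by
    intro i j hij
    induction j, hij using Nat.le_induction with
    | base => exact fun _ => le_rfl
    | succ j hij ih => exact fun hj => (ih (by omega)).trans (hu j (by omega))
  rcases Nat.eq_zero_or_pos m with hm0 | hm0
  · subst hm0
    refine (Tr.loop_const (fun s μ' => s = 0 ∧ μ' = μ) (2 * 10) 0 f ⟨rfl, rfl⟩
      (fun s μ' h => h.1.le) ?_).mono ?_ fun _ _ h => h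
    · rintro s μ' _ ⟨rfl, rfl⟩
      refine (Tr.round (e := 0) 10 hk (by decide) ?_).mono (by simp) fun _ _ h => h
      simp only [safe_rules, cell_rules, h4, h0, sortArea, mem_rules]
      simp
      omega
    · norm_num
  obtain ⟨I, hI⟩ : ∃ I : ℕ → Mem α → Prop, ∀ s μ', I s μ' ↔ s ≤ m ∧ μ' c = .num s ∧
      (∀ i < s, ms μ' (D + u i) (D + u (i + 1)) = ms μ (A + u i) (A + u (i + 1)) ∧
        Sorted μ' (D + u i) (D + u (i + 1))) ∧
      (∀ a, A + u s ≤ a → a < A + n → μ' a = μ a) ∧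
      (∀ a, fp + 1 ≤ a → a < fp + 10 + 4 * m → a ≠ c → μ' a = μ a) := ⟨_, fun _ _ => Iff.rfl⟩
  refine (Tr.loop_box I (fun i => (90 : ℕ) + if i < m then T (u (i + 1) - u i) else 0) m f
    ((hI _ _).2 ⟨by omega, h0, by omega, fun _ _ _ => rfl, fun _ _ _ _ => rfl⟩)
    (fun s μ' h => ((hI _ _).1 h).1) ?_).mono ?_ fun _ _ h => h
  swap
  · rw [sum_add_distrib, ← Finset.range_eq_Ico, sum_range_succ
      (f := fun i => if i < m then T (u (i + 1) - u i) else 0), if_neg (lt_irrefl m), add_zero,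
      sum_congr rfl fun i hi => if_pos (mem_range.1 hi)]
    gcongr
    simp only [Finset.sum_const, card_range, nsmul_eq_mul]
    norm_cast
    omega
  intro s μ' hfr hμ'
  obtain ⟨hsm, ec, g1, g2, g3⟩ := (hI _ _).1 hμ'
  have e4 : μ' (fp + 4) = .num m := (g3 _ (by omega) (by omega) (by omega)).trans h4
  refine (Tr.round (e := (80 : ℕ) + if s < m then T (u (s + 1) - u s) else 0) 5 hk
    (by decide) ?_).mono ?_ fun _ _ h => h
  swap
  · rw [← add_assoc]
    gcongr
    norm_cast
  simp only [safe_rules, cell_rules, ec, e4]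
  refine ⟨by simp only [sortArea, mem_rules]; omega, by simp only [sortArea, mem_rules]; omega, ?_⟩
  by_cases hs : s < m
  swap
  · simp only [hs, decide_false, Bool.false_eq_true, if_false]
    obtain rfl : s = m := by omega
    exact g1
  have hle := hu s hs
  have hle' := hum (s + 1) m hs le_rfl
  simp only [hs, decide_true, if_true]
  refine (Tr.bind (hp.call hk e4 hle (hle'.trans hun) hAD hA hD (hst s hs)
    (fun x h h' => (g2 x h (by omega)) ▸ hit x (by omega) (by omega))
    (by
      rw [ms_congr (μ' := μ) fun x h h' => g2 x h (by omega)]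
      exact Multiset.nodup_of_le (ms_sub μ (by omega) (by omega)) hnd) hN
    (hes s hs μ' ec g3) |>.box_frame.box_mono subset_rfl ?_) (e' := (20 : ℕ)) ?_).mono ?_
        fun _ _ h => h
  · intro a ha
    rw [hW]
    simp only [mem_rules] at ha
    omega
  · rintro _ μ₁ ⟨⟨h1, h2⟩, h3⟩
    have ec₁ : μ₁ c = .num s := (h3 _ (by simp only [mem_rules]; omega)).trans ec
    refine Tr.of_len 10 hk (by decide) ?_
    simp only [safe_rules, cell_rules, ec₁, hW]
    refine ⟨by simp only [sortArea, mem_rules]; omega, by simp, (hI _ _).2 ⟨hs, by simp,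
      fun i his => ?_, fun a ha ha' => ?_, fun a ha ha' hac => ?_⟩⟩
    · have hw : ∀ a, D ≤ a → a < D + n → update μ₁ c (.num (s + 1)) a = μ₁ a :=
        fun a h h' => update_of_ne (by omega) _ _
      have h5 := hum (i + 1) m (by omega) le_rfl
      rw [ms_congr (μ' := μ₁) fun a h h' => hw a (by omega) (by omega)]
      rcases (show i ≤ s by omega).eq_or_lt with rfl | h
      · refine ⟨h1.trans (ms_congr fun a h h' => g2 a (by omega) (by omega)),
          h2.congr fun a h h' => hw a (by omega) (by omega)⟩
      · have h6 := hum (i + 1) s h hs.le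
        have h7 : ∀ a, D + u i ≤ a → a < D + u (i + 1) → μ₁ a = μ' a := fun a _ _ =>
          h3 a (by simp only [mem_rules]; omega)
        rw [ms_congr h7]
        exact ⟨(g1 i h).1, (g1 i h).2.congr fun a h h' => by
          rw [hw a (by omega) (by omega), h7 a h h']⟩
    · rw [update_of_ne (by omega), h3 a (by simp only [mem_rules]; omega),
        g2 a (by omega) ha']
    · rw [update_of_ne hac, h3 a (by simp only [mem_rules]; omega), g3 a ha ha' hac]
  · rw [add_right_comm]
    gcongr
    norm_cast

theorem columnLoop_tr {T : ℕ → ℝ≥0∞} (hp : SortSpec α k B T (squareSort f)) (hk : 2 ≤ k)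
    (h : Locals A D n m fp μ) (hS : Spans n m fp μ) (h5 : μ (fp + 5) = .num 0)
    (h5m : 5 ≤ m) (h3m : 3 * m ≤ n)
    (hAD : A + n ≤ D ∨ D + n ≤ A) (hA : A + n ≤ fp) (hD : D + n ≤ fp)
    (hit : Items μ A (A + n)) (hnd : (ms μ A (A + n)).Nodup) :
    Tr k B (.box (sortArea A D n fp) {a | a = fp + 5 ∨ A ≤ a ∧ a < A + n ∨ D ≤ a ∧ a < D + n ∨
        fp + 10 + 4 * m ≤ a ∧ a < fp + 16 * n + 32})
      (((m + 1) * 100 : ℕ) + ∑ i ∈ range m, T (edge n m (i + 1) - edge n m i))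
      (columnLoop f fp) μ fun _ μ' =>
      ∀ i < m, ms μ' (D + edge n m i) (D + edge n m (i + 1)) =
        ms μ (A + edge n m i) (A + edge n m (i + 1)) ∧
        Sorted μ' (D + edge n m i) (D + edge n m (i + 1)) := by
  refine segments_tr hp hk h.count (Or.inl rfl) h5 (edge n m) (fun i _ => edge_mono n m (by omega))
    (edge_le _ _ _) hAD hA hD (fun i _ => ?_) hit hnd (by decide) ?_
  · have := edge_succ_le n m i
    omega
  · intro i hi μ' h5' hμ' W
    obtain ⟨e1, e2, e3, e4⟩ := h.of_eq (μ' := μ') fun x h h' => hμ' x h (by omega) (by omega)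
    have hS' := hS.of_eq (μ' := μ') fun x h h' => hμ' x (by omega) (by omega) (by omega)
    have hrd : ∀ c, fp ≤ c → c < fp + 16 * n + 32 → ∀ μ : Mem α,
        (Policy.box (sortArea A D n fp) W).rd μ c := fun c h h' μ => Or.inl ⟨h, h'⟩
    have c1 : Eval (.box (sortArea A D n fp) W) (deref (lit (fp + 9) + v (fp + 5))) μ'
        (fp + 10 + 4 * m) (edge n m i) :=
      (Eval.lit.add (Eval.v (by omega) h5' (hrd _ (by omega) (by omega)))).deref (by omega)
        (hS'.col i hi) (hrd _ (by omega) (by omega))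
    have c2 : Eval (.box (sortArea A D n fp) W) (deref (lit (fp + 9) + v (fp + 4) + v (fp + 5))) μ'
        (fp + 10 + 4 * m) (edge n m (i + 1)) :=
      ((Eval.lit.add (Eval.v (by omega) e4 (hrd _ (by omega) (by omega)))).add
        (Eval.v (by omega) h5' (hrd _ (by omega) (by omega)))).deref (by omega)
        (hS'.colEnd i hi) (hrd _ (by omega) (by omega))
    exact .cons ((Eval.v (by omega) e1 (hrd _ (by omega) (by omega))).add c1)
      (.cons ((Eval.v (by omega) e2 (hrd _ (by omega) (by omega))).add c1)
      (.cons (c2.sub c1) .nil))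

theorem bucketLoop_tr {T : ℕ → ℝ≥0∞} (hp : SortSpec α k B T (squareSort f)) (hk : 2 ≤ k)
    (h : Locals A D n m fp μ) (h6 : μ (fp + 6) = .num 0) (u : ℕ → ℕ)
    (hu : ∀ i < m, u i < u (i + 1)) (hu0 : u 0 = 0) (hun : u m = n)
    (hb : ∀ j ≤ m, μ (fp + 9 + 3 * m + j) = .num (u j)) (h5m : 5 ≤ m) (h3m : 3 * m ≤ n)
    (hAD : A + n ≤ D ∨ D + n ≤ A) (hA : A + n ≤ fp) (hD : D + n ≤ fp)
    (hit : Items μ A (A + n)) (hnd : (ms μ A (A + n)).Nodup) :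
    Tr k B (.box (sortArea A D n fp) {a | a = fp + 6 ∨ A ≤ a ∧ a < A + n ∨ D ≤ a ∧ a < D + n ∨
        fp + 10 + 4 * m ≤ a ∧ a < fp + 16 * n + 32})
      (((m + 1) * 100 : ℕ) + ∑ i ∈ range m, T (u (i + 1) - u i))
      (bucketLoop f fp) μ fun _ μ' =>
      ∀ i < m, ms μ' (D + u i) (D + u (i + 1)) = ms μ (A + u i) (A + u (i + 1)) ∧
        Sorted μ' (D + u i) (D + u (i + 1)) := by
  refine segments_tr hp hk h.count (Or.inr rfl) h6 u (fun i hi => (hu i hi).le) hun.le hAD hA hD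
    (fun i hi => ?_) hit hnd (by decide) ?_
  · -- the other `m - 1` buckets are not empty
    have h1 : ∀ j ≤ m, j ≤ u j := fun j hj => by
      induction j with
      | zero => omega
      | succ j ih => have := hu j (by omega); have := ih (by omega); omega
    have h2 : ∀ j, i + 1 + j ≤ m → u (i + 1) + j ≤ u (i + 1 + j) := fun j hj => by
      induction j with
      | zero => rfl
      | succ j ih =>
        have := hu (i + 1 + j) (by omega)
        have := ih (by omega)
        rw [← add_assoc (i + 1)]
        omega
    have h3 := h1 i hi.le
    have h4 := h2 (m - (i + 1)) (by omega)
    rw [show i + 1 + (m - (i + 1)) = m by omega] at h4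
    omega
  · intro i hi μ' h6' hμ' W
    obtain ⟨e1, e2, e3, e4⟩ := h.of_eq (μ' := μ') fun x h h' => hμ' x h (by omega) (by omega)
    have hrd : ∀ c, fp ≤ c → c < fp + 16 * n + 32 → ∀ μ : Mem α,
        (Policy.box (sortArea A D n fp) W).rd μ c := fun c h h' μ => Or.inl ⟨h, h'⟩
    have c0 : Eval (.box (sortArea A D n fp) W) (lit (fp + 9) + 3 * v (fp + 4) + v (fp + 6)) μ'
        (fp + 10 + 4 * m) (fp + 9 + 3 * m + i) :=
      ((Eval.lit.add (Eval.ofNat.mul (Eval.v (by omega) e4 (hrd _ (by omega) (by omega))))).add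
        (Eval.v (by omega) h6' (hrd _ (by omega) (by omega))))
    have c1 := c0.deref (by omega) ((hμ' _ (by omega) (by omega) (by omega)).trans (hb i hi.le))
      (hrd _ (by omega) (by omega))
    have c2 := (c0.add Eval.one).deref (by omega)
      ((hμ' _ (by omega) (by omega) (by omega)).trans (hb (i + 1) hi)) (hrd _ (by omega) (by omega))
    exact .cons ((Eval.v (by omega) e1 (hrd _ (by omega) (by omega))).add c1)
      (.cons ((Eval.v (by omega) e2 (hrd _ (by omega) (by omega))).add c1)
      (.cons (c2.sub c1) .nil))

/-! ### Checking a sample of pivots -/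

/-- The sample is kept if and only if the sorted sample has distinct entries and its least entry
exceeds the first item of some column. -/
theorem checkSample_tr (hB : 64 ≤ B) (hk : B ≤ k) (h : Locals A D n m fp μ) (hS : Spans n m fp μ)
    (h5m : 5 ≤ m) (h3m : 3 * m ≤ n) (hD : D + n ≤ fp)
    (hP : Items μ (fp + 9 + 2 * m) (fp + 9 + 2 * m + (m - 1))) :
    Tr k B (.box (sortArea A D n fp) {a | a = fp + 5 ∨ a = fp + 7 ∨ a = fp + 8 ∨
        fp + 9 + 2 * m ≤ a ∧ a < fp + 9 + 2 * m + (m - 1) ∨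
        fp + 10 + 4 * m ≤ a ∧ a < fp + 16 * n + 32})
      (((m + m * m / B + 1) * 41000 : ℕ) : ℝ≥0∞) (checkSample f fp) μ fun _ μ' =>
      ms μ' (fp + 9 + 2 * m) (fp + 9 + 2 * m + (m - 1)) =
        ms μ (fp + 9 + 2 * m) (fp + 9 + 2 * m + (m - 1)) ∧
      Sorted μ' (fp + 9 + 2 * m) (fp + 9 + 2 * m + (m - 1)) ∧
      ∃ b : ℕ, μ' (fp + 8) = .num b ∧ (0 < b ↔ (∀ i, i + 2 < m →
        (μ' (fp + 9 + 2 * m + i)).lt (μ' (fp + 9 + 2 * m + i + 1)) = true) ∧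
        ∃ i < m, edge n m i < edge n m (i + 1) ∧
          (μ (D + edge n m i)).lt (μ' (fp + 9 + 2 * m)) = true) := by
  have hk2 : 2 ≤ k := by omega
  obtain ⟨S, hS'⟩ : ∃ S : Set ℕ, S = sortArea A D n fp := ⟨_, rfl⟩
  have hSm := mem_sortArea A D n fp
  rw [← hS'] at hSm
  rw [← hS']
  obtain ⟨W, hW⟩ : ∃ W : Set ℕ, W = {a | a = fp + 5 ∨ a = fp + 7 ∨ a = fp + 8 ∨
        fp + 9 + 2 * m ≤ a ∧ a < fp + 9 + 2 * m + (m - 1) ∨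
        fp + 10 + 4 * m ≤ a ∧ a < fp + 16 * n + 32} := ⟨_, rfl⟩
  have hWm : ∀ a, a ∈ W ↔ a = fp + 5 ∨ a = fp + 7 ∨ a = fp + 8 ∨
        fp + 9 + 2 * m ≤ a ∧ a < fp + 9 + 2 * m + (m - 1) ∨
        fp + 10 + 4 * m ≤ a ∧ a < fp + 16 * n + 32 := fun a => hW ▸ Iff.rfl
  rw [← hW]
  obtain ⟨P, hPd⟩ : ∃ P, P = fp + 9 + 2 * m := ⟨_, rfl⟩
  have hPd' : P + (m - 1) + 1 = fp + 9 + 3 * m := by omega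
  obtain ⟨q, hq⟩ : ∃ q, q = m - 1 := ⟨_, rfl⟩
  obtain ⟨t, ht⟩ : ∃ t, t = fp + 10 + 4 * m := ⟨_, rfl⟩
  simp only [← hPd, ← hq, ← ht] at hP hWm hPd' ⊢
  unfold checkSample
  have hrd : ∀ c, fp ≤ c → c < fp + 16 * n + 32 → ∀ μ : Mem α, (Policy.box S W).rd μ c :=
    fun c h h' μ => (hSm c).2 (Or.inl ⟨h, h'⟩)
  have htop : Eval (.box S W) (lit (fp + 10) + 4 * v (fp + 4)) μ t t := by
    have := (Eval.lit (π := .box S W) (μ := μ) (s := t) (a := fp + 10)).add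
      ((Eval.ofNat (a := 4)).mul (Eval.v (c := fp + 4) (by omega) h.count
        (hrd _ (by omega) (by omega))))
    rwa [← ht] at this
  have h1 : Eval (.box S W) (lit (fp + 9) + 2 * v (fp + 4)) μ t P := by
    have := (Eval.lit (π := .box S W) (μ := μ) (s := t) (a := fp + 9)).add
      ((Eval.ofNat (a := 2)).mul (Eval.v (c := fp + 4) (by omega) h.count
        (hrd _ (by omega) (by omega))))
    rwa [← hPd] at this
  have h2 : Eval (.box S W) (v (fp + 4) - 1) μ t q := by
    rw [hq]
    exact (Eval.v (by omega) h.count (hrd _ (by omega) (by omega))).sub Eval.one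
  have hsq : q * q / B ≤ m * m / B := Nat.div_le_div_right
      (by rw [hq]; exact Nat.mul_le_mul (by omega) (by omega))
  -- the call of merge sort
  have c1 : Tr k B (.box S W) ((2 * 30 : ℕ) + (((q + q * q / B + 1) * 40000 : ℕ) : ℝ≥0∞))
      (call fp (lit (fp + 10) + 4 * v (fp + 4)) [lit (fp + 9) + 2 * v (fp + 4), v (fp + 4) - 1]
      (mergeSort f)) μ fun _ μ' => (ms μ' P (P + q) = ms μ P (P + q) ∧ Sorted μ' P (P + q)) := by
    refine Tr.call 30 hk2 (by decide) htop (.cons h1 (.cons h2 .nil)) (fun μ' y d h h' => ?_) ?_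
    · simp only [List.length_cons, List.length_nil] at h'
      rw [box_wr, hWm]; omega
    · intro μ₁ g1 g2
      simp only [List.length_cons, List.length_nil] at g2
      have e1 : μ₁ (t + 1) = _ := g1 0 _ rfl
      have e2 : μ₁ (t + 2) = _ := g1 1 _ rfl
      have eP : ∀ a, P ≤ a → a < P + q → μ₁ a = μ a := fun a _ _ => g2 a (by omega)
      refine ((mergeSort_cost hB hk e1 e2 (by omega) (hP.of_ms (ms_congr eP))).box_mono
        ?_ ?_).mono le_rfl ?_
      · intro a ha
        rw [hSm]
        simp only [Set.mem_ofPred_eq] at ha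
        omega
      · intro a ha
        rw [hWm]
        simp only [Set.mem_ofPred_eq] at ha
        omega
      · rintro _ μ' ⟨h3, h4⟩
        exact ⟨hrd _ (by omega) (by omega) _, h3.trans (ms_congr eP), h4⟩
  have cW : Tr k B (.box S W) ((2 * 30 : ℕ) + (((q + q * q / B + 1) * 40000 : ℕ) : ℝ≥0∞))
      (call fp (lit (fp + 10) + 4 * v (fp + 4)) [lit (fp + 9) + 2 * v (fp + 4), v (fp + 4) - 1]
      (mergeSort f)) μ fun _ μ' => (ms μ' P (P + q) = ms μ P (P + q) ∧ Sorted μ' P (P + q)) ∧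
        ∀ a ∉ W, μ' a = μ a := c1.box_frame
  refine (cW.bind (e' := (((m + 1) * 200 : ℕ) : ℝ≥0∞)) ?_).mono ?_ fun _ _ h => h
  swap
  · simp only [← Nat.cast_add, Nat.cast_le]
    generalize m * m / B = x at *
    generalize q * q / B = y at *
    omega
  rintro _ μ₁ ⟨⟨p1, p2⟩, fr₁⟩
  have hWn : ∀ a, fp ≤ a → a < P → a ≠ fp + 5 → a ≠ fp + 7 → a ≠ fp + 8 → a ∉ W :=
      fun a _ _ _ _ _ => by
    rw [hWm]; omega
  have l₁ := h.of_eq (μ' := μ₁) fun x h h' => fr₁ x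
      (hWn x (by omega) (by omega) (by omega) (by omega) (by omega))
  have s₁ := hS.of_eq (μ' := μ₁) fun x h h' => fr₁ x
      (hWn x (by omega) (by omega) (by omega) (by omega) (by omega))
  refine (Tr.step (e := (((m + 1) * 190 : ℕ) : ℝ≥0∞)) 1 hk2 (by decide) ?_).mono ?_ fun _ _ h => h
  swap
  · norm_cast; omega
  simp only [safe_rules, cell_rules, hWm]
  refine ⟨by simp, ?_⟩
  refine (Tr.step (e := (((m + 1) * 180 : ℕ) : ℝ≥0∞)) 1 hk2 (by decide) ?_).mono ?_ fun _ _ h => h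
  swap
  · norm_cast; omega
  simp only [safe_rules, cell_rules, hWm]
  refine ⟨by simp, ?_⟩
  obtain ⟨μ₂, hμ₂⟩ : ∃ m, m = update (update μ₁ (fp + 8) (.num 1)) (fp + 5)
    (.num 0) := ⟨_, rfl⟩
  rw [← hμ₂]
  have v₂ : ∀ x, x ≠ fp + 8 → x ≠ fp + 5 → μ₂ x = μ₁ x := fun x hx hx' => by
    rw [hμ₂, update_of_ne hx', update_of_ne hx]
  have l₂ := l₁.of_eq (μ' := μ₂) fun x h h' => v₂ x (by omega) (by omega)
  have s₂ := s₁.of_eq (μ' := μ₂) fun x h h' => v₂ x (by omega) (by omega)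
  have e8 : μ₂ (fp + 8) = .num 1 := by
    rw [hμ₂, update_of_ne (by omega), update_self]
  refine (Tr.bind (((distinctLoop_tr (f := f) hk2 l₂ (by rw [hμ₂, update_self])
      e8)).box_frame.box_mono
    (fun a ha => ?_) (fun a ha => ?_)) (e' := (((m + 1) * 120 : ℕ) : ℝ≥0∞)) ?_).mono ?_
        fun _ _ h => h
  · rw [hSm]
    simp only [Set.mem_ofPred_eq] at ha
    omega
  · rw [hWm]
    simp only [Set.mem_ofPred_eq] at ha
    omega
  swap
  · norm_cast; omega
  rintro _ μ₃ ⟨⟨b, b1, b2⟩, fr₃⟩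
  simp only [mem_rules, not_or] at fr₃
  refine (Tr.step (e := (((m + 1) * 110 : ℕ) : ℝ≥0∞)) 1 hk2 (by decide) ?_).mono ?_ fun _ _ h => h
  swap
  · norm_cast; omega
  simp only [safe_rules, cell_rules, hWm]
  refine ⟨by simp, ?_⟩
  refine (Tr.step (e := (((m + 1) * 100 : ℕ) : ℝ≥0∞)) 1 hk2 (by decide) ?_).mono ?_ fun _ _ h => h
  swap
  · norm_cast; omega
  simp only [safe_rules, cell_rules, hWm]
  refine ⟨by simp, ?_⟩
  obtain ⟨μ₄, hμ₄⟩ : ∃ m, m = update (update μ₃ (fp + 7) (.num 0)) (fp + 5)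
    (.num 0) := ⟨_, rfl⟩
  rw [← hμ₄]
  have v₄ : ∀ x, x ≠ fp + 7 → x ≠ fp + 5 → μ₄ x = μ₃ x := fun x hx hx' => by
    rw [hμ₄, update_of_ne hx', update_of_ne hx]
  have w₄ : ∀ x, x ≠ fp + 5 → x ≠ fp + 7 → x ≠ fp + 8 → μ₄ x = μ₁ x := fun x h h' h'' => by
    rw [v₄ x h' h, fr₃ x ⟨h, h''⟩, v₂ x h'' h]
  have l₄ := l₁.of_eq (μ' := μ₄) fun x h h' => w₄ x (by omega) (by omega) (by omega)
  have s₄ := s₁.of_eq (μ' := μ₄) fun x h h' => w₄ x (by omega) (by omega) (by omega)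
  have e7 : μ₄ (fp + 7) = .num 0 := by
    rw [hμ₄, update_of_ne (by omega), update_self]
  refine (Tr.bind (((minimumLoop_tr (f := f) hk2 l₄ s₄ (by omega) hD (by rw [hμ₄, update_self])
      e7)).box_frame.box_mono
    (fun a ha => ?_) (fun a ha => ?_)) (e' := (((m + 1) * 30 : ℕ) : ℝ≥0∞)) ?_).mono ?_
        fun _ _ h => h
  · rw [hSm]
    simp only [Set.mem_ofPred_eq] at ha
    omega
  · rw [hWm]
    simp only [Set.mem_ofPred_eq] at ha
    omega
  swap
  · norm_cast; omega
  rintro _ μ₅ ⟨⟨c, d1, d2⟩, fr₅⟩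
  simp only [mem_rules, not_or] at fr₅
  have w₅ : ∀ x, x ≠ fp + 5 → x ≠ fp + 7 → x ≠ fp + 8 → μ₅ x = μ₁ x := fun x h h' h'' => by
    rw [fr₅ x ⟨h, h'⟩, w₄ x h h' h'']
  have x8 : μ₅ (fp + 8) = .num b := by
    rw [fr₅ _ ⟨by omega, by omega⟩, v₄ _ (by omega) (by omega), b1]
  have x8' : ∀ c, update μ₅ (fp + 8) c (fp + 8) = c := fun c => update_self _ _ _
  have fin : ∀ (μ' : Mem α) (b' : ℕ), μ' (fp + 8) = .num b' → (0 < b' ↔ 0 < b ∧ 0 < c) →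
      (∀ x, P ≤ x → x < P + q → μ' x = μ₅ x) →
      ms μ' P (P + q) = ms μ P (P + q) ∧ Sorted μ' P (P + q) ∧ ∃ b : ℕ, μ' (fp + 8) = .num b ∧
        (0 < b ↔ (∀ i, i + 2 < m → (μ' (P + i)).lt (μ' (P + i + 1)) = true) ∧
        ∃ i < m, edge n m i < edge n m (i + 1) ∧ (μ (D + edge n m i)).lt (μ' P) = true) := by
    intro μ' b' hb hbc hμ'
    have hμ'₁ : ∀ x, P ≤ x → x < P + q → μ' x = μ₁ x := fun x h h' => by
      rw [hμ' x h h', w₅ x (by omega) (by omega) (by omega)]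
    refine ⟨(ms_congr hμ'₁).trans p1, p2.congr fun x h h' => hμ'₁ x h h', b', hb, ?_⟩
    simp only [← hPd] at b2 d2
    rw [hbc, b2, d2, hμ'₁ P (by omega) (by omega), w₄ P (by omega) (by omega) (by omega)]
    refine and_congr (forall₂_congr fun i hi => ?_) (exists_congr fun i => and_congr_right fun hi =>
      and_congr_right fun hlt => ?_)
    · rw [hμ'₁ _ (by omega) (by omega), hμ'₁ _ (by omega) (by omega),
        v₂ _ (by omega) (by omega), v₂ _ (by omega) (by omega)]
    · have := edge_le n m (i + 1)
      rw [w₄ _ (by omega) (by omega) (by omega), fr₁ _ (by rw [hWm]; omega)]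
  obtain ⟨J, hJ⟩ : ∃ J : Mem α → Prop, ∀ μ', J μ' ↔ ms μ' P (P + q) = ms μ P (P + q) ∧
      Sorted μ' P (P + q) ∧ ∃ b : ℕ, μ' (fp + 8) = .num b ∧
        (0 < b ↔ (∀ i, i + 2 < m → (μ' (P + i)).lt (μ' (P + i + 1)) = true) ∧
        ∃ i < m, edge n m i < edge n m (i + 1) ∧ (μ (D + edge n m i)).lt (μ' P) = true) :=
    ⟨_, fun _ => Iff.rfl⟩
  refine (Tr.of_len (Q := fun _ => J) 6 hk2 (by decide) ?_).mono ?_ fun _ μ' h => (hJ μ').1 h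
  · simp only [safe_rules, cell_rules, hWm, hSm, d1]
    refine ⟨by omega, ?_⟩
    by_cases hc : c < 1
    · simp only [hc, decide_true, if_true]
      exact ⟨by simp, (hJ _).2 (fin _ 0 (x8' _) (by omega)
        fun x h h' => update_of_ne (by omega) _ _)⟩
    · simp only [hc, decide_false, Bool.false_eq_true, if_false]
      exact (hJ _).2 (fin _ b x8 (by omega) fun x h h' => rfl)
  · norm_cast; omega

/-! ### Counting the items of the buckets -/

/-- The pivots `piv` cut the `i`-th column of `d` at the indices `r i j`. -/
structure Cuts (n m : ℕ) (d piv : ℕ → Cell α) (r : ℕ → ℕ → ℕ) : Prop where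
  zero : ∀ i < m, r i 0 = edge n m i
  last : ∀ i < m, r i m = edge n m (i + 1)
  mono : ∀ i < m, ∀ j < m, r i j ≤ r i (j + 1)
  below : ∀ i < m, ∀ j < m, ∀ x, r i j ≤ x → x < r i (j + 1) → (d x).lt (piv j) = true
  ends : ∀ i < m, ∀ j < m, r i (j + 1) < r i m → (d (r i (j + 1))).lt (piv j) = false

theorem Cuts.mono_of_le {d piv : ℕ → Cell α} {r : ℕ → ℕ → ℕ} (h : Cuts n m d piv r) {i : ℕ}
    (hi : i < m) {j j' : ℕ} (hj : j ≤ j') (hj' : j' ≤ m) : r i j ≤ r i j' := by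
  induction j', hj using Nat.le_induction with
  | base => exact le_rfl
  | succ j' hj ih => exact (ih (by omega)).trans (h.mono i hi j' (by omega))

/-- The accesses of `scanLoop` in the column `i`: apart from constantly many cells, they follow the
position `t` in the column, which stays below `e`, and the number `j` of the current bucket. -/
def scanPolicy (α : Type*) (D m fp i e : ℕ) : Policy α where
  rd μ a := fp ≤ a ∧ a ≤ fp + 8 ∨ a = fp + 9 + m + i ∨
    a = D + (μ (fp + 7)).toNat ∧ (μ (fp + 7)).toNat < e ∨
    (a = fp + 9 + 2 * m + (μ (fp + 6)).toNat ∨ a = fp + 10 + 3 * m + (μ (fp + 6)).toNat) ∧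
      (μ (fp + 6)).toNat < m
  wr μ a c := (a = fp + 6 ∧ c = .num ((μ a).toNat + 1) ∧ (μ a).toNat + 1 < m) ∨
    (a = fp + 7 ∧ c = .num ((μ a).toNat + 1) ∧ (μ a).toNat < e) ∨
    a = fp + 10 + 3 * m + (μ (fp + 6)).toNat ∧ (μ (fp + 6)).toNat < m

theorem scanLoop_safe {r : ℕ → ℕ → ℕ} {i : ℕ} (h : Locals A D n m fp μ) (hS : Spans n m fp μ)
    (hr : Cuts n m (fun x => μ (D + x)) (fun j => μ (fp + 9 + 2 * m + j)) r) (hi : i < m)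
    (h5 : μ (fp + 5) = .num i) (h6 : μ (fp + 6) = .num 0) (h7 : μ (fp + 7) = .num (r i 0))
    (hD : D + n ≤ fp) (c : ℕ → ℕ) (hc : ∀ j < m, μ (fp + 9 + 3 * m + j + 1) = .num (c j)) :
    Safe (scanPolicy α D m fp i (r i m)) (scanLoop f fp) μ fun _ μ' =>
      ∀ j < m, μ' (fp + 9 + 3 * m + j + 1) = .num (c j + (r i (j + 1) - r i j)) := by
  unfold scanLoop
  obtain ⟨I, hI⟩ : ∃ I : Mem α → Prop, ∀ μ', I μ' ↔
      (∀ a, a ≠ fp + 6 → a ≠ fp + 7 → a < fp + 10 + 3 * m → μ' a = μ a) ∧ ∃ j t,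
      μ' (fp + 6) = .num j ∧ μ' (fp + 7) = .num t ∧ j < m ∧ r i j ≤ t ∧ t ≤ r i (j + 1) ∧
      (∀ x < j, μ' (fp + 9 + 3 * m + x + 1) = .num (c x + (r i (x + 1) - r i x))) ∧
      μ' (fp + 9 + 3 * m + j + 1) = .num (c j + (t - r i j)) ∧
      ∀ x, j < x → x < m → μ' (fp + 9 + 3 * m + x + 1) = .num (c x) := ⟨_, fun _ => Iff.rfl⟩
  refine Safe.loop I f ((hI _).2 ⟨fun _ _ _ _ => rfl, 0, r i 0, h6, h7, by omega, le_rfl,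
    hr.mono i hi 0 (by omega), by omega, ?_, fun x _ hx => hc x hx⟩) ?_
  · rw [hc 0 (by omega), Nat.sub_self, Nat.add_zero]
  intro μ' hμ'
  obtain ⟨g0, j, t, e6, e7, hj, ht, ht', g1, g2, g3⟩ := (hI _).1 hμ'
  obtain ⟨e1, e2, e3, e4⟩ := h.of_eq (μ' := μ') fun x h h' => g0 x (by omega) (by omega) (by omega)
  have e5 := (g0 (fp + 5) (by omega) (by omega) (by omega)).trans h5
  have eE : μ' (fp + 9 + m + i) = .num (r i m) := by
    rw [g0 _ (by omega) (by omega) (by omega), hS.colEnd i hi, hr.last i hi]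
  have eP : μ' (fp + 9 + 2 * m + j) = μ (fp + 9 + 2 * m + j) :=
    g0 _ (by omega) (by omega) (by omega)
  have hrm : r i m ≤ n := by rw [hr.last i hi]; exact edge_le _ _ _
  obtain ⟨π, hπ⟩ : ∃ π, π = scanPolicy α D m fp i (r i m) := ⟨_, rfl⟩
  have r0 : ∀ μ a, fp ≤ a → a ≤ fp + 8 → π.rd μ a := fun _ _ h h' => hπ ▸ Or.inl ⟨h, h'⟩
  have r1 : ∀ μ, π.rd μ (fp + 9 + m + i) := fun _ => hπ ▸ Or.inr (Or.inl rfl)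
  have r2 : t < r i m → π.rd μ' (D + t) := fun h =>
    hπ ▸ Or.inr (Or.inr (Or.inl (by rw [e7]; exact ⟨rfl, h⟩)))
  have r3 : π.rd μ' (fp + 9 + 2 * m + j) :=
    hπ ▸ Or.inr (Or.inr (Or.inr (by rw [e6]; exact ⟨Or.inl rfl, hj⟩)))
  have r4 : π.rd μ' (fp + 9 + 3 * m + j + 1) :=
    hπ ▸ Or.inr (Or.inr (Or.inr (by
      rw [e6]; exact ⟨Or.inr (by simp only [toNat_num]; omega), hj⟩)))
  have w1 : ∀ c, π.wr μ' (fp + 9 + 3 * m + j + 1) c := fun c =>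
    hπ ▸ Or.inr (Or.inr (by rw [e6]; exact ⟨by simp only [toNat_num]; omega, hj⟩))
  have w2 : ∀ μ₁ : Mem α, μ₁ (fp + 7) = .num t → t < r i m → π.wr μ₁ (fp + 7) (.num (t + 1)) :=
    fun μ₁ h h' => hπ ▸ Or.inr (Or.inl ⟨rfl, by rw [h]; rfl, by rwa [h]⟩)
  have w3 : j + 1 < m → π.wr μ' (fp + 6) (.num (j + 1)) :=
    fun h' => hπ ▸ Or.inl ⟨rfl, by rw [e6]; rfl, by rwa [e6]⟩
  rw [← hπ]
  by_cases hlt : t < r i m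
  · have eD : μ' (D + t) = μ (D + t) := g0 _ (by omega) (by omega) (by omega)
    simp only [safe_rules, cell_rules, e2, e4, e5, e6, e7, eE, hlt, decide_true,
      if_true, eD, eP]
    by_cases hcmp : (μ (D + t)).lt (μ (fp + 9 + 2 * m + j)) = true
    · have ht2 : t < r i (j + 1) := by
        refine lt_of_le_of_ne ht' fun heq => ?_
        have := hr.ends i hi j hj (heq ▸ hlt)
        simp only [← heq, hcmp] at this
        exact absurd this (by simp)
      have u6 : ∀ c, update μ' (fp + 9 + 3 * m + j + 1) c (fp + 6) = .num j :=
        fun c => (update_of_ne (by omega) _ _).trans e6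
      have u7 : ∀ c, update μ' (fp + 9 + 3 * m + j + 1) c (fp + 7) = .num t :=
        fun c => (update_of_ne (by omega) _ _).trans e7
      simp only [hcmp, if_true, u7, g2, cell_rules]
      constructorm* _ ∧ _
      any_goals first | exact r0 _ _ (by omega) (by omega) | exact r1 _ | exact r2 hlt | exact r3
                      | exact r4 | exact w1 _
      any_goals first | exact w2 _ e7 hlt | exact w2 _ (u7 _) hlt
      refine (hI _).2 ⟨fun a h h' h'' => ?_, j, t + 1, ?_, ?_, hj, by omega, ht2, fun x hx => ?_,
        ?_, fun x hx hx' => ?_⟩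
      · rw [update_of_ne h', update_of_ne (by omega), g0 a h h' h'']
      · rw [update_of_ne (by omega), u6]
      · rw [update_self]
      · rw [update_of_ne (by omega), update_of_ne (by omega), g1 x hx]
      · rw [update_of_ne (by omega), update_self]
        congr 1
        omega
      · rw [update_of_ne (by omega), update_of_ne (by omega), g3 x hx hx']
    · have ht2 : t = r i (j + 1) := by
        refine le_antisymm ht' (not_lt.1 fun hlt => hcmp (hr.below i hi j hj t ht hlt))
      have hj1 : j + 1 < m := by
        refine lt_of_le_of_ne hj fun heq => ?_
        rw [heq] at ht2
        omega
      simp only [hcmp, Bool.false_eq_true, if_false]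
      constructorm* _ ∧ _
      any_goals first | exact r0 _ _ (by omega) (by omega) | exact r1 _ | exact r2 hlt | exact r3
                      | exact w3 hj1
      refine (hI _).2 ⟨fun a h h' h'' => ?_, j + 1, t, ?_, ?_, hj1, ht2.ge,
        ht2.le.trans (hr.mono i hi _ hj1), fun x hx => ?_, ?_, fun x hx hx' => ?_⟩
      · rw [update_of_ne h, g0 a h h' h'']
      · rw [update_self]
      · rw [update_of_ne (by omega), e7]
      · rw [update_of_ne (by omega)]
        rcases (show x ≤ j by omega).eq_or_lt with rfl | h
        · rw [g2, ht2]
        · exact g1 x h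
      · rw [update_of_ne (by omega), g3 _ (by omega) hj1, ht2, Nat.sub_self]
        rfl
      · rw [update_of_ne (by omega), g3 _ (by omega) hx']
  · simp only [safe_rules, cell_rules, e4, e5, e7, eE, hlt, decide_false,
      Bool.false_eq_true, if_false]
    constructorm* _ ∧ _
    any_goals first | exact r0 _ _ (by omega) (by omega) | exact r1 _
    intro x hx
    have hj1 := hr.mono_of_le hi (show j + 1 ≤ m by omega) le_rfl
    rcases lt_trichotomy x j with h | rfl | h
    · exact g1 x h
    · rw [g2]
      congr 2
      omega
    · rw [g3 x h hx]
      have h1 := hr.mono_of_le hi (show j + 1 ≤ x by omega) hx.le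
      have h2 := hr.mono_of_le hi (show x + 1 ≤ m by omega) le_rfl
      have h3 := hr.mono i hi x hx
      congr 1
      omega

theorem scanLoop_tr (hB : 64 ≤ B) (hk : B ≤ k) {r : ℕ → ℕ → ℕ} {i : ℕ} (h : Locals A D n m fp μ)
    (hS : Spans n m fp μ)
    (hr : Cuts n m (fun x => μ (D + x)) (fun j => μ (fp + 9 + 2 * m + j)) r) (hi : i < m)
    (h5 : μ (fp + 5) = .num i) (h6 : μ (fp + 6) = .num 0) (h7 : μ (fp + 7) = .num (r i 0))
    (hD : D + n ≤ fp) (c : ℕ → ℕ) (hc : ∀ j < m, μ (fp + 9 + 3 * m + j + 1) = .num (c j)) :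
    Tr k B (.box {a | fp ≤ a ∧ a < fp + 10 + 4 * m ∨ D ≤ a ∧ a < D + n}
      {a | a = fp + 6 ∨ a = fp + 7 ∨ fp + 10 + 3 * m ≤ a ∧ a < fp + 10 + 4 * m})
      ((20 + 6 * (m / B) : ℕ) : ℝ≥0∞) (scanLoop f fp) μ fun _ μ' =>
      ∀ j < m, μ' (fp + 9 + 3 * m + j + 1) = .num (c j + (r i (j + 1) - r i j)) := by
  have key := scanLoop_safe (f := f) h hS hr hi h5 h6 h7 hD c hc
  have hrm : r i m ≤ n := by rw [hr.last i hi]; exact edge_le _ _ _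
  refine Tr.imp (π := scanPolicy α D m fp i (r i m)) ⟨key, ?_⟩ ?_ ?_
  · obtain ⟨P, hP⟩ : ∃ P : Finset (ℕ × ℕ), P = {(D, fp + 7), (fp + 9 + 2 * m, fp + 6),
      (fp + 10 + 3 * m, fp + 6)} := ⟨_, rfl⟩
    have hPm : ∀ x, x ∈ P ↔ x = (D, fp + 7) ∨ x = (fp + 9 + 2 * m, fp + 6) ∨
      x = (fp + 10 + 3 * m, fp + 6) := by simp [hP]
    have hPc : P.card ≤ 3 := hP ▸ Finset.card_le_three
    obtain ⟨lim, hlim⟩ : ∃ lim : ℕ × ℕ → ℕ, ∀ x, lim x = if x.2 = fp + 7 then D + r i m else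
      x.1 + m := ⟨_, fun _ => rfl⟩
    have p1 : ptr μ (D, fp + 7) = D + r i 0 := by simp [ptr, h7]
    have p2 : ∀ a, ptr μ (a, fp + 6) = a := by simp [ptr, h6]
    have l1 : lim (D, fp + 7) = D + r i m := by rw [hlim, if_pos rfl]
    have l2 : ∀ a, lim (a, fp + 6) = a + m := fun a => by rw [hlim, if_neg (by simp)]
    have hR : (blocks B fp (fp + 8) ∪ {(fp + 9 + m + i) / B}).card ≤ 3 := by
      have := card_blocks (B := B) (by omega) fp 8
      rw [Nat.div_eq_of_lt (by omega)] at this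
      exact (card_union_le _ _).trans (by simp; omega)
    have hlen : r i m ≤ r i 0 + m := by
      rw [hr.last i hi, hr.zero i hi]
      exact edge_succ_le _ _ _
    have hle : ∀ x ∈ P, ptr μ x ≤ lim x ∧ lim x ≤ ptr μ x + m := by
      intro x hx
      rcases (hPm x).1 hx with rfl | rfl | rfl
      · rw [p1, l1]
        have := hr.mono_of_le hi (Nat.zero_le m) le_rfl
        omega
      · rw [p2, l2]; omega
      · rw [p2, l2]; omega
    refine (Cost.of_pointers (blocks B fp (fp + 8) ∪ {(fp + 9 + m + i) / B}) P lim key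
      (fun x hx => (hle x hx).1) (by omega) ?_ ?_).mono ?_ fun _ _ h => h
    · rintro μ' a (⟨h, h'⟩ | rfl | ⟨rfl, h'⟩ | ⟨rfl | rfl, h'⟩)
      · exact Or.inl (mem_union_left _ (mem_blocks h h'))
      · exact Or.inl (mem_union_right _ (Finset.mem_singleton_self _))
      · exact Or.inr ⟨_, (hPm _).2 (Or.inl rfl), rfl⟩
      · exact Or.inr ⟨_, (hPm _).2 (Or.inr (Or.inl rfl)), rfl⟩
      · exact Or.inr ⟨_, (hPm _).2 (Or.inr (Or.inr rfl)), rfl⟩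
    · rintro μ' a c (⟨rfl, rfl, h'⟩ | ⟨rfl, rfl, h'⟩ | ⟨rfl, h'⟩)
      · refine ⟨Or.inl (mem_union_left _ (mem_blocks (by omega) (by omega))),
          fun x hx hxa => ⟨rfl, ?_⟩⟩
        rcases (hPm x).1 hx with rfl | rfl | rfl
        · simp at hxa
        · rw [l2]; simp only [ptr]; omega
        · rw [l2]; simp only [ptr]; omega
      · refine ⟨Or.inl (mem_union_left _ (mem_blocks (by omega) (by omega))),
          fun x hx hxa => ⟨rfl, ?_⟩⟩
        rcases (hPm x).1 hx with rfl | rfl | rfl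
        · rw [l1]; simp only [ptr]; omega
        · simp at hxa
        · simp at hxa
      · refine ⟨Or.inr ⟨_, (hPm _).2 (Or.inr (Or.inr rfl)), rfl⟩, fun x hx hxa => ?_⟩
        rcases (hPm x).1 hx with rfl | rfl | rfl <;> simp only at hxa <;> omega
    · refine Nat.cast_le.2 ?_
      have : ∑ x ∈ P, (lim x / B - ptr μ x / B) ≤ P.card • (m / B + 1) := by
        refine Finset.sum_le_card_nsmul _ _ _ fun x hx => ?_
        have h1 : lim x / B ≤ (ptr μ x + m) / B := Nat.div_le_div_right (hle x hx).2
        have h2 : (ptr μ x + m) / B ≤ ptr μ x / B + m / B + 1 := by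
          rw [Nat.add_div (by omega)]
          split_ifs <;> omega
        generalize m / B = z at *
        generalize ptr μ x / B = y at *
        generalize lim x / B = w at *
        omega
      have h2 : P.card • (m / B + 1) ≤ 3 * (m / B + 1) := Nat.mul_le_mul_right _ hPc
      omega
  · rintro μ' a (⟨h, h'⟩ | rfl | ⟨rfl, h'⟩ | ⟨rfl | rfl, h'⟩) <;>
      simp only [box_rd, mem_rules] <;> omega
  · rintro μ' a c (⟨rfl, _, h'⟩ | ⟨rfl, _, h'⟩ | ⟨rfl, h'⟩) <;>
      simp only [box_wr, mem_rules] <;> omega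

theorem countLoop_tr (hB : 64 ≤ B) (hk : B ≤ k) {r : ℕ → ℕ → ℕ} (h : Locals A D n m fp μ)
    (hS : Spans n m fp μ)
    (hr : Cuts n m (fun x => μ (D + x)) (fun j => μ (fp + 9 + 2 * m + j)) r)
    (h5 : μ (fp + 5) = .num 0) (hD : D + n ≤ fp)
    (hc : ∀ j < m, μ (fp + 9 + 3 * m + j + 1) = .num 0) :
    Tr k B (.box {a | fp ≤ a ∧ a < fp + 10 + 4 * m ∨ D ≤ a ∧ a < D + n}
      {a | a = fp + 5 ∨ a = fp + 6 ∨ a = fp + 7 ∨ fp + 10 + 3 * m ≤ a ∧ a < fp + 10 + 4 * m})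
      ((80 * (m + 1) + 12 * (m * m / B) : ℕ) : ℝ≥0∞) (countLoop f fp) μ fun _ μ' =>
      ∀ j < m, μ' (fp + 9 + 3 * m + j + 1) =
        .num (∑ i ∈ range m, (r i (j + 1) - r i j)) := by
  have hk2 : 2 ≤ k := by omega
  unfold countLoop
  obtain ⟨I, hI⟩ : ∃ I : ℕ → Mem α → Prop, ∀ s μ', I s μ' ↔ s ≤ m ∧ μ' (fp + 5) = .num s ∧
      ∀ j < m, μ' (fp + 9 + 3 * m + j + 1) =
        .num (∑ i ∈ range s, (r i (j + 1) - r i j)) := ⟨_, fun _ _ => Iff.rfl⟩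
  refine (Tr.loop_const I (74 + 6 * (m / B)) m f ((hI _ _).2 ⟨by omega, h5, by simpa using hc⟩)
    (fun s μ' h => ((hI _ _).1 h).1) ?_).mono ?_ fun _ _ h => h
  swap
  · refine Nat.cast_le.2 ?_
    have h1 : m * (m / B) ≤ m * m / B := Nat.mul_div_le_mul_div_assoc _ _ _
    have h2 : m / B ≤ m := Nat.div_le_self _ _
    have h3 : (m + 1) * (74 + 6 * (m / B)) = 74 * (m + 1) + 6 * (m * (m / B)) + 6 * (m / B) := by
      ring
    rw [h3]
    omega
  intro s μ' hfr hμ'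
  obtain ⟨hsm, e5, g1⟩ := (hI _ _).1 hμ'
  simp only [mem_rules, not_or, not_and, not_lt] at hfr
  have l' := h.of_eq (μ' := μ') fun x h h' => hfr x (by omega)
  have s' := hS.of_eq (μ' := μ') fun x h h' => hfr x (by omega)
  refine (Tr.round (e := ((68 + 6 * (m / B) : ℕ) : ℝ≥0∞)) 3 hk2 (by decide) ?_).mono ?_
      fun _ _ h => h
  swap
  · simp only [← Nat.cast_add, Nat.cast_le]; omega
  simp only [safe_rules, cell_rules, mem_rules, e5, l'.count]
  by_cases hs : s < m
  swap
  · simp only [hs, decide_false, Bool.false_eq_true, if_false]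
    obtain rfl : s = m := by omega
    exact ⟨by omega, by omega, g1⟩
  simp only [hs, decide_true, if_true]
  refine ⟨by omega, by omega, ?_⟩
  refine (Tr.step (e := ((60 + 6 * (m / B) : ℕ) : ℝ≥0∞)) 1 hk2 (by decide) ?_).mono ?_
    fun _ _ h => h
  swap
  · simp only [← Nat.cast_add, Nat.cast_le]; omega
  have u5 : ∀ c, update μ' (fp + 6) c (fp + 5) = .num s :=
    fun c => (update_of_ne (by omega) _ _).trans e5
  have uc : ∀ c, update μ' (fp + 6) c (fp + 9 + s) = .num (r s 0) := fun c => by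
    rw [update_of_ne (by omega), s'.col s hs, hr.zero s hs]
  simp only [safe_rules, cell_rules, mem_rules]
  refine ⟨trivial, ?_⟩
  refine (Tr.step (e := ((50 + 6 * (m / B) : ℕ) : ℝ≥0∞)) 4 hk2 (by decide) ?_).mono ?_
    fun _ _ h => h
  swap
  · simp only [← Nat.cast_add, Nat.cast_le]; omega
  simp only [safe_rules, cell_rules, mem_rules, u5, uc]
  refine ⟨by omega, by omega, by simp, ?_⟩
  obtain ⟨μ₁, hμ₁⟩ : ∃ m, m = update (update μ' (fp + 6) (.num 0)) (fp + 7)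
    (.num (r s 0)) := ⟨_, rfl⟩
  rw [← hμ₁]
  have v₁ : ∀ x, x ≠ fp + 6 → x ≠ fp + 7 → μ₁ x = μ' x := fun x hx hx' => by
    rw [hμ₁, update_of_ne hx', update_of_ne hx]
  have hD₁ : ∀ x < n, μ₁ (D + x) = μ (D + x) := fun x hx => by
    rw [v₁ _ (by omega) (by omega), hfr _ (by omega)]
  have hP₁ : ∀ j < m, μ₁ (fp + 9 + 2 * m + j) = μ (fp + 9 + 2 * m + j) := fun x hx => by
    rw [v₁ _ (by omega) (by omega), hfr _ (by omega)]
  have hr₁ : Cuts n m (fun x => μ₁ (D + x)) (fun j => μ₁ (fp + 9 + 2 * m + j)) r := by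
    refine ⟨hr.zero, hr.last, hr.mono, fun i hi j hj x hx hx' => ?_, fun i hi j hj hlt => ?_⟩
    · have h1 := hr.mono_of_le hi (show j + 1 ≤ m by omega) le_rfl
      have h2 := (hr.last i hi).trans_le (edge_le _ _ _)
      simp only [hD₁ x (by omega), hP₁ j hj]
      exact hr.below i hi j hj x hx hx'
    · have h2 := (hr.last i hi).trans_le (edge_le _ _ _)
      simp only [hD₁ _ (show r i (j + 1) < n by omega), hP₁ j hj]
      exact hr.ends i hi j hj hlt
  refine (Tr.bind ((scanLoop_tr (f := f) hB hk (l'.of_eq fun x h h' => v₁ x (by omega) (by omega))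
    (s'.of_eq fun x h h' => v₁ x (by omega) (by omega)) hr₁ hs
        (by rw [v₁ _ (by omega) (by omega), e5])
    (by rw [hμ₁, update_of_ne (by omega), update_self])
    (by rw [hμ₁, update_self]) hD _
    (fun j hj => by rw [v₁ _ (by omega) (by omega)]; exact g1 j hj)).box_frame.box_mono subset_rfl
    (fun a ha => Or.inr ha)) (e' := (20 : ℕ)) ?_).mono ?_ fun _ _ h => h
  swap
  · simp only [← Nat.cast_add, Nat.cast_le]; omega
  rintro _ μ₂ ⟨q1, fr₂⟩
  simp only [mem_rules, not_or, not_and, not_lt] at fr₂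
  have q5 : μ₂ (fp + 5) = .num s := by rw [fr₂ _ (by omega), v₁ _ (by omega) (by omega), e5]
  refine Tr.of_len 10 hk2 (by decide) ?_
  simp only [safe_rules, cell_rules, mem_rules, q5]
  refine ⟨Or.inl ⟨by omega, by omega⟩, Or.inl rfl, (hI _ _).2 ⟨hs, by simp, fun j hj => ?_⟩⟩
  rw [update_of_ne (by omega), q1 j hj, sum_range_succ]

/-! ### Pivots and buckets -/

theorem exists_threshold (P : ℕ → Prop) {a b : ℕ} (hab : a ≤ b)
    (hP : ∀ x y, a ≤ x → x ≤ y → y < b → P y → P x) :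
    ∃ t, a ≤ t ∧ t ≤ b ∧ ∀ x, a ≤ x → x < b → (P x ↔ x < t) := by
  induction b, hab using Nat.le_induction with
  | base => exact ⟨a, le_rfl, le_rfl, fun x h h' => by omega⟩
  | succ b hab ih =>
    by_cases hb : P b
    · exact ⟨b + 1, by omega, le_rfl, fun x h h' =>
        ⟨fun _ => h', fun _ => hP x b h (by omega) (by omega) hb⟩⟩
    · obtain ⟨t, h1, h2, h3⟩ := ih fun x y h h' h'' => hP x y h h' (by omega)
      refine ⟨t, h1, by omega, fun x h h' => ?_⟩
      rcases (show x ≤ b by omega).eq_or_lt with rfl | h4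
      · exact ⟨fun h => absurd h hb, fun h => by omega⟩
      · exact h3 x h h4

theorem exists_segment (u : ℕ → ℕ) {m x : ℕ} (h0 : u 0 ≤ x) (hx : x < u m) :
    ∃ j < m, u j ≤ x ∧ x < u (j + 1) := by
  induction m with
  | zero => omega
  | succ m ih =>
    rcases lt_or_ge x (u m) with h | h
    · obtain ⟨j, hj, h'⟩ := ih h
      exact ⟨j, by omega, h'⟩
    · exact ⟨m, by omega, h, hx⟩

theorem edge_div {x i : ℕ} (hm : 0 < m) (hx : x < n) :
    x / m = i ↔ edge n m i ≤ x ∧ x < edge n m (i + 1) := by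
  have h1 := Nat.div_add_mod' x m
  have h2 := Nat.mod_lt x hm
  simp only [edge, Nat.succ_mul]
  constructor
  · rintro rfl
    omega
  · rintro ⟨h3, h4⟩
    refine Nat.div_eq_of_lt_le (by omega) ?_
    rw [Nat.succ_mul]
    omega

/-- A sample that is kept: `m - 1` items of `d`, increasing, and above the minimum. -/
structure Pivots (n m : ℕ) (d piv : ℕ → Cell α) : Prop where
  mem : ∀ j, j + 1 < m → ∃ x < n, piv j = d x
  lt : ∀ j, j + 2 < m → (piv j).key < (piv (j + 1)).key
  low : ∃ x < n, (d x).key < (piv 0).key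

/-- The item `d x` belongs to the `j`-th bucket. The first bucket has no lower pivot and the last
one no upper pivot. -/
def InBucket (m : ℕ) (d piv : ℕ → Cell α) (j x : ℕ) : Prop :=
  (j = 0 ∨ (piv (j - 1)).key ≤ (d x).key) ∧ (j + 1 = m ∨ (d x).key < (piv j).key)

open Classical in
/-- The number of the items `d 0, …, d (n - 1)` in the `j`-th bucket. -/
noncomputable def bucketSize (n m : ℕ) (d piv : ℕ → Cell α) (j : ℕ) : ℕ :=
  ((range n).filter fun x => InBucket m d piv j x).card

theorem bucketSize_congr {d d' piv piv' : ℕ → Cell α} (hd : ∀ x < n, d x = d' x)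
    (hp : ∀ j, j + 1 < m → piv j = piv' j) {j : ℕ} (hj : j < m) :
    bucketSize n m d piv j = bucketSize n m d' piv' j := by
  classical
  unfold bucketSize
  congr 1
  refine Finset.filter_congr fun x hx => ?_
  rw [mem_range] at hx
  unfold InBucket
  rw [hd x hx]
  refine and_congr ?_ ?_
  · rcases Nat.eq_zero_or_pos j with rfl | h
    · simp
    · rw [hp (j - 1) (by omega)]
  · rcases (show j + 1 ≤ m by omega).eq_or_lt with rfl | h
    · simp
    · rw [hp j h]

theorem Pivots.bucketSize_pos {d piv : ℕ → Cell α} (h : Pivots n m d piv) {j : ℕ} (hj : j < m) :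
    0 < bucketSize n m d piv j := by
  classical
  rw [bucketSize, Finset.card_pos]
  rcases Nat.eq_zero_or_pos j with rfl | h0
  · obtain ⟨x, hx, hx'⟩ := h.low
    exact ⟨x, mem_filter.2 ⟨mem_range.2 hx, Or.inl rfl, Or.inr hx'⟩⟩
  · obtain ⟨x, hx, e⟩ := h.mem (j - 1) (by omega)
    refine ⟨x, mem_filter.2 ⟨mem_range.2 hx, Or.inr (le_of_eq (by rw [e])), ?_⟩⟩
    rw [← e]
    rcases (show j + 1 ≤ m by omega).eq_or_lt with h1 | h1
    · exact Or.inl h1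
    · have := h.lt (j - 1) (by omega)
      rw [Nat.sub_add_cancel h0] at this
      exact Or.inr this

theorem exists_cuts {d piv : ℕ → Cell α} (hm : 0 < m)
    (hs : ∀ i < m, ∀ x y, edge n m i ≤ x → x < y → y < edge n m (i + 1) → (d x).key ≤ (d y).key)
    (hd : ∀ x < n, (d x).key < ⊤) (hp : ∀ j, j + 1 < m → (piv j).key < ⊤)
    (hmono : ∀ j, j + 1 < m → (piv j).key ≤ (piv (j + 1)).key) (hlast : piv (m - 1) = .infty) :
    ∃ r, Cuts n m d piv r ∧ ∀ i < m, ∀ j < m, ∀ x, edge n m i ≤ x → x < edge n m (i + 1) →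
      ((d x).key < (piv j).key ↔ x < r i (j + 1)) := by
  have key : ∀ i j, ∃ t, i < m → edge n m i ≤ t ∧ t ≤ edge n m (i + 1) ∧
      ∀ x, edge n m i ≤ x → x < edge n m (i + 1) → ((d x).key < (piv j).key ↔ x < t) := by
    intro i j
    by_cases hi : i < m
    · obtain ⟨t, ht⟩ := exists_threshold (fun x => (d x).key < (piv j).key)
        (edge_mono n m (Nat.le_succ i)) (fun x y h h' h'' h3 => by
          rcases h'.eq_or_lt with rfl | h'
          exacts [h3, (hs i hi x y h h' h'').trans_lt h3])
      exact ⟨t, fun _ => ht⟩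
    · exact ⟨0, fun h => absurd h hi⟩
  choose t ht using key
  have hlt : ∀ j < m, ∀ c : Cell α, c.lt (piv j) = true ↔ c.key < (piv j).key := by
    intro j hj c
    refine Cell.lt_iff ?_
    rcases (show j + 1 ≤ m by omega).eq_or_lt with h | h
    · exact Or.inr (by rw [← hlast]; congr 1; omega)
    · exact Or.inl (hp j h)
  have htm : ∀ i < m, t i (m - 1) = edge n m (i + 1) := by
    intro i hi
    obtain ⟨h1, h2, h3⟩ := ht i (m - 1) hi
    refine h2.antisymm (not_lt.1 fun h4 => ?_)
    have := (h3 _ h1 h4).1 (by rw [hlast]; exact hd _ (h4.trans_le (edge_le _ _ _)))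
    omega
  refine ⟨fun i j => if j = 0 then edge n m i else t i (j - 1), ⟨fun i _ => if_pos rfl,
    fun i hi => ?_, fun i hi j hj => ?_, fun i hi j hj x hx hx' => ?_, fun i hi j hj hx => ?_⟩,
    fun i hi j hj x hx hx' => ?_⟩
  · simp only [hm.ne', if_false]
    exact htm i hi
  · rcases Nat.eq_zero_or_pos j with rfl | h
    · simpa using (ht i 0 hi).1
    · simp only [h.ne', if_false, Nat.succ_ne_zero, Nat.add_sub_cancel]
      refine not_lt.1 fun h4 => ?_
      have h5 := ht i j hi
      have h6 := ht i (j - 1) hi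
      have h7 := (h6.2.2 _ h5.1 (h4.trans_le h6.2.1)).2 h4
      have h8 := hmono (j - 1) (by omega)
      rw [Nat.sub_add_cancel h] at h8
      have := (h5.2.2 _ h5.1 (h4.trans_le h6.2.1)).1 (h7.trans_le h8)
      omega
  · have h5 := ht i j hi
    simp only [Nat.succ_ne_zero, if_false, Nat.add_sub_cancel] at hx'
    refine (hlt j hj _).2 ((h5.2.2 x ?_ (hx'.trans_le h5.2.1)).2 hx')
    refine le_trans ?_ hx
    split_ifs
    exacts [le_rfl, (ht i _ hi).1]
  · have h5 := ht i j hi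
    simp only [Nat.succ_ne_zero, if_false, Nat.add_sub_cancel, hm.ne', htm i hi] at hx ⊢
    rw [← Bool.not_eq_true, hlt j hj, h5.2.2 _ h5.1 hx]
    omega
  · simp only [Nat.succ_ne_zero, if_false, Nat.add_sub_cancel]
    exact (ht i j hi).2.2 x hx hx'

theorem Cuts.inBucket_iff {d piv : ℕ → Cell α} {r : ℕ → ℕ → ℕ} (hr : Cuts n m d piv r)
    (hc : ∀ i < m, ∀ j < m, ∀ x, edge n m i ≤ x → x < edge n m (i + 1) →
      ((d x).key < (piv j).key ↔ x < r i (j + 1))) {i j x : ℕ} (hi : i < m) (hj : j < m)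
    (hx : edge n m i ≤ x) (hx' : x < edge n m (i + 1)) :
    InBucket m d piv j x ↔ r i j ≤ x ∧ x < r i (j + 1) := by
  refine and_congr ?_ ?_
  · rcases Nat.eq_zero_or_pos j with rfl | h
    · simp [hr.zero i hi, hx]
    · have := hc i hi (j - 1) (by omega) x hx hx'
      rw [Nat.sub_add_cancel h] at this
      rw [← not_lt, ← not_lt, ← this]
      simp [h.ne']
  · rw [hc i hi j hj x hx hx']
    rcases (show j + 1 ≤ m by omega).eq_or_lt with rfl | h
    · simp [hr.last i hi, hx']
    · simp [h.ne]

theorem Cuts.sum_eq {d piv : ℕ → Cell α} {r : ℕ → ℕ → ℕ} (hr : Cuts n m d piv r) (hm : 0 < m)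
    (hnm : n ≤ m * m) (hc : ∀ i < m, ∀ j < m, ∀ x, edge n m i ≤ x → x < edge n m (i + 1) →
      ((d x).key < (piv j).key ↔ x < r i (j + 1))) {j : ℕ} (hj : j < m) :
    ∑ i ∈ range m, (r i (j + 1) - r i j) = bucketSize n m d piv j := by
  classical
  rw [bucketSize, Finset.card_eq_sum_card_fiberwise (f := fun x => x / m) (t := range m)]
  · refine sum_congr rfl fun i hi => ?_
    rw [mem_range] at hi
    rw [← Nat.card_Ico]
    congr 1
    ext x
    simp only [Finset.mem_Ico, mem_filter, mem_range]
    constructor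
    · rintro ⟨h1, h2⟩
      have h3 := hr.mono_of_le hi (Nat.zero_le j) hj.le
      have h4 := hr.mono_of_le hi (show j + 1 ≤ m by omega) le_rfl
      rw [hr.zero i hi] at h3
      rw [hr.last i hi] at h4
      have h5 : x < n := by have := edge_le n m (i + 1); omega
      exact ⟨⟨h5, (hr.inBucket_iff hc hi hj (by omega) (by omega)).2 ⟨h1, h2⟩⟩,
        (edge_div hm h5).2 ⟨by omega, by omega⟩⟩
    · rintro ⟨⟨h1, h2⟩, h3⟩
      obtain ⟨h4, h5⟩ := (edge_div hm h1).1 h3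
      exact (hr.inBucket_iff hc hi hj h4 h5).1 h2
  · intro x hx
    have hx : x < n := by simpa using (mem_filter.1 hx).1
    have : x / m < m := (Nat.div_lt_iff_lt_mul hm).2 (hx.trans_le hnm)
    simpa using this

theorem Cuts.sum_sum {d piv : ℕ → Cell α} {r : ℕ → ℕ → ℕ} (hr : Cuts n m d piv r)
    (hnm : n ≤ m * m) :
    ∑ j ∈ range m, ∑ i ∈ range m, (r i (j + 1) - r i j) = n := by
  rw [Finset.sum_comm]
  have h1 : ∀ i < m, ∑ j ∈ range m, (r i (j + 1) - r i j) =
      edge n m (i + 1) - edge n m i := by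
    intro i hi
    rw [← hr.zero i hi, ← hr.last i hi]
    have : ∀ l ≤ m, r i 0 ≤ r i l ∧ ∑ j ∈ range l, (r i (j + 1) - r i j) = r i l - r i 0 := by
      intro l hl
      induction l with
      | zero => simp
      | succ l ih =>
        have h2 := hr.mono i hi l hl
        rw [sum_range_succ, (ih (by omega)).2]
        have := (ih (by omega)).1
        omega
    exact (this m le_rfl).2
  rw [sum_congr rfl fun i hi => h1 i (mem_range.1 hi)]
  have : ∀ l, ∑ i ∈ range l, (edge n m (i + 1) - edge n m i) = edge n m l := by
    intro l
    induction l with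
    | zero => simp [edge]
    | succ l ih =>
      have := edge_mono n m (show l ≤ l + 1 by omega)
      rw [sum_range_succ, ih]
      omega
  rw [this, edge, min_eq_right hnm]

/-! ### Moving the items into the buckets -/

/-- The first position of the `j`-th bucket: the total size of the earlier ones. -/
def bucketStart (m : ℕ) (r : ℕ → ℕ → ℕ) (j : ℕ) : ℕ :=
  ∑ j' ∈ range j, ∑ i ∈ range m, (r i (j' + 1) - r i j')

theorem bucketStart_succ (r : ℕ → ℕ → ℕ) (j : ℕ) : bucketStart m r (j + 1) =
    bucketStart m r j + ∑ i ∈ range m, (r i (j + 1) - r i j) := sum_range_succ _ _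

theorem bucketStart_mono (r : ℕ → ℕ → ℕ) {i j : ℕ} (h : i ≤ j) :
    bucketStart m r i ≤ bucketStart m r j := by
  induction j, h using Nat.le_induction with
  | base => exact le_rfl
  | succ j h ih => rw [bucketStart_succ]; omega

/-- The position where the items of the `i`-th column start in the `j`-th bucket. -/
def slot (m : ℕ) (r : ℕ → ℕ → ℕ) (j i : ℕ) : ℕ :=
  bucketStart m r j + ∑ i' ∈ range i, (r i' (j + 1) - r i' j)

theorem slot_succ (r : ℕ → ℕ → ℕ) (j i : ℕ) :
    slot m r j (i + 1) = slot m r j i + (r i (j + 1) - r i j) := by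
  rw [slot, slot, sum_range_succ, add_assoc]

theorem slot_zero (r : ℕ → ℕ → ℕ) (j : ℕ) : slot m r j 0 = bucketStart m r j := by
  simp [slot]

theorem slot_last (r : ℕ → ℕ → ℕ) (j : ℕ) : slot m r j m = bucketStart m r (j + 1) := by
  rw [bucketStart_succ, slot]

theorem skewCall_tr (hB : 1024 ≤ B) (hk : B ≤ k) (h : Locals A D n m fp μ) (hS : Spans n m fp μ)
    (h5m : 5 ≤ m) (h3m : 3 * m ≤ n) (hnm : n ≤ m * m)
    (hAD : A + n ≤ D ∨ D + n ≤ A) (hA : A + n ≤ fp) (hD : D + n ≤ fp) {r : ℕ → ℕ → ℕ}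
    (hr : Cuts n m (fun x => μ (D + x)) (fun j => μ (fp + 9 + 2 * m + j)) r)
    (hb : ∀ j < m, μ (fp + 9 + 3 * m + j + 1) = .num (bucketStart m r j)) :
    Tr k B (.box (sortArea A D n fp) {a | fp + 9 ≤ a ∧ a < fp + 9 + m ∨
        fp + 10 + 3 * m ≤ a ∧ a < fp + 16 * n + 32 ∨ A ≤ a ∧ a < A + n})
      ((2 * 50 : ℕ) + (400 * (m * m / B) + 8 * m + 4 * (n / B) + 500 : ℕ))
      (call fp (lit (fp + 10) + 4 * v (fp + 4)) [v (fp + 2), v (fp + 1), v (fp + 4), lit (fp + 9),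
    lit (fp + 9) + v (fp + 4), v (fp + 4), lit (fp + 9) + 2 * v (fp + 4),
    lit (fp + 9) + 3 * v (fp + 4) + 1] (skewTranspose f)) μ fun _ μ' =>
      (∀ j < m, μ' (fp + 9 + 3 * m + j + 1) = .num (bucketStart m r (j + 1))) ∧
      ∀ i < m, ∀ j < m, ∀ x < r i (j + 1) - r i j,
        μ' (A + slot m r j i + x) = μ (D + r i j + x) := by
  have hk2 : 2 ≤ k := by omega
  obtain ⟨S, hS'⟩ : ∃ S : Set ℕ, S = sortArea A D n fp := ⟨_, rfl⟩
  have hSm := mem_sortArea A D n fp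
  rw [← hS'] at hSm
  obtain ⟨W, hW⟩ : ∃ W : Set ℕ, W = {a | fp + 9 ≤ a ∧ a < fp + 9 + m ∨
        fp + 10 + 3 * m ≤ a ∧ a < fp + 16 * n + 32 ∨ A ≤ a ∧ a < A + n} := ⟨_, rfl⟩
  have hWm : ∀ a, a ∈ W ↔ fp + 9 ≤ a ∧ a < fp + 9 + m ∨
        fp + 10 + 3 * m ≤ a ∧ a < fp + 16 * n + 32 ∨ A ≤ a ∧ a < A + n := fun a => hW ▸ Iff.rfl
  rw [← hS', ← hW]
  obtain ⟨t, ht⟩ : ∃ t, t = fp + 10 + 4 * m := ⟨_, rfl⟩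
  have hrd : ∀ c, fp ≤ c → c < fp + 16 * n + 32 → ∀ μ : Mem α, (Policy.box S W).rd μ c :=
    fun c h h' μ => (hSm c).2 (Or.inl ⟨h, h'⟩)
  have ev : ∀ c a, c < t → fp ≤ c → μ c = .num a → Eval (.box S W) (v c) μ t a :=
    fun c a h h' h'' => Eval.v h h'' (hrd _ h' (by omega))
  have e1 := ev (fp + 1) _ (by omega) (by omega) h.src
  have e2 := ev (fp + 2) _ (by omega) (by omega) h.dst
  have e4 := ev (fp + 4) _ (by omega) (by omega) h.count
  have htop : Eval (.box S W) (lit (fp + 10) + 4 * v (fp + 4)) μ t t := by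
    have := (Eval.lit (π := .box S W) (μ := μ) (s := t) (a := fp + 10)).add
      ((Eval.ofNat (a := 4)).mul e4)
    rwa [← ht] at this
  obtain ⟨G, hG⟩ : ∃ G : Grid α, G = ⟨D, A, fp + 9, fp + 9 + m, fp + 9 + 2 * m, fp + 10 + 3 * m, m,
      r,
    slot m r, fun x => μ (D + x), fun j => μ (fp + 9 + 2 * m + j)⟩ := ⟨_, rfl⟩
  have hrm : ∀ i < m, r i m ≤ n := fun i hi => (hr.last i hi).trans_le (edge_le _ _ _)
  have hSn : ∀ j ≤ m, bucketStart m r j ≤ n := fun j hj =>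
    (bucketStart_mono r hj).trans (hr.sum_sum hnm).le
  have hV : G.Valid n t := by
    subst hG
    refine ⟨by simp only; omega, by simp only; omega, by simp only; omega, by simp only; omega,
      by simp only; omega, by simp only; omega, by simp only; omega, hrm,
      fun i hi j j' h h' => hr.mono_of_le hi h h', hr.below, hr.ends,
      fun i hi j hj => slot_succ r j i, fun j hj => ?_, fun j hj => ?_⟩
    · simp only [slot_last]; exact hSn _ hj
    · simp only [slot_last, slot_zero]; exact le_rfl
  have key := Grid.spec_square (k := k) (B := B) hk hB hV le_rfl (by
    subst hG
    intro i hi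
    simp only at hi ⊢
    rw [hr.last i (by omega), hr.zero _ hi]) f
  refine (Tr.call (e := (400 * (m * m / B) + 8 * m + 4 * (n / B) + 500 : ℕ)) 50 hk2 (by decide) htop
    (.cons e2 (.cons e1 (.cons e4 (.cons Eval.lit (.cons (Eval.lit.add e4) (.cons e4
      (.cons (Eval.lit.add (Eval.ofNat.mul e4)) (.cons ((Eval.lit.add (Eval.ofNat.mul e4)).add
        Eval.one) .nil)))))))) (fun μ' y d h h' => ?_) ?_).mono le_rfl fun _ _ h => h
  · simp only [List.length_cons, List.length_nil] at h'
    rw [box_wr, hWm]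
    omega
  intro μ₁ g1 g2
  simp only [List.length_cons, List.length_nil] at g2
  have g1' : ∀ i b, _ → μ₁ (t + 1 + i) = .num b := g1
  have hst : G.Static n μ₁ := by
    subst hG
    refine ⟨fun i hi => ?_, fun j hj => ?_, fun x hx => ?_⟩ <;> simp only at *
    · rw [g2 _ (by omega), hS.colEnd i hi, hr.last i hi]
    · rw [g2 _ (by omega)]
    · rw [g2 _ (by omega)]
  have harg : G.Args 0 G.m 0 G.m t μ₁ := by
    subst hG
    exact ⟨g1 0 _ rfl, g1 1 _ rfl, g1 2 _ rfl, g1 3 _ rfl, g1 4 _ rfl, g1 5 _ rfl, g1 6 _ rfl,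
      (g1 7 _ rfl).trans (by congr 1; simp only; omega)⟩
  have hsta : G.Start 0 G.m 0 G.m μ₁ := by
    subst hG
    refine ⟨fun i _ hi => ?_, fun j _ hj => ?_⟩ <;> simp only at *
    · rw [g2 _ (by omega), hS.col i (by omega), hr.zero i (by omega)]
    · rw [g2 _ (by omega), slot_zero, ← hb j (by omega)]
      congr 1
      omega
  have k1 := key μ₁ hst harg hsta
  subst hG
  simp only at k1
  refine (k1.imp (π' := .box S W) ?_ ?_).mono le_rfl ?_
  · rintro μ' a (⟨h, h'⟩ | ⟨i, h, h', rfl | rfl | ⟨rfl, h3⟩⟩ | ⟨j, h, h', rfl | rfl⟩) <;>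
      rw [box_rd, hSm] <;> simp only at *
    any_goals omega
    have := hrm i (by omega)
    omega
  · intro μ' a c ha
    rw [box_wr, hWm]
    rcases Grid.policy_frame ha with ha | ha | ha | ⟨j, y, h1, h2, h3, h4, rfl⟩ <;> simp only at *
    any_goals omega
    have h5 := hV.slot_lt (j := j) (i := m) (y := y) (by simp only; omega) le_rfl
        (by simpa using h4)
    have h6 : slot m r j m ≤ n := by rw [slot_last]; exact hSn _ (by omega)
    rw [zero_add] at h4
    omega
  · rintro _ μ' ⟨_, f2, f3⟩
    simp only at f2 f3
    refine ⟨hrd _ (by omega) (by omega) _, fun j hj => ?_, fun i hi j hj x hx => ?_⟩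
    · have := f2 j (by omega) (by omega)
      rw [zero_add, slot_last] at this
      rw [← this]
      congr 1
      omega
    · rw [add_assoc, f3 i (by omega) (by omega) j (by omega) (by omega) x hx, add_assoc]

theorem ms_split {α : Type*} (μ : Mem α) (u : ℕ → ℕ) (a l : ℕ) (hu : ∀ i < l, u i ≤ u (i + 1)) :
    u 0 ≤ u l ∧ ms μ (a + u 0) (a + u l) =
      ∑ i ∈ range l, ms μ (a + u i) (a + u (i + 1)) := by
  induction l with
  | zero => simp
  | succ l ih =>
    obtain ⟨h1, h2⟩ := ih fun i hi => hu i (by omega)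
    have h3 := hu l (by omega)
    refine ⟨h1.trans h3, ?_⟩
    rw [sum_range_succ, ← h2, ms_add _ (by omega) (by omega)]

theorem ms_buckets {μ μ' : Mem α} {r : ℕ → ℕ → ℕ} {d piv : ℕ → Cell α} (hr : Cuts n m d piv r)
    (hsl : ∀ i < m, ∀ j < m, ∀ x < r i (j + 1) - r i j,
        μ' (A + slot m r j i + x) = μ (D + r i j + x)) {j : ℕ} (hj : j < m) :
    ms μ' (A + bucketStart m r j) (A + bucketStart m r (j + 1)) =
      ∑ i ∈ range m, ms μ (D + r i j) (D + r i (j + 1)) := by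
  rw [← slot_zero, ← slot_last, (ms_split μ' (slot m r j) A m fun i hi => by
    rw [slot_succ]; omega).2]
  refine sum_congr rfl fun i hi => ?_
  rw [mem_range] at hi
  have h1 := hr.mono i hi j hj
  rw [slot_succ, show D + r i (j + 1) = D + r i j + (r i (j + 1) - r i j) by omega, ← add_assoc]
  exact ms_shift (hsl i hi j hj)

theorem ms_all_buckets {μ μ' : Mem α} {r : ℕ → ℕ → ℕ} {d piv : ℕ → Cell α}
    (hr : Cuts n m d piv r) (hnm : n ≤ m * m)
    (hsl : ∀ i < m, ∀ j < m, ∀ x < r i (j + 1) - r i j,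
        μ' (A + slot m r j i + x) = μ (D + r i j + x)) :
    ms μ' A (A + n) = ms μ D (D + n) := by
  have h1 := (ms_split μ' (bucketStart m r) A m fun i hi => bucketStart_mono r (by omega)).2
  have h2 := (ms_split μ (edge n m) D m fun i hi => edge_mono n m (by omega)).2
  have h3 : bucketStart m r m = n := hr.sum_sum hnm
  have h4 : edge n m m = n := min_eq_right hnm
  rw [h3, show bucketStart m r 0 = 0 from rfl, add_zero] at h1
  rw [h4, show edge n m 0 = 0 by simp [edge], add_zero] at h2
  rw [h1, h2, sum_congr rfl fun j hj => ms_buckets hr hsl (mem_range.1 hj),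
    Finset.sum_comm]
  refine sum_congr rfl fun i hi => ?_
  rw [mem_range] at hi
  rw [← hr.zero i hi, ← hr.last i hi, (ms_split μ (r i) D m (hr.mono i hi)).2]

theorem sorted_of_buckets {μ μ' : Mem α} {r : ℕ → ℕ → ℕ} {piv : ℕ → Cell α}
    (hr : Cuts n m (fun x => μ (D + x)) piv r) (hnm : n ≤ m * m)
    (hin : ∀ i < m, ∀ j < m, ∀ x, r i j ≤ x → x < r i (j + 1) →
      InBucket m (fun x => μ (D + x)) piv j x)
    (hpiv : ∀ j, j + 2 < m → (piv j).key ≤ (piv (j + 1)).key)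
    (hms : ∀ j < m, ms μ' (D + bucketStart m r j) (D + bucketStart m r (j + 1)) =
      ∑ i ∈ range m, ms μ (D + r i j) (D + r i (j + 1)))
    (hso : ∀ j < m, Sorted μ' (D + bucketStart m r j) (D + bucketStart m r (j + 1))) :
    Sorted μ' D (D + n) := by
  have h3 : bucketStart m r m = n := hr.sum_sum hnm
  have key : ∀ j < m, ∀ x, bucketStart m r j ≤ x → x < bucketStart m r (j + 1) →
      ∃ y, μ' (D + x) = μ (D + y) ∧ InBucket m (fun x => μ (D + x)) piv j y := by
    intro j hj x hx hx'
    have : μ' (D + x) ∈ ∑ i ∈ range m, ms μ (D + r i j) (D + r i (j + 1)) := by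
      rw [← hms j hj]
      exact mem_ms.2 ⟨_, by omega, by omega, rfl⟩
    obtain ⟨i, hi, hx⟩ := Multiset.mem_sum.1 this
    obtain ⟨y, hy, hy', e⟩ := mem_ms.1 hx
    obtain ⟨z, rfl⟩ := Nat.exists_eq_add_of_le ((Nat.le_add_right D _).trans hy)
    exact ⟨z, e.symm, hin i (mem_range.1 hi) j hj z (by omega) (by omega)⟩
  have hpm : ∀ j j', j ≤ j' → j' + 1 < m → (piv j).key ≤ (piv j').key := by
    intro j j' h
    induction j', h using Nat.le_induction with
    | base => exact fun _ => le_rfl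
    | succ j' h ih => exact fun h' => (ih (by omega)).trans (hpiv j' (by omega))
  intro x y hx hxy hy
  obtain ⟨x, rfl⟩ := Nat.exists_eq_add_of_le hx
  obtain ⟨y, rfl⟩ := Nat.exists_eq_add_of_le (hx.trans hxy.le)
  obtain ⟨j, hj, h1, h2⟩ := exists_segment (bucketStart m r) (m := m) (x := x) (Nat.zero_le _)
    (by omega)
  obtain ⟨j', hj', h1', h2'⟩ := exists_segment (bucketStart m r) (m := m) (x := y) (Nat.zero_le _)
    (by omega)
  rcases lt_trichotomy j j' with h | rfl | h
  · obtain ⟨x', e, hx1, hx2⟩ := key j hj x h1 h2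
    obtain ⟨y', e', hy1, hy2⟩ := key j' hj' y h1' h2'
    rw [e, e']
    exact ((hx2.resolve_left (by omega)).le.trans (hpm j (j' - 1) (by omega) (by omega))).trans
      (hy1.resolve_left (by omega))
  · exact hso j hj _ _ (by omega) (by omega) (by omega)
  · have := bucketStart_mono (m := m) r (show j' + 1 ≤ j by omega)
    omega

theorem distribute_tr (hB : 1024 ≤ B) (hk : B ≤ k) {T : ℕ → ℝ≥0∞}
    (hp : SortSpec α k B T (squareSort f)) (h : Locals A D n m fp μ) (hS : Spans n m fp μ)
    (h5m : 5 ≤ m) (h3m : 3 * m ≤ n) (hnm : n ≤ m * m)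
    (hAD : A + n ≤ D ∨ D + n ≤ A) (hA : A + n ≤ fp) (hD : D + n ≤ fp)
    (hit : Items μ D (D + n)) (hnd : (ms μ D (D + n)).Nodup)
    (hcol : ∀ i < m, Sorted μ (D + edge n m i) (D + edge n m (i + 1)))
    (hpv : Pivots n m (fun x => μ (D + x)) (fun j => μ (fp + 9 + 2 * m + j))) :
    Tr k B (.box (sortArea A D n fp) (sortArea A D n fp))
      ((2000 * (m + m * m / B + n / B + 1) : ℕ) + ∑ j ∈ range m,
        T (bucketSize n m (fun x => μ (D + x)) (fun j => μ (fp + 9 + 2 * m + j)) j))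
      (distribute f fp) μ fun _ μ' => ms μ' D (D + n) = ms μ D (D + n) ∧ Sorted μ' D (D + n) := by
  have hk2 : 2 ≤ k := by omega
  obtain ⟨S, hS'⟩ : ∃ S : Set ℕ, S = sortArea A D n fp := ⟨_, rfl⟩
  have hSm := mem_sortArea A D n fp
  rw [← hS'] at hSm
  obtain ⟨P, hP⟩ : ∃ P, P = fp + 9 + 2 * m := ⟨_, rfl⟩
  obtain ⟨X, hX⟩ : ∃ X, X = m * m / B := ⟨_, rfl⟩
  obtain ⟨Y, hY⟩ : ∃ Y, Y = n / B := ⟨_, rfl⟩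
  obtain ⟨Z, hZ⟩ : ∃ Z : ℝ≥0∞, Z = ∑ j ∈ range m,
        T (bucketSize n m (fun x => μ (D + x)) (fun j => μ (fp + 9 + 2 * m + j)) j) := ⟨_, rfl⟩
  rw [← hZ, ← hX, ← hY, ← hS']
  -- the memory after the last pivot has been set to infinity
  obtain ⟨μ₁, hμ₁⟩ : ∃ m', m' = update μ (P + (m - 1)) .infty := ⟨_, rfl⟩
  have v₁ : ∀ a, a ≠ P + (m - 1) → μ₁ a = μ a := fun a ha => by
    rw [hμ₁, update_of_ne ha]
  have hi1 : ∀ x < n, (μ₁ (D + x)).key < ⊤ := fun x hx => by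
    rw [v₁ _ (by omega)]; exact hit _ (by omega) (by omega)
  have hpi : ∀ j, j + 1 < m → μ₁ (P + j) = μ (P + j) := fun j hj => v₁ _ (by omega)
  have hplast : μ₁ (P + (m - 1)) = .infty := by rw [hμ₁, update_self]
  rw [← hP] at hpv
  have hpk : ∀ j, j + 1 < m → (μ₁ (P + j)).key < ⊤ := fun j hj => by
    obtain ⟨x, hx, e⟩ := hpv.mem j hj
    rw [hpi j hj, e]
    exact hit _ (by omega) (by omega)
  have hpm : ∀ j, j + 2 < m → (μ₁ (P + j)).key ≤ (μ₁ (P + (j + 1))).key := fun j hj => by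
    rw [hpi j (by omega), hpi (j + 1) (by omega)]
    exact (hpv.lt j hj).le
  obtain ⟨r, hr, hrc⟩ := exists_cuts (n := n) (m := m) (d := fun x => μ₁ (D + x))
    (piv := fun j => μ₁ (P + j)) (by omega) (fun i hi x y hx hxy hy => by
      have := edge_le n m (i + 1)
      simp only [v₁ (D + x) (by omega), v₁ (D + y) (by omega)]
      exact hcol i hi _ _ (by omega) (by omega) (by omega)) hi1 hpk (fun j hj => by
      rcases (show j + 2 ≤ m by omega).eq_or_lt with h1 | h1
      · rw [show j + 1 = m - 1 by omega, hplast]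
        exact le_top
      · exact hpm j h1) hplast
  have hsz : ∀ j < m, bucketStart m r (j + 1) - bucketStart m r j =
      bucketSize n m (fun x => μ (D + x)) (fun j => μ (P + j)) j := by
    intro j hj
    rw [bucketStart_succ, Nat.add_sub_cancel_left, hr.sum_eq (by omega) hnm hrc hj]
    exact bucketSize_congr (fun x hx => v₁ _ (by omega)) hpi hj
  have hZ' : Z = ∑ j ∈ range m, T (bucketStart m r (j + 1) - bucketStart m r j) := by
    rw [hZ]
    exact sum_congr rfl fun j hj => by rw [hsz j (mem_range.1 hj), hP]
  have l₁ := h.of_eq (μ' := μ₁) fun x h h' => v₁ x (by omega)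
  have s₁ := hS.of_eq (μ' := μ₁) fun x h h' => v₁ x (by omega)
  unfold distribute
  refine Tr.step_add (c' := 1900 * (m + X + Y + 1)) 10 hk2 (by decide) (by clear * -; omega) ?_
  simp only [safe_rules, cell_rules, hSm, h.count]
  refine ⟨by omega, by omega, by omega, ?_⟩
  rw [show fp + 9 + 2 * m + m - 1 = P + (m - 1) by omega, ← hμ₁]
  refine Tr.step_add (c' := 1800 * (m + X + Y + 1)) 1 hk2 (by decide) (by clear * -; omega) ?_
  simp only [safe_rules, cell_rules, hSm]
  refine ⟨by omega, ?_⟩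
  obtain ⟨μ₂, hμ₂⟩ : ∃ m, m = update μ₁ (fp + 6) (.num 0) := ⟨_, rfl⟩
  rw [← hμ₂]
  have v₂ : ∀ a, a ≠ fp + 6 → μ₂ a = μ₁ a := fun a ha => by rw [hμ₂, update_of_ne ha]
  refine (Tr.bind ((clearLoop_tr (f := f) hk2 (l₁.of_eq fun x h h' => v₂ x (by omega))
    (by rw [hμ₂, update_self])).box_frame.box_mono (fun a ha => ?_) (fun a ha => ?_))
    (e' := (1700 * (m + X + Y + 1) : ℕ) + Z) ?_).mono ?_ fun _ _ h => h
  · rw [hSm]; simp only [mem_rules] at ha; omega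
  · rw [hSm]; simp only [mem_rules] at ha; omega
  swap
  · rw [← add_assoc, ← Nat.cast_add]
    exact add_le_add_left (Nat.cast_le.2 (by clear * -; omega)) _
  rintro _ μ₃ ⟨c₃, fr₃⟩
  simp only [mem_rules, not_or, not_and, not_lt] at fr₃
  refine Tr.step_add (c' := 1600 * (m + X + Y + 1)) 1 hk2 (by decide) (by clear * -; omega) ?_
  simp only [safe_rules, cell_rules, hSm]
  refine ⟨by omega, ?_⟩
  obtain ⟨μ₄, hμ₄⟩ : ∃ m, m = update μ₃ (fp + 5) (.num 0) := ⟨_, rfl⟩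
  rw [← hμ₄]
  have v₄ : ∀ a, a ≠ fp + 5 → a ≠ fp + 6 → a < fp + 10 + 3 * m → μ₄ a = μ₁ a := fun a ha ha' h => by
    rw [hμ₄, update_of_ne ha, fr₃ a ⟨ha', fun _ => by omega⟩, v₂ a ha']
  have cuts : ∀ μ' : Mem α, (∀ a, (a < fp ∨ P ≤ a) → a < fp + 10 + 3 * m → μ' a = μ₁ a) →
      Cuts n m (fun x => μ' (D + x)) (fun j => μ' (fp + 9 + 2 * m + j)) r := by
    intro μ' hμ'
    have hP' : ∀ j < m, μ' (fp + 9 + 2 * m + j) = μ₁ (P + j) := fun j hj => by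
      rw [hμ' _ (by omega) (by omega), hP]
    have hD' : ∀ x < n, μ' (D + x) = μ₁ (D + x) := fun x hx => hμ' _ (by omega) (by omega)
    refine ⟨hr.zero, hr.last, hr.mono, fun i hi j hj x hx hx' => ?_, fun i hi j hj hlt => ?_⟩
    · have h1 := hr.mono_of_le hi (show j + 1 ≤ m by omega) le_rfl
      have h2 := (hr.last i hi).trans_le (edge_le _ _ _)
      simp only [hD' x (by omega), hP' j hj]
      exact hr.below i hi j hj x hx hx'
    · have h2 := (hr.last i hi).trans_le (edge_le _ _ _)
      simp only [hD' _ (show r i (j + 1) < n by omega), hP' j hj]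
      exact hr.ends i hi j hj hlt
  refine (Tr.bind ((countLoop_tr (f := f) (r := r) (by omega) hk
    (l₁.of_eq fun x h h' => v₄ x (by omega) (by omega) (by omega))
    (s₁.of_eq fun x h h' => v₄ x (by omega) (by omega) (by omega))
    (cuts _ fun a h h' => v₄ a (by omega) (by omega) h')
    (by rw [hμ₄, update_self]) hD (fun j hj => by
      rw [hμ₄, update_of_ne (by omega), c₃ j hj])).box_frame.box_mono
      (fun a ha => ?_) (fun a ha => ?_))
    (e' := (1400 * (m + X + Y + 1) : ℕ) + Z) ?_).mono ?_ fun _ _ h => h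
  · rw [hSm]; simp only [mem_rules] at ha; omega
  · rw [hSm]; simp only [mem_rules] at ha; omega
  swap
  · rw [← add_assoc, ← Nat.cast_add, ← hX]
    exact add_le_add_left (Nat.cast_le.2 (by clear * -; omega)) _
  rintro _ μ₅ ⟨c₅, fr₅⟩
  simp only [mem_rules, not_or, not_and, not_lt] at fr₅
  refine Tr.step_add (c' := 1300 * (m + X + Y + 1)) 1 hk2 (by decide) (by clear * -; omega) ?_
  simp only [safe_rules, cell_rules, hSm]
  refine ⟨by omega, ?_⟩
  refine Tr.step_add (c' := 1200 * (m + X + Y + 1)) 1 hk2 (by decide) (by clear * -; omega) ?_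
  simp only [safe_rules, cell_rules, hSm]
  refine ⟨by omega, ?_⟩
  obtain ⟨μ₆, hμ₆⟩ : ∃ m, m = update (update μ₅ (fp + 7) (.num 0)) (fp + 6)
    (.num 0) := ⟨_, rfl⟩
  rw [← hμ₆]
  have v₆ : ∀ a, a ≠ fp + 6 → a ≠ fp + 7 → μ₆ a = μ₅ a := fun a h h' => by
    rw [hμ₆, update_of_ne h, update_of_ne h']
  have w₆ : ∀ a, a ≠ fp + 5 → a ≠ fp + 6 → a ≠ fp + 7 → a < fp + 10 + 3 * m → μ₆ a = μ₁ a :=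
    fun a h h' h'' h3 => by
      rw [v₆ a h' h'', fr₅ a ⟨h, h', h'', fun _ => by omega⟩, v₄ a h h' h3]
  refine (Tr.bind ((offsetLoop_tr (f := f) hk2
    (l₁.of_eq fun x h h' => w₆ x (by omega) (by omega) (by omega) (by omega))
    (by rw [hμ₆, update_self])
    (by rw [hμ₆, update_of_ne (by omega), update_self])
    (fun j => ∑ i ∈ range m, (r i (j + 1) - r i j)) (fun j hj => by
      rw [v₆ _ (by omega) (by omega), c₅ j hj])).box_frame.box_mono
      (fun a ha => ?_) (fun a ha => ?_))
    (e' := (1100 * (m + X + Y + 1) : ℕ) + Z) ?_).mono ?_ fun _ _ h => h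
  · rw [hSm]; simp only [mem_rules] at ha; omega
  · rw [hSm]; simp only [mem_rules] at ha; omega
  swap
  · rw [← add_assoc, ← Nat.cast_add]
    exact add_le_add_left (Nat.cast_le.2 (by clear * -; omega)) _
  rintro _ μ₇ ⟨c₇, fr₇⟩
  simp only [mem_rules, not_or, not_and, not_lt] at fr₇
  have w₇ : ∀ a, a ≠ fp + 5 → a ≠ fp + 6 → a ≠ fp + 7 → a < fp + 10 + 3 * m → μ₇ a = μ₁ a :=
    fun a h h' h'' h3 => by
      rw [fr₇ a ⟨fun _ => by omega, fun _ => by omega⟩, w₆ a h h' h'' h3]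
  have l₇ := l₁.of_eq (μ' := μ₇) fun x h h' => w₇ x (by omega) (by omega) (by omega) (by omega)
  have hD₇ : ∀ a, D ≤ a → a < D + n → μ₇ a = μ a := fun a h h' => by
    rw [w₇ a (by omega) (by omega) (by omega) (by omega), v₁ a (by omega)]
  have hr₇ := cuts μ₇ fun a h h' => w₇ a (by omega) (by omega) (by omega) h'
  refine (Tr.bind ((skewCall_tr (f := f) hB hk l₇
    (s₁.of_eq fun x h h' => w₇ x (by omega) (by omega) (by omega) (by omega)) h5m h3m hnm hAD hA hD
    hr₇ c₇).box_frame.box_mono (fun a ha => ?_) (fun a ha => ?_))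
    (e' := (400 * (m + X + Y + 1) : ℕ) + Z) ?_).mono ?_ fun _ _ h => h
  · rwa [hS']
  · rw [hSm]; simp only [mem_rules] at ha; omega
  swap
  · rw [← add_assoc, ← Nat.cast_add, ← Nat.cast_add, ← hX, ← hY]
    exact add_le_add_left (Nat.cast_le.2 (by clear * -; omega)) _
  rintro _ μ₈ ⟨⟨c₈, sl₈⟩, fr₈⟩
  simp only [mem_rules, not_or, not_and, not_lt] at fr₈
  have l₈ := l₇.of_eq (μ' := μ₈) fun x h h' => fr₈ x ⟨by omega, by omega, by omega⟩
  refine Tr.step_add (c' := 300 * (m + X + Y + 1)) 6 hk2 (by decide) (by clear * -; omega) ?_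
  simp only [safe_rules, cell_rules, hSm, l₈.count]
  refine ⟨by omega, by omega, ?_⟩
  refine Tr.step_add (c' := 200 * (m + X + Y + 1)) 1 hk2 (by decide) (by clear * -; omega) ?_
  simp only [safe_rules, cell_rules, hSm]
  refine ⟨by omega, ?_⟩
  obtain ⟨μ₉, hμ₉⟩ : ∃ m', m' = update (update μ₈ (fp + 9 + 3 * m) (.num 0))
    (fp + 6) (.num 0) := ⟨_, rfl⟩
  rw [← hμ₉]
  have v₉ : ∀ a, a ≠ fp + 6 → a ≠ fp + 9 + 3 * m → μ₉ a = μ₈ a := fun a h h' => by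
    rw [hμ₉, update_of_ne h, update_of_ne h']
  have hmA : ms μ₉ A (A + n) = ms μ D (D + n) := by
    rw [ms_congr (μ' := μ₈) fun a _ _ => v₉ a (by omega) (by omega), ms_all_buckets hr₇ hnm sl₈]
    exact ms_congr hD₇
  have hSn : bucketStart m r m = n := hr.sum_sum hnm
  refine (bucketLoop_tr hp hk2 (l₈.of_eq fun x h h' => v₉ x (by omega) (by omega))
    (by rw [hμ₉, update_self]) (bucketStart m r) (fun j hj => ?_) rfl hSn
    (fun j hj => ?_) h5m h3m hAD hA hD (hit.of_ms hmA) (hmA ▸ hnd) |>.box_mono (fun a ha => ?_)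
    (fun a ha => ?_)).mono ?_ ?_
  · have h1 := hsz j hj
    have h2 := hpv.bucketSize_pos hj
    omega
  · rcases Nat.eq_zero_or_pos j with rfl | h0
    · rw [hμ₉, update_of_ne (by omega)]
      exact update_self _ _ _
    · obtain ⟨j, rfl⟩ : ∃ i, j = i + 1 := ⟨j - 1, by omega⟩
      rw [v₉ _ (by omega) (by omega), ← c₈ j (by omega)]
      rfl
  · rwa [hS']
  · rw [hSm]; simp only [mem_rules] at ha; omega
  · rw [hZ']
    exact add_le_add_left (Nat.cast_le.2 (by clear * -; omega)) _
  · intro _ μ' hμ'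
    have hb : ∀ j < m, ms μ' (D + bucketStart m r j) (D + bucketStart m r (j + 1)) =
        ∑ i ∈ range m, ms μ₇ (D + r i j) (D + r i (j + 1)) := by
      intro j hj
      have h1 := bucketStart_mono (m := m) r (show j + 1 ≤ m by omega)
      rw [(hμ' j hj).1, ← ms_buckets hr₇ sl₈ hj]
      exact ms_congr fun a _ _ => v₉ a (by omega) (by omega)
    constructor
    · rw [← hmA]
      have h1 := (ms_split μ' (bucketStart m r) D m fun i hi => bucketStart_mono r (by omega)).2
      have h2 := (ms_split μ₉ (bucketStart m r) A m fun i hi => bucketStart_mono r (by omega)).2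
      rw [hSn, show bucketStart m r 0 = 0 from rfl, add_zero] at h1 h2
      rw [h1, h2]
      exact sum_congr rfl fun j hj => (hμ' j (mem_range.1 hj)).1
    · refine sorted_of_buckets (piv := fun j => μ₁ (P + j)) (r := r) (μ := μ₇) (n := n) (m := m)
        (by
          have := hr₇
          rw [show (fun j => μ₇ (fp + 9 + 2 * m + j)) = _ from rfl] at this
          refine ⟨hr.zero, hr.last, hr.mono, fun i hi j hj x hx hx' => ?_,
            fun i hi j hj hlt => ?_⟩
          · have h1 := hr₇.below i hi j hj x hx hx'
            simp only [w₇ (fp + 9 + 2 * m + j) (by omega) (by omega) (by omega) (by omega)] at h1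
            rwa [hP]
          · have h1 := hr₇.ends i hi j hj hlt
            simp only [w₇ (fp + 9 + 2 * m + j) (by omega) (by omega) (by omega) (by omega)] at h1
            rwa [hP]) hnm (fun i hi j hj x hx hx' => ?_) hpm hb fun j hj => (hμ' j hj).2
      have h3 := hr.mono_of_le hi (Nat.zero_le j) hj.le
      have h4 := hr.mono_of_le hi (show j + 1 ≤ m by omega) le_rfl
      rw [hr.zero i hi] at h3
      rw [hr.last i hi] at h4
      have h5 := edge_le n m (i + 1)
      have := (hr.inBucket_iff hrc hi hj (h3.trans hx) (hx'.trans_le h4)).2 ⟨hx, hx'⟩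
      unfold InBucket at this ⊢
      simp only at this ⊢
      rwa [w₇ (D + x) (by omega) (by omega) (by omega) (by omega)]

/-! ### Averages over random samples -/

/-- The average of `g` over all lists of `q` elements of `{0, …, r}`, defined in the order in which
the program draws the elements. -/
noncomputable def avgL (r : ℕ) : ℕ → (List ℕ → ℝ≥0∞) → ℝ≥0∞
  | 0, g => g []
  | q + 1, g => (∑ x : Fin (r + 1), avgL r q fun l => g (x :: l)) / ((r + 1 : ℕ) : ℝ≥0∞)

theorem avgL_mono {r q : ℕ} {g h : List ℕ → ℝ≥0∞}
    (H : ∀ l : List ℕ, l.length = q → (∀ z ∈ l, z < r + 1) → g l ≤ h l) :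
    avgL r q g ≤ avgL r q h := by
  induction q generalizing g h with
  | zero => exact H [] rfl (by simp)
  | succ q ih =>
    refine ENNReal.div_le_div_right (sum_le_sum fun x _ => ih fun l hl hz => ?_) _
    exact H _ (by simp [hl]) (List.forall_mem_cons.2 ⟨x.2, hz⟩)

theorem avgL_add {r q : ℕ} {g h : List ℕ → ℝ≥0∞} :
    avgL r q (fun l => g l + h l) = avgL r q g + avgL r q h := by
  induction q generalizing g h with
  | zero => rfl
  | succ q ih => simp only [avgL, ih, sum_add_distrib, ENNReal.add_div]

theorem avgL_mul {r q : ℕ} {g : List ℕ → ℝ≥0∞} {c : ℝ≥0∞} :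
    avgL r q (fun l => c * g l) = c * avgL r q g := by
  induction q generalizing g with
  | zero => rfl
  | succ q ih => simp only [avgL, ih, ← Finset.mul_sum, mul_div_assoc]

theorem avg_const {r : ℕ} {c : ℝ≥0∞} : (∑ _x : Fin (r + 1), c) / ((r + 1 : ℕ) : ℝ≥0∞) = c := by
  rw [Finset.sum_const, Finset.card_fin, nsmul_eq_mul, mul_comm, mul_div_assoc,
    ENNReal.div_self (by simp) (by simp), mul_one]

theorem avgL_const {r q : ℕ} {c : ℝ≥0∞} : avgL r q (fun _ => c) = c := by
  induction q with
  | zero => rfl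
  | succ q ih => simp only [avgL, ih, avg_const]

theorem avgL_sum {ι : Type*} {r q : ℕ} (s : Finset ι) (g : ι → List ℕ → ℝ≥0∞) :
    avgL r q (fun l => ∑ i ∈ s, g i l) = ∑ i ∈ s, avgL r q (g i) := by
  induction q generalizing g with
  | zero => rfl
  | succ q ih =>
    simp only [avgL, ih]
    rw [Finset.sum_comm, div_eq_mul_inv, Finset.sum_mul]
    rfl

open Classical in
theorem avgL_all {r q : ℕ} (p : ℕ → Prop) :
    avgL r q (fun l => if ∀ z ∈ l, p z then 1 else 0) =
      ((((range (r + 1)).filter p).card : ℝ≥0∞) / ((r + 1 : ℕ) : ℝ≥0∞)) ^ q := by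
  induction q with
  | zero => simp [avgL]
  | succ q ih =>
    have : ∀ x : Fin (r + 1), avgL r q (fun l => if ∀ z ∈ (x : ℕ) :: l, p z then 1 else 0) =
        (if p x then 1 else 0) * avgL r q (fun l => if ∀ z ∈ l, p z then 1 else 0) := by
      intro x
      rw [← avgL_mul]
      congr 1
      funext l
      by_cases h : p x <;> simp [h]
    simp only [avgL, this, ← Finset.sum_mul, ih]
    rw [pow_succ', div_eq_mul_inv, mul_right_comm, ← div_eq_mul_inv]
    congr 2
    rw [Finset.card_filter, Finset.sum_range]
    push_cast
    rfl

open Classical in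
/-- The union bound for repetitions: the `i`-th element hits `U` or an earlier element with
probability at most `(u + i) / (r + 1)`. -/
theorem avgL_collision {r q : ℕ} (U : Finset ℕ) {u : ℕ} (hu : U.card ≤ u) :
    avgL r q (fun l => if l.Nodup ∧ ∀ z ∈ l, z ∉ U then 0 else 1) ≤
      ((∑ i ∈ range q, (u + i) : ℕ) : ℝ≥0∞) / ((r + 1 : ℕ) : ℝ≥0∞) := by
  induction q generalizing U u with
  | zero => simp [avgL]
  | succ q ih =>
    refine ENNReal.div_le_div_right ?_ _
    have h1 : ∀ x : Fin (r + 1), avgL r q (fun l => if ((x : ℕ) :: l).Nodup ∧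
        ∀ z ∈ (x : ℕ) :: l, z ∉ U then 0 else 1) ≤ (if (x : ℕ) ∈ U then 1 else 0) +
        ((∑ i ∈ range q, (u + 1 + i) : ℕ) : ℝ≥0∞) / ((r + 1 : ℕ) : ℝ≥0∞) := by
      intro x
      refine le_trans ?_ (add_le_add_right (ih (insert (x : ℕ) U) (u := u + 1)
        ((Finset.card_insert_le _ _).trans (by omega))) _)
      rw [← avgL_const (r := r) (q := q) (c := if (x : ℕ) ∈ U then 1 else 0), ← avgL_add]
      refine avgL_mono fun l _ _ => ?_
      by_cases hx : (x : ℕ) ∈ U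
      · simp only [hx, if_true]
        refine le_add_right ?_
        split_ifs <;> simp
      · by_cases hl : l.Nodup ∧ ∀ z ∈ l, z ∉ insert (x : ℕ) U
        · rw [if_pos]
          · simp
          · simp only [Finset.mem_insert, not_or] at hl
            refine ⟨List.nodup_cons.2 ⟨fun h => (hl.2 _ h).1 rfl, hl.1⟩, ?_⟩
            simp only [List.mem_cons, forall_eq_or_imp]
            exact ⟨hx, fun z hz => (hl.2 z hz).2⟩
        · rw [if_neg hl]
          refine le_add_left ?_
          split_ifs <;> simp
    refine (sum_le_sum fun x _ => h1 x).trans ?_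
    rw [sum_add_distrib, Finset.sum_const, Finset.card_fin, nsmul_eq_mul,
      ENNReal.mul_div_cancel (by simp) (by simp), Finset.sum_range_succ']
    have h2 : (∑ x : Fin (r + 1), if (x : ℕ) ∈ U then (1 : ℝ≥0∞) else 0) ≤ (u : ℕ) := by
      rw [← Finset.sum_range (fun x => if x ∈ U then (1 : ℝ≥0∞) else 0), Finset.sum_boole]
      refine Nat.cast_le.2 ((card_le_card ?_).trans hu)
      intro x hx
      exact (mem_filter.1 hx).2
    refine (add_le_add_left h2 _).trans ?_
    rw [← Nat.cast_add]
    refine Nat.cast_le.2 ?_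
    rw [add_comm]
    refine le_of_eq ?_
    congr 1
    exact sum_congr rfl fun i _ => by omega

theorem pow_add_le_succ_pow (n q : ℕ) : n ^ (q + 1) + (q + 1) * n ^ q ≤ (n + 1) ^ (q + 1) := by
  induction q with
  | zero => simp
  | succ q ih =>
    calc n ^ (q + 1 + 1) + (q + 1 + 1) * n ^ (q + 1)
        ≤ (n + 1) * (n ^ (q + 1) + (q + 1) * n ^ q) := by
          have h1 : n ^ (q + 1) = n ^ q * n := pow_succ _ _
          have h2 : n ^ (q + 1 + 1) = n ^ q * n * n := by rw [pow_succ, pow_succ]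
          rw [h1, h2]
          nlinarith [Nat.zero_le (n ^ q), Nat.zero_le ((q + 1) * n ^ q)]
      _ ≤ (n + 1) * (n + 1) ^ (q + 1) := Nat.mul_le_mul_left _ ih
      _ = _ := (pow_succ' _ _).symm

theorem sum_pow_le (n q : ℕ) : (q + 1) * ∑ s ∈ range n, s ^ q ≤ n ^ (q + 1) := by
  induction n with
  | zero => simp
  | succ n ih =>
    rw [sum_range_succ, mul_add]
    have := pow_add_le_succ_pow n q
    omega

/-- The probability that none of `q` samples falls among `e` given items, summed over `e`. -/
theorem sum_ratio_pow_le {n m q : ℕ} (hn : 0 < n) (hnm : n ≤ m * m) (hq : q + 1 = m) :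
    ∑ e ∈ range n, (((n - e : ℕ) : ℝ≥0∞) / (n : ℝ≥0∞)) ^ q ≤ ((m + 1 : ℕ) : ℝ≥0∞) := by
  have h0 : (n : ℝ≥0∞) ≠ 0 := by simpa using hn.ne'
  have h1 : ∑ e ∈ range n, (n - e) ^ q ≤ (m + 1) * n ^ q := by
    have h2 : ∑ e ∈ range n, (n - e) ^ q = ∑ s ∈ range n, (s + 1) ^ q := by
      rw [← Finset.sum_range_reflect]
      refine sum_congr rfl fun i hi => ?_
      rw [mem_range] at hi
      congr 1
      omega
    have h3 : ∑ s ∈ range n, (s + 1) ^ q ≤ ∑ s ∈ range n, s ^ q + n ^ q := by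
      have := Finset.sum_range_succ' (fun s => s ^ q) n
      rw [sum_range_succ] at this
      exact (Nat.le_add_right _ _).trans this.symm.le
    have h4 := sum_pow_le n q
    rw [hq] at h4
    have h5 : ∑ s ∈ range n, s ^ q ≤ m * n ^ q := by
      refine Nat.le_of_mul_le_mul_left (h4.trans ?_) (show 0 < m by omega)
      rw [← hq, pow_succ, hq, ← mul_assoc, mul_comm]
      exact Nat.mul_le_mul_right _ hnm
    rw [h2, Nat.succ_mul]
    exact h3.trans (Nat.add_le_add_right h5 _)
  simp only [div_eq_mul_inv, mul_pow, ← ENNReal.inv_pow]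
  rw [← Finset.sum_mul, ← div_eq_mul_inv, ENNReal.div_le_iff (by simp [h0]) (by simp)]
  exact_mod_cast h1

/-! ### The sizes of the buckets -/

open Classical in
/-- The number of ordered pairs of items, equal items included, that no entry with the property `p`
separates. Two items in one bucket are not separated by any pivot, so that the sum of the squares of
the bucket sizes is at most twice this number. -/
noncomputable def unseparated (n : ℕ) (d : ℕ → Cell α) (p : Cell α → Prop) : ℕ :=
  ∑ x ∈ range n, ((range n).filter fun y => (d x).key ≤ (d y).key ∧
    ∀ c, p c → ¬ ((d x).key < c.key ∧ c.key ≤ (d y).key)).card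

theorem avgL_unseparated {d : ℕ → Cell α} {r q m : ℕ} (hnm : r + 1 ≤ m * m) (hq : q + 1 = m)
    (hd : ∀ x y, x < r + 1 → y < r + 1 → (d x).key = (d y).key → x = y) :
    avgL r q (fun l => (unseparated (r + 1) d (· ∈ l.map d) : ℝ≥0∞)) ≤
      (((r + 1) * (m + 1) : ℕ) : ℝ≥0∞) := by
  classical
  obtain ⟨n, hn⟩ : ∃ n, n = r + 1 := ⟨_, rfl⟩
  rw [← hn] at hnm hd ⊢
  have e1 : ∀ l : List ℕ, (unseparated n d (· ∈ l.map d) : ℝ≥0∞) = ∑ x ∈ range n,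
      ∑ y ∈ range n, (if (d x).key ≤ (d y).key then 1 else 0) * (if ∀ z ∈ l,
        ¬ ((d x).key < (d z).key ∧ (d z).key ≤ (d y).key) then 1 else 0) := by
    intro l
    unfold unseparated
    push_cast
    refine sum_congr rfl fun x _ => ?_
    rw [Finset.card_filter]
    push_cast
    refine sum_congr rfl fun y _ => ?_
    have : (∀ c, c ∈ l.map d → ¬ ((d x).key < c.key ∧ c.key ≤ (d y).key)) ↔
        ∀ z ∈ l, ¬ ((d x).key < (d z).key ∧ (d z).key ≤ (d y).key) := by simp
    by_cases h1 : (d x).key ≤ (d y).key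
    · by_cases h2 : ∀ z ∈ l, ¬ ((d x).key < (d z).key ∧ (d z).key ≤ (d y).key)
      · rw [if_pos ⟨h1, this.2 h2⟩, if_pos h1, if_pos h2, one_mul]
      · rw [if_neg fun h => h2 (this.1 h.2), if_neg h2, mul_zero]
    · rw [if_neg fun h => h1 h.1, if_neg h1, zero_mul]
  simp only [e1]
  rw [avgL_sum]
  have e2 : ∀ x ∈ range n, avgL r q (fun l => ∑ y ∈ range n,
      (if (d x).key ≤ (d y).key then 1 else 0) * (if ∀ z ∈ l,
        ¬ ((d x).key < (d z).key ∧ (d z).key ≤ (d y).key) then 1 else 0))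
            ≤ ((m + 1 : ℕ) : ℝ≥0∞) := by
    intro x _
    rw [avgL_sum]
    simp only [avgL_mul]
    have e4 : ∀ y, avgL r q (fun l => if ∀ z ∈ l, ¬ ((d x).key < (d z).key ∧
        (d z).key ≤ (d y).key) then 1 else 0) = ((((range n).filter fun z =>
        ¬ ((d x).key < (d z).key ∧ (d z).key ≤ (d y).key)).card : ℝ≥0∞) / (n : ℝ≥0∞)) ^ q := by
      intro y
      rw [hn]
      convert avgL_all (r := r) (q := q) fun z =>
        ¬ ((d x).key < (d z).key ∧ (d z).key ≤ (d y).key)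
    simp only [e4]
    have e3 : ∑ y ∈ range n, (if (d x).key ≤ (d y).key then (1 : ℝ≥0∞) else 0) *
        ((((range n).filter fun z => ¬ ((d x).key < (d z).key ∧ (d z).key ≤ (d y).key)).card :
          ℝ≥0∞) / (n : ℝ≥0∞)) ^ q = ∑ y ∈ (range n).filter (fun y => (d x).key ≤ (d y).key),
        (((n - ((range n).filter fun z => (d x).key < (d z).key ∧ (d z).key ≤
          (d y).key).card : ℕ) : ℝ≥0∞) / (n : ℝ≥0∞)) ^ q := by
      rw [Finset.sum_filter]
      refine sum_congr rfl fun y _ => ?_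
      split_ifs
      · rw [one_mul]
        congr 3
        have := Finset.card_filter_add_card_filter_not (s := range n)
          (fun z => (d x).key < (d z).key ∧ (d z).key ≤ (d y).key)
        rw [card_range] at this
        omega
      · rw [zero_mul]
    rw [e3, ← Finset.sum_image (f := fun e => (((n - e : ℕ) : ℝ≥0∞) / (n : ℝ≥0∞)) ^ q)
      (g := fun y => ((range n).filter fun z => (d x).key < (d z).key ∧ (d z).key ≤
          (d y).key).card)]
    · refine le_trans (Finset.sum_le_sum_of_subset ?_) (sum_ratio_pow_le (by omega) hnm hq)
      intro e he
      obtain ⟨y, hy, rfl⟩ := Finset.mem_image.1 he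
      rw [mem_range]
      -- the index `x` is not counted
      calc _ < (range n).card := Finset.card_lt_card (Finset.filter_ssubset.2
            ⟨x, ‹_›, fun h => lt_irrefl _ h.1⟩)
        _ = n := card_range n
    · intro y hy y' hy' h
      simp only [Finset.coe_filter, mem_range, Set.mem_ofPred_eq] at hy hy'
      have key : ∀ y y', y' < n → (d x).key ≤ (d y).key → (d y).key < (d y').key →
          ((range n).filter fun z => (d x).key < (d z).key ∧ (d z).key ≤ (d y).key).card <
          ((range n).filter fun z => (d x).key < (d z).key ∧ (d z).key ≤ (d y').key).card := by
        intro y y' hy' hxy hlt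
        refine Finset.card_lt_card (Finset.ssubset_iff_of_subset ?_ |>.2 ⟨y', ?_, ?_⟩)
        · intro z hz
          simp only [mem_filter] at hz ⊢
          exact ⟨hz.1, hz.2.1, hz.2.2.trans hlt.le⟩
        · simp only [mem_filter, mem_range]
          exact ⟨hy', hxy.trans_lt hlt, le_rfl⟩
        · simp only [mem_filter, not_and, not_le]
          exact fun _ _ => hlt
      rcases lt_trichotomy (d y).key (d y').key with h1 | h1 | h1
      · exact absurd h (key y y' hy'.1 hy.2 h1).ne
      · exact hd y y' hy.1 hy'.1 h1
      · exact absurd h (key y' y hy.1 hy'.2 h1).ne'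
  refine (sum_le_sum e2).trans ?_
  rw [Finset.sum_const, card_range, nsmul_eq_mul, ← Nat.cast_mul]

theorem sum_bucketSize_le {d piv : ℕ → Cell α}
    (hpm : ∀ j, j + 2 < m → (piv j).key ≤ (piv (j + 1)).key) :
    ∑ j ∈ range m, bucketSize n m d piv j ≤ n ∧
    ∑ j ∈ range m, bucketSize n m d piv j ^ 2 ≤
      2 * unseparated n d (fun c => ∃ j, j + 1 < m ∧ piv j = c) := by
  classical
  have hm' : ∀ j j', j ≤ j' → j' + 1 < m → (piv j).key ≤ (piv j').key := by
    intro j j' h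
    induction j', h using Nat.le_induction with
    | base => exact fun _ => le_rfl
    | succ j' h ih => exact fun h' => (ih (by omega)).trans (hpm j' (by omega))
  have huniq : ∀ j j' x, j < j' → j' < m → InBucket m d piv j x → ¬ InBucket m d piv j' x := by
    intro j j' x h h' h1 h2
    have h3 := h1.2.resolve_left (by omega)
    have h4 := h2.1.resolve_left (by omega)
    exact absurd (h3.trans_le ((hm' j (j' - 1) (by omega) (by omega)).trans h4)) (lt_irrefl _)
  constructor
  · unfold bucketSize
    rw [← Finset.card_biUnion]
    · refine (card_le_card ?_).trans (card_range n).le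
      intro x hx
      obtain ⟨j, _, hx⟩ := Finset.mem_biUnion.1 hx
      exact (mem_filter.1 hx).1
    · intro j hj j' hj' hne
      rw [Function.onFun, Finset.disjoint_left]
      intro x hx hx'
      have h1 := (mem_filter.1 hx).2
      have h2 := (mem_filter.1 hx').2
      rcases lt_or_gt_of_ne hne with h | h
      · exact huniq j j' x h (by simpa using hj') h1 h2
      · exact huniq j' j x h (by simpa using hj) h2 h1
  · -- pairs of positions in the same bucket; one of the two orders is unseparated
    obtain ⟨V, hV⟩ : ∃ V : Finset (ℕ × ℕ), V = (range n ×ˢ range n).filter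
      fun p => (d p.1).key ≤ (d p.2).key ∧ ∀ c, (∃ j, j + 1 < m ∧ piv j = c) →
        ¬ ((d p.1).key < c.key ∧ c.key ≤ (d p.2).key) := ⟨_, rfl⟩
    have hVc : V.card = unseparated n d (fun c => ∃ j, j + 1 < m ∧ piv j = c) := by
      rw [hV, unseparated, Finset.card_filter, Finset.sum_product]
      exact sum_congr rfl fun x _ => (Finset.card_filter _ _).symm
    have hsq : ∀ j, bucketSize n m d piv j ^ 2 = (((range n).filter fun x =>
        InBucket m d piv j x) ×ˢ ((range n).filter fun x => InBucket m d piv j x)).card := by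
      intro j
      rw [Finset.card_product, sq, bucketSize]
    simp only [hsq]
    rw [← Finset.card_biUnion]
    · have hsub : ((range m).biUnion fun j => ((range n).filter fun x =>
          InBucket m d piv j x) ×ˢ ((range n).filter fun x => InBucket m d piv j x)) ⊆
          V ∪ V.image Prod.swap := by
        rintro ⟨x, y⟩ h
        simp only [Finset.mem_biUnion, Finset.mem_product, mem_filter, mem_range] at h
        obtain ⟨j, hj, ⟨hx, hx'⟩, hy, hy'⟩ := h
        have hin : ∀ x y, x < n → y < n → InBucket m d piv j x → InBucket m d piv j y →
            (d x).key ≤ (d y).key → (x, y) ∈ V := by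
          intro x y hx hy hx' hy' hxy
          rw [hV, mem_filter, Finset.mem_product, mem_range, mem_range]
          refine ⟨⟨hx, hy⟩, hxy, ?_⟩
          rintro c ⟨i, hi, rfl⟩ ⟨h1, h2⟩
          rcases lt_or_ge i j with h | h
          · have := hx'.1.resolve_left (by omega)
            exact absurd (h1.trans_le ((hm' i (j - 1) (by omega) (by omega)).trans this))
              (lt_irrefl _)
          · have := hy'.2.resolve_left (by omega)
            exact absurd ((h2.trans_lt this).trans_le (hm' j i h hi)) (lt_irrefl _)
        rcases le_total (d x).key (d y).key with h | h
        · exact mem_union_left _ (hin x y hx hy hx' hy' h)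
        · exact mem_union_right _ (Finset.mem_image.2 ⟨(y, x), hin y x hy hx hy' hx' h, rfl⟩)
      refine (card_le_card hsub).trans ((card_union_le _ _).trans ?_)
      have := card_image_le (s := V) (f := Prod.swap)
      omega
    · intro j hj j' hj' hne
      rw [Function.onFun, Finset.disjoint_left]
      rintro ⟨x, y⟩ hx hx'
      have h1 := (mem_filter.1 (Finset.mem_product.1 hx).1).2
      have h2 := (mem_filter.1 (Finset.mem_product.1 hx').1).2
      rcases lt_or_gt_of_ne hne with h | h
      · exact huniq j j' x h (by simpa using hj') h1 h2
      · exact huniq j' j x h (by simpa using hj) h2 h1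

/-! ### Sampling the pivots -/

theorem ms_eq_map {α : Type*} {μ : Mem α} {d : ℕ → Cell α} {l : List ℕ} {a : ℕ}
    (h : ∀ j < l.length, μ (a + j) = d (l.getD j 0)) :
    ms μ a (a + l.length) = (l.map d : Multiset (Cell α)) := by
  induction l generalizing a with
  | nil => simp
  | cons x l ih =>
    have h0 := h 0 (by simp)
    have h1 := ih (a := a + 1) fun j hj => by
      have := h (j + 1) (by simpa using hj)
      rw [List.getD_cons_succ, ← add_assoc, add_right_comm] at this
      exact this
    rw [List.length_cons, ← ms_add μ (b := a + 1) (by omega) (by omega),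
      show a + (l.length + 1) = a + 1 + l.length by omega, h1, ms_succ μ le_rfl, ms_self,
      List.map_cons, ← Multiset.cons_coe]
    simp only [add_zero, List.getD_cons_zero] at h0
    rw [h0, Multiset.cons_add, zero_add]

/-- One draw: unlike in a triple, the continuation is averaged over the sample instead of being
bounded by its worst case. -/
theorem draw_ex {r i : ℕ} (hk : 2 ≤ k) (h : Locals A D (r + 1) m fp μ) (h5 : μ (fp + 5) = .num i)
    (hi : i + 1 < m) {ψ : Bool → Mem α → ℝ≥0∞} :
    ex k B (iter (lt (v (fp + 5) + 1) (v (fp + 4))) do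
      moveAt (lit (fp + 9) + 2 * v (fp + 4) + v (fp + 5)) (v (fp + 2) + random (v (fp + 3)))
      assign (fp + 5) (v (fp + 5) + 1)) μ ∅ ψ ≤
    (60 : ℕ) + (∑ x : Fin (r + 1), ψ true (update (update μ
      (fp + 9 + 2 * m + i) (μ (D + x))) (fp + 5) (.num (i + 1)))) / ((r + 1 : ℕ) : ℝ≥0∞) := by
  obtain ⟨e1, e2, e3, e4⟩ := h
  have c1 : Tr k B (.box Set.univ Set.univ) ((2 * 4 : ℕ) : ℝ≥0∞)
      (lt (v (fp + 5) + 1) (v (fp + 4))) μ fun b μ' => b = true ∧ μ' = μ := by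
    refine Tr.of_len 4 hk (by decide) ?_
    simp only [safe_rules, cell_rules, Set.mem_univ, e4, h5, hi, decide_true, and_self]
  have c2 : Tr k B (.box Set.univ Set.univ) ((2 * 8 : ℕ) : ℝ≥0∞)
      (do
        let x ← lit (fp + 9) + 2 * v (fp + 4) + v (fp + 5)
        let d ← v (fp + 2)
        let s ← v (fp + 3)
        return (x, d, s - 1)) μ fun t μ' => t = (fp + 9 + 2 * m + i, D, r) ∧ μ' = μ := by
    refine Tr.of_len 8 hk (by decide) ?_
    simp only [safe_rules, cell_rules, Set.mem_univ, e4, e2, e3, h5, and_self, Nat.add_sub_cancel]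
  have c3 : ∀ x : ℕ, Tr k B (.box Set.univ Set.univ) ((2 * 8 : ℕ) : ℝ≥0∞)
      (do
        moveAt (lit (fp + 9 + 2 * m + i)) (lit (D + x))
        assign (fp + 5) (v (fp + 5) + 1)
        return true) μ fun b μ' => b = true ∧ μ' = update (update μ
      (fp + 9 + 2 * m + i) (μ (D + x))) (fp + 5) (.num (i + 1)) := by
    intro x
    refine Tr.of_len 8 hk (by decide) ?_
    have u : ∀ c, update μ (fp + 9 + 2 * m + i) c (fp + 5) = .num i :=
      fun c => (update_of_ne (by omega) _ _).trans h5
    simp only [safe_rules, cell_rules, Set.mem_univ, u, and_self]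
  obtain ⟨Z, hZ⟩ : ∃ Z, Z = (∑ x : Fin (r + 1), ψ true (update (update μ
    (fp + 9 + 2 * m + i) (μ (D + x))) (fp + 5) (.num (i + 1)))) / ((r + 1 : ℕ) : ℝ≥0∞) := ⟨_, rfl⟩
  rw [← hZ]
  refine ex_bind_le.trans ((c1.cost _ (((2 * 8 : ℕ) : ℝ≥0∞) + (((2 * 8 : ℕ) : ℝ≥0∞) + Z + 20))
    fun b μ' h => ?_).trans (le_of_eq ?_))
  · obtain ⟨rfl, rfl⟩ := h
    have hsplit : (do
        moveAt (lit (fp + 9) + 2 * v (fp + 4) + v (fp + 5)) (v (fp + 2) + random (v (fp + 3)))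
        assign (fp + 5) (v (fp + 5) + 1)
        return true) = (do
          let x ← lit (fp + 9) + 2 * v (fp + 4) + v (fp + 5)
          let d ← v (fp + 2)
          let s ← v (fp + 3)
          return (x, d, s - 1)) >>= fun t : ℕ × ℕ × ℕ => Prog.rand t.2.2 fun x => (do
            moveAt (lit t.1) (lit (t.2.1 + x))
            assign (fp + 5) (v (fp + 5) + 1)
            return true) := rfl
    simp only [if_true]
    have hb : ∀ p q : Prog Unit, ((do p; q) >>= fun _ => (pure true : Prog Bool)) =
      (do p; q; return true) := fun p q => Prog.bind_assoc ..
    refine le_trans (le_of_eq (congrArg (fun p => ex k B p μ' ∅ ψ) ((hb _ _).trans hsplit))) ?_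
    refine ex_bind_le.trans (c2.cost _ _ fun t μ'' h => ?_)
    obtain ⟨rfl, rfl⟩ := h
    refine le_trans ?_ le_self_add
    rw [ex]
    have h3 : ∀ x : Fin (r + 1), ex k B (do
        moveAt (lit (fp + 9 + 2 * m + i)) (lit (D + x))
        assign (fp + 5) (v (fp + 5) + 1)
        return true) μ'' ∅ ψ ≤ ((2 * 8 : ℕ) : ℝ≥0∞) + ψ true (update (update μ''
          (fp + 9 + 2 * m + i) (μ'' (D + x))) (fp + 5) (.num (i + 1))) := fun x =>
      (c3 x).cost ψ _ fun b μ' h => by rw [h.1, h.2]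
    refine (ENNReal.div_le_div_right (sum_le_sum fun x _ => h3 x) _).trans (le_of_eq ?_)
    change _ / ((r + 1 : ℕ) : ℝ≥0∞) = _
    rw [sum_add_distrib, ENNReal.add_div, avg_const, hZ]
  · push_cast
    ring

theorem drawLoop_ex {r : ℕ} (hk : 2 ≤ k) (hD : D + (r + 1) ≤ fp) {g : List ℕ → ℝ≥0∞}
    {ψ : Unit → Mem α → ℝ≥0∞} {q i : ℕ} (h : Locals A D (r + 1) m fp μ)
    (h5 : μ (fp + 5) = .num i) (hi : i + q + 1 = m)
    (hψ : ∀ l : List ℕ, l.length = q → (∀ z ∈ l, z < r + 1) → ∀ μ' : Mem α,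
      (∀ a, a ≠ fp + 5 → ¬ (fp + 9 + 2 * m + i ≤ a ∧ a < fp + 9 + 2 * m + (m - 1)) → μ' a = μ a) →
      (∀ j < q, μ' (fp + 9 + 2 * m + i + j) = μ (D + l.getD j 0)) → ψ () μ' ≤ g l) :
    ex k B (drawLoop f fp) μ ∅ ψ ≤ ((q + 1) * 60 : ℕ) + avgL r q g := by
  unfold drawLoop
  induction f generalizing q i μ g with
  | zero => simp [loop, ex]
  | succ f ih =>
    rw [loop_succ]
    refine ex_bind_le.trans ?_
    cases q with
    | zero =>
      have c : Tr k B (.box Set.univ Set.univ) ((2 * 30 : ℕ) : ℝ≥0∞)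
          (iter (lt (v (fp + 5) + 1) (v (fp + 4))) do
            moveAt (lit (fp + 9) + 2 * v (fp + 4) + v (fp + 5)) (v (fp + 2) + random (v (fp + 3)))
            assign (fp + 5) (v (fp + 5) + 1)) μ fun b μ' => b = false ∧ μ' = μ := by
        refine Tr.of_len 30 hk (by decide) ?_
        simp only [safe_rules, cell_rules, Set.mem_univ, h.count, h5,
          show ¬ i + 1 < m by omega, decide_false, Bool.false_eq_true, if_false, and_self]
      refine (c.cost _ (g []) fun b μ' h' => ?_).trans (by simp [avgL])
      obtain ⟨rfl, rfl⟩ := h'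
      exact hψ [] rfl (by simp) μ' (fun _ _ _ => rfl) (by simp)
    | succ q =>
      refine (draw_ex hk h h5 (by omega)).trans ?_
      have key : ∀ x : Fin (r + 1), ex k B (loop f (lt (v (fp + 5) + 1) (v (fp + 4))) do
            moveAt (lit (fp + 9) + 2 * v (fp + 4) + v (fp + 5)) (v (fp + 2) + random (v (fp + 3)))
            assign (fp + 5) (v (fp + 5) + 1)) (update (update μ
          (fp + 9 + 2 * m + i) (μ (D + x))) (fp + 5) (.num (i + 1))) ∅ ψ ≤
          ((q + 1) * 60 : ℕ) + avgL r q fun l => g (x :: l) := by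
        intro x
        have hx := x.2
        obtain ⟨μ₁, hμ₁⟩ : ∃ m', m' = update (update μ
          (fp + 9 + 2 * m + i) (μ (D + x))) (fp + 5) (.num (i + 1)) := ⟨_, rfl⟩
        rw [← hμ₁]
        have w : ∀ a, a ≠ fp + 5 → a ≠ fp + 9 + 2 * m + i → μ₁ a = μ a := fun a h1 h2 => by
          rw [hμ₁, update_of_ne h1, update_of_ne h2]
        refine ih ⟨?_, ?_, ?_, ?_⟩ (by rw [hμ₁, update_self]) (by omega) ?_
        · rw [w _ (by omega) (by omega), h.src]
        · rw [w _ (by omega) (by omega), h.dst]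
        · rw [w _ (by omega) (by omega), h.size]
        · rw [w _ (by omega) (by omega), h.count]
        · intro l hl hz μ' hfr hv
          refine hψ (x :: l) (by simp [hl]) (List.forall_mem_cons.2 ⟨hx, hz⟩) μ' ?_ ?_
          · intro a h1 h2
            rw [hfr a h1 (by omega), w a h1 (by omega)]
          · rintro (_ | j) hj
            · rw [hfr _ (by omega) (by omega), hμ₁, update_of_ne (by omega), add_zero,
                update_self, List.getD_cons_zero]
            · have := hv j (by omega)
              rw [show fp + 9 + 2 * m + i + (j + 1) = fp + 9 + 2 * m + (i + 1) + j by omega, this,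
                List.getD_cons_succ]
              have hlt : l.getD j 0 < r + 1 := by
                rw [List.getD_eq_getElem _ _ (by omega)]
                exact hz _ (List.getElem_mem _)
              exact w _ (by omega) (by omega)
      simp only [if_true]
      refine (add_le_add_right (ENNReal.div_le_div_right (sum_le_sum fun x _ => key x) _)
        _).trans (le_of_eq ?_)
      rw [sum_add_distrib, ENNReal.add_div, avg_const, ← add_assoc, ← Nat.cast_add, avgL]
      congr 2
      ring

theorem drawLoop_safe (h : Locals A D n m fp μ) (h5 : μ (fp + 5) = .num 0) (hm : 2 ≤ m)
    (h3m : 3 * m ≤ n) (hD : D + n ≤ fp) :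
    Safe (.box (sortArea A D n fp) {a | a = fp + 5 ∨
        fp + 9 + 2 * m ≤ a ∧ a < fp + 9 + 2 * m + (m - 1)}) (drawLoop f fp) μ fun _ μ' =>
      ∀ j, j + 1 < m → ∃ x < n, μ' (fp + 9 + 2 * m + j) = μ (D + x) := by
  unfold drawLoop
  obtain ⟨I, hI⟩ : ∃ I : Mem α → Prop, ∀ μ', I μ' ↔ ∃ i, i + 1 ≤ m ∧ μ' (fp + 5) = .num i ∧
      ∀ j < i, ∃ x < n, μ' (fp + 9 + 2 * m + j) = μ (D + x) := ⟨_, fun _ => Iff.rfl⟩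
  refine Safe.loop_box I f ((hI _).2 ⟨0, by omega, h5, by simp⟩) fun μ' hfr hμ' => ?_
  obtain ⟨i, hi, e5, hx⟩ := (hI _).1 hμ'
  obtain ⟨e1, e2, e3, e4⟩ := h.of_eq (μ' := μ') fun x h h' => hfr x (by simp; omega)
  have eD : ∀ x < n, μ' (D + x) = μ (D + x) := fun x _ => hfr _ (by simp; omega)
  have hSm := mem_sortArea A D n fp
  by_cases him : i + 1 < m
  · have u5 : ∀ c, update μ' (fp + 9 + 2 * m + i) c (fp + 5) = .num i :=
      fun c => (update_of_ne (by omega) _ _).trans e5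
    simp only [safe_rules, cell_rules, mem_rules, e2, e3, e4, e5, u5, him, decide_true, if_true,
      hSm]
    constructorm* _ ∧ _
    any_goals first | exact trivial | omega
    intro y hy
    constructorm* _ ∧ _
    any_goals first | exact trivial | omega
    refine (hI _).2 ⟨i + 1, by omega, by simp, fun j hj => ?_⟩
    rw [update_of_ne (by omega)]
    rcases (show j ≤ i by omega).eq_or_lt with rfl | h'
    · exact ⟨y, by omega, by rw [update_self, eD y (by omega)]⟩
    · rw [update_of_ne (by omega)]
      exact hx j h'
  · simp only [safe_rules, cell_rules, mem_rules, e4, e5, him, decide_false, Bool.false_eq_true,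
      if_false, hSm]
    exact ⟨by omega, by omega, fun j hj => hx j (by omega)⟩

theorem pivots_of_check {μ' : Mem α} {P : ℕ} {d : ℕ → Cell α} (hm : 2 ≤ m)
    (hit : ∀ x < n, (d x).key < ⊤) (hmem : ∀ j, j + 1 < m → ∃ x < n, μ (P + j) = d x)
    (hms : ms μ' P (P + (m - 1)) = ms μ P (P + (m - 1)))
    (hlt : ∀ i, i + 2 < m → (μ' (P + i)).lt (μ' (P + i + 1)) = true)
    (hlow : ∃ i < m, edge n m i < edge n m (i + 1) ∧ (d (edge n m i)).lt (μ' P) = true) :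
    Pivots n m d fun j => μ' (P + j) := by
  have h1 : ∀ j, j + 1 < m → ∃ x < n, μ' (P + j) = d x := by
    intro j hj
    have : μ' (P + j) ∈ ms μ P (P + (m - 1)) := hms ▸ mem_ms.2 ⟨P + j, by omega, by omega, rfl⟩
    obtain ⟨y, hy, hy', e⟩ := mem_ms.1 this
    obtain ⟨z, rfl⟩ := Nat.exists_eq_add_of_le hy
    obtain ⟨x, hx, e'⟩ := hmem z (by omega)
    exact ⟨x, hx, e ▸ e'⟩
  have h2 : ∀ j, j + 1 < m → (μ' (P + j)).key < ⊤ := fun j hj => by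
    obtain ⟨x, hx, e⟩ := h1 j hj
    exact e ▸ hit x hx
  refine ⟨h1, fun j hj => ?_, ?_⟩
  · have := hlt j hj
    rw [add_assoc] at this
    exact (Cell.lt_iff (Or.inl (h2 (j + 1) (by omega)))).1 this
  · obtain ⟨i, hi, he, hl⟩ := hlow
    exact ⟨edge n m i, he.trans_le (edge_le _ _ _), (Cell.lt_iff (Or.inl (h2 0 (by omega)))).1 hl⟩

/-- A sample with distinct entries that avoids the minimum passes the check. -/
theorem check_of_good {μ' : Mem α} {P x₀ : ℕ} {d : ℕ → Cell α} {l : List ℕ} (hm : 2 ≤ m)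
    (hnm : n ≤ m * m) (hit : ∀ x < n, (d x).key < ⊤)
    (hinj : ∀ x y, x < n → y < n → (d x).key = (d y).key → x = y) (hx₀ : x₀ < n)
    (hmin : ∀ x < n, (d x₀).key ≤ (d x).key)
    (hcol : ∀ i x, i < m → edge n m i ≤ x → x < edge n m (i + 1) →
      (d (edge n m i)).key ≤ (d x).key)
    (hl : l.Nodup) (hl₀ : x₀ ∉ l) (hln : ∀ z ∈ l, z < n)
    (hms : ms μ' P (P + (m - 1)) = (l.map d : Multiset (Cell α)))
    (hs : Sorted μ' P (P + (m - 1))) :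
    (∀ i, i + 2 < m → (μ' (P + i)).lt (μ' (P + i + 1)) = true) ∧
    ∃ i < m, edge n m i < edge n m (i + 1) ∧ (d (edge n m i)).lt (μ' P) = true := by
  have hmem : ∀ j, j + 1 < m → ∃ x ∈ l, μ' (P + j) = d x := by
    intro j hj
    have : μ' (P + j) ∈ ms μ' P (P + (m - 1)) := mem_ms.2 ⟨P + j, by omega, by omega, rfl⟩
    rw [hms, Multiset.mem_coe] at this
    obtain ⟨x, hx, e⟩ := List.mem_map.1 this
    exact ⟨x, hx, e.symm⟩
  have hkey : ∀ j, j + 1 < m → (μ' (P + j)).key < ⊤ := fun j hj => by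
    obtain ⟨x, hx, e⟩ := hmem j hj
    exact e ▸ hit x (hln x hx)
  have hI : Items μ' P (P + (m - 1)) := fun x hx hx' => by
    obtain ⟨j, rfl⟩ := Nat.exists_eq_add_of_le hx
    exact hkey j (by omega)
  have hnd : (ms μ' P (P + (m - 1))).Nodup := by
    rw [hms, Multiset.coe_nodup]
    exact hl.map_on fun x hx y hy h => hinj x y (hln x hx) (hln y hy) (congrArg _ h)
  constructor
  · intro i hi
    exact (Cell.lt_iff (Or.inl (hI _ (by omega) (by omega)))).2
      (hs.lt hnd hI (by omega) (by omega) (by omega))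
  · obtain ⟨i, hi, h1, h2⟩ := exists_segment (edge n m) (m := m) (x := x₀) (by simp [edge])
      (by rw [edge, min_eq_right hnm]; exact hx₀)
    refine ⟨i, hi, by omega, (Cell.lt_iff (Or.inl (hkey 0 (by omega)))).2 ?_⟩
    obtain ⟨x, hx, e⟩ := hmem 0 (by omega)
    rw [e]
    refine (hcol i x₀ hi h1 h2).trans_lt ((hmin x (hln x hx)).lt_of_ne fun h => ?_)
    exact hl₀ (hinj _ _ hx₀ (hln x hx) h ▸ hx)

/-- The cells that change while the pivots are drawn. -/
def sampleCells (n m fp : ℕ) : Set ℕ :=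
  {a | a = fp + 5 ∨ a = fp + 7 ∨ a = fp + 8 ∨ fp + 9 + 2 * m ≤ a ∧ a < fp + 9 + 2 * m + (m - 1) ∨
    fp + 10 + 4 * m ≤ a ∧ a < fp + 16 * n + 32}

theorem mem_sampleCells (n m fp a : ℕ) : a ∈ sampleCells n m fp ↔
    a = fp + 5 ∨ a = fp + 7 ∨ a = fp + 8 ∨
    fp + 9 + 2 * m ≤ a ∧ a < fp + 9 + 2 * m + (m - 1) ∨
    fp + 10 + 4 * m ≤ a ∧ a < fp + 16 * n + 32 := Iff.rfl

theorem sampleLoop_safe (hB : 64 ≤ B) (h : Locals A D n m fp μ) (hS : Spans n m fp μ)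
    (h8 : μ (fp + 8) = .num 0) (h5m : 5 ≤ m) (h3m : 3 * m ≤ n) (hD : D + n ≤ fp)
    (hit : Items μ D (D + n)) :
    Safe (.box (sortArea A D n fp) (sampleCells n m fp)) (sampleLoop f fp) μ fun _ μ' =>
      Pivots n m (fun x => μ (D + x)) fun j => μ' (fp + 9 + 2 * m + j) := by
  unfold sampleLoop
  have hW := mem_sampleCells n m fp
  have hSm := mem_sortArea A D n fp
  obtain ⟨I, hI⟩ : ∃ I : Mem α → Prop, ∀ μ', I μ' ↔ ∃ b, μ' (fp + 8) = .num b ∧ (0 < b →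
      Pivots n m (fun x => μ (D + x)) fun j => μ' (fp + 9 + 2 * m + j)) := ⟨_, fun _ => Iff.rfl⟩
  refine Safe.loop_box I f ((hI _).2 ⟨0, h8, by simp⟩) fun μ' hfr hμ' => ?_
  obtain ⟨b, e8, hb⟩ := (hI _).1 hμ'
  by_cases hb1 : b < 1
  · simp only [safe_rules, cell_rules, hW, hSm, e8, hb1, decide_true, if_true]
    refine ⟨by omega, by simp, ?_⟩
    obtain ⟨μ₁, hμ₁⟩ : ∃ m', m' = update μ' (fp + 5) (.num 0) := ⟨_, rfl⟩
    rw [← hμ₁]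
    have w : ∀ a, a ∉ sampleCells n m fp → μ₁ a = μ a := fun a h1 => by
      rw [hμ₁, update_of_ne (fun h => h1 ((hW a).2 (Or.inl h))), hfr a h1]
    refine ((drawLoop_safe (h.of_eq fun x h h' => w x (by rw [hW]; omega)) (by simp [hμ₁])
      (by omega) h3m hD).box_frame.box_mono le_rfl ?_).mono fun _ μ₂ h₂ => ?_
    · intro a ha
      rw [Set.mem_ofPred_eq] at ha
      rw [hW]
      omega
    · obtain ⟨hp, hfr₂⟩ := h₂
      have w₂ : ∀ a, a ∉ sampleCells n m fp → μ₂ a = μ a := fun a h1 => by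
        rw [← w a h1]
        refine hfr₂ a fun h2 => h1 ?_
        rw [Set.mem_ofPred_eq] at h2
        rw [hW]
        omega
      have eD : ∀ x < n, μ₂ (D + x) = μ (D + x) := fun x _ => w₂ _ (by rw [hW]; omega)
      have eD₁ : ∀ x < n, μ₁ (D + x) = μ (D + x) := fun x _ => w _ (by rw [hW]; omega)
      have hp' : ∀ j, j + 1 < m → ∃ x < n, μ₂ (fp + 9 + 2 * m + j) = μ (D + x) := fun j hj => by
        obtain ⟨x, hx, e⟩ := hp j hj
        exact ⟨x, hx, e.trans (eD₁ x hx)⟩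
      have hd : ∀ x < n, (μ (D + x)).key < ⊤ := fun x hx => hit _ (by omega) (by omega)
      refine (checkSample_tr hB le_rfl (h.of_eq fun x h h' => w₂ x (by rw [hW]; omega))
        (hS.of_eq fun x h h' => w₂ x (by rw [hW]; omega)) h5m h3m hD ?_).safe.mono
          fun _ μ₃ h₃ => ?_
      · intro y hy hy'
        obtain ⟨j, rfl⟩ := Nat.exists_eq_add_of_le hy
        obtain ⟨x, hx, e⟩ := hp' j (by omega)
        exact e ▸ hd x hx
      · obtain ⟨hms, hs, b', e', hb'⟩ := h₃
        refine (hI _).2 ⟨b', e', fun h0 => ?_⟩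
        obtain ⟨h1, i, hi, h2, h3⟩ := hb'.1 h0
        refine pivots_of_check (by omega) hd hp' hms h1 ⟨i, hi, h2, ?_⟩
        rwa [eD _ (h2.trans_le (edge_le _ _ _))] at h3
  · simp only [safe_rules, cell_rules, hW, hSm, e8, hb1, decide_false, Bool.false_eq_true, if_false]
    exact ⟨by omega, hb (by omega)⟩

open Classical in
/-- If the cost of what follows depends on the accepted sample `l` only through `F l`, the expected
cost is at most `X` and three times the cost of a round plus the average of `F` over all samples:
with probability at most `2/3` the process starts anew. -/
theorem sampleLoop_ex {r : ℕ} (hB : 64 ≤ B) (hk : B ≤ k) (hn : n = r + 1)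
    (h : Locals A D n m fp μ) (hS : Spans n m fp μ) (h8 : μ (fp + 8) = .num 0) (h5m : 5 ≤ m)
    (h3m : 3 * m ≤ n) (hnm : n ≤ m * m) (hmn : (m - 1) * (m - 1) < n) (hD : D + n ≤ fp)
    (hit : Items μ D (D + n)) (hnd : (ms μ D (D + n)).Nodup)
    (hcol : ∀ i < m, Sorted μ (D + edge n m i) (D + edge n m (i + 1)))
    {X : ℝ≥0∞} {F : List ℕ → ℝ≥0∞} {ψ : Unit → Mem α → ℝ≥0∞}
    (hψ : ∀ (l : List ℕ) (μ' : Mem α), (∀ a ∉ sampleCells n m fp, μ' a = μ a) →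
      ms μ' (fp + 9 + 2 * m) (fp + 9 + 2 * m + (m - 1)) =
        (l.map fun x => μ (D + x) : Multiset (Cell α)) →
      Pivots n m (fun x => μ (D + x)) (fun j => μ' (fp + 9 + 2 * m + j)) → ψ () μ' ≤ X + F l) :
    ex k B (sampleLoop f fp) μ ∅ ψ ≤
      X + 3 * ((50000 * (m + m * m / B + 1) : ℕ) + avgL r (m - 1) F) := by
  have hk2 : 2 ≤ k := by omega
  obtain ⟨P, hP⟩ : ∃ P, P = fp + 9 + 2 * m := ⟨_, rfl⟩
  obtain ⟨Y, hY⟩ : ∃ Y, Y = m * m / B := ⟨_, rfl⟩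
  obtain ⟨w, hw⟩ : ∃ w, w = ((50000 * (m + m * m / B + 1) : ℕ) : ℝ≥0∞) + avgL r (m - 1) F :=
    ⟨_, rfl⟩
  have hW := mem_sampleCells n m fp
  have hd : ∀ x < n, (μ (D + x)).key < ⊤ := fun x hx => hit _ (by omega) (by omega)
  have hinj : ∀ x y, x < n → y < n → (μ (D + x)).key = (μ (D + y)).key → x = y := by
    intro x y hx hy e
    have := ms_inj hnd (x := D + x) (y := D + y) (by omega) (by omega) (Cell.key_inj (hd x hx) e)
    omega
  obtain ⟨x₀, hx₀, hmin⟩ := Finset.exists_min_image (range n) (fun x => (μ (D + x)).key)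
    ⟨0, by simp; omega⟩
  simp only [mem_range] at hx₀ hmin
  obtain ⟨good, hgood⟩ : ∃ good : List ℕ → Prop, ∀ l, good l ↔ l.Nodup ∧ ∀ z ∈ l,
    z ∉ ({x₀} : Finset ℕ) := ⟨_, fun _ => Iff.rfl⟩
  -- a sample is rejected with probability at most `2/3`
  have hbad : 3 * avgL r (m - 1) (fun l => if good l then 0 else 1) ≤ 2 := by
    simp only [hgood]
    refine (mul_le_mul_right (avgL_collision (r := r) (q := m - 1) {x₀} (u := 1) (by simp))
      3).trans ?_
    rw [← mul_div_assoc]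
    refine ENNReal.div_le_of_le_mul ?_
    rw [← hn]
    have hs : ∀ q, (∑ i ∈ range q, (1 + i)) * 2 = q * (q + 1) := by
      intro q
      induction q with
      | zero => rfl
      | succ q ih => rw [sum_range_succ, add_mul, ih]; ring
    have := hs (m - 1)
    have h2 : (∑ i ∈ range (m - 1), (1 + i)) * 3 ≤ 2 * n := by
      obtain ⟨s, rfl⟩ : ∃ s, m = s + 1 := ⟨m - 1, by omega⟩
      simp only [Nat.add_sub_cancel] at this hmn ⊢
      nlinarith
    have h3 : 3 * (∑ i ∈ range (m - 1), (1 + i)) ≤ 2 * n := by omega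
    exact_mod_cast h3
  -- the bound holds for every memory in which a round may start
  have main : ∀ (f' : ℕ) (μ' : Mem α), (∀ a ∉ sampleCells n m fp, μ' a = μ a) →
      μ' (fp + 8) = .num 0 → ex k B (loop f' (lt (v (fp + 8)) 1) do
        assign (fp + 5) 0
        drawLoop f fp
        checkSample f fp) μ' ∅ ψ ≤ X + 3 * w := by
    intro f'
    induction f' with
    | zero => intro _ _ _; simp [loop, ex]
    | succ f' ih =>
      intro μ' hfr e8
      rw [loop_succ]
      have hsplit : (iter (lt (v (fp + 8)) 1) do
          assign (fp + 5) 0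
          drawLoop f fp
          checkSample f fp) = lt (v (fp + 8)) 1 >>= fun b => if b then (do
            assign (fp + 5) 0
            drawLoop f fp
            checkSample f fp
            return true) else return false := by
        unfold iter
        congr 1
        funext b
        cases b
        · rfl
        · simp only [if_true]
          exact (Prog.bind_assoc ..).trans (congrArg _ (funext fun _ => Prog.bind_assoc ..))
      rw [hsplit]
      have c1 : Tr k B (.box Set.univ Set.univ) ((2 * 4 : ℕ) : ℝ≥0∞)
          (lt (v (fp + 8)) 1) μ' fun b μ₁ => b = true ∧ μ₁ = μ' := by
        refine Tr.of_len 4 hk2 (by decide) ?_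
        simp only [safe_rules, cell_rules, Set.mem_univ, e8, Nat.zero_lt_one, decide_true, and_self]
      have c2 : Tr k B (.box Set.univ Set.univ) ((2 * 4 : ℕ) : ℝ≥0∞)
          (assign (fp + 5) 0) μ' fun _ μ₁ => μ₁ = update μ' (fp + 5) (.num 0) := by
        refine Tr.of_len 4 hk2 (by decide) ?_
        simp only [safe_rules, cell_rules, Set.mem_univ, and_self]
      obtain ⟨μ₁, hμ₁⟩ : ∃ m', m' = update μ' (fp + 5) (.num 0) := ⟨_, rfl⟩
      rw [← hμ₁] at c2
      have w₁ : ∀ a, a ∉ sampleCells n m fp → μ₁ a = μ a := fun a h1 => by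
        rw [hμ₁, update_of_ne (fun h => h1 ((hW a).2 (Or.inl h))), hfr a h1]
      have eD₁ : ∀ x < n, μ₁ (D + x) = μ (D + x) := fun x _ => w₁ _ (by rw [hW]; omega)
      have hround : ex k B (drawLoop f fp) μ₁ ∅ (fun _ μ₂ => ex k B (do
            checkSample f fp
            return true) μ₂ ∅ fun b μ₃ => ex k B (if b then (loop f' (lt (v (fp + 8)) 1) do
              assign (fp + 5) 0
              drawLoop f fp
              checkSample f fp) else Prog.ret ()) μ₃ ∅ ψ) ≤
          ((m - 1 + 1) * 60 : ℕ) + avgL r (m - 1) fun l =>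
            ((m + m * m / B + 1) * 41000 : ℕ) + (60 + X + F l +
              3 * w * (if good l then 0 else 1)) := by
        subst hn
        refine drawLoop_ex hk2 hD (h.of_eq fun x h h' => w₁ x (by rw [hW]; omega))
          (by rw [hμ₁, update_self]) (by omega) fun l hl hz μ₂ hfr₂ hv => ?_
        have w₂ : ∀ a, a ∉ sampleCells (r + 1) m fp → μ₂ a = μ a := fun a h1 => by
          rw [← w₁ a h1]
          rw [hW] at h1
          exact hfr₂ a (by omega) (by omega)
        have eD₂ : ∀ x < r + 1, μ₂ (D + x) = μ (D + x) := fun x _ => w₂ _ (by rw [hW]; omega)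
        have hget : ∀ j < m - 1, l.getD j 0 < r + 1 := fun j hj => by
          rw [List.getD_eq_getElem _ _ (by omega)]
          exact hz _ (List.getElem_mem _)
        have hv' : ∀ j < m - 1, μ₂ (P + j) = μ (D + l.getD j 0) := fun j hj => by
          rw [← eD₁ _ (hget j hj), ← hv j hj, hP, add_zero]
        have hms₂ : ms μ₂ P (P + (m - 1)) = (l.map fun x => μ (D + x) : Multiset (Cell α)) := by
          rw [← hl]
          exact ms_eq_map fun j hj => hv' j (by omega)
        refine ex_bind_le.trans ((checkSample_tr hB hk
          (h.of_eq fun x h h' => w₂ x (by rw [hW]; omega))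
          (hS.of_eq fun x h h' => w₂ x (by rw [hW]; omega)) h5m h3m hD ?_).box_frame.cost _ _
            fun _ μ₃ h₃ => ?_)
        · intro y hy hy'
          rw [← hP] at hy hy'
          obtain ⟨j, rfl⟩ := Nat.exists_eq_add_of_le hy
          rw [hv' j (by omega)]
          exact hd _ (hget j (by omega))
        · obtain ⟨⟨hms, hs, b, e8', hb⟩, hfr₃⟩ := h₃
          rw [← hP] at hms hs hb
          have w₃ : ∀ a, a ∉ sampleCells (r + 1) m fp → μ₃ a = μ a := fun a h1 => by
            rw [← w₂ a h1]
            exact hfr₃ a h1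
          have hc : (pure true >>= fun b : Bool => pure b : Prog Bool) = pure true := rfl
          change ex k B (loop f' (lt (v (fp + 8)) 1) do
              assign (fp + 5) 0
              drawLoop f fp
              checkSample f fp) μ₃ ∅ ψ ≤ _
          rcases Nat.eq_zero_or_pos b with rfl | hb0
          · have hng : ¬ good l := by
              intro hg
              rw [hgood] at hg
              refine lt_irrefl 0 (hb.2 ?_)
              have hfirst : ∀ i x, i < m → edge (r + 1) m i ≤ x → x < edge (r + 1) m (i + 1) →
                  (μ (D + edge (r + 1) m i)).key ≤ (μ (D + x)).key := by
                intro i x hi h1 h2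
                rcases h1.eq_or_lt with rfl | h1
                · exact le_rfl
                · exact hcol i hi _ _ le_rfl (by omega) (by omega)
              obtain ⟨g1, i, hi, g2, g3⟩ := check_of_good (d := fun x => μ (D + x)) (by omega) hnm
                  hd
                hinj hx₀ hmin hfirst hg.1
                (fun h => hg.2 _ h (Finset.mem_singleton_self _)) hz (hms.trans hms₂) hs
              refine ⟨g1, i, hi, g2, ?_⟩
              rwa [eD₂ _ (g2.trans_le (edge_le _ _ _))]
            rw [if_neg hng, mul_one]
            refine (ih μ₃ w₃ e8').trans (add_le_add_left ?_ _)
            exact (le_add_left le_rfl).trans (le_add_right le_rfl)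
          · obtain ⟨g1, i, hi, g2, g3⟩ := hb.1 hb0
            rw [eD₂ _ (g2.trans_le (edge_le _ _ _))] at g3
            have hpv := pivots_of_check (d := fun x => μ (D + x)) (by omega) hd
              (fun j hj => ⟨_, hget j (by omega), hv' j (by omega)⟩) hms g1 ⟨i, hi, g2, g3⟩
            refine le_trans ?_ (le_add_right le_rfl)
            rw [add_assoc]
            cases f' with
            | zero => simp [loop, ex]
            | succ f' =>
              rw [loop_succ]
              have c3 : Tr k B (.box Set.univ Set.univ) ((2 * 4 : ℕ) : ℝ≥0∞)
                  (lt (v (fp + 8)) 1) μ₃ fun b μ₄ => b = false ∧ μ₄ = μ₃ := by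
                refine Tr.of_len 4 hk2 (by decide) ?_
                simp only [safe_rules, cell_rules, Set.mem_univ, e8', show ¬ b < 1 by omega,
                  decide_false, and_self]
              refine ex_bind_le.trans (ex_bind_le.trans ((c3.cost _ (X + F l)
                fun b μ₄ h₄ => ?_).trans (add_le_add_left (by norm_num) _)))
              obtain ⟨rfl, rfl⟩ := h₄
              rw [hP] at hms hms₂ hpv
              exact hψ l μ₄ w₃ (hms.trans hms₂) hpv
      obtain ⟨Z, hZ⟩ : ∃ Z, Z = ((m - 1 + 1) * 60 : ℕ) + avgL r (m - 1) fun l =>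
        ((m + m * m / B + 1) * 41000 : ℕ) + (60 + X + F l + 3 * w * (if good l then 0 else 1)) :=
        ⟨_, rfl⟩
      rw [← hZ] at hround
      refine ex_bind_le.trans (ex_bind_le.trans ((c1.cost _ (((2 * 4 : ℕ) : ℝ≥0∞) + Z)
        fun b μ₂ h₂ => ?_).trans ?_))
      · obtain ⟨rfl, rfl⟩ := h₂
        refine ex_bind_le.trans (c2.cost _ _ fun _ μ₂ h₂ => ?_)
        rw [h₂]
        exact ex_bind_le.trans hround
      · rw [hZ, avgL_add, avgL_add, avgL_add, avgL_const, avgL_const, avgL_mul]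
        have h1 : ((2 * 4 : ℕ) : ℝ≥0∞) + ((2 * 4 : ℕ) + (((m - 1 + 1) * 60 : ℕ) +
            (((m + m * m / B + 1) * 41000 : ℕ) + (60 + X + avgL r (m - 1) F +
              3 * w * avgL r (m - 1) fun l => if good l then 0 else 1)))) =
            X + (((2 * 4 + (2 * 4 + ((m - 1 + 1) * 60 + ((m + m * m / B + 1) * 41000 + 60))) : ℕ) :
              ℝ≥0∞) + avgL r (m - 1) F + w * (3 * avgL r (m - 1) fun l => if good l then 0 else 1))
            := by
          push_cast
          ring
        rw [h1]
        refine add_le_add_right ?_ _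
        calc _ ≤ w + w * 2 := by
              refine add_le_add ?_ (mul_le_mul_right hbad _)
              rw [hw]
              refine add_le_add_left (Nat.cast_le.2 ?_) _
              rw [← hY]
              omega
          _ = 3 * w := by ring
  rw [← hw]
  exact main f μ (fun _ _ => rfl) h8

/-! ### One level of the recursion -/

theorem Pivots.congr {d d' piv : ℕ → Cell α} (h : Pivots n m d piv) (hd : ∀ x < n, d' x = d x) :
    Pivots n m d' piv := by
  obtain ⟨h1, h2, x, hx, h3⟩ := h
  refine ⟨fun j hj => ?_, h2, x, hx, by rwa [hd x hx]⟩
  obtain ⟨y, hy, e⟩ := h1 j hj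
  exact ⟨y, hy, by rw [hd y hy, e]⟩

theorem sampleCells_subset (h3m : 3 * m ≤ n) : sampleCells n m fp ⊆ sortArea A D n fp := by
  intro a ha
  change fp ≤ a ∧ a < fp + 16 * n + 32 ∨ A ≤ a ∧ a < A + n ∨ D ≤ a ∧ a < D + n
  change a = fp + 5 ∨ a = fp + 7 ∨ a = fp + 8 ∨ fp + 9 + 2 * m ≤ a ∧ a < fp + 9 + 2 * m + (m - 1) ∨
    fp + 10 + 4 * m ≤ a ∧ a < fp + 16 * n + 32 at ha
  omega

/-- A quadratic bound on the cost of sorting becomes one by the number of unseparated pairs. -/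
theorem sum_cost_bucketSize_le {T : ℕ → ℝ≥0∞} {d piv : ℕ → Cell α} {a b c : ℝ} (ha : 0 ≤ a)
    (hb : 0 ≤ b) (hc : 0 ≤ c) (hT : ∀ y ≤ n, T y ≤ ENNReal.ofReal (a + b * y + c * (y : ℝ) ^ 2))
    (hpv : Pivots n m d piv) :
    ∑ j ∈ range m, T (bucketSize n m d piv j) ≤ ENNReal.ofReal (m * a + b * n) +
      ENNReal.ofReal (2 * c) * (unseparated n d (fun x => ∃ j, j + 1 < m ∧ piv j = x) : ℝ≥0∞) := by
  obtain ⟨h1, h2⟩ := sum_bucketSize_le (n := n) (d := d) fun j hj => (hpv.lt j hj).le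
  have hle : ∀ j, bucketSize n m d piv j ≤ n := fun j => by
    classical
    rw [bucketSize]
    exact (Finset.card_filter_le _ _).trans (card_range n).le
  refine (sum_le_sum fun j _ => hT _ (hle j)).trans ?_
  rw [← ENNReal.ofReal_sum_of_nonneg fun j _ => by positivity, ← ENNReal.ofReal_natCast,
    ← ENNReal.ofReal_mul (by positivity), ← ENNReal.ofReal_add (by positivity) (by positivity)]
  refine ENNReal.ofReal_le_ofReal ?_
  rw [sum_add_distrib, sum_add_distrib, ← Finset.mul_sum, ← Finset.mul_sum,
    Finset.sum_const, card_range, nsmul_eq_mul]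
  have h1' : (∑ j ∈ range m, (bucketSize n m d piv j : ℝ)) ≤ n := by exact_mod_cast h1
  have h2' : (∑ j ∈ range m, (bucketSize n m d piv j : ℝ) ^ 2) ≤
      2 * (unseparated n d (fun x => ∃ j, j + 1 < m ∧ piv j = x) : ℝ) := by exact_mod_cast h2
  have := mul_le_mul_of_nonneg_left h1' hb
  have := mul_le_mul_of_nonneg_left h2' hc
  linarith

/-- From the sorted columns to the sorted array. The expected number of unseparated pairs is at most
`n (m + 1)`, hence the term `12 c n m`. -/
theorem sample_distribute_tr (hB : 1024 ≤ B) (hk : B ≤ k) {T : ℕ → ℝ≥0∞}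
    (hp : SortSpec α k B T (squareSort f)) (h : Locals A D n m fp μ) (hS : Spans n m fp μ)
    (h8 : μ (fp + 8) = .num 0) (h5m : 5 ≤ m) (h3m : 3 * m ≤ n) (hnm : n ≤ m * m)
    (hmn : (m - 1) * (m - 1) < n)
    (hAD : A + n ≤ D ∨ D + n ≤ A) (hA : A + n ≤ fp) (hD : D + n ≤ fp)
    (hit : Items μ D (D + n)) (hnd : (ms μ D (D + n)).Nodup)
    (hcol : ∀ i < m, Sorted μ (D + edge n m i) (D + edge n m (i + 1)))
    {a b c : ℝ} (ha : 0 ≤ a) (hb : 0 ≤ b) (hc : 0 ≤ c)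
    (hT : ∀ y ≤ n, T y ≤ ENNReal.ofReal (a + b * y + c * (y : ℝ) ^ 2)) :
    Tr k B (.box (sortArea A D n fp) (sortArea A D n fp))
      ((152000 * (m + m * m / B + n / B + 1) : ℕ) + (ENNReal.ofReal (m * a + b * n) +
        ENNReal.ofReal (12 * c * n * m)))
      (do sampleLoop f fp; distribute f fp) μ fun _ μ' =>
        ms μ' D (D + n) = ms μ D (D + n) ∧ Sorted μ' D (D + n) := by
  have hW := mem_sampleCells n m fp
  obtain ⟨Y, hY⟩ : ∃ Y, Y = m * m / B := ⟨_, rfl⟩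
  obtain ⟨Z, hZ⟩ : ∃ Z, Z = n / B := ⟨_, rfl⟩
  have hd : ∀ x < n, (μ (D + x)).key < ⊤ := fun x hx => hit _ (by omega) (by omega)
  -- the state after sampling
  have key : ∀ μ' : Mem α, (∀ a ∉ sampleCells n m fp, μ' a = μ a) →
      Pivots n m (fun x => μ (D + x)) (fun j => μ' (fp + 9 + 2 * m + j)) →
      Tr k B (.box (sortArea A D n fp) (sortArea A D n fp))
      ((2000 * (m + m * m / B + n / B + 1) : ℕ) + ∑ j ∈ range m,
        T (bucketSize n m (fun x => μ (D + x)) (fun j => μ' (fp + 9 + 2 * m + j)) j))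
      (distribute f fp) μ' fun _ μ'' =>
        ms μ'' D (D + n) = ms μ D (D + n) ∧ Sorted μ'' D (D + n) := by
    intro μ' hfr hpv
    have eD : ∀ a, D ≤ a → a < D + n → μ' a = μ a := fun a _ _ => hfr a (by rw [hW]; omega)
    have hms : ms μ' D (D + n) = ms μ D (D + n) := ms_congr eD
    have hsum : ∑ j ∈ range m, T (bucketSize n m (fun x => μ (D + x))
        (fun j => μ' (fp + 9 + 2 * m + j)) j) = ∑ j ∈ range m, T (bucketSize n m
          (fun x => μ' (D + x)) (fun j => μ' (fp + 9 + 2 * m + j)) j) := by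
      refine sum_congr rfl fun j hj => congrArg T ?_
      exact bucketSize_congr (fun x hx => (eD (D + x) (by omega) (by omega)).symm) (fun _ _ => rfl)
        (mem_range.1 hj)
    rw [hsum, ← hms]
    refine distribute_tr hB hk hp (h.of_eq fun x h h' => hfr x (by rw [hW]; omega))
      (hS.of_eq fun x h h' => hfr x (by rw [hW]; omega)) h5m h3m hnm hAD hA hD (hit.of_ms hms)
      (hms ▸ hnd) (fun i hi x y hx hxy hy => ?_)
      (hpv.congr fun x hx => eD (D + x) (by omega) (by omega))
    have := edge_le n m (i + 1)
    rw [eD x (by omega) (by omega), eD y (by omega) (by omega)]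
    exact hcol i hi x y hx hxy hy
  refine ⟨?_, fun ψ K hK => ?_⟩
  · rw [safe_rules.2.2.1]
    refine ((sampleLoop_safe (B := B) (by omega) h hS h8 h5m h3m hD hit).box_frame.box_mono le_rfl
      (sampleCells_subset h3m)).mono fun _ μ' h => (key μ' h.2 h.1).safe
  · obtain ⟨r, hr⟩ : ∃ r, n = r + 1 := ⟨n - 1, by omega⟩
    refine ex_bind_le.trans ((sampleLoop_ex (r := r)
        (X := (2000 * (m + m * m / B + n / B + 1) : ℕ) +
      ENNReal.ofReal (m * a + b * n) + K) (F := fun l => ENNReal.ofReal (2 * c) *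
      (unseparated (r + 1) (fun x => μ (D + x)) (· ∈ l.map fun x => μ (D + x)) : ℝ≥0∞)) (by omega)
          hk
      hr h hS h8 h5m h3m hnm hmn hD hit hnd hcol fun l μ' hfr hms hpv => ?_).trans ?_)
    · refine ((key μ' hfr hpv).cost ψ K hK).trans ?_
      have hpred : (fun x => ∃ j, j + 1 < m ∧ μ' (fp + 9 + 2 * m + j) = x) =
          fun x => x ∈ l.map fun x => μ (D + x) := by
        funext x
        rw [← Multiset.mem_coe, ← hms, mem_ms]
        refine propext ⟨?_, ?_⟩
        · rintro ⟨j, hj, e⟩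
          exact ⟨_, by omega, by omega, e⟩
        · rintro ⟨y, hy, hy', e⟩
          obtain ⟨j, rfl⟩ := Nat.exists_eq_add_of_le hy
          exact ⟨j, by omega, e⟩
      have hs := sum_cost_bucketSize_le ha hb hc hT hpv
      rw [hpred] at hs
      rw [← hr]
      refine (add_le_add_left (add_le_add_right hs _) _).trans (le_of_eq ?_)
      ring
    · have hU := avgL_unseparated (d := fun x => μ (D + x)) (r := r) (q := m - 1) (m := m)
        (by omega) (by omega) (fun x y hx hy e => by
          have := ms_inj hnd (x := D + x) (y := D + y) (by omega) (by omega)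
            (Cell.key_inj (hd x (by omega)) e)
          omega)
      have h6 : 3 * (ENNReal.ofReal (2 * c) * (((r + 1) * (m + 1) : ℕ) : ℝ≥0∞)) ≤
          ENNReal.ofReal (12 * c * n * m) := by
        rw [← hr, ← ENNReal.ofReal_natCast, ← ENNReal.ofReal_mul (by positivity),
          show (3 : ℝ≥0∞) = ENNReal.ofReal 3 by simp, ← ENNReal.ofReal_mul (by norm_num)]
        refine ENNReal.ofReal_le_ofReal ?_
        push_cast
        have h1 : (1 : ℝ) ≤ m := by exact_mod_cast (by omega : 1 ≤ m)
        have h2 : 0 ≤ c * n := by positivity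
        nlinarith
      rw [avgL_mul, mul_add (3 : ℝ≥0∞)]
      have h7 : 3 * (ENNReal.ofReal (2 * c) * avgL r (m - 1) fun l =>
          (unseparated (r + 1) (fun x => μ (D + x)) (· ∈ l.map fun x => μ (D + x)) : ℝ≥0∞)) ≤
          ENNReal.ofReal (12 * c * n * m) :=
        (mul_le_mul_right (mul_le_mul_right hU _) _).trans h6
      refine (add_le_add_right (add_le_add_right h7 _) _).trans ?_
      rw [← hY, ← hZ]
      have h8 : (2000 * (m + Y + Z + 1) + 3 * (50000 * (m + Y + 1)) : ℕ) ≤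
          152000 * (m + Y + Z + 1) := by clear * -; omega
      calc _ = ((2000 * (m + Y + Z + 1) + 3 * (50000 * (m + Y + 1)) : ℕ) : ℝ≥0∞) +
            (ENNReal.ofReal (m * a + b * n) + ENNReal.ofReal (12 * c * n * m)) + K := by
              push_cast
              ring
        _ ≤ _ := add_le_add_left (add_le_add_left (Nat.cast_le.2 h8) _) _

theorem squareSort_small (h1 : μ (fp + 1) = .num A) (h2 : μ (fp + 2) = .num D)
    (h3 : μ (fp + 3) = .num n) (hAD : A + n ≤ D ∨ D + n ≤ A) (hA : A + n ≤ fp) (hD : D + n ≤ fp)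
    (hit : Items μ A (A + n)) (hn : n < 17) :
    Safe (.box (sortArea A D n fp) (sortArea A D n fp)) (squareSort (f + 1) fp) μ fun _ μ' =>
      ms μ' D (D + n) = ms μ A (A + n) ∧ Sorted μ' D (D + n) := by
  have hSm := mem_sortArea A D n fp
  rw [squareSort_eq]
  simp only [safe_cond, safe_rules, cell_rules, hSm, h3, hn, decide_true, if_true]
  refine ⟨by omega, ?_⟩
  have hrd : ∀ a, a ∈ sortArea A D n fp → ∀ μ' : Mem α,
    (Policy.box (sortArea A D n fp) (sortArea A D n fp)).rd μ' a := fun _ h _ => h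
  refine (Tr.call (k := 2) (B := 1) (e := ⊤) 30 le_rfl (by decide) Eval.lit
    (as := [A, D, n]) (.cons (Eval.v (by omega) h1 (hrd _ (by rw [hSm]; omega)))
    (.cons (Eval.v (by omega) h2 (hrd _ (by rw [hSm]; omega)))
    (.cons (Eval.v (by omega) h3 (hrd _ (by rw [hSm]; omega))) .nil))) (fun μ' y d h h' => ?_)
    fun μ₁ g1 g2 => ?_).safe
  · simp only [List.length_cons, List.length_nil] at h'
    change y ∈ sortArea A D n fp
    rw [hSm]
    omega
  · simp only [List.length_cons, List.length_nil] at g2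
    have e1 : μ₁ (fp + 9 + 1) = _ := g1 0 _ rfl
    have e2 : μ₁ (fp + 9 + 2) = _ := g1 1 _ rfl
    have e3 : μ₁ (fp + 9 + 3) = _ := g1 2 _ rfl
    have eA : ms μ₁ A (A + n) = ms μ A (A + n) := ms_congr fun a _ _ => g2 a (by omega)
    refine (Tr.of_safe ((simpleSort_safe e1 e2 e3 (by omega) (by omega) hAD
      (hit.of_ms eA)).box_mono ?_ ?_)).mono le_rfl ?_
    · intro a ha
      rw [hSm]
      simp only [Set.mem_ofPred_eq] at ha
      omega
    · intro a ha
      rw [hSm]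
      simp only [Set.mem_ofPred_eq] at ha
      omega
    · rintro _ μ' ⟨h4, h5⟩
      exact ⟨hrd _ (by rw [hSm]; omega) _, h4.trans eA, h5⟩

theorem ceilSqrt_bounds (hn : 17 ≤ n) (hm : m = ceilSqrt n) :
    5 ≤ m ∧ 3 * m ≤ n ∧ n ≤ m * m ∧ (m - 1) * (m - 1) < n := by
  have h1 := Nat.sqrt_le n
  have h2 := Nat.lt_succ_sqrt n
  rw [Nat.succ_eq_add_one] at h2
  rw [ceilSqrt] at hm
  obtain ⟨s, hs⟩ : ∃ s, s = n.sqrt := ⟨_, rfl⟩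
  rw [← hs] at h1 h2 hm
  have h4 : 4 ≤ s := by
    by_contra h
    have : s ≤ 3 := by omega
    nlinarith
  split_ifs at hm with h
  · subst hm
    refine ⟨by omega, ?_, h2.le, by simpa using h⟩
    rcases h4.eq_or_lt with rfl | h4
    · omega
    · nlinarith
  · subst hm
    have h5 : n = m * m := by omega
    have h6 : 5 ≤ m := by
      by_contra h
      have : m ≤ 4 := by omega
      nlinarith
    refine ⟨h6, by nlinarith, h5.le, ?_⟩
    obtain ⟨t, rfl⟩ : ∃ t, m = t + 1 := ⟨m - 1, by omega⟩
    rw [Nat.add_sub_cancel, h5]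
    nlinarith

/-- The recurrence for the expected cost, for any linear majorant of the cost of the columns and any
quadratic majorant of the cost of the buckets. -/
theorem squareSort_large (hB : 1024 ≤ B) (hk : B ≤ k) {T : ℕ → ℝ≥0∞}
    (hp : SortSpec α k B T (squareSort f)) (h1 : μ (fp + 1) = .num A) (h2 : μ (fp + 2) = .num D)
    (h3 : μ (fp + 3) = .num n) (hAD : A + n ≤ D ∨ D + n ≤ A) (hA : A + n ≤ fp) (hD : D + n ≤ fp)
    (hit : Items μ A (A + n)) (hnd : (ms μ A (A + n)).Nodup) (hn : 17 ≤ n) (hm : m = ceilSqrt n)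
    {a b c a' b' : ℝ} (ha : 0 ≤ a) (hb : 0 ≤ b) (hc : 0 ≤ c) (ha' : 0 ≤ a') (hb' : 0 ≤ b')
    (hT' : ∀ y ≤ m, T y ≤ ENNReal.ofReal (a' + b' * y))
    (hT : ∀ y ≤ n, T y ≤ ENNReal.ofReal (a + b * y + c * (y : ℝ) ^ 2)) :
    Tr k B (.box (sortArea A D n fp) (sortArea A D n fp))
      (ENNReal.ofReal (160000 * (m + m * m / B + n / B + 1) + (m * a' + b' * n) +
        (m * a + b * n + 12 * c * n * m)))
      (squareSort (f + 1) fp) μ fun _ μ' =>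
        ms μ' D (D + n) = ms μ A (A + n) ∧ Sorted μ' D (D + n) := by
  have hk2 : 2 ≤ k := by omega
  obtain ⟨h5m, h3m, hnm, hmn⟩ := ceilSqrt_bounds hn hm
  obtain ⟨S, hS'⟩ : ∃ S : Set ℕ, S = sortArea A D n fp := ⟨_, rfl⟩
  have hSm := mem_sortArea A D n fp
  rw [← hS'] at hSm
  obtain ⟨X, hX⟩ : ∃ X, X = m * m / B := ⟨_, rfl⟩
  obtain ⟨Y, hY⟩ : ∃ Y, Y = n / B := ⟨_, rfl⟩
  obtain ⟨Z, hZ⟩ : ∃ Z, Z = ENNReal.ofReal (m * a + b * n) + ENNReal.ofReal (12 * c * n * m) :=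
    ⟨_, rfl⟩
  obtain ⟨Z', hZ'⟩ : ∃ Z', Z' = ∑ i ∈ range m, T (edge n m (i + 1) - edge n m i) := ⟨_, rfl⟩
  -- the total length of the columns is `n`, and each of them has at most `m` items
  have hcols : Z' ≤ ENNReal.ofReal (m * a' + b' * n) := by
    have hlen : ∀ l, ∑ i ∈ range l, (edge n m (i + 1) - edge n m i) = edge n m l := by
      intro l
      induction l with
      | zero => simp [edge]
      | succ l ih =>
        rw [sum_range_succ, ih]
        have := edge_mono n m (show l ≤ l + 1 by omega)
        omega
    have hle : ∀ i, edge n m (i + 1) - edge n m i ≤ m := fun i => by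
      have := edge_succ_le n m i
      omega
    rw [hZ']
    refine (sum_le_sum fun i _ => hT' _ (hle i)).trans ?_
    rw [← ENNReal.ofReal_sum_of_nonneg fun j _ => by positivity]
    refine ENNReal.ofReal_le_ofReal (le_of_eq ?_)
    have hl := hlen m
    rw [edge, min_eq_right hnm] at hl
    rw [sum_add_distrib, ← Finset.mul_sum, Finset.sum_const, card_range, nsmul_eq_mul,
      ← Nat.cast_sum, hl]
  have hcost : ((160000 * (m + X + Y + 1) : ℕ) : ℝ≥0∞) + (Z' + Z) ≤
      ENNReal.ofReal (160000 * (m + m * m / B + n / B + 1) + (m * a' + b' * n) +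
        (m * a + b * n + 12 * c * n * m)) := by
    refine (add_le_add_right (add_le_add_left hcols _) _).trans ?_
    rw [hZ, ← ENNReal.ofReal_natCast, ← ENNReal.ofReal_add (by positivity) (by positivity),
      ← ENNReal.ofReal_add (by positivity) (by positivity),
      ← ENNReal.ofReal_add (by positivity) (by positivity)]
    refine ENNReal.ofReal_le_ofReal ?_
    have g1 : (X : ℝ) ≤ m * m / B := by
      rw [hX]
      exact Nat.cast_div_le.trans (le_of_eq (by push_cast; rfl))
    have g2 : (Y : ℝ) ≤ n / B := hY ▸ Nat.cast_div_le
    push_cast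
    linarith
  refine Tr.mono ?_ hcost fun _ _ h => h
  clear hcost
  rw [squareSort_eq, ← hS']
  refine (Tr.cond (e := (159000 * (m + X + Y + 1) : ℕ) + (Z' + Z)) 4 hk2 (by decide) ?_).mono ?_
    fun _ _ h => h
  swap
  · rw [← add_assoc, ← Nat.cast_add]
    exact add_le_add_left (Nat.cast_le.2 (by clear * -; omega)) _
  simp only [safe_rules, cell_rules, hSm, h3, show ¬ n < 17 by omega, decide_false,
    Bool.false_eq_true, if_false]
  refine ⟨by omega, ?_⟩
  refine Tr.step_add (c' := 158000 * (m + X + Y + 1)) 4 hk2 (by decide) (by clear * -; omega) ?_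
  simp only [safe_rules, cell_rules, hSm, h3]
  refine ⟨by omega, by omega, ?_⟩
  refine Tr.step_add (c' := 157000 * (m + X + Y + 1)) 4 hk2 (by decide) (by clear * -; omega) ?_
  simp only [safe_rules, cell_rules, hSm, ← hm]
  refine ⟨by omega, ?_⟩
  obtain ⟨μ₁, hμ₁⟩ : ∃ m', m' = update (update μ (fp + 4) (.num m)) (fp + 5)
    (.num 0) := ⟨_, rfl⟩
  rw [← hμ₁]
  have v₁ : ∀ a, a ≠ fp + 4 → a ≠ fp + 5 → μ₁ a = μ a := fun a h h' => by
    rw [hμ₁, update_of_ne h', update_of_ne h]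
  have l₁ : Locals A D n m fp μ₁ := by
    refine ⟨?_, ?_, ?_, ?_⟩
    · rw [v₁ _ (by omega) (by omega), h1]
    · rw [v₁ _ (by omega) (by omega), h2]
    · rw [v₁ _ (by omega) (by omega), h3]
    · rw [hμ₁, update_of_ne (by omega), update_self]
  refine (Tr.bind ((spanLoop_tr (f := f) hk2 l₁
    (by rw [hμ₁, update_self])).box_frame.box_mono (fun a ha => ?_) (fun a ha => ?_))
    (e' := (156000 * (m + X + Y + 1) : ℕ) + (Z' + Z)) ?_).mono ?_ fun _ _ h => h
  · rw [hSm]; simp only [mem_rules] at ha; omega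
  · rw [hSm]; simp only [mem_rules] at ha; omega
  swap
  · rw [← add_assoc, ← Nat.cast_add]
    exact add_le_add_left (Nat.cast_le.2 (by clear * -; omega)) _
  rintro _ μ₂ ⟨s₂, fr₂⟩
  simp only [mem_rules, not_or, not_and, not_lt] at fr₂
  refine Tr.step_add (c' := 155000 * (m + X + Y + 1)) 4 hk2 (by decide) (by clear * -; omega) ?_
  simp only [safe_rules, cell_rules, hSm]
  refine ⟨by omega, ?_⟩
  obtain ⟨μ₃, hμ₃⟩ : ∃ m', m' = update μ₂ (fp + 5) (.num 0) := ⟨_, rfl⟩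
  rw [← hμ₃]
  have v₃ : ∀ a, a ≠ fp + 5 → μ₃ a = μ₂ a := fun a h => by rw [hμ₃, update_of_ne h]
  have w₃ : ∀ a, a ≠ fp + 5 → a < fp + 9 → μ₃ a = μ₁ a := fun a h h' => by
    rw [v₃ a h, fr₂ a ⟨h, fun _ => by omega⟩]
  have eA : ∀ a, A ≤ a → a < A + n → μ₃ a = μ a := fun a _ _ => by
    rw [w₃ a (by omega) (by omega), v₁ a (by omega) (by omega)]
  have msA : ms μ₃ A (A + n) = ms μ A (A + n) := ms_congr eA
  have l₃ := l₁.of_eq (μ' := μ₃) fun x h h' => w₃ x (by omega) (by omega)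
  have s₃ := s₂.of_eq (μ' := μ₃) fun x h h' => v₃ x (by omega)
  refine (Tr.bind ((columnLoop_tr (f := f) hp hk2 l₃ s₃ (by rw [hμ₃, update_self]) h5m h3m hAD
    hA hD (hit.of_ms msA) (msA ▸ hnd)).box_frame.box_mono (fun a ha => ?_) (fun a ha => ?_))
    (e' := (153000 * (m + X + Y + 1) : ℕ) + Z) ?_).mono ?_ fun _ _ h => h
  · rw [hSm]; exact ha
  · rw [hSm]; simp only [mem_rules] at ha; omega
  swap
  · rw [← hZ', add_add_add_comm, ← Nat.cast_add]
    exact add_le_add_left (Nat.cast_le.2 (by clear * -; omega)) _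
  rintro _ μ₄ ⟨c₄, fr₄⟩
  simp only [mem_rules, not_or, not_and, not_lt] at fr₄
  have l₄ := l₃.of_eq (μ' := μ₄) fun x h h' => fr₄ x (by omega)
  have s₄ := s₃.of_eq (μ' := μ₄) fun x h h' => fr₄ x (by omega)
  have hedge : ∀ i < m, edge n m i ≤ edge n m (i + 1) := fun i _ => edge_mono n m (by omega)
  have e0 : edge n m 0 = 0 := by simp [edge]
  have em : edge n m m = n := by rw [edge, min_eq_right hnm]
  have msD : ms μ₄ D (D + n) = ms μ A (A + n) := by
    have t1 := (ms_split μ₄ (edge n m) D m hedge).2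
    have t2 := (ms_split μ₃ (edge n m) A m hedge).2
    rw [e0, em, add_zero] at t1 t2
    rw [t1, ← msA, t2]
    exact sum_congr rfl fun i hi => (c₄ i (mem_range.1 hi)).1
  refine Tr.step_add (c' := 152000 * (m + X + Y + 1)) 4 hk2 (by decide) (by clear * -; omega) ?_
  simp only [safe_rules, cell_rules, hSm]
  refine ⟨by omega, ?_⟩
  obtain ⟨μ₅, hμ₅⟩ : ∃ m', m' = update μ₄ (fp + 8) (.num 0) := ⟨_, rfl⟩
  rw [← hμ₅]
  have v₅ : ∀ a, a ≠ fp + 8 → μ₅ a = μ₄ a := fun a h => by rw [hμ₅, update_of_ne h]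
  have msD' : ms μ₅ D (D + n) = ms μ A (A + n) :=
    (ms_congr fun a _ _ => v₅ a (by omega)).trans msD
  rw [hS', hX, hY, hZ, ← msD']
  refine sample_distribute_tr hB hk hp (l₄.of_eq fun x h h' => v₅ x (by omega))
    (s₄.of_eq fun x h h' => v₅ x (by omega)) (by rw [hμ₅, update_self]) h5m h3m hnm hmn hAD
    hA hD (hit.of_ms msD') (msD' ▸ hnd) (fun i hi x y hx hxy hy => ?_) ha hb hc hT
  have := edge_le n m (i + 1)
  rw [v₅ x (by omega), v₅ y (by omega)]
  exact (c₄ i hi).2 x y hx hxy hy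

/-! ### Solving the recurrence -/

/-- The solution of the recurrence. Up to `L` items, everything fits into the cache. -/
noncomputable def bound (L B y : ℝ) : ℝ :=
  if y ≤ L then 36 * (y / B + 1) else 10 ^ 7 * (y / B) * (2 * (Real.log y / Real.log L) - 1)

/-- `bound` satisfies the recurrence. With `u = n / B`, `p = log n / log L` and `q = log m / log L`,
where `2 q ≤ p` up to a small error, the claim is `10⁷ u (2 p - 1)` on the right side. A majorant of
the cost of the buckets comes from a tangent `log y ≤ log z + y / z`, which makes `y log y`
quadratic in `y`. The columns and the linear part of the buckets contribute `10⁷ u (2 q - 1)` each,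
which leaves room for `10⁷ u` on all other terms; the quadratic part contributes
`24 · 10⁷ u / log L`, which is small as `log L ≥ 200`. -/
theorem bound_recurrence {L B n m : ℝ} (hB : 0 < B) (hL : 1 < L) (hlog : 200 ≤ Real.log L)
    (hBL : B ^ 2 ≤ 36 * L) (hn : L < n) (hm : 1 ≤ m) (hmn : m ^ 2 ≤ 4 * n) :
    ∃ a b c a' b' : ℝ, 0 ≤ a ∧ 0 ≤ b ∧ 0 ≤ c ∧ 0 ≤ a' ∧ 0 ≤ b' ∧
      (∀ y, 0 ≤ y → y ≤ m → bound L B y ≤ a' + b' * y) ∧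
      (∀ y, 0 ≤ y → y ≤ n → bound L B y ≤ a + b * y + c * y ^ 2) ∧
      160000 * (m + m * m / B + n / B + 1) + (m * a' + b' * n) + (m * a + b * n + 12 * c * n * m) ≤
        bound L B n := by
  obtain ⟨lam, hlam⟩ : ∃ lam, lam = Real.log L := ⟨_, rfl⟩
  obtain ⟨u, hu⟩ : ∃ u, u = n / B := ⟨_, rfl⟩
  obtain ⟨e, he⟩ : ∃ e, e = 1 / lam := ⟨_, rfl⟩
  obtain ⟨p, hp⟩ : ∃ p, p = Real.log n / lam := ⟨_, rfl⟩
  obtain ⟨q, hq⟩ : ∃ q, q = Real.log m / lam := ⟨_, rfl⟩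
  rw [← hlam] at hlog
  have hl0 : 0 < lam := by linarith
  have hn0 : 0 < n := by linarith
  have hm0 : 0 < m := by linarith
  have hL0 : 0 < L := by linarith
  have hu0 : 0 < u := hu ▸ div_pos hn0 hB
  have he0 : 0 < e := he ▸ div_pos one_pos hl0
  have he1 : e ≤ 1 / 200 := he ▸ one_div_le_one_div_of_le (by norm_num) hlog
  have hp1 : 1 ≤ p := by
    rw [hp, le_div_iff₀ hl0, one_mul, hlam]
    exact Real.log_le_log hL0 hn.le
  have hlogm : 2 * Real.log m ≤ Real.log n + 3 := by
    have h1 : Real.log (m ^ 2) ≤ Real.log (4 * n) := Real.log_le_log (by positivity) hmn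
    rw [Real.log_pow, Real.log_mul (by norm_num) hn0.ne'] at h1
    have h2 := Real.log_le_sub_one_of_pos (show (0 : ℝ) < 4 by norm_num)
    push_cast at h1
    linarith
  have hqp : 2 * q ≤ p + 3 * e := by
    rw [hq, hp, he, ← mul_div_assoc, ← mul_div_assoc, ← add_div]
    exact div_le_div_of_nonneg_right (by linarith) hl0.le
  -- `√n` is at least a constant times `B`
  have hmu : m ≤ 12 * u := by
    rw [hu, ← mul_div_assoc, le_div_iff₀ hB]
    refine le_of_sq_le_sq ?_ (by positivity)
    nlinarith [mul_le_mul hmn hBL (by positivity) (by positivity)]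
  have hmm : m * m / B ≤ 4 * u := by
    rw [hu, ← mul_div_assoc]
    exact div_le_div_of_nonneg_right (by linarith) hB.le
  have hover : 160000 * (m + m * m / B + n / B + 1) ≤ 4640000 * u := by
    rw [← hu]
    linarith
  have hbn : bound L B n = 10 ^ 7 * u * (2 * p - 1) := by
    rw [bound, if_neg (not_le.2 hn), ← hu, ← hlam, ← hp]
  have hsmall : ∀ y, y ≤ L → bound L B y = 36 + 36 / B * y := fun y hy => by
    rw [bound, if_pos hy]
    ring
  have hlarge : ∀ y, ¬ y ≤ L → bound L B y = 10 ^ 7 * (y / B) * (2 * (Real.log y / lam) - 1) :=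
    fun y hy => by rw [bound, if_neg hy, hlam]
  have hdiv : ∀ x y : ℝ, x ≤ y → x / lam ≤ y / lam := fun x y h =>
    div_le_div_of_nonneg_right h hl0.le
  have hmon : ∀ r s t : ℝ, 0 ≤ t → r ≤ s →
      (10 : ℝ) ^ 7 * t * (2 * r - 1) ≤ 10 ^ 7 * t * (2 * s - 1) := fun r s t ht h => by gcongr
  -- the tangent to the logarithm at `z`
  have htan : ∀ y z : ℝ, 0 < y → 0 < z → Real.log y ≤ Real.log z + y / z := fun y z hy hz => by
    have := Real.log_le_sub_one_of_pos (div_pos hy hz)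
    rw [Real.log_div hy.ne' hz.ne'] at this
    linarith
  have h36 : 36 / B * n = 36 * u := by rw [hu]; ring
  rw [hbn]
  rcases le_or_gt m L with hmL | hmL
  · rcases le_or_gt p (3 / 2) with hp2 | hp2
    -- the columns are free, and so are buckets of at most `L` items; for larger ones `1 ≤ y / L`
    · refine ⟨36, 36 / B, 2 * 10 ^ 7 / (B * L), 36, 36 /
        B, by norm_num, by positivity, by positivity,
        by norm_num, by positivity, fun y h0 h1 => (hsmall y (h1.trans hmL)).le,
        fun y h0 h1 => ?_, ?_⟩
      · by_cases hy : y ≤ L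
        · rw [hsmall y hy]
          have : 0 ≤ 2 * 10 ^ 7 / (B * L) * y ^ 2 := by positivity
          linarith
        · rw [hlarge y hy]
          push Not at hy
          have hy0 : 0 < y := hL0.trans hy
          have h2 : Real.log y / lam ≤ p := hp ▸ hdiv _ _ (Real.log_le_log hy0 h1)
          have h3 : 1 ≤ y / L := (one_le_div hL0).2 hy.le
          have h4 : 0 < y / B := by positivity
          have h5 : 2 * 10 ^ 7 / (B * L) * y ^ 2 = 2 * 10 ^ 7 * ((y / B) * (y / L)) := by
            field_simp
          have h6 : 0 ≤ 36 / B * y := by positivity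
          have h7 := hmon _ _ _ h4.le (h2.trans hp2)
          have h8 := mul_le_mul_of_nonneg_left h3 h4.le
          rw [h5]
          linarith
      · -- here `m` is much smaller than `L`
        have h1 : m / L ≤ 1 / 49 := by
          have h2 : Real.log m - lam ≤ -48 := by
            have : Real.log n ≤ 3 / 2 * lam := by rwa [hp, div_le_iff₀ hl0] at hp2
            linarith
          have h3 : m / L = (Real.exp (lam - Real.log m))⁻¹ := by
            rw [← Real.exp_neg, neg_sub, Real.exp_sub, Real.exp_log hm0, hlam, Real.exp_log hL0]
          rw [h3, one_div]
          refine inv_anti₀ (by norm_num) ?_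
          have := Real.add_one_le_exp (lam - Real.log m)
          linarith
        have h2 : 12 * (2 * 10 ^ 7 / (B * L)) * n * m = 24 * 10 ^ 7 * (u * (m / L)) := by
          rw [hu]
          field_simp
          ring
        have h3 := mul_le_mul_of_nonneg_left h1 hu0.le
        have h4 := mul_le_mul_of_nonneg_left hp1 hu0.le
        rw [h36, h2]
        linarith
    -- the columns are free, and the tangent is taken at `L`
    · refine ⟨36, (36 + 10 ^ 7) / B, 2 * 10 ^ 7 / (B * (L * lam)), 36, 36 / B, by norm_num,
        by positivity, by positivity, by norm_num, by positivity,
        fun y h0 h1 => (hsmall y (h1.trans hmL)).le, fun y h0 h1 => ?_, ?_⟩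
      · have h5 : 0 ≤ 2 * 10 ^ 7 / (B * (L * lam)) * y ^ 2 := by positivity
        by_cases hy : y ≤ L
        · rw [hsmall y hy]
          have : 36 / B * y ≤ (36 + 10 ^ 7) / B * y := by gcongr; linarith
          linarith
        · rw [hlarge y hy]
          push Not at hy
          have hy0 : 0 < y := hL0.trans hy
          have h2 : Real.log y / lam ≤ 1 + y / (L * lam) := by
            have := hdiv _ _ (htan y L hy0 hL0)
            rwa [add_div, ← hlam, div_self hl0.ne', div_div] at this
          have h4 : 0 < y / B := by positivity
          have h5 : 2 * 10 ^ 7 / (B * (L * lam)) * y ^ 2 = 2 * 10 ^ 7 *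
              ((y / B) * (y / (L * lam))) := by
            field_simp
          have h6 : (36 + 10 ^ 7) / B * y = (36 + 10 ^ 7) * (y / B) := by ring
          have h7 := hmon _ _ _ h4.le h2
          rw [h5, h6]
          linarith
      · have h1 : m / L ≤ 1 := (div_le_one hL0).2 hmL
        have h2 : 12 * (2 * 10 ^ 7 / (B * (L * lam))) * n * m = 24 * 10 ^ 7 *
            (u * (m / L * e)) := by
          rw [hu, he]
          field_simp
          ring
        have h3 : m / L * e ≤ 1 / 200 :=
          (mul_le_mul h1 he1 he0.le zero_le_one).trans (by norm_num)
        have h4 := mul_le_mul_of_nonneg_left h3 hu0.le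
        have h5 := mul_le_mul_of_nonneg_left hp2.le hu0.le
        have h6 : (36 + 10 ^ 7) / B * n = (36 + 10 ^ 7) * u := by rw [hu]; ring
        rw [h36, h2, h6]
        linarith
  -- the columns are large as well, and the tangent is taken at `m`, the average size of a bucket
  · have hq1 : 1 ≤ q := by
      rw [hq, le_div_iff₀ hl0, one_mul, hlam]
      exact Real.log_le_log hL0 hmL.le
    have hb : 36 ≤ (10 : ℝ) ^ 7 * (2 * q - 1) := by linarith
    have hb0 : 0 ≤ 10 ^ 7 * (2 * q - 1) / B := div_nonneg (by linarith) hB.le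
    have hsm : ∀ y, 0 ≤ y → y ≤ L → bound L B y ≤ 36 + 10 ^ 7 * (2 * q - 1) / B * y := by
      intro y h0 hy
      rw [hsmall y hy]
      have : 36 / B * y ≤ 10 ^ 7 * (2 * q - 1) / B * y := by gcongr
      linarith
    refine ⟨36, 10 ^ 7 * (2 * q - 1) / B, 2 * 10 ^ 7 / (B * (m * lam)), 36,
      10 ^ 7 * (2 * q - 1) / B, by norm_num, hb0, by positivity, by norm_num, hb0,
      fun y h0 h1 => ?_, fun y h0 h1 => ?_, ?_⟩
    · by_cases hy : y ≤ L
      · exact hsm y h0 hy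
      · rw [hlarge y hy]
        push Not at hy
        have hy0 : 0 < y := hL0.trans hy
        have h2 : Real.log y / lam ≤ q := hq ▸ hdiv _ _ (Real.log_le_log hy0 h1)
        have h4 : 0 < y / B := by positivity
        have h6 : 10 ^ 7 * (2 * q - 1) / B * y = 10 ^ 7 * (y / B) * (2 * q - 1) := by ring
        have h7 := hmon _ _ _ h4.le h2
        rw [h6]
        linarith
    · have h5 : 0 ≤ 2 * 10 ^ 7 / (B * (m * lam)) * y ^ 2 := by positivity
      by_cases hy : y ≤ L
      · have := hsm y h0 hy
        linarith
      · rw [hlarge y hy]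
        push Not at hy
        have hy0 : 0 < y := hL0.trans hy
        have h2 : Real.log y / lam ≤ q + y / (m * lam) := by
          have := hdiv _ _ (htan y m hy0 hm0)
          rwa [add_div, ← hq, div_div] at this
        have h4 : 0 < y / B := by positivity
        have h5 : 2 * 10 ^ 7 / (B * (m * lam)) * y ^ 2 = 2 * 10 ^ 7 *
            ((y / B) * (y / (m * lam))) := by
          field_simp
        have h6 : 10 ^ 7 * (2 * q - 1) / B * y = 10 ^ 7 * (y / B) * (2 * q - 1) := by ring
        have h7 := hmon _ _ _ h4.le h2
        rw [h5, h6]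
        linarith
    · have h2 : 12 * (2 * 10 ^ 7 / (B * (m * lam))) * n * m = 24 * 10 ^ 7 * (u * e) := by
        rw [hu, he]
        field_simp
        ring
      have h6 : 10 ^ 7 * (2 * q - 1) / B * n = 10 ^ 7 * (u * (2 * q - 1)) := by rw [hu]; ring
      have h4 := mul_le_mul_of_nonneg_left he1 hu0.le
      have h5 := mul_le_mul_of_nonneg_left hqp hu0.le
      rw [h2, h6]
      linarith

/-- If both arrays and the stack fit into the cache, only the blocks that they occupy are paid. -/
theorem cost_sortArea {p : Prog Unit} {Q : Unit → Mem α → Prop} (hB : 32 ≤ B)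
    (hn : 18 * (n : ℝ) / B + 7 ≤ k)
    (h : Safe (.box (sortArea A D n fp) (sortArea A D n fp)) p μ Q) :
    Cost k B (ENNReal.ofReal (36 * (n / B + 1))) p μ Q := by
  have hB0 : (0 : ℝ) < B := by exact_mod_cast (by omega : 0 < B)
  have hS : ∀ a ∈ sortArea A D n fp, a / B ∈ blocks B fp (fp + (16 * n + 31)) ∪
      (blocks B A (A + n) ∪ blocks B D (D + n)) := by
    intro a ha
    rcases ha with h | h | h
    · exact mem_union_left _ (mem_blocks (by omega) (by omega))
    · exact mem_union_right _ (mem_union_left _ (mem_blocks (by omega) (by omega)))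
    · exact mem_union_right _ (mem_union_right _ (mem_blocks (by omega) (by omega)))
  have hcard : ((blocks B fp (fp + (16 * n + 31)) ∪
      (blocks B A (A + n) ∪ blocks B D (D + n))).card : ℝ) ≤ 18 * n / B + 7 := by
    have h1 := card_blocks (B := B) (by omega) fp (16 * n + 31)
    have h2 := card_blocks (B := B) (by omega) A n
    have h3 := card_blocks (B := B) (by omega) D n
    have h4 := (card_union_le (blocks B fp (fp + (16 * n + 31)))
      (blocks B A (A + n) ∪ blocks B D (D + n))).trans
      (Nat.add_le_add_left (card_union_le _ _) _)
    have h5 : ((blocks B fp (fp + (16 * n + 31)) ∪ (blocks B A (A + n) ∪ blocks B D (D + n))).card :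
        ℝ) ≤ (((16 * n + 31) / B : ℕ) : ℝ) + 2 * ((n / B : ℕ) : ℝ) + 6 := by
      exact_mod_cast (by omega)
    have h6 : (((16 * n + 31) / B : ℕ) : ℝ) ≤ ((16 * n + 31 : ℕ) : ℝ) / B := Nat.cast_div_le
    have h7 : ((n / B : ℕ) : ℝ) ≤ (n : ℝ) / B := Nat.cast_div_le
    have h8 : (31 : ℝ) / B ≤ 1 := (div_le_one hB0).2 (by exact_mod_cast (by omega : 31 ≤ B))
    have h9 : ((16 * n + 31 : ℕ) : ℝ) / B = 16 * (n / B) + 31 / B := by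
      push_cast
      ring
    have h10 : 18 * (n : ℝ) / B = 18 * (n / B) := by ring
    linarith
  refine (Cost.of_blocks _ h (by exact_mod_cast hcard.trans hn) hS hS).mono ?_ fun _ _ h => h
  rw [← ENNReal.ofReal_natCast]
  refine ENNReal.ofReal_le_ofReal ?_
  have h10 : 18 * (n : ℝ) / B = 18 * (n / B) := by ring
  push_cast
  linarith

theorem one_lt_log {B L : ℝ} (hB : 36 * Real.exp 200 < B) (hBL : B ^ 2 ≤ 36 * L) :
    1024 < B ∧ B ≤ L ∧ 200 ≤ Real.log L := by
  have h0 := Real.add_one_le_exp 200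
  have h1 : B ≤ L := by nlinarith
  refine ⟨by linarith, h1, ?_⟩
  rw [Real.le_log_iff_exp_le (by linarith)]
  linarith

/-- The expected cost is at most `bound`, whatever the limit `f` is at which runs are cut off. For
small `n` the recursion is used for safety only. -/
theorem squareSort_spec {M : ℕ} (hB : 36 * Real.exp 200 < B) (hM : B ^ 2 ≤ M) :
    SortSpec α (M / B) B (fun y => ENNReal.ofReal (bound (M / 36) B y)) (squareSort f) := by
  obtain ⟨L, hL⟩ : ∃ L : ℝ, L = M / 36 := ⟨_, rfl⟩
  have hBL : (B : ℝ) ^ 2 ≤ 36 * L := by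
    rw [hL, mul_div_cancel₀ _ (by norm_num)]
    exact_mod_cast hM
  obtain ⟨hB1, hLB, hlog⟩ := one_lt_log hB hBL
  have hB2 : 1024 ≤ B := by exact_mod_cast hB1.le
  have hk : B ≤ M / B := (Nat.le_div_iff_mul_le (by omega)).2 (by rwa [sq] at hM)
  have hB0 : (0 : ℝ) < B := by linarith
  rw [← hL]
  induction f with
  | zero =>
    intro μ A D n fp _ _ _ _ _ _ _ _
    exact ⟨trivial, fun ψ K _ => by simp [squareSort, ex]⟩
  | succ f ih =>
    intro μ A D n fp h1 h2 h3 hAD hA hD hit hnd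
    rcases le_or_gt (n : ℝ) L with hn | hn
    · -- the arrays and the stack fit into the cache
      have hs : Safe (.box (sortArea A D n fp) (sortArea A D n fp)) (squareSort (f + 1) fp) μ
          fun _ μ' => ms μ' D (D + n) = ms μ A (A + n) ∧ Sorted μ' D (D + n) := by
        rcases lt_or_ge n 17 with h17 | h17
        · exact squareSort_small h1 h2 h3 hAD hA hD hit h17
        · have hT : ∃ a : ℝ, 0 ≤ a ∧ ∀ y ≤ n, bound L B y ≤ a := by
            refine ⟨36 * (n / B + 1), by positivity, fun y hy => ?_⟩
            have hy' : (y : ℝ) ≤ n := by exact_mod_cast hy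
            rw [bound, if_pos (hy'.trans hn)]
            gcongr
          obtain ⟨a, ha, hT⟩ := hT
          obtain ⟨-, h3m, -, -⟩ := ceilSqrt_bounds h17 rfl
          refine (squareSort_large hB2 hk ih h1 h2 h3 hAD hA hD hit hnd h17 rfl (a := a) (b := 0)
            (c := 0) (a' := a) (b' := 0) ha le_rfl le_rfl ha le_rfl (fun y hy => ?_)
            fun y hy => ?_).safe
          · exact ENNReal.ofReal_le_ofReal (by simpa using hT y (by omega))
          · exact ENNReal.ofReal_le_ofReal (by simpa using hT y hy)
      refine ⟨hs, ?_⟩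
      simp only [bound, if_pos hn]
      refine cost_sortArea (by omega) ?_ hs
      have h4 : (M : ℝ) / B < ((M / B : ℕ) : ℝ) + 1 := by
        rw [div_lt_iff₀ hB0]
        exact_mod_cast Nat.lt_mul_of_div_lt (Nat.lt_succ_self _) (by omega)
      have h5 : 18 * (n : ℝ) / B ≤ M / B / 2 := by
        rw [div_div, mul_comm (B : ℝ) 2, ← div_div]
        refine div_le_div_of_nonneg_right ?_ hB0.le
        rw [hL] at hn
        linarith
      have h6 : (B : ℝ) ≤ M / B := by
        rw [le_div_iff₀ hB0, ← sq]
        exact_mod_cast hM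
      linarith
    · have h17 : 17 ≤ n := by
        have : (17 : ℝ) < n := by linarith
        exact_mod_cast this.le
      obtain ⟨h5m, h3m, hnm, hmn⟩ := ceilSqrt_bounds h17 rfl
      have hm2 : ((ceilSqrt n : ℕ) : ℝ) ^ 2 ≤ 4 * n := by
        obtain ⟨t, ht⟩ : ∃ t, ceilSqrt n = t + 1 := ⟨ceilSqrt n - 1, by omega⟩
        rw [ht, Nat.add_sub_cancel] at hmn
        rw [ht] at h5m ⊢
        have : (t + 1) ^ 2 ≤ 4 * n := by nlinarith
        exact_mod_cast this
      obtain ⟨a, b, c, a', b', ha, hb, hc, ha', hb', hT', hT, hle⟩ := bound_recurrence hB0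
        (by linarith) hlog hBL hn (m := (ceilSqrt n : ℕ)) (by exact_mod_cast (by omega)) hm2
      refine (squareSort_large hB2 hk ih h1 h2 h3 hAD hA hD hit hnd h17 rfl ha hb hc ha' hb'
        (fun y hy => ?_) fun y hy => ?_).mono (ENNReal.ofReal_le_ofReal hle) fun _ _ h => h
      · exact ENNReal.ofReal_le_ofReal (hT' y (Nat.cast_nonneg _) (by exact_mod_cast hy))
      · exact ENNReal.ofReal_le_ofReal (hT y (Nat.cast_nonneg _) (by exact_mod_cast hy))

theorem bound_nonneg {L B y : ℝ} (hB : 0 < B) (hL : 1 < L) (hy : 0 ≤ y) : 0 ≤ bound L B y := by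
  rw [bound]
  split_ifs with h
  · positivity
  · have h1 : 1 ≤ Real.log y / Real.log L := by
      rw [one_le_div (Real.log_pos hL)]
      exact Real.log_le_log (by linarith) (not_le.1 h).le
    exact mul_nonneg (by positivity) (by linarith)

theorem Input.cost_le {M : ℕ} (hB : 36 * Real.exp 200 < B) (hM : B ^ 2 ≤ M) (I : Input α n) :
    I.cost M B ≤ ENNReal.ofReal (20 + bound (M / 36) B n) := by
  have hB2 : 1024 < (B : ℝ) := by linarith [Real.add_one_le_exp 200]
  have hB3 : 1024 < B := by exact_mod_cast hB2
  have hk : 2 ≤ M / B := (Nat.le_div_iff_mul_le (by omega)).2 (by nlinarith)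
  have hcell : ∀ x, I.a ≤ x → x < I.a + n → ∃ i : Fin n, x = I.a + i := fun x hx hx' =>
    ⟨⟨x - I.a, by omega⟩, by simp; omega⟩
  have hit : Items I.mem I.a (I.a + n) := by
    intro x hx hx'
    obtain ⟨i, rfl⟩ := hcell x hx hx'
    rw [I.mem_eq]
    exact WithTop.coe_lt_top _
  have hnd : (ms I.mem I.a (I.a + n)).Nodup := by
    refine Multiset.Nodup.map_on (fun x hx y hy h => ?_) (Multiset.nodup_Ico ..)
    rw [Multiset.mem_Ico] at hx hy
    obtain ⟨i, rfl⟩ := hcell x hx.1 hx.2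
    obtain ⟨j, rfl⟩ := hcell y hy.1 hy.2
    rw [I.mem_eq, I.mem_eq, Cell.item.injEq] at h
    rw [I.distinct h]
  refine iSup_le fun f => (tsum_traceLaw_le _ _ _).trans ?_
  have key : Tr (M / B) B (.box Set.univ Set.univ) (((2 * 10 : ℕ) : ℝ≥0∞) +
      ENNReal.ofReal (bound (M / 36) B n)) (I.main f) I.mem fun _ _ => True := by
    refine Tr.call 10 hk (by decide) Eval.lit (as := [I.a, I.d, n])
      (.cons Eval.lit (.cons Eval.lit (.cons Eval.lit .nil))) (fun _ _ _ _ _ => Set.mem_univ _)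
      fun μ₁ g1 g2 => ?_
    simp only [List.length_cons, List.length_nil] at g2
    have e1 : μ₁ (I.s + 1) = _ := g1 0 _ rfl
    have e2 : μ₁ (I.s + 2) = _ := g1 1 _ rfl
    have e3 : μ₁ (I.s + 3) = _ := g1 2 _ rfl
    have eA : ms μ₁ I.a (I.a + n) = ms I.mem I.a (I.a + n) :=
      ms_congr fun a _ _ => g2 a (by have := I.a_le; omega)
    exact ((squareSort_spec hB hM μ₁ I.a I.d n I.s e1 e2 e3 I.disjoint I.a_le I.d_le (hit.of_ms eA)
      (eA ▸ hnd)).box_mono (Set.subset_univ _) (Set.subset_univ _)).mono le_rfl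
      fun _ _ _ => ⟨Set.mem_univ _, trivial⟩
  refine (key.cost _ 0 fun _ _ _ => le_rfl).trans ?_
  have hBL : (B : ℝ) ^ 2 ≤ 36 * ((M : ℝ) / 36) := by
    rw [mul_div_cancel₀ _ (by norm_num)]
    exact_mod_cast hM
  obtain ⟨h1, h2, -⟩ := one_lt_log hB hBL
  rw [add_zero, ENNReal.ofReal_add (by norm_num) (bound_nonneg (by linarith) (by linarith)
    (Nat.cast_nonneg _))]
  exact add_le_add_left (le_of_eq (by norm_num)) _

end SquareSort

theorem theorem1 :
    ∃ c α β C : ℝ, 64 ≤ c ∧ 1 < α ∧ α < β ∧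
      ∀ (K : Type*) [LinearOrder K] (M B n : ℕ), β < B → B ^ 2 ≤ M → 1 ≤ n →
        SquareSort.expectedTransfers K M B n ≤
            ENNReal.ofReal (c * n / B * (2 * max (Real.logb (M / α) n) 1 - 1) + c / 16) ∧
        ((M : ℝ) / B ≤ n →
          SquareSort.expectedTransfers K M B n ≤
            ENNReal.ofReal (C * (n / B * Real.logb (M / B) n))) := by
  have h200 := Real.add_one_le_exp 200
  refine ⟨10 ^ 7, 36, 36 * Real.exp 200, 3 * 10 ^ 7, by norm_num, by norm_num, by linarith, ?_⟩
  intro K _ M B n hB hM hn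
  have hBL : (B : ℝ) ^ 2 ≤ 36 * ((M : ℝ) / 36) := by
    rw [mul_div_cancel₀ _ (by norm_num)]
    exact_mod_cast hM
  obtain ⟨hB1, hLB, hlog⟩ := SquareSort.one_lt_log hB hBL
  have hB0 : (0 : ℝ) < B := by linarith
  have hn1 : (1 : ℝ) ≤ n := by exact_mod_cast hn
  have hu0 : (0 : ℝ) < n / B := by positivity
  have h1 : SquareSort.expectedTransfers K M B n ≤
      ENNReal.ofReal (20 + SquareSort.bound (M / 36) B n) :=
    iSup_le fun I => I.cost_le hB hM
  have h2 : 20 + SquareSort.bound (M / 36) B n ≤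
      10 ^ 7 * n / B * (2 * max (Real.logb (M / 36) n) 1 - 1) + 10 ^ 7 / 16 := by
    have e : (10 : ℝ) ^ 7 * n / B = 10 ^ 7 * (n / B) := by ring
    rw [SquareSort.bound, Real.logb, e]
    split_ifs with h
    · have := le_max_right (Real.log n / Real.log (M / 36)) 1
      nlinarith
    · have := mul_le_mul_of_nonneg_left (le_max_left (Real.log n / Real.log (M / 36)) 1) hu0.le
      nlinarith
  have h3 := h1.trans (ENNReal.ofReal_le_ofReal h2)
  refine ⟨h3, fun hMn => h3.trans (ENNReal.ofReal_le_ofReal ?_)⟩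
  have hMB : (B : ℝ) ≤ M / B := by
    rw [le_div_iff₀ hB0, ← sq]
    exact_mod_cast hM
  have hu1 : (1 : ℝ) ≤ n / B := (one_le_div hB0).2 (hMB.trans hMn)
  have hl0 : 0 < Real.log (M / B) := Real.log_pos (by linarith)
  have hl1 : 1 ≤ Real.logb (M / B) n := by
    rw [Real.logb, le_div_iff₀ hl0, one_mul]
    exact Real.log_le_log (by linarith) hMn
  have hl2 : Real.logb (M / 36) n ≤ Real.logb (M / B) n := by
    refine div_le_div_of_nonneg_left (Real.log_nonneg hn1) hl0 (Real.log_le_log (by linarith) ?_)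
    exact div_le_div_of_nonneg_left (Nat.cast_nonneg _) (by norm_num) (by linarith)
  have hl3 := mul_le_mul_of_nonneg_left (max_le hl2 hl1) hu0.le
  have hl4 := mul_le_mul hu1 hl1 zero_le_one hu0.le
  have e : (10 : ℝ) ^ 7 * n / B = 10 ^ 7 * (n / B) := by ring
  rw [e]
  nlinarith
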